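/- **Setting.** Let $n,k\ge 0$ be integers, write $q=(q',q_{n+1})\in\mathbb H^{n+1}=\mathbb R^{4n+4}$ with real coordinates $x_1,\dots,x_{4n+4}$ ($q_{l+1}=x_{4l+1}+\mathbf i x_{4l+2}+\mathbf j x_{4l+3}+\mathbf k x_{4l+4}$), let $\phi$ be a smooth real function of $(q',\operatorname{Im}q_{n+1})$, $\varrho=\operatorname{Re}q_{n+1}-\phi(q',\operatorname{Im}q_{n+1})$, $D=\{\varrho>0\}$, $bD=\{\varrho=0\}$, and let $U\subseteq\mathbb H^{n+1}$ be open. Primed indices run over $0',1'$, and repeated primed indices are summed; they are raised and lowered by $f^{A'}=f_{B'}\varepsilon^{B'A'}$, $f_{A'}=f^{B'}\varepsilon_{B'A'}$ with $\varepsilon_{0'1'}=1=-\varepsilon_{1'0'}$, $\varepsilon^{0'1'}=-1=-\varepsilon^{1'0'}$. For $0\le l\le n$ put $$\nabla_{(2l)0'}=\partial_{x_{4l+1}}+i\partial_{x_{4l+2}},\quad \nabla_{(2l)1'}=-\partial_{x_{4l+3}}-i\partial_{x_{4l+4}},\quad \nabla_{(2l+1)0'}=\partial_{x_{4l+3}}-i\partial_{x_{4l+4}},\quad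 \nabla_{(2l+1)1'}=\partial_{x_{4l+1}}-i\partial_{x_{4l+2}},$$ and $d^{A'}F=\sum_{a=0}^{2n+1}\omega^a\wedge\nabla_a^{A'}F$, where $\omega^0,\dots,\omega^{2n+1}$ is the basis of $\mathbb C^{2n+2}$. Let $\odot^\sigma\mathbb C^2$ be the space of homogeneous polynomials of degree $\sigma$ in $(s^{0'},s^{1'})$, $\partial_{A'}=\partial/\partial s^{A'}$, $s_{A'}=s^{B'}\varepsilon_{B'A'}$. With $\sigma_j=k-j,\ \tau_j=j$ for $j\le k$ and $\sigma_j=j-k-1,\ \tau_j=j+1$ for $j>k$, the $k$-Cauchy–Fueter complex is $(\Gamma(U,V_j),D_j)_{0\le j\le 2n}$ with last space $\Gamma(U,V_{2n+1})$, where $V_j=\odot^{\sigma_j}\mathbb C^2\otimes\wedge^{\tau_j}\mathbb C^{2n+2}$ and $$D_j=\partial_{A'}d^{A'}\ (j<k),\qquad D_k=d^{0'}d^{1'},\qquad D_j=s_{A'}d^{A'}\ (j>k);$$ put $D_j=0$ for $j>2n$. A section $u\in\Gamma(U,V_j)$ has *zero Cauchy data* if $\int_{D}\langle D_ju,\psi\rangle=\int_{D}\langle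 u,D_j^*\psi\rangle$ for every $\psi\in\Gamma(U,V_{j+1})$ with compact support in $U$ ($D_j^*$ is the formal adjoint). Let $\mathcal J_j(U)$ be the space of these sections and $Q_j=\Gamma(U,V_j)/\mathcal J_j(U)$. The complex of the spaces $Q_j$ with the operators induced by $D_j$ is the *boundary complex*. **Tangential operators.** For $0\le A\le 2n-1$ and $B',C'\in\{0',1'\}$ let $\mathbf N_{B'C'}=\nabla_{(2n+B')C'}$ and let $\mathbf N\varrho=(\mathbf N_{B'C'}\varrho)$, an invertible matrix. Put (on $bD\cap U$, repeated indices summed) $$n_{AB'}=\nabla_{AD'}\varrho\,(\mathbf N\varrho)^{-1}_{D'B'},\qquad Z_A^{A'}=\nabla_A^{A'}-n_{AB'}\mathbf N_{B'}^{A'},\qquad \mathfrak d^{A'}F=\sum_{A=0}^{2n-1}\omega^A\wedge Z_A^{A'}F,$$ $$R_{B'C'}=\varepsilon_{B'D'}(\mathbf N\varrho)^{-1}_{D'C'},\qquad \mathbf T_{B'}^{A'}=R_{B'C'}\mathbf N_{C'}^{A'}-\delta_{B'}^{A'}\partial_{x_{4n+1}},\qquad \mathbf T^{A'B'}=\mathbf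 T_{C'}^{A'}\varepsilon^{C'B'}.$$ Let $\Omega^{A'}=d^{A'}\varrho=\sum_a(\nabla_a^{A'}\varrho)\,\omega^a$; the forms $\omega^0,\dots,\omega^{2n-1},\Omega^{0'},\Omega^{1'}$ are a frame. Let $\mathcal E_0\in\wedge^2\mathbb C^{2n}$, $\mathcal E_{A'}\in\mathbb C^{2n}$ and the scalar $\mathcal E_{0'1'}$ be the components, on $bD\cap U$, of $$\mathcal E:=-d^{0'}d^{1'}\varrho=\mathcal E_0+\Omega^{A'}\wedge\mathcal E_{A'}+\mathcal E_{0'1'}\,\Omega^{0'}\wedge\Omega^{1'}.$$ **Theorem.** The fields $Z_A^{A'}$ and $\mathbf T_{B'}^{A'}$ are tangential to $bD$, and the decomposition of $\mathcal E$ above holds with the components calculated from $\omega^{2n+B'}=-\sum_A n_{AB'}\omega^A+R_{C'B'}\Omega^{C'}$. Moreover $D_j\mathcal J_j(U)\subseteq\mathcal J_{j+1}(U)$ for all $j$, $Q_j=0$ for $j>2n$, and there are linear isomorphisms $$\mathbf\Pi_j:Q_j\to\Gamma(bD\cap U,\mathscr V_j),\qquad 0\le j\le 2n,\qquad \mathscr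 V_j=\mathscr V_j^{(1)}\oplus\mathscr V_j^{(2)},$$ where, with $\mathscr V^{\sigma,\tau}=\odot^\sigma\mathbb C^2\otimes\wedge^\tau\mathbb C^{2n}$ (zero for $\tau=-1$), $$\mathscr V_j^{(1)}=\mathscr V^{\sigma_j,\tau_j},\quad \mathscr V_j^{(2)}=\mathscr V^{\sigma_{j+1},\tau_j-1}\quad(j\ne k),\qquad \mathscr V_k^{(1)}=\mathscr V_k^{(2)}=\mathscr V^{0,k};$$ in particular $\mathscr V_0^{(2)}=0$ if $k\ge1$. Every $u\in\Gamma(U,V_j)$ can be written as $u=f+\Omega^{A'}\wedge H_{A'}+\Omega^{0'}\wedge\Omega^{1'}\wedge K$ with $f,H_{A'},K$ smooth on $U$ with values in $\odot^{\sigma_j}\mathbb C^2\otimes\wedge^{\bullet}\mathbb C^{2n}$, $\bullet=\tau_j,\tau_j-1,\tau_j-2$, and $\mathbf\Pi_j$ is given by $$\mathbf\Pi_j[u]=\begin{cases}\big(f,\ \partial_{1'}H_{0'}-\partial_{0'}H_{1'}\big),&j<k,\\ \big(f,\ \partial_{x_{4n+1}}f-\mathfrak d^{A'}H_{A'}+\mathcal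 E_0\wedge K\big),&j=k,\\ \big(f,\ s_{1'}H_{0'}-s_{0'}H_{1'}\big),&j>k,\end{cases}$$ everything restricted to $bD\cap U$. For $0\le j\le 2n-1$ they carry the operator $Q_j\to Q_{j+1}$ induced by $D_j$ to $\mathscr D_j=(\mathscr D_j^{(1)},\mathscr D_j^{(2)})$, where for $\mathbb F=(\mathbb F_1,\mathbb F_2)$ $$\mathscr D_j^{(1)}\mathbb F=\begin{cases}\partial_{A'}\mathfrak d^{A'}\mathbb F_1+\mathcal E_0\wedge\mathbb F_2,&j<k,\\ \mathfrak d^{0'}\mathfrak d^{1'}\mathbb F_1-\mathcal E_0\wedge(\mathbf T^{1'0'}\mathbb F_1+\mathbb F_2),&j=k,\\ s_{A'}\mathfrak d^{A'}\mathbb F_1+\mathcal E_0\wedge\mathbb F_2,&j>k,\end{cases}$$ $$\mathscr D_j^{(2)}\mathbb F=\begin{cases}-\partial_{A'}(\mathfrak d^{A'}+\mathcal E^{A'}\wedge)\mathbb F_2-\partial_{A'}\partial_{B'}\mathbf T^{A'B'}\mathbb F_1,&j<k-1,\\[2pt] \tfrac12(\mathfrak d^{0'}\mathfrak d^{1'}-\mathfrak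 d^{1'}\mathfrak d^{0'})\mathbb F_2-\mathfrak d^{A'}(\mathcal E_{A'}\wedge\mathbb F_2)+\mathcal E_0\wedge\big(\tfrac12(\mathbf T^{0'1'}-\mathbf T^{1'0'})+\mathcal E_{0'1'}\big)\mathbb F_2-\partial_{A'}\mathfrak d^{B'}\mathbf T_{B'}^{A'}\mathbb F_1,&j=k-1,\\[2pt] s^{A'}\big(-\mathfrak d_{A'}\mathbb F_2-\mathcal E_{A'}\wedge(\mathbf T^{1'0'}\mathbb F_1+\mathbb F_2)+\mathbf T_{A'}^{0'}\mathfrak d^{1'}\mathbb F_1-\mathfrak d^{0'}\mathbf T_{A'}^{1'}\mathbb F_1\big),&j=k,\\[2pt] -s_{A'}(\mathfrak d^{A'}+\mathcal E^{A'}\wedge)\mathbb F_2-s_{A'}s_{B'}\mathbf T^{A'B'}\mathbb F_1,&j>k.\end{cases}$$ Hence the boundary complex is the differential complex $$0\to\Gamma(bD\cap U,\mathscr V_0)\xrightarrow{\mathscr D_0}\cdots\xrightarrow{\mathscr D_{2n-1}}\Gamma(bD\cap U,\mathscr V_{2n})\to0,\qquad \mathscr D_{j+1}\mathscr D_j=0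 .$$ If $\mathcal E_0=0$ on $bD\cap U$ (the right-type case), then $\mathscr D_j^{(1)}\mathbb F$ depends on $\mathbb F_1$ only; it is $\partial_{A'}\mathfrak d^{A'}\mathbb F_1$ ($j<k$), $\mathfrak d^{0'}\mathfrak d^{1'}\mathbb F_1$ ($j=k$), $s_{A'}\mathfrak d^{A'}\mathbb F_1$ ($j>k$), and the spaces $\Gamma(bD\cap U,\mathscr V_j^{(1)})$ with these operators are a differential complex of the same form as the $k$-Cauchy–Fueter complex. (In all cases $\mathscr V_j^{(1)}=0$ if $j>k$ and $j\ge 2n$.) -/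

import Mathlib

open scoped ContDiff

noncomputable section

namespace KCF

/-! ### The space `ℍ^{n+1} = ℝ^{4(n+1)}`, smooth functions and derivatives -/

/-- `ℍ^{n+1}` identified with `ℝ^{4n+4}`. The coordinate with index `i` (counted from `0`) is the
coordinate usually written `x_{i+1}`; in particular `Re q_{n+1}` has index `4n`. -/
abbrev HSpace (n : ℕ) : Type := Fin (4 * n + 4) → ℝ

/-- The index of the coordinate `x_{4n+1} = Re q_{n+1}`. -/
def nIdx (n : ℕ) : Fin (4 * n + 4) := ⟨4 * n, by omega⟩

/-- The algebra of smooth complex functions on a set `S`: the restrictions to `S` of functions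
that are `C^∞` on some open neighbourhood of `S`. For `S` open this is `C^∞(S)`, and for `S` a
(locally closed) smooth hypersurface it is the algebra of smooth functions on that hypersurface. -/
def SmoothFn {n : ℕ} (S : Set (HSpace n)) : Subalgebra ℂ (S → ℂ) where
  carrier := {f | ∃ O : Set (HSpace n), IsOpen O ∧ S ⊆ O ∧
    ∃ g : HSpace n → ℂ, ContDiffOn ℝ ∞ g O ∧ ∀ x : S, f x = g x}
  mul_mem' := by
    rintro f₁ f₂ ⟨O₁, h₁, s₁, g₁, c₁, e₁⟩ ⟨O₂, h₂, s₂, g₂, c₂, e₂⟩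
    exact ⟨O₁ ∩ O₂, h₁.inter h₂, Set.subset_inter s₁ s₂, fun x => g₁ x * g₂ x,
      (c₁.mono Set.inter_subset_left).mul (c₂.mono Set.inter_subset_right),
      fun x => by simp [e₁ x, e₂ x]⟩
  add_mem' := by
    rintro f₁ f₂ ⟨O₁, h₁, s₁, g₁, c₁, e₁⟩ ⟨O₂, h₂, s₂, g₂, c₂, e₂⟩
    exact ⟨O₁ ∩ O₂, h₁.inter h₂, Set.subset_inter s₁ s₂, fun x => g₁ x + g₂ x,
      (c₁.mono Set.inter_subset_left).add (c₂.mono Set.inter_subset_right),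
      fun x => by simp [e₁ x, e₂ x]⟩
  algebraMap_mem' := fun c =>
    ⟨Set.univ, isOpen_univ, Set.subset_univ _, fun _ => c, contDiffOn_const, fun _ => rfl⟩

/-- Restriction of smooth functions. -/
def restr {n : ℕ} {S S' : Set (HSpace n)} (h : S ⊆ S') : SmoothFn S' →ₗ[ℂ] SmoothFn S where
  toFun f := ⟨fun x => f.1 ⟨x.1, h x.2⟩, by
    obtain ⟨f, O, hO, hs, g, hg, e⟩ := f
    exact ⟨O, hO, h.trans hs, g, hg, fun x => e ⟨x.1, h x.2⟩⟩⟩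
  map_add' _ _ := rfl
  map_smul' _ _ := rfl

open Classical in
/-- Extension of a function on `S` by zero. -/
def zext {n : ℕ} {S : Set (HSpace n)} (f : S → ℂ) : HSpace n → ℂ :=
  fun x => if h : x ∈ S then f ⟨x, h⟩ else 0

theorem zext_of_mem {n : ℕ} {S : Set (HSpace n)} (f : S → ℂ) {x : HSpace n} (h : x ∈ S) :
    zext f x = f ⟨x, h⟩ := by
  simp [zext, h]

theorem contDiffOn_zext {n : ℕ} (U : TopologicalSpace.Opens (HSpace n))
    (f : SmoothFn (U : Set (HSpace n))) : ContDiffOn ℝ ∞ (zext f.1) (U : Set (HSpace n)) := by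
  obtain ⟨f, O, hO, hs, g, hg, e⟩ := f
  exact (hg.mono hs).congr fun x hx => by rw [zext_of_mem f hx]; exact e ⟨x, hx⟩

/-- The partial derivative `∂/∂x_{i+1}` on `C^∞(U)`, for `U` open. -/
def pd {n : ℕ} (U : TopologicalSpace.Opens (HSpace n)) (i : Fin (4 * n + 4)) :
    SmoothFn (U : Set (HSpace n)) →ₗ[ℂ] SmoothFn (U : Set (HSpace n)) where
  toFun f := ⟨fun x => fderiv ℝ (zext f.1) x.1 (Pi.single i 1),
    U, U.isOpen, subset_rfl, fun x => fderiv ℝ (zext f.1) x (Pi.single i 1),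
    ((contDiffOn_zext U f).fderiv_of_isOpen U.isOpen (by simp)).clm_apply contDiffOn_const,
    fun _ => rfl⟩
  map_add' f₁ f₂ := by
    ext x
    have hd := fun f : SmoothFn (U : Set (HSpace n)) =>
      ((contDiffOn_zext U f).contDiffAt (U.isOpen.mem_nhds x.2)).differentiableAt (by simp)
    have : zext (f₁ + f₂).1 = zext f₁.1 + zext f₂.1 := by
      funext y; by_cases hy : y ∈ (U : Set (HSpace n)) <;> simp [zext, hy]
    change fderiv ℝ (zext (f₁ + f₂).1) x.1 _ = fderiv ℝ (zext f₁.1) x.1 _ + fderiv ℝ (zext f₂.1) x.1 _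
    rw [this, fderiv_add (hd f₁) (hd f₂)]; rfl
  map_smul' c f := by
    ext x
    have hd := ((contDiffOn_zext U f).contDiffAt (U.isOpen.mem_nhds x.2)).differentiableAt
      (by simp : (∞ : WithTop ℕ∞) ≠ 0)
    have : zext (c • f).1 = c • zext f.1 := by
      funext y; by_cases hy : y ∈ (U : Set (HSpace n)) <;> simp [zext, hy]
    change fderiv ℝ (zext (c • f).1) x.1 _ = c • fderiv ℝ (zext f.1) x.1 _
    rw [this, fderiv_const_smul hd]; rfl

/-! ### The fields `∇_{ȦA'}` and primed indices -/

/-- `ε_{A'B'}`, used to lower primed indices: `f_{C'} = f^{A'} ε_{A'C'}`. -/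
def epsLow : Matrix (Fin 2) (Fin 2) ℂ := !![0, 1; -1, 0]

/-- `ε^{A'B'}`, used to raise primed indices: `f^{A'} = f_{B'} ε^{B'A'}`. -/
def epsUp : Matrix (Fin 2) (Fin 2) ℂ := !![0, -1; 1, 0]

/-- `nabLow a A' i` is the coefficient of `∂/∂x_{i+1}` in `∇_{aA'}`: with `a = 2l` or `a = 2l + 1`,
`∇_{(2l)0'} = ∂_{4l+1} + i ∂_{4l+2}`, `∇_{(2l)1'} = -∂_{4l+3} - i ∂_{4l+4}`,
`∇_{(2l+1)0'} = ∂_{4l+3} - i ∂_{4l+4}`, `∇_{(2l+1)1'} = ∂_{4l+1} - i ∂_{4l+2}`. -/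
def nabLow {n : ℕ} (a : Fin (2 * n + 2)) (A' : Fin 2) (i : Fin (4 * n + 4)) : ℂ :=
  let δ : ℕ → ℂ := fun m => if (i : ℕ) = 4 * ((a : ℕ) / 2) + m then 1 else 0
  if (a : ℕ) % 2 = 0 then
    if A' = 0 then δ 0 + Complex.I * δ 1 else -δ 2 - Complex.I * δ 3
  else
    if A' = 0 then δ 2 - Complex.I * δ 3 else δ 0 - Complex.I * δ 1

/-- The coefficients of `∇_a^{A'} = ∇_{aB'} ε^{B'A'}`. -/
def nabUp {n : ℕ} (a : Fin (2 * n + 2)) (A' : Fin 2) (i : Fin (4 * n + 4)) : ℂ :=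
  ∑ B' : Fin 2, nabLow a B' i * epsUp B' A'

/-! ### Forms with polynomial coefficients -/

/-- An element `F` of `Ten n R` is the family of coefficients of
`∑ F p q S (s^{0'})^p (s^{1'})^q ω^S`, where `ω^S = ω^{a_1} ∧ … ∧ ω^{a_τ}` for
`S = {a_1 < … < a_τ} ⊆ {0, …, 2n+1}`; the coefficients lie in a commutative `ℂ`-algebra `R` of
functions. -/
abbrev Ten (n : ℕ) (R : Type) : Type := ℕ → ℕ → Finset (Fin (2 * n + 2)) → R

/-- `Sec n R N σ τ`: the elements that are homogeneous of degree `σ` in `(s^{0'}, s^{1'})`, of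
degree `τ` in the `ω`'s, and that involve only `ω^0, …, ω^{N-1}`. For `R = C^∞(S)` these are the
smooth functions on `S` with values in `⊙^σ ℂ² ⊗ ∧^τ ℂ^N`, where `⊙^σ ℂ²` is the space of
homogeneous polynomials of degree `σ` on `ℂ²`. For `τ = -1` the space is zero. -/
def Sec (n : ℕ) (R : Type) [CommRing R] [Algebra ℂ R] (N σ : ℕ) (τ : ℤ) :
    Submodule ℂ (Ten n R) where
  carrier := {F | ∀ p q S, ¬(p + q = σ ∧ (S.card : ℤ) = τ ∧ ∀ a : Fin (2 * n + 2), a ∈ S → a.val < N) → F p q S = 0}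
  add_mem' := fun {F G} hF hG p q S h => by simp [hF p q S h, hG p q S h]
  zero_mem' := fun _ _ _ _ => rfl
  smul_mem' := fun c F hF p q S h => by simp [hF p q S h]

/-- A linear map applied to every coefficient. -/
def mapT {n : ℕ} {R R' : Type} [CommRing R] [Algebra ℂ R] [CommRing R'] [Algebra ℂ R']
    (L : R →ₗ[ℂ] R') : Ten n R →ₗ[ℂ] Ten n R' where
  toFun F := fun p q S => L (F p q S)
  map_add' F G := by funext p q S; simp
  map_smul' c F := by funext p q S; simp

/-- The quotient of a space of sections by a subspace. -/
abbrev SecQuot {R : Type} [CommRing R] [Algebra ℂ R] {n N σ : ℕ} {τ : ℤ}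
    (J : Submodule ℂ (Sec n R N σ τ)) : Type := Sec n R N σ τ ⧸ J

/-- The class of a section in the quotient. -/
def secMk {R : Type} [CommRing R] [Algebra ℂ R] {n N σ : ℕ} {τ : ℤ}
    (J : Submodule ℂ (Sec n R N σ τ)) : Sec n R N σ τ →ₗ[ℂ] SecQuot J := J.mkQ

/-- The map of quotients induced by `L`, for `L(J) ⊆ J'`. -/
def secMap {R : Type} [CommRing R] [Algebra ℂ R] {n N σ σ' : ℕ} {τ τ' : ℤ}
    (J : Submodule ℂ (Sec n R N σ τ)) (J' : Submodule ℂ (Sec n R N σ' τ'))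
    (L : Sec n R N σ τ →ₗ[ℂ] Sec n R N σ' τ') (h : J ≤ J'.comap L) : SecQuot J →ₗ[ℂ] SecQuot J' :=
  J.mapQ J' L h

section Algebra

variable {n : ℕ} {R : Type} [CommRing R] [Algebra ℂ R]

/-- Multiplication by a function. -/
def mulT (r : R) : Ten n R →ₗ[ℂ] Ten n R := mapT (LinearMap.mulLeft ℂ r)

/-- `F ↦ ω^a ∧ F`. -/
def ext1 (a : Fin (2 * n + 2)) : Ten n R →ₗ[ℂ] Ten n R where
  toFun F := fun p q S =>
    if a ∈ S then (-1) ^ (S.filter (· < a)).card * F p q (S.erase a) else 0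
  map_add' F G := by funext p q S; by_cases h : a ∈ S <;> simp [h, mul_add]
  map_smul' c F := by funext p q S; by_cases h : a ∈ S <;> simp [h]

/-- `∂_{A'} = ∂/∂s^{A'}`. -/
def partialS (A' : Fin 2) : Ten n R →ₗ[ℂ] Ten n R where
  toFun F := fun p q S =>
    if A' = 0 then ((p : R) + 1) * F (p + 1) q S else ((q : R) + 1) * F p (q + 1) S
  map_add' F G := by funext p q S; by_cases h : A' = 0 <;> simp [h, mul_add]
  map_smul' c F := by funext p q S; by_cases h : A' = 0 <;> simp [h]

/-- Multiplication by `s^{A'}`. -/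
def sUp (A' : Fin 2) : Ten n R →ₗ[ℂ] Ten n R where
  toFun F := fun p q S =>
    if A' = 0 then (if p = 0 then 0 else F (p - 1) q S)
    else (if q = 0 then 0 else F p (q - 1) S)
  map_add' F G := by
    funext p q S
    by_cases h : A' = 0 <;> by_cases hp : p = 0 <;> by_cases hq : q = 0 <;> simp [h, hp, hq]
  map_smul' c F := by
    funext p q S
    by_cases h : A' = 0 <;> by_cases hp : p = 0 <;> by_cases hq : q = 0 <;> simp [h, hp, hq]

/-- Multiplication by `s_{A'} = s^{B'} ε_{B'A'}`. -/
def sLow (A' : Fin 2) : Ten n R →ₗ[ℂ] Ten n R := ∑ B' : Fin 2, epsLow B' A' • sUp B'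

/-- `F ↦ α ∧ F` for the one-form `α = ∑ α_a ω^a` on `ℂ^{2n+2}`. -/
def wedge1 (α : Fin (2 * n + 2) → R) : Ten n R →ₗ[ℂ] Ten n R := ∑ a, mulT (α a) ∘ₗ ext1 a

/-- `F ↦ β ∧ F` for the two-form `β = ∑ β_{ab} ω^a ∧ ω^b` on `ℂ^{2n+2}`. -/
def wedge2 (β : Fin (2 * n + 2) → Fin (2 * n + 2) → R) : Ten n R →ₗ[ℂ] Ten n R :=
  ∑ a, ∑ b, mulT (β a b) ∘ₗ ext1 a ∘ₗ ext1 b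

/-- `ω^A` for `A ∈ {0, …, 2n-1}`. -/
def hIdx (A : Fin (2 * n)) : Fin (2 * n + 2) := Fin.castAdd 2 A

/-- `ω^{2n+B'}` for `B' ∈ {0, 1}`. -/
def vIdx (B' : Fin 2) : Fin (2 * n + 2) := Fin.natAdd (2 * n) B'

/-- `F ↦ α ∧ F` for the one-form `α = ∑ α_A ω^A` on `ℂ^{2n}`. -/
def hwedge1 (α : Fin (2 * n) → R) : Ten n R →ₗ[ℂ] Ten n R :=
  ∑ A, mulT (α A) ∘ₗ ext1 (hIdx A)

/-- `F ↦ β ∧ F` for the two-form `β = ∑ β_{AB} ω^A ∧ ω^B` on `ℂ^{2n}`. -/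
def hwedge2 (β : Fin (2 * n) → Fin (2 * n) → R) : Ten n R →ₗ[ℂ] Ten n R :=
  ∑ A, ∑ B, mulT (β A B) ∘ₗ ext1 (hIdx A) ∘ₗ ext1 (hIdx B)

/-- The function `r` as an element of degree zero. -/
def scalarT (r : R) : Ten n R := fun p q S => if p = 0 ∧ q = 0 ∧ S = ∅ then r else 0

/-! Degrees of these operations. -/

theorem mem_Sec {N σ : ℕ} {τ : ℤ} {F : Ten n R} : F ∈ Sec n R N σ τ ↔
    ∀ p q S, ¬(p + q = σ ∧ (S.card : ℤ) = τ ∧ ∀ a : Fin (2 * n + 2), a ∈ S → a.val < N) → F p q S = 0 := Iff.rfl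

theorem mapT_mem {R' : Type} [CommRing R'] [Algebra ℂ R'] (L : R →ₗ[ℂ] R') {N σ : ℕ} {τ : ℤ}
    {F : Ten n R} (hF : F ∈ Sec n R N σ τ) : mapT L F ∈ Sec n R' N σ τ := fun p q S h => by
  simp [mapT, hF p q S h]

theorem ext1_mem {a : Fin (2 * n + 2)} {N σ : ℕ} {τ : ℤ} (ha : (a : ℕ) < N)
    {F : Ten n R} (hF : F ∈ Sec n R N σ τ) : ext1 a F ∈ Sec n R N σ (τ + 1) := fun p q S h => by
  by_cases hS : a ∈ S
  · have : F p q (S.erase a) = 0 := by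
      refine hF _ _ _ fun ⟨h1, h2, h3⟩ => h ⟨h1, ?_, fun b hb => ?_⟩
      · rw [← h2, ← Finset.card_erase_add_one hS]; push_cast; ring
      · by_cases hba : b = a
        · rw [hba]; exact ha
        · exact h3 b (Finset.mem_erase.2 ⟨hba, hb⟩)
    simp [ext1, hS, this]
  · simp [ext1, hS]

theorem partialS_mem {A' : Fin 2} {N σ : ℕ} {τ : ℤ} {F : Ten n R}
    (hF : F ∈ Sec n R N (σ + 1) τ) : partialS A' F ∈ Sec n R N σ τ := fun p q S h => by
  have h1 : F (p + 1) q S = 0 := hF _ _ _ fun ⟨h1, h2, h3⟩ => h ⟨by omega, h2, h3⟩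
  have h2 : F p (q + 1) S = 0 := hF _ _ _ fun ⟨h1, h2, h3⟩ => h ⟨by omega, h2, h3⟩
  simp [partialS, h1, h2]

theorem sUp_mem {A' : Fin 2} {N σ : ℕ} {τ : ℤ} {F : Ten n R}
    (hF : F ∈ Sec n R N σ τ) : sUp A' F ∈ Sec n R N (σ + 1) τ := fun p q S h => by
  have h1 : p ≠ 0 → F (p - 1) q S = 0 :=
    fun hp => hF _ _ _ fun ⟨h1, h2, h3⟩ => h ⟨by omega, h2, h3⟩
  have h2 : q ≠ 0 → F p (q - 1) S = 0 :=
    fun hp => hF _ _ _ fun ⟨h1, h2, h3⟩ => h ⟨by omega, h2, h3⟩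
  by_cases hA : A' = 0 <;> simp only [sUp, LinearMap.coe_mk, AddHom.coe_mk, hA, if_true, if_false]
  · split_ifs with hp
    · rfl
    · exact h1 hp
  · split_ifs with hq
    · rfl
    · exact h2 hq

theorem sLow_mem {A' : Fin 2} {N σ : ℕ} {τ : ℤ} {F : Ten n R}
    (hF : F ∈ Sec n R N σ τ) : sLow A' F ∈ Sec n R N (σ + 1) τ := by
  rw [sLow, LinearMap.sum_apply]
  exact Submodule.sum_mem _ fun B _ => Submodule.smul_mem _ _ (sUp_mem hF)

theorem hwedge1_mem (α : Fin (2 * n) → R) {σ : ℕ} {τ : ℤ} {F : Ten n R}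
    (hF : F ∈ Sec n R (2 * n) σ τ) : hwedge1 α F ∈ Sec n R (2 * n) σ (τ + 1) := by
  rw [hwedge1, LinearMap.sum_apply]
  refine Submodule.sum_mem _ fun A _ => ?_
  change mapT (LinearMap.mulLeft ℂ (α A)) (ext1 (hIdx A) F) ∈ _
  exact mapT_mem _ (ext1_mem (by simp [hIdx]) hF)

theorem hwedge2_mem (β : Fin (2 * n) → Fin (2 * n) → R) {σ : ℕ} {τ : ℤ} {F : Ten n R}
    (hF : F ∈ Sec n R (2 * n) σ τ) : hwedge2 β F ∈ Sec n R (2 * n) σ (τ + 2) := by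
  rw [hwedge2, LinearMap.sum_apply]
  refine Submodule.sum_mem _ fun A _ => ?_
  rw [LinearMap.sum_apply]
  refine Submodule.sum_mem _ fun B _ => ?_
  change mapT (LinearMap.mulLeft ℂ (β A B)) (ext1 (hIdx A) (ext1 (hIdx B) F)) ∈ _
  refine mapT_mem _ ?_
  have := ext1_mem (a := hIdx A) (N := 2 * n) (by simp [hIdx])
    (ext1_mem (a := hIdx B) (by simp [hIdx]) hF)
  rwa [add_assoc] at this

end Algebra

/-! ### The `k`-Cauchy–Fueter complex -/

/-- `σ_j`. -/
def sig (k j : ℕ) : ℕ := if j ≤ k then k - j else j - k - 1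

/-- `τ_j`. -/
def tau (k j : ℕ) : ℤ := if j ≤ k then j else j + 1

section Domain

variable {n : ℕ} (U : TopologicalSpace.Opens (HSpace n))

/-- The differential operator `∑ c_i ∂/∂x_{i+1}` with constant coefficients. -/
def vfU (c : Fin (4 * n + 4) → ℂ) :
    SmoothFn (U : Set (HSpace n)) →ₗ[ℂ] SmoothFn (U : Set (HSpace n)) := ∑ i, c i • pd U i

/-- `d^{A'} F = ∑_a ω^a ∧ ∇_a^{A'} F`. -/
def dUp (A' : Fin 2) :
    Ten n (SmoothFn (U : Set (HSpace n))) →ₗ[ℂ] Ten n (SmoothFn (U : Set (HSpace n))) :=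
  ∑ a, ext1 a ∘ₗ mapT (vfU U (nabUp a A'))

/-- The formula for the `j`-th operator of the `k`-Cauchy–Fueter complex: `∂_{A'} d^{A'}` for
`j < k`, `d^{0'} d^{1'}` for `j = k`, `s_{A'} d^{A'}` for `k < j`; the complex has the operators
`j = 0, …, 2n`, so the operator is zero for `j > 2n`. -/
def cfOp (k j : ℕ) :
    Ten n (SmoothFn (U : Set (HSpace n))) →ₗ[ℂ] Ten n (SmoothFn (U : Set (HSpace n))) :=
  if 2 * n < j then 0
  else if j < k then ∑ A' : Fin 2, partialS A' ∘ₗ dUp U A'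
  else if j = k then dUp U 0 ∘ₗ dUp U 1
  else ∑ A' : Fin 2, sLow A' ∘ₗ dUp U A'

/-- `Γ(U, V_j)` with `V_j = ⊙^{σ_j} ℂ² ⊗ ∧^{τ_j} ℂ^{2n+2}`. -/
abbrev cfSec (k j : ℕ) : Submodule ℂ (Ten n (SmoothFn (U : Set (HSpace n)))) :=
  Sec n (SmoothFn (U : Set (HSpace n))) (2 * n + 2) (sig k j) (tau k j)

theorem dUp_mem (A' : Fin 2) {σ : ℕ} {τ : ℤ} {F : Ten n (SmoothFn (U : Set (HSpace n)))}
    (hF : F ∈ Sec n (SmoothFn (U : Set (HSpace n))) (2 * n + 2) σ τ) :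
    dUp U A' F ∈ Sec n (SmoothFn (U : Set (HSpace n))) (2 * n + 2) σ (τ + 1) := by
  rw [dUp, LinearMap.sum_apply]
  exact Submodule.sum_mem _ fun a _ => ext1_mem a.2 (mapT_mem _ hF)

theorem cfOp_mem (k j : ℕ) {F : Ten n (SmoothFn (U : Set (HSpace n)))} (hF : F ∈ cfSec U k j) :
    cfOp U k j F ∈ cfSec U k (j + 1) := by
  unfold cfOp
  split_ifs with h0 h1 h2
  · exact Submodule.zero_mem _
  · rw [LinearMap.sum_apply]
    refine Submodule.sum_mem _ fun A _ => partialS_mem ?_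
    have e1 : sig k (j + 1) + 1 = sig k j := by unfold sig; split_ifs <;> omega
    have e2 : tau k (j + 1) = tau k j + 1 := by unfold tau; split_ifs <;> omega
    rw [e1, e2]; exact dUp_mem U A hF
  · have e1 : sig k (j + 1) = sig k j := by unfold sig; split_ifs <;> omega
    have e2 : tau k (j + 1) = tau k j + 1 + 1 := by
      unfold tau; split_ifs <;> omega
    rw [cfSec, e1, e2]; exact dUp_mem U 0 (dUp_mem U 1 hF)
  · rw [LinearMap.sum_apply]
    refine Submodule.sum_mem _ fun A _ => ?_
    have e1 : sig k (j + 1) = sig k j + 1 := by unfold sig; split_ifs <;> omega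
    have e2 : tau k (j + 1) = tau k j + 1 := by
      unfold tau; split_ifs <;> omega
    rw [cfSec, e1, e2]; exact sLow_mem (dUp_mem U A hF)

/-- The operator `D_j : Γ(U, V_j) → Γ(U, V_{j+1})` of the `k`-Cauchy–Fueter complex. -/
def cfD (k j : ℕ) : cfSec U k j →ₗ[ℂ] cfSec U k (j + 1) :=
  (cfOp U k j).restrict fun _ hF => cfOp_mem U k j hF

/-! ### Zero Cauchy data -/

/-- The pointwise Hermitian inner product of two sections of `V_j`, extended by zero outside `U`;
the basis `(s^{0'})^p (s^{1'})^q ω^S` is orthonormal. (Another choice of a constant Hermitian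
inner product would lead to the same notion of zero Cauchy data.) -/
def pairing (k j : ℕ) (u v : cfSec U k j) : HSpace n → ℂ :=
  zext (S := (U : Set (HSpace n))) fun x =>
    ∑ pq ∈ Finset.HasAntidiagonal.antidiagonal (sig k j), ∑ S : Finset (Fin (2 * n + 2)),
      (u.1 pq.1 pq.2 S).1 x * (starRingEnd ℂ) ((v.1 pq.1 pq.2 S).1 x)

/-- The section vanishes outside a compact subset of `U`. -/
def CompactSupp {k j : ℕ} (u : cfSec U k j) : Prop :=
  ∃ K : Set (HSpace n), IsCompact K ∧ K ⊆ U ∧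
    ∀ p q S, ∀ x : (U : Set (HSpace n)), x.1 ∉ K → (u.1 p q S).1 x = 0

/-- `χ = D_j^* ψ`, where `D_j^*` is the formal adjoint of `D_j`. -/
def IsAdjointImage (k j : ℕ) (ψ : cfSec U k (j + 1)) (χ : cfSec U k j) : Prop :=
  ∀ v : cfSec U k j, CompactSupp U v →
    ∫ x, pairing U k (j + 1) (cfD U k j v) ψ x = ∫ x, pairing U k j v χ x

/-- `u` has zero Cauchy data on the boundary of `D` in `U` for `D_j`:
`∫_D ⟨D_j u, ψ⟩ = ∫_D ⟨u, D_j^* ψ⟩` for every section `ψ` with compact support in `U`. -/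
def ZeroCauchy (D : Set (HSpace n)) (k j : ℕ) (u : cfSec U k j) : Prop :=
  ∀ ψ : cfSec U k (j + 1), CompactSupp U ψ →
    ∀ χ : cfSec U k j, CompactSupp U χ → IsAdjointImage U k j ψ χ →
      ∫ x in D, pairing U k (j + 1) (cfD U k j u) ψ x = ∫ x in D, pairing U k j u χ x

theorem pairing_integrable {k j : ℕ} (u v : cfSec U k j) (hv : CompactSupp U v) :
    MeasureTheory.Integrable (pairing U k j u v) := by
  obtain ⟨K, hK, hKU, hz⟩ := hv
  have hc : ContinuousOn (pairing U k j u v) (U : Set (HSpace n)) := by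
    have : ContinuousOn (fun x => ∑ pq ∈ Finset.HasAntidiagonal.antidiagonal (sig k j),
        ∑ S : Finset (Fin (2 * n + 2)), zext (u.1 pq.1 pq.2 S).1 x *
          (starRingEnd ℂ) (zext (v.1 pq.1 pq.2 S).1 x)) (U : Set (HSpace n)) :=
      continuousOn_finsetSum _ fun pq _ => continuousOn_finsetSum _ fun S _ =>
        (contDiffOn_zext U _).continuousOn.mul
          (Complex.continuous_conj.comp_continuousOn (contDiffOn_zext U _).continuousOn)
    refine this.congr fun x hx => ?_
    rw [pairing, zext_of_mem _ hx]
    exact Finset.sum_congr rfl fun pq _ => Finset.sum_congr rfl fun S _ => by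
      rw [zext_of_mem _ hx, zext_of_mem _ hx]
  have hs : Function.support (pairing U k j u v) ⊆ K := fun x hx => by
    by_contra hxK
    refine hx ?_
    by_cases hxU : x ∈ (U : Set (HSpace n))
    · rw [pairing, zext_of_mem _ hxU]
      exact Finset.sum_eq_zero fun pq _ => Finset.sum_eq_zero fun S _ => by
        rw [hz _ _ _ ⟨x, hxU⟩ hxK]; simp
    · rw [pairing, zext, dif_neg hxU]
  exact (MeasureTheory.integrableOn_iff_integrable_of_support_subset hs).1
    ((hc.mono hKU).integrableOn_compact hK)

theorem pairing_add {k j : ℕ} (u u' v : cfSec U k j) :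
    pairing U k j (u + u') v = pairing U k j u v + pairing U k j u' v := by
  funext x
  by_cases hx : x ∈ (U : Set (HSpace n))
  · simp [pairing, zext, hx, add_mul, Finset.sum_add_distrib]
  · simp [pairing, zext, hx]

theorem pairing_smul {k j : ℕ} (c : ℂ) (u v : cfSec U k j) :
    pairing U k j (c • u) v = c • pairing U k j u v := by
  funext x
  by_cases hx : x ∈ (U : Set (HSpace n))
  · simp [pairing, zext, hx, mul_assoc, Finset.mul_sum]
  · simp [pairing, zext, hx]

/-- `J_j(U)`: the sections of `V_j` over `U` with zero Cauchy data on the boundary of `D`. -/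
def cauchyJ (D : Set (HSpace n)) (k j : ℕ) : Submodule ℂ (cfSec U k j) where
  carrier := {u | ZeroCauchy U D k j u}
  zero_mem' := fun ψ _ χ _ _ => by
    have h (i : ℕ) (w : cfSec U k i) : pairing U k i 0 w = 0 := by
      funext x; simp [pairing, zext]
    rw [map_zero, h, h]
  add_mem' := fun {u u'} hu hu' ψ hψ χ hχ had => by
    rw [map_add, pairing_add, pairing_add]
    have e1 := MeasureTheory.integral_add
      (pairing_integrable U (cfD U k j u) ψ hψ).integrableOn.integrable
      (pairing_integrable U (cfD U k j u') ψ hψ).integrableOn.integrable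
      (μ := MeasureTheory.volume.restrict D)
    have e2 := MeasureTheory.integral_add
      (pairing_integrable U u χ hχ).integrableOn.integrable
      (pairing_integrable U u' χ hχ).integrableOn.integrable
      (μ := MeasureTheory.volume.restrict D)
    exact e1.trans ((congrArg₂ (· + ·) (hu ψ hψ χ hχ had) (hu' ψ hψ χ hχ had)).trans e2.symm)
  smul_mem' := fun c u hu ψ hψ χ hχ had => by
    rw [map_smul, pairing_smul, pairing_smul]
    exact (MeasureTheory.integral_smul c _).trans
      ((congrArg (c • ·) (hu ψ hψ χ hχ had)).trans (MeasureTheory.integral_smul c _).symm)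

end Domain

/-! ### The hypersurface and its tangential operators -/

/-- A smooth real function `φ` of the coordinates `(q', Im q_{n+1})`. -/
structure GraphFn (n : ℕ) where
  /-- The function. -/
  toFun : (Fin (4 * n + 3) → ℝ) → ℝ
  smooth : ContDiff ℝ ∞ toFun

section Boundary

variable {n : ℕ}

/-- `(q', q_{n+1}) ↦ (q', Im q_{n+1})`: the coordinate with index `4n` is left out. -/
def proj (x : HSpace n) : Fin (4 * n + 3) → ℝ := fun i => x ((nIdx n).succAbove i)

variable (φ : GraphFn n)

/-- `ϱ = Re q_{n+1} - φ(q', Im q_{n+1})`. -/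
def rho (x : HSpace n) : ℝ := x (nIdx n) - φ.toFun (proj x)

/-- The domain `D = {ϱ > 0}`. -/
def dom : Set (HSpace n) := {x | 0 < rho φ x}

/-- The point of the graph `bD = {ϱ = 0}` with the same coordinates `(q', Im q_{n+1})` as `x`. -/
def retr (x : HSpace n) : HSpace n := Function.update x (nIdx n) (φ.toFun (proj x))

theorem proj_contDiff : ContDiff ℝ ∞ (proj (n := n)) :=
  contDiff_pi.2 fun i => contDiff_apply ℝ ℝ ((nIdx n).succAbove i)

theorem rho_contDiff : ContDiff ℝ ∞ (rho φ) :=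
  (contDiff_apply ℝ ℝ (nIdx n)).sub (φ.smooth.comp proj_contDiff)

theorem retr_contDiff : ContDiff ℝ ∞ (retr φ) := by
  refine contDiff_pi.2 fun i => ?_
  by_cases h : i = nIdx n
  · subst h; simpa [retr, Function.comp_def] using φ.smooth.comp (proj_contDiff (n := n))
  · simpa [retr, h] using contDiff_apply ℝ ℝ i

theorem rho_retr (x : HSpace n) : rho φ (retr φ x) = 0 := by
  have : proj (retr φ x) = proj x := by
    funext i; simp [proj, retr, Fin.succAbove_ne]
  rw [rho, this]; simp [retr]

theorem retr_eq {x : HSpace n} (h : rho φ x = 0) : retr φ x = x := by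
  have h' : φ.toFun (proj x) = x (nIdx n) := by unfold rho at h; linarith
  simp [retr, h']

/-- A globally defined smooth real function, as an element of the algebra of `S`. -/
def ofGlobal (S : Set (HSpace n)) (g : HSpace n → ℝ) (hg : ContDiff ℝ ∞ g) : SmoothFn S :=
  ⟨fun x => (g x : ℂ), Set.univ, isOpen_univ, Set.subset_univ _, fun x => (g x : ℂ),
    (Complex.ofRealCLM.contDiff.comp hg).contDiffOn, fun _ => rfl⟩

theorem contDiff_partial {g : HSpace n → ℝ} (hg : ContDiff ℝ ∞ g) (i : Fin (4 * n + 4)) :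
    ContDiff ℝ ∞ fun x => fderiv ℝ g x (Pi.single i 1) :=
  (hg.fderiv_right (by simp)).clm_apply contDiff_const

/-- `∂ϱ/∂x_{i+1}` on `S`. -/
def drho (S : Set (HSpace n)) (i : Fin (4 * n + 4)) : SmoothFn S :=
  ofGlobal S (fun x => fderiv ℝ (rho φ) x (Pi.single i 1)) (contDiff_partial (rho_contDiff φ) i)

/-- `∂²ϱ/∂x_{i+1}∂x_{j+1}` on `S`. -/
def ddrho (S : Set (HSpace n)) (i j : Fin (4 * n + 4)) : SmoothFn S :=
  ofGlobal S (fun x => fderiv ℝ (fun y => fderiv ℝ (rho φ) y (Pi.single j 1)) x (Pi.single i 1))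
    (contDiff_partial (contDiff_partial (rho_contDiff φ) j) i)

/-- The one-form `Ω^{A'} = d^{A'} ϱ = ∑_a (∇_a^{A'} ϱ) ω^a`. -/
def Omega (S : Set (HSpace n)) (A' : Fin 2) (a : Fin (2 * n + 2)) : SmoothFn S :=
  ∑ i, nabUp a A' i • drho φ S i

/-- The coefficients of `ℰ = -d^{0'} d^{1'} ϱ = ∑_{a,b} ℰ_{ab} ω^a ∧ ω^b`, skew-symmetric in
`a, b`: `ℰ_{ab} = -½ (∇_a^{0'} ∇_b^{1'} - ∇_b^{0'} ∇_a^{1'}) ϱ`. -/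
def Eform (S : Set (HSpace n)) (a b : Fin (2 * n + 2)) : SmoothFn S :=
  (-(1 / 2) : ℂ) • ∑ i, ∑ j, (nabUp a 0 i * nabUp b 1 j - nabUp b 0 i * nabUp a 1 j) •
    ddrho φ S i j

variable (U : TopologicalSpace.Opens (HSpace n))

/-- `bD ∩ U`. -/
def bdry : Set (HSpace n) := {x | x ∈ U ∧ rho φ x = 0}

theorem bdry_subset : bdry φ U ⊆ (U : Set (HSpace n)) := fun _ h => h.1

/-- The extension of a function on `bD ∩ U` that does not depend on `x_{4n+1}`. -/
def cext (f : bdry φ U → ℂ) (y : HSpace n) : ℂ := zext f (retr φ y)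

theorem cext_smooth (f : SmoothFn (bdry φ U)) : ∃ O : Set (HSpace n), IsOpen O ∧ bdry φ U ⊆ O ∧
    ContDiffOn ℝ ∞ (cext φ U f.1) O := by
  obtain ⟨f, O, hO, hs, g, hg, e⟩ := f
  refine ⟨retr φ ⁻¹' (O ∩ U), (hO.inter U.isOpen).preimage (retr_contDiff φ).continuous,
    fun x hx => ?_, ?_⟩
  · rw [Set.mem_preimage, retr_eq φ hx.2]; exact ⟨hs hx, hx.1⟩
  · refine (hg.comp (retr_contDiff φ).contDiffOn fun y hy => hy.1).congr fun y hy => ?_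
    have hb : retr φ y ∈ bdry φ U := ⟨hy.2, rho_retr φ y⟩
    rw [cext, zext_of_mem f hb]; exact e ⟨_, hb⟩

/-- The derivative in the direction `x_{i+1}` of the extension that does not depend on `x_{4n+1}`.
If `∑ c_i ∂/∂x_{i+1}` is tangential to `bD`, then `∑ c_i bpd i` is its action on functions on
`bD ∩ U`. -/
def bpd (i : Fin (4 * n + 4)) : SmoothFn (bdry φ U) →ₗ[ℂ] SmoothFn (bdry φ U) where
  toFun f := ⟨fun x => fderiv ℝ (cext φ U f.1) x.1 (Pi.single i 1), by
    obtain ⟨O, hO, hs, hc⟩ := cext_smooth φ U f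
    exact ⟨O, hO, hs, _, (hc.fderiv_of_isOpen hO (by simp)).clm_apply contDiffOn_const,
      fun _ => rfl⟩⟩
  map_add' f₁ f₂ := by
    ext x
    have hd : ∀ f : SmoothFn (bdry φ U), DifferentiableAt ℝ (cext φ U f.1) x.1 := fun f => by
      obtain ⟨O, hO, hs, hc⟩ := cext_smooth φ U f
      exact (hc.contDiffAt (hO.mem_nhds (hs x.2))).differentiableAt (by simp)
    have : cext φ U (f₁ + f₂).1 = cext φ U f₁.1 + cext φ U f₂.1 := by
      funext y; by_cases hy : retr φ y ∈ bdry φ U <;> simp [cext, zext, hy]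
    change fderiv ℝ (cext φ U (f₁ + f₂).1) x.1 _ =
      fderiv ℝ (cext φ U f₁.1) x.1 _ + fderiv ℝ (cext φ U f₂.1) x.1 _
    rw [this, fderiv_add (hd f₁) (hd f₂)]; rfl
  map_smul' c f := by
    ext x
    have hd : DifferentiableAt ℝ (cext φ U f.1) x.1 := by
      obtain ⟨O, hO, hs, hc⟩ := cext_smooth φ U f
      exact (hc.contDiffAt (hO.mem_nhds (hs x.2))).differentiableAt (by simp)
    have : cext φ U (c • f).1 = c • cext φ U f.1 := by
      funext y; by_cases hy : retr φ y ∈ bdry φ U <;> simp [cext, zext, hy]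
    change fderiv ℝ (cext φ U (c • f).1) x.1 _ = c • fderiv ℝ (cext φ U f.1) x.1 _
    rw [this, fderiv_const_smul hd]; rfl

/-- The action on functions on `bD ∩ U` of a tangential field `∑ c_i ∂/∂x_{i+1}`. -/
def vfB (c : Fin (4 * n + 4) → SmoothFn (bdry φ U)) :
    SmoothFn (bdry φ U) →ₗ[ℂ] SmoothFn (bdry φ U) :=
  ∑ i, LinearMap.mulLeft ℂ (c i) ∘ₗ bpd φ U i

/-- The matrix `(𝐍_{B'C'} ϱ)`, where `𝐍_{B'C'} = ∇_{(2n+B')C'}`. -/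
def Nrho : Matrix (Fin 2) (Fin 2) (SmoothFn (bdry φ U)) :=
  Matrix.of fun B' C' => ∑ i, nabLow (vIdx B') C' i • drho φ (bdry φ U) i

/-- `n_{AB'} = ∇_{AD'}ϱ · (𝐍ϱ)^{-1}_{D'B'}`. -/
def nCo (A : Fin (2 * n)) (B' : Fin 2) : SmoothFn (bdry φ U) :=
  ∑ D' : Fin 2, (∑ i, nabLow (hIdx A) D' i • drho φ (bdry φ U) i) * (Nrho φ U)⁻¹ D' B'

/-- The coefficients of `Z_A^{A'} = ∇_A^{A'} - n_{AB'} 𝐍_{B'}^{A'}`. -/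
def Zfield (A : Fin (2 * n)) (A' : Fin 2) (i : Fin (4 * n + 4)) : SmoothFn (bdry φ U) :=
  algebraMap ℂ _ (nabUp (hIdx A) A' i) - ∑ B' : Fin 2, nabUp (vIdx B') A' i • nCo φ U A B'

/-- `R_{B'C'} = ε_{B'D'} (𝐍ϱ)^{-1}_{D'C'}`. -/
def Rco (B' C' : Fin 2) : SmoothFn (bdry φ U) :=
  ∑ D' : Fin 2, epsLow B' D' • (Nrho φ U)⁻¹ D' C'

/-- The coefficients of `𝐓_{B'}^{A'} = R_{B'C'} 𝐍_{C'}^{A'} - δ_{B'}^{A'} ∂_{4n+1}`. -/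
def Tfield (B' A' : Fin 2) (i : Fin (4 * n + 4)) : SmoothFn (bdry φ U) :=
  (∑ C' : Fin 2, nabUp (vIdx C') A' i • Rco φ U B' C') - if A' = B' ∧ i = nIdx n then 1 else 0

/-- The operators act on sections over `bD ∩ U`. -/
abbrev BTen : Type := Ten n (SmoothFn (bdry φ U))

/-- `𝔡^{A'} F = ∑_A ω^A ∧ Z_A^{A'} F`. -/
def frd (A' : Fin 2) : BTen φ U →ₗ[ℂ] BTen φ U :=
  ∑ A, ext1 (hIdx A) ∘ₗ mapT (vfB φ U (Zfield φ U A A'))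

/-- `𝔡_{A'} = 𝔡^{B'} ε_{B'A'}`. -/
def frdLow (A' : Fin 2) : BTen φ U →ₗ[ℂ] BTen φ U := ∑ B' : Fin 2, epsLow B' A' • frd φ U B'

/-- `𝐓_{B'}^{A'}`, acting on coefficients. -/
def Top (B' A' : Fin 2) : BTen φ U →ₗ[ℂ] BTen φ U := mapT (vfB φ U (Tfield φ U B' A'))

/-- `𝐓^{A'B'} = 𝐓_{C'}^{A'} ε^{C'B'}`. -/
def TopUp (A' B' : Fin 2) : BTen φ U →ₗ[ℂ] BTen φ U := ∑ C' : Fin 2, epsUp C' B' • Top φ U C' A'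

/-- The coefficients `P_{aA}` in `ω^a = ∑_A P_{aA} ω^A + ∑_{B'} Q_{aB'} Ω^{B'}` on `bD ∩ U`. -/
def Pco (a : Fin (2 * n + 2)) (A : Fin (2 * n)) : SmoothFn (bdry φ U) :=
  Fin.addCases (fun B : Fin (2 * n) => if B = A then 1 else 0) (fun C' : Fin 2 => -nCo φ U A C') a

/-- The coefficients `Q_{aB'}` in `ω^a = ∑_A P_{aA} ω^A + ∑_{B'} Q_{aB'} Ω^{B'}` on `bD ∩ U`. -/
def Qco (a : Fin (2 * n + 2)) (B' : Fin 2) : SmoothFn (bdry φ U) :=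
  Fin.addCases (fun _ : Fin (2 * n) => 0) (fun C' : Fin 2 => Rco φ U B' C') a

/-- `ℰ_0` in `ℰ = ℰ_0 + Ω^{A'} ∧ ℰ_{A'} + ℰ_{0'1'} Ω^{0'} ∧ Ω^{1'}`. -/
def E0 (A B : Fin (2 * n)) : SmoothFn (bdry φ U) :=
  ∑ a, ∑ b, Eform φ (bdry φ U) a b * (Pco φ U a A * Pco φ U b B)

/-- `ℰ_{C'}` in `ℰ = ℰ_0 + Ω^{A'} ∧ ℰ_{A'} + ℰ_{0'1'} Ω^{0'} ∧ Ω^{1'}`. -/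
def E1 (C' : Fin 2) (A : Fin (2 * n)) : SmoothFn (bdry φ U) :=
  ∑ a, ∑ b, Eform φ (bdry φ U) a b * (Qco φ U a C' * Pco φ U b A - Pco φ U a A * Qco φ U b C')

/-- `ℰ^{A'} = ℰ_{B'} ε^{B'A'}`. -/
def E1Up (A' : Fin 2) (A : Fin (2 * n)) : SmoothFn (bdry φ U) :=
  ∑ B' : Fin 2, epsUp B' A' • E1 φ U B' A

/-- `ℰ_{0'1'}` in `ℰ = ℰ_0 + Ω^{A'} ∧ ℰ_{A'} + ℰ_{0'1'} Ω^{0'} ∧ Ω^{1'}`. -/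
def E01 : SmoothFn (bdry φ U) :=
  ∑ a, ∑ b, Eform φ (bdry φ U) a b * (Qco φ U a 0 * Qco φ U b 1 - Qco φ U a 1 * Qco φ U b 0)

/-! ### The spaces and operators of the boundary complex -/

/-- `Γ(bD ∩ U, 𝒱_j^{(1)})`, `𝒱_j^{(1)} = ⊙^{σ_j} ℂ² ⊗ ∧^{τ_j} ℂ^{2n}`. -/
abbrev bSec1 (k j : ℕ) : Submodule ℂ (BTen φ U) :=
  Sec n (SmoothFn (bdry φ U)) (2 * n) (sig k j) (tau k j)

/-- `Γ(bD ∩ U, 𝒱_j^{(2)})`, where `𝒱_j^{(2)} = ⊙^{σ_{j+1}} ℂ² ⊗ ∧^{τ_j - 1} ℂ^{2n}` for `j ≠ k`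
and `𝒱_k^{(2)} = ∧^k ℂ^{2n}`. -/
abbrev bSec2 (k j : ℕ) : Submodule ℂ (BTen φ U) :=
  Sec n (SmoothFn (bdry φ U)) (2 * n) (if j = k then 0 else sig k (j + 1))
    (if j = k then (k : ℤ) else tau k j - 1)

/-- The first-order operators `∂_{A'} 𝔡^{A'}` (`j < k`) and `s_{A'} 𝔡^{A'}` (`j > k`), and the
second-order operator `𝔡^{0'} 𝔡^{1'}` (`j = k`). -/
def bOp (k j : ℕ) : BTen φ U →ₗ[ℂ] BTen φ U :=
  if j < k then ∑ A' : Fin 2, partialS A' ∘ₗ frd φ U A'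
  else if j = k then frd φ U 0 ∘ₗ frd φ U 1
  else ∑ A' : Fin 2, sLow A' ∘ₗ frd φ U A'

/-- The first component `𝒟_j^{(1)}` of `𝒟_j`. -/
def bD1 (k j : ℕ) : BTen φ U × BTen φ U →ₗ[ℂ] BTen φ U :=
  let F₁ := LinearMap.fst ℂ (BTen φ U) (BTen φ U)
  let F₂ := LinearMap.snd ℂ (BTen φ U) (BTen φ U)
  if j = k then
    frd φ U 0 ∘ₗ frd φ U 1 ∘ₗ F₁ - hwedge2 (E0 φ U) ∘ₗ (TopUp φ U 1 0 ∘ₗ F₁ + F₂)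
  else if j < k then
    (∑ A' : Fin 2, partialS A' ∘ₗ frd φ U A' ∘ₗ F₁) + hwedge2 (E0 φ U) ∘ₗ F₂
  else
    (∑ A' : Fin 2, sLow A' ∘ₗ frd φ U A' ∘ₗ F₁) + hwedge2 (E0 φ U) ∘ₗ F₂

/-- The second component `𝒟_j^{(2)}` of `𝒟_j`. -/
def bD2 (k j : ℕ) : BTen φ U × BTen φ U →ₗ[ℂ] BTen φ U :=
  let F₁ := LinearMap.fst ℂ (BTen φ U) (BTen φ U)
  let F₂ := LinearMap.snd ℂ (BTen φ U) (BTen φ U)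
  if j + 1 < k then
    -(∑ A' : Fin 2, partialS A' ∘ₗ (frd φ U A' + hwedge1 (E1Up φ U A')) ∘ₗ F₂)
      - ∑ A' : Fin 2, ∑ B' : Fin 2, partialS A' ∘ₗ partialS B' ∘ₗ TopUp φ U A' B' ∘ₗ F₁
  else if j + 1 = k then
    ((1 / 2 : ℂ) • (frd φ U 0 ∘ₗ frd φ U 1 - frd φ U 1 ∘ₗ frd φ U 0)) ∘ₗ F₂
      - (∑ A' : Fin 2, frd φ U A' ∘ₗ hwedge1 (E1 φ U A') ∘ₗ F₂)
      + hwedge2 (E0 φ U) ∘ₗ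
          ((1 / 2 : ℂ) • (TopUp φ U 0 1 - TopUp φ U 1 0) + mulT (E01 φ U)) ∘ₗ F₂
      - ∑ A' : Fin 2, ∑ B' : Fin 2, partialS A' ∘ₗ frd φ U B' ∘ₗ Top φ U B' A' ∘ₗ F₁
  else if j = k then
    ∑ A' : Fin 2, sUp A' ∘ₗ (-(frdLow φ U A' ∘ₗ F₂)
      - hwedge1 (E1 φ U A') ∘ₗ (TopUp φ U 1 0 ∘ₗ F₁ + F₂)
      + Top φ U A' 0 ∘ₗ frd φ U 1 ∘ₗ F₁ - frd φ U 0 ∘ₗ Top φ U A' 1 ∘ₗ F₁)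
  else
    -(∑ A' : Fin 2, sLow A' ∘ₗ (frd φ U A' + hwedge1 (E1Up φ U A')) ∘ₗ F₂)
      - ∑ A' : Fin 2, ∑ B' : Fin 2, sLow A' ∘ₗ sLow B' ∘ₗ TopUp φ U A' B' ∘ₗ F₁

/-! Degrees of the operators `𝒟_j`. -/

theorem Sec_congr {R : Type} [CommRing R] [Algebra ℂ R] {N σ σ' : ℕ} {τ τ' : ℤ} {F : Ten n R}
    (hF : F ∈ Sec n R N σ τ) (hσ : σ = σ') (hτ : τ = τ') : F ∈ Sec n R N σ' τ' := by
  subst hσ; subst hτ; exact hF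

theorem frd_mem (A' : Fin 2) {σ : ℕ} {τ : ℤ} {F : BTen φ U}
    (hF : F ∈ Sec n (SmoothFn (bdry φ U)) (2 * n) σ τ) :
    frd φ U A' F ∈ Sec n (SmoothFn (bdry φ U)) (2 * n) σ (τ + 1) := by
  rw [frd, LinearMap.sum_apply]
  exact Submodule.sum_mem _ fun A _ => ext1_mem (by simp [hIdx]) (mapT_mem _ hF)

theorem frdLow_mem (A' : Fin 2) {σ : ℕ} {τ : ℤ} {F : BTen φ U}
    (hF : F ∈ Sec n (SmoothFn (bdry φ U)) (2 * n) σ τ) :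
    frdLow φ U A' F ∈ Sec n (SmoothFn (bdry φ U)) (2 * n) σ (τ + 1) := by
  rw [frdLow, LinearMap.sum_apply]
  exact Submodule.sum_mem _ fun B _ => Submodule.smul_mem _ _ (frd_mem φ U B hF)

theorem Top_mem (B' A' : Fin 2) {σ : ℕ} {τ : ℤ} {F : BTen φ U}
    (hF : F ∈ Sec n (SmoothFn (bdry φ U)) (2 * n) σ τ) :
    Top φ U B' A' F ∈ Sec n (SmoothFn (bdry φ U)) (2 * n) σ τ := mapT_mem _ hF

theorem TopUp_mem (A' B' : Fin 2) {σ : ℕ} {τ : ℤ} {F : BTen φ U}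
    (hF : F ∈ Sec n (SmoothFn (bdry φ U)) (2 * n) σ τ) :
    TopUp φ U A' B' F ∈ Sec n (SmoothFn (bdry φ U)) (2 * n) σ τ := by
  rw [TopUp, LinearMap.sum_apply]
  exact Submodule.sum_mem _ fun C _ => Submodule.smul_mem _ _ (Top_mem φ U C A' hF)

theorem bD1_mem (k j : ℕ) {F₁ F₂ : BTen φ U} (h₁ : F₁ ∈ bSec1 φ U k j) (h₂ : F₂ ∈ bSec2 φ U k j) :
    bD1 φ U k j (F₁, F₂) ∈ bSec1 φ U k (j + 1) := by
  unfold bD1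
  split_ifs with hjk hlt
  · subst hjk
    have h₁' := Sec_congr h₁ (show sig j j = 0 by simp [sig]) (show tau j j = j by simp [tau])
    have h₂' : F₂ ∈ Sec n (SmoothFn (bdry φ U)) (2 * n) 0 (j : ℤ) := by simpa [bSec2] using h₂
    refine Sec_congr (σ := 0) (τ := j + 2) ?_ (by simp [sig]) (by simp [tau]; ring)
    refine Submodule.sub_mem _ (Sec_congr (frd_mem φ U 0 (frd_mem φ U 1 h₁')) rfl (by ring))
      (hwedge2_mem _ (Submodule.add_mem _ (TopUp_mem φ U 1 0 h₁') h₂'))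
  · have h₂' : F₂ ∈ Sec n (SmoothFn (bdry φ U)) (2 * n) (sig k (j + 1)) (tau k j - 1) := by
      simpa [bSec2, hjk] using h₂
    have e1 : sig k (j + 1) + 1 = sig k j := by unfold sig; split_ifs <;> omega
    have e2 : tau k (j + 1) = tau k j + 1 := by unfold tau; split_ifs <;> omega
    refine Submodule.add_mem _ ?_ (Sec_congr (hwedge2_mem _ h₂') rfl (by rw [e2]; ring))
    rw [LinearMap.sum_apply]
    refine Submodule.sum_mem _ fun A _ => partialS_mem ?_
    exact Sec_congr (frd_mem φ U A h₁) e1.symm e2.symm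
  · have h₂' : F₂ ∈ Sec n (SmoothFn (bdry φ U)) (2 * n) (sig k (j + 1)) (tau k j - 1) := by
      simpa [bSec2, hjk] using h₂
    have e1 : sig k (j + 1) = sig k j + 1 := by unfold sig; split_ifs <;> omega
    have e2 : tau k (j + 1) = tau k j + 1 := by unfold tau; split_ifs <;> omega
    refine Submodule.add_mem _ ?_ (Sec_congr (hwedge2_mem _ h₂') rfl (by rw [e2]; ring))
    rw [LinearMap.sum_apply]
    refine Submodule.sum_mem _ fun A _ => ?_
    exact Sec_congr (sLow_mem (frd_mem φ U A h₁)) e1.symm e2.symm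

theorem bD2_mem (k j : ℕ) {F₁ F₂ : BTen φ U} (h₁ : F₁ ∈ bSec1 φ U k j) (h₂ : F₂ ∈ bSec2 φ U k j) :
    bD2 φ U k j (F₁, F₂) ∈ bSec2 φ U k (j + 1) := by
  unfold bD2
  split_ifs with hlt hjk1 hjk
  · have h₂' : F₂ ∈ Sec n (SmoothFn (bdry φ U)) (2 * n) (sig k (j + 1)) (tau k j - 1) := by
      simpa [bSec2, show j ≠ k by omega] using h₂
    have e1 : sig k (j + 1) = sig k (j + 2) + 1 := by unfold sig; split_ifs <;> omega
    have e0 : sig k j = sig k (j + 2) + 1 + 1 := by unfold sig; split_ifs <;> omega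
    have e2 : tau k (j + 1) = tau k j + 1 := by unfold tau; split_ifs <;> omega
    have h₂'' := Sec_congr h₂' e1 rfl
    have h₁' := Sec_congr h₁ e0 rfl
    refine Sec_congr (σ := sig k (j + 2)) (τ := tau k j) ?_
      (by rw [if_neg (by omega)]) (by rw [if_neg (by omega), e2]; ring)
    refine Submodule.sub_mem _ (Submodule.neg_mem _ ?_) ?_
    · rw [LinearMap.sum_apply]
      refine Submodule.sum_mem _ fun A _ => partialS_mem ?_
      exact Sec_congr (Submodule.add_mem _ (frd_mem φ U A h₂'') (hwedge1_mem _ h₂'')) rfl (by ring)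
    · rw [LinearMap.sum_apply]
      refine Submodule.sum_mem _ fun A _ => ?_
      rw [LinearMap.sum_apply]
      exact Submodule.sum_mem _ fun B _ => partialS_mem (partialS_mem (TopUp_mem φ U A B h₁'))
  · subst hjk1
    have h₁' := Sec_congr h₁ (show sig (j + 1) j = 0 + 1 by simp [sig])
      (show tau (j + 1) j = j by simp [tau])
    have h₂' : F₂ ∈ Sec n (SmoothFn (bdry φ U)) (2 * n) 0 ((j : ℤ) - 1) := by
      simpa [bSec2, sig, tau] using h₂
    refine Sec_congr (σ := 0) (τ := j + 1) ?_ (by simp) (by simp)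
    have hd (A B : Fin 2) : frd φ U A (frd φ U B F₂) ∈
        Sec n (SmoothFn (bdry φ U)) (2 * n) 0 ((j : ℤ) + 1) :=
      Sec_congr (frd_mem φ U A (frd_mem φ U B h₂')) rfl (by ring)
    refine Submodule.sub_mem _ (Submodule.add_mem _ (Submodule.sub_mem _ ?_ ?_) ?_) ?_
    · exact Submodule.smul_mem _ _ (Submodule.sub_mem _ (hd 0 1) (hd 1 0))
    · rw [LinearMap.sum_apply]
      exact Submodule.sum_mem _ fun A _ =>
        Sec_congr (frd_mem φ U A (hwedge1_mem (E1 φ U A) h₂')) rfl (by ring)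
    · refine Sec_congr (hwedge2_mem (E0 φ U) (σ := 0) (τ := (j : ℤ) - 1) ?_) rfl (by ring)
      exact Submodule.add_mem _ (Submodule.smul_mem _ _ (Submodule.sub_mem _
        (TopUp_mem φ U 0 1 h₂') (TopUp_mem φ U 1 0 h₂'))) (mapT_mem _ h₂')
    · rw [LinearMap.sum_apply]
      refine Submodule.sum_mem _ fun A _ => ?_
      rw [LinearMap.sum_apply]
      exact Submodule.sum_mem _ fun B _ => partialS_mem (frd_mem φ U B (Top_mem φ U B A h₁'))
  · subst hjk
    have h₁' := Sec_congr h₁ (show sig j j = 0 by simp [sig]) (show tau j j = j by simp [tau])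
    have h₂' : F₂ ∈ Sec n (SmoothFn (bdry φ U)) (2 * n) 0 (j : ℤ) := by simpa [bSec2] using h₂
    refine Sec_congr (σ := 0 + 1) (τ := j + 1) ?_
      (by rw [if_neg (by omega)]; unfold sig; split_ifs <;> omega)
      (by rw [if_neg (by omega)]; unfold tau; split_ifs <;> push_cast <;> omega)
    rw [LinearMap.sum_apply]
    refine Submodule.sum_mem _ fun A _ => sUp_mem ?_
    exact Submodule.sub_mem _ (Submodule.add_mem _ (Submodule.sub_mem _
      (Submodule.neg_mem _ (frdLow_mem φ U A h₂'))
      (hwedge1_mem _ (Submodule.add_mem _ (TopUp_mem φ U 1 0 h₁') h₂')))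
      (Top_mem φ U A 0 (frd_mem φ U 1 h₁'))) (frd_mem φ U 0 (Top_mem φ U A 1 h₁'))
  · have h₂' : F₂ ∈ Sec n (SmoothFn (bdry φ U)) (2 * n) (sig k (j + 1)) (tau k j - 1) := by
      simpa [bSec2, show j ≠ k by omega] using h₂
    have e1 : sig k (j + 2) = sig k (j + 1) + 1 := by unfold sig; split_ifs <;> omega
    have e0 : sig k (j + 2) = sig k j + 1 + 1 := by unfold sig; split_ifs <;> omega
    have e2 : tau k (j + 1) = tau k j + 1 := by unfold tau; split_ifs <;> omega
    refine Sec_congr (σ := sig k (j + 2)) (τ := tau k j) ?_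
      (by rw [if_neg (by omega)]) (by rw [if_neg (by omega), e2]; ring)
    refine Submodule.sub_mem _ (Submodule.neg_mem _ ?_) ?_
    · rw [LinearMap.sum_apply]
      refine Submodule.sum_mem _ fun A _ => ?_
      exact Sec_congr (sLow_mem
        (Submodule.add_mem _ (frd_mem φ U A h₂') (hwedge1_mem (E1Up φ U A) h₂'))) e1.symm (by ring)
    · rw [LinearMap.sum_apply]
      refine Submodule.sum_mem _ fun A _ => ?_
      rw [LinearMap.sum_apply]
      exact Submodule.sum_mem _ fun B _ =>
        Sec_congr (sLow_mem (sLow_mem (TopUp_mem φ U A B h₁))) e0.symm rfl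

/-- The operator `𝒟_j = (𝒟_j^{(1)}, 𝒟_j^{(2)}) : Γ(bD ∩ U, 𝒱_j) → Γ(bD ∩ U, 𝒱_{j+1})`. -/
def bDop (k j : ℕ) : (bSec1 φ U k j × bSec2 φ U k j) →ₗ[ℂ]
    (bSec1 φ U k (j + 1) × bSec2 φ U k (j + 1)) :=
  LinearMap.prod
    ((bD1 φ U k j ∘ₗ LinearMap.prodMap (bSec1 φ U k j).subtype (bSec2 φ U k j).subtype).codRestrict
      _ fun F => bD1_mem φ U k j F.1.2 F.2.2)
    ((bD2 φ U k j ∘ₗ LinearMap.prodMap (bSec1 φ U k j).subtype (bSec2 φ U k j).subtype).codRestrict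
      _ fun F => bD2_mem φ U k j F.1.2 F.2.2)

theorem bOp_mem (k j : ℕ) {F : BTen φ U} (hF : F ∈ bSec1 φ U k j) :
    bOp φ U k j F ∈ bSec1 φ U k (j + 1) := by
  unfold bOp
  split_ifs with h1 h2
  · rw [LinearMap.sum_apply]
    refine Submodule.sum_mem _ fun A _ => partialS_mem ?_
    exact Sec_congr (frd_mem φ U A hF) (by unfold sig; split_ifs <;> omega)
      (by unfold tau; split_ifs <;> omega)
  · exact Sec_congr (frd_mem φ U 0 (frd_mem φ U 1 hF)) (by unfold sig; split_ifs <;> omega)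
      (by unfold tau; split_ifs <;> omega)
  · rw [LinearMap.sum_apply]
    refine Submodule.sum_mem _ fun A _ => ?_
    exact Sec_congr (sLow_mem (frd_mem φ U A hF)) (by unfold sig; split_ifs <;> omega)
      (by unfold tau; split_ifs <;> omega)

/-- The operators `∂_{A'} 𝔡^{A'}`, `𝔡^{0'} 𝔡^{1'}`, `s_{A'} 𝔡^{A'}` between the spaces
`Γ(bD ∩ U, 𝒱_j^{(1)})`. -/
def bD1only (k j : ℕ) : bSec1 φ U k j →ₗ[ℂ] bSec1 φ U k (j + 1) :=
  (bOp φ U k j).restrict fun _ hF => bOp_mem φ U k j hF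

/-! ### The identification of the quotient spaces -/

/-- `Q_j = Γ(U, V_j) / J_j(U)`. -/
abbrev cfQuot (k j : ℕ) : Type := SecQuot (cauchyJ U (dom φ) k j)

/-- The quotient map `Γ(U, V_j) → Q_j`. -/
def cfQuotMk (k j : ℕ) : cfSec U k j →ₗ[ℂ] cfQuot φ U k j := secMk (cauchyJ U (dom φ) k j)

/-- The operator `Q_j → Q_{j+1}` induced by `D_j`. -/
def cfQuotD (k j : ℕ)
    (h : cauchyJ U (dom φ) k j ≤ (cauchyJ U (dom φ) k (j + 1)).comap (cfD U k j)) :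
    cfQuot φ U k j →ₗ[ℂ] cfQuot φ U k (j + 1) :=
  secMap (cauchyJ U (dom φ) k j) (cauchyJ U (dom φ) k (j + 1)) (cfD U k j) h

/-- `f + Ω^{A'} ∧ H_{A'} + Ω^{0'} ∧ Ω^{1'} ∧ K` on `U`. -/
def frameForm (f : Ten n (SmoothFn (U : Set (HSpace n))))
    (H : Fin 2 → Ten n (SmoothFn (U : Set (HSpace n))))
    (K : Ten n (SmoothFn (U : Set (HSpace n)))) : Ten n (SmoothFn (U : Set (HSpace n))) :=
  f + (∑ A' : Fin 2, wedge1 (Omega φ (U : Set (HSpace n)) A') (H A'))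
    + wedge1 (Omega φ (U : Set (HSpace n)) 0) (wedge1 (Omega φ (U : Set (HSpace n)) 1) K)

/-- Restriction of sections over `U` to `bD ∩ U`. -/
def toBdry : Ten n (SmoothFn (U : Set (HSpace n))) →ₗ[ℂ] BTen φ U := mapT (restr (bdry_subset φ U))

/-- The second component of `Π_j [f + Ω^{A'} ∧ H_{A'} + Ω^{0'} ∧ Ω^{1'} ∧ K]`, for `f`, `H_{A'}`, `K`
with values in polynomial forms on `ℂ^{2n}`; all terms are restricted to `bD ∩ U`. -/
def piSecond (k j : ℕ) (f : Ten n (SmoothFn (U : Set (HSpace n))))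
    (H : Fin 2 → Ten n (SmoothFn (U : Set (HSpace n))))
    (K : Ten n (SmoothFn (U : Set (HSpace n)))) : BTen φ U :=
  if j < k then toBdry φ U (partialS 1 (H 0) - partialS 0 (H 1))
  else if j = k then
    toBdry φ U (mapT (pd U (nIdx n)) f) - (∑ A' : Fin 2, frd φ U A' (toBdry φ U (H A')))
      + hwedge2 (E0 φ U) (toBdry φ U K)
  else toBdry φ U (sLow 1 (H 0) - sLow 0 (H 1))

/-- The restriction of `ℰ = -d^{0'} d^{1'} ϱ` to `bD ∩ U`. -/
def Ebdry : BTen φ U :=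
  toBdry φ U (-(dUp U 0 (dUp U 1 (scalarT (ofGlobal (U : Set (HSpace n)) (rho φ) (rho_contDiff φ))))))

end Boundary

end KCF

end

/-! The theorem comes from Green's formula together with linear algebra in the frame `ω^A`,
`Ω^{0'}`, `Ω^{1'}`.

Zero Cauchy data. The boundary is a graph over `(q', Im q_{n+1})` and `∂ϱ/∂x_{4n+1} = 1`, so the
divergence theorem reads `∫_D ∂_i g = -∫_{bD} (∂_i ϱ) g`, with Lebesgue measure in the graph
coordinates on the right (`intD_pd`). For an operator of first order it shows that `u ∈ J_j` exactly
when the symbol at `dϱ` kills `u` on `bD`: `∂_{A'}(Ω^{A'} ∧ u) = 0` or `s_{A'} Ω^{A'} ∧ u = 0`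
(`mem_cauchyJ_of_lt`, `mem_cauchyJ_of_between`). For `j = k` the boundary term contains both the
test section and its normal derivative. Test sections divisible by `ϱ` separate the two, which
leaves `Ω^{0'} ∧ Ω^{1'} ∧ u = 0` and one further condition on the first jet (`mem_cauchyJ_of_eq`).

The isomorphisms. Expand `u = f + Ω^{A'} ∧ H_{A'} + Ω^{0'} ∧ Ω^{1'} ∧ K`, and let `L_{A'}` be
`∂_{A'}` or `s_{A'}`. The first-order condition becomes `L_{A'} f = 0` and `L_{1'} H_{0'} - L_{0'}
H_{1'} = 0`; the former forces `f = 0`, by Euler's identity or because multiplication by `s` is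
injective. For `j = k` the condition becomes the vanishing of `f` and of `∂_{4n+1} f - 𝔡^{A'} H_{A'}
+ ℰ_0 ∧ K`. So `J_j` is the kernel of an explicit map `piMap` (`ker_piMap`). It is surjective:
Euler's identity solves the equation for the `H_{A'}` (`exists_fib_sub_eq`), and the value and
normal derivative on `bD` may be prescribed (`exists_lift_Sec`).

The operators. On `bD` one has `d^{A'} u = dB^{A'}(u) + Ω^{A'} ∧ ∂_{4n+1} u` (`toBdry_dUp`), where
`dB` differentiates the extension that is constant in `x_{4n+1}`. Moreover `dB^{A'} = 𝔡^{A'} +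
Ω^{B'} ∧ 𝐓_{B'}^{A'}` (`dB_eq`), and moving `dB` past an `Ω` costs only a sign and a multiple of
`ℰ`, because `d^{A'} d^{A'} ϱ = 0` and `d^{0'} d^{1'} ϱ = -ℰ`. Computing `D_j u` for a lift `u` with
simple normal derivatives and reading off the frame components yields `𝒟_j`.

One lift suffices because `D_j J_j ⊆ J_{j+1}` (`cauchyJ_le_comap`). This inclusion is formal: if `χ`
is an adjoint image of `ψ`, then `0` is an adjoint image of `χ`, since `D_{j+1} D_j = 0`. Finally
`𝒟_{j+1} 𝒟_j = 0` is inherited from `D_{j+1} D_j = 0` through the surjectivity of `Π_j`, and the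
right-type case follows by taking the second component to be zero. -/

noncomputable section

namespace KCF

/-! ### The exterior algebra: creation and annihilation operators -/

section Sign

variable {R : Type} [CommRing R]

/-- The sign in the definitions of `ext1` and `int1`. -/
def posSign {m : ℕ} (R : Type) [CommRing R] (a : Fin m) (S : Finset (Fin m)) : R :=
  (-1) ^ (S.filter (· < a)).card

theorem posSign_mul_self {m : ℕ} (a : Fin m) (S : Finset (Fin m)) :
    posSign R a S * posSign R a S = 1 := by
  rw [posSign, ← mul_pow]; simp

/-- The number of elements below `a` changes by one exactly when `b < a`. This is the source of
every anticommutation sign below. -/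
theorem posSign_insert {m : ℕ} (a : Fin m) {b : Fin m} {S : Finset (Fin m)} (hb : b ∉ S) :
    posSign R a (insert b S) = if b < a then -posSign R a S else posSign R a S := by
  unfold posSign
  rw [Finset.filter_insert]
  split_ifs with h
  · rw [Finset.card_insert_of_notMem (by simp [hb]), pow_succ]; ring
  · rfl

theorem posSign_erase {m : ℕ} (a : Fin m) {b : Fin m} {S : Finset (Fin m)} (hb : b ∈ S) :
    posSign R a (S.erase b) = if b < a then -posSign R a S else posSign R a S := by
  conv_rhs => rw [← Finset.insert_erase hb]
  rw [posSign_insert a (Finset.notMem_erase b S)]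
  split_ifs <;> simp

end Sign

section Fock

variable {n : ℕ} {R : Type} [CommRing R] [Algebra ℂ R]

theorem mulT_eq_smul (r : R) (F : Ten n R) : mulT r F = r • F := rfl

theorem mapT_apply {R' : Type} [CommRing R'] [Algebra ℂ R'] (L : R →ₗ[ℂ] R') (F : Ten n R)
    (p q : ℕ) (S : Finset (Fin (2 * n + 2))) : mapT L F p q S = L (F p q S) := rfl

theorem ext1_apply (a : Fin (2 * n + 2)) (F : Ten n R) (p q : ℕ)
    (S : Finset (Fin (2 * n + 2))) : ext1 a F p q S =
      if a ∈ S then (-1) ^ (S.filter (· < a)).card * F p q (S.erase a) else 0 := rfl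

/-- The contraction with the vector dual to `ω^a`. -/
def int1 (a : Fin (2 * n + 2)) : Ten n R →ₗ[ℂ] Ten n R where
  toFun F := fun p q S =>
    if a ∈ S then 0 else (-1) ^ (S.filter (· < a)).card * F p q (insert a S)
  map_add' F G := by funext p q S; by_cases h : a ∈ S <;> simp [h, mul_add]
  map_smul' c F := by funext p q S; by_cases h : a ∈ S <;> simp [h]

theorem int1_apply (a : Fin (2 * n + 2)) (F : Ten n R) (p q : ℕ)
    (S : Finset (Fin (2 * n + 2))) : int1 a F p q S =
      if a ∈ S then 0 else (-1) ^ (S.filter (· < a)).card * F p q (insert a S) := rfl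

theorem ext1_smul (a : Fin (2 * n + 2)) (r : R) (F : Ten n R) :
    ext1 a (r • F) = r • ext1 a F := by
  funext p q S
  by_cases h : a ∈ S <;> simp [ext1_apply, h, mul_left_comm]

theorem int1_smul (a : Fin (2 * n + 2)) (r : R) (F : Ten n R) :
    int1 a (r • F) = r • int1 a F := by
  funext p q S
  by_cases h : a ∈ S <;> simp [int1_apply, h, mul_left_comm]

/-- Removing both indices gives the same coefficient in either order. Only the larger of the two
indices notices the removal of the other, so exactly one of the two products of signs is flipped. -/
theorem ext1_ext1 (a b : Fin (2 * n + 2)) (F : Ten n R) :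
    ext1 a (ext1 b F) = -ext1 b (ext1 a F) := by
  funext p q S
  change (if a ∈ S then posSign R a S * (if b ∈ S.erase a then
      posSign R b (S.erase a) * F p q ((S.erase a).erase b) else 0) else 0) =
    -(if b ∈ S then posSign R b S * (if a ∈ S.erase b then
      posSign R a (S.erase b) * F p q ((S.erase b).erase a) else 0) else 0)
  by_cases hab : a = b
  · subst hab; simp
  by_cases ha : a ∈ S <;> by_cases hb : b ∈ S <;>
    simp only [ha, hb, Finset.mem_erase, ne_eq, hab, Ne.symm hab, not_false_eq_true, and_self,
      and_false, if_true, if_false, mul_zero, neg_zero]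
  rw [posSign_erase _ ha, posSign_erase _ hb, Finset.erase_right_comm]
  rcases lt_or_gt_of_ne hab with h | h
  · rw [if_pos h, if_neg h.not_gt]; ring
  · rw [if_pos h, if_neg h.not_gt]; ring

theorem int1_int1 (a b : Fin (2 * n + 2)) (F : Ten n R) :
    int1 a (int1 b F) = -int1 b (int1 a F) := by
  funext p q S
  change (if a ∈ S then 0 else posSign R a S * (if b ∈ insert a S then 0 else
      posSign R b (insert a S) * F p q (insert b (insert a S)))) =
    -(if b ∈ S then 0 else posSign R b S * (if a ∈ insert b S then 0 else
      posSign R a (insert b S) * F p q (insert a (insert b S))))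
  by_cases hab : a = b
  · subst hab; simp
  by_cases ha : a ∈ S <;> by_cases hb : b ∈ S <;>
    simp only [ha, hb, Finset.mem_insert, hab, Ne.symm hab, or_self, or_true,
      if_true, if_false, mul_zero, neg_zero]
  rw [posSign_insert _ ha, posSign_insert _ hb, Finset.insert_comm]
  rcases lt_or_gt_of_ne hab with h | h
  · rw [if_pos h, if_neg h.not_gt]; ring
  · rw [if_pos h, if_neg h.not_gt]; ring

theorem int1_ext1_of_ne {a b : Fin (2 * n + 2)} (hab : a ≠ b) (F : Ten n R) :
    int1 a (ext1 b F) = -ext1 b (int1 a F) := by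
  funext p q S
  change (if a ∈ S then 0 else posSign R a S * (if b ∈ insert a S then
      posSign R b (insert a S) * F p q ((insert a S).erase b) else 0)) =
    -(if b ∈ S then posSign R b S * (if a ∈ S.erase b then 0 else
      posSign R a (S.erase b) * F p q (insert a (S.erase b))) else 0)
  by_cases ha : a ∈ S <;> by_cases hb : b ∈ S <;>
    simp only [ha, hb, Finset.mem_insert, Finset.mem_erase, ne_eq, hab, Ne.symm hab, or_self,
      or_true, not_false_eq_true, and_self, and_false, if_true, if_false, mul_zero, neg_zero]
  rw [posSign_insert _ ha, posSign_erase _ hb, Finset.erase_insert_of_ne hab]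
  rcases lt_or_gt_of_ne hab with h | h
  · rw [if_pos h, if_neg h.not_gt]; ring
  · rw [if_pos h, if_neg h.not_gt]; ring

theorem int1_ext1_self (a : Fin (2 * n + 2)) (F : Ten n R) :
    int1 a (ext1 a F) = F - ext1 a (int1 a F) := by
  funext p q S
  change (if a ∈ S then 0 else posSign R a S * (if a ∈ insert a S then
      posSign R a (insert a S) * F p q ((insert a S).erase a) else 0)) =
    F p q S - (if a ∈ S then posSign R a S * (if a ∈ S.erase a then 0 else
      posSign R a (S.erase a) * F p q (insert a (S.erase a))) else 0)
  by_cases ha : a ∈ S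
  · simp only [ha, if_true, Finset.notMem_erase, if_false, posSign_erase _ ha, lt_irrefl,
      Finset.insert_erase ha, ← mul_assoc, posSign_mul_self, one_mul, sub_self]
  · simp only [ha, if_false, Finset.mem_insert_self, if_true, posSign_insert _ ha, lt_irrefl,
      Finset.erase_insert ha, ← mul_assoc, posSign_mul_self, one_mul, sub_zero]

/-- The canonical anticommutation relation. The contraction calculus of a frame is deduced from it
without returning to signs of index sets. -/
theorem int1_ext1 (a b : Fin (2 * n + 2)) (F : Ten n R) :
    int1 a (ext1 b F) = (if a = b then F else 0) - ext1 b (int1 a F) := by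
  split_ifs with h
  · subst h; exact int1_ext1_self a F
  · rw [int1_ext1_of_ne h, zero_sub]

theorem int1_mem {a : Fin (2 * n + 2)} {N σ : ℕ} {τ : ℤ}
    {F : Ten n R} (hF : F ∈ Sec n R N σ τ) : int1 a F ∈ Sec n R N σ (τ - 1) := fun p q S h => by
  by_cases hS : a ∈ S
  · simp [int1_apply, hS]
  · have : F p q (insert a S) = 0 := by
      refine hF _ _ _ fun ⟨h1, h2, h3⟩ => h ⟨h1, ?_, fun b hb => ?_⟩
      · rw [← h2, Finset.card_insert_of_notMem hS]; push_cast; ring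
      · exact h3 b (Finset.mem_insert_of_mem hb)
    simp [int1_apply, this]

theorem Sec_smul_mem {N σ : ℕ} {τ : ℤ} (r : R) {F : Ten n R} (hF : F ∈ Sec n R N σ τ) :
    r • F ∈ Sec n R N σ τ := fun p q S h => by simp [hF p q S h]

theorem Sec_mono {N N' σ : ℕ} {τ : ℤ} (hN : N ≤ N') {F : Ten n R} (hF : F ∈ Sec n R N σ τ) :
    F ∈ Sec n R N' σ τ :=
  fun p q S h => hF p q S fun ⟨h1, h2, h3⟩ => h ⟨h1, h2, fun a ha => (h3 a ha).trans_le hN⟩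

/-! Commutation with the operations on the polynomial variables. -/

theorem partialS_smul (A' : Fin 2) (r : R) (F : Ten n R) :
    partialS A' (r • F) = r • partialS A' F := by
  funext p q S
  by_cases h : A' = 0 <;> simp [partialS, h, mul_left_comm]

theorem sUp_smul (A' : Fin 2) (r : R) (F : Ten n R) : sUp A' (r • F) = r • sUp A' F := by
  funext p q S
  by_cases h : A' = 0 <;> by_cases hp : p = 0 <;> by_cases hq : q = 0 <;>
    simp [sUp, h, hp, hq]

theorem partialS_ext1 (A' : Fin 2) (a : Fin (2 * n + 2)) (F : Ten n R) :
    partialS A' (ext1 a F) = ext1 a (partialS A' F) := by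
  funext p q S
  by_cases h : A' = 0 <;> by_cases ha : a ∈ S <;> simp [partialS, ext1_apply, h, ha, mul_left_comm]

theorem partialS_int1 (A' : Fin 2) (a : Fin (2 * n + 2)) (F : Ten n R) :
    partialS A' (int1 a F) = int1 a (partialS A' F) := by
  funext p q S
  by_cases h : A' = 0 <;> by_cases ha : a ∈ S <;> simp [partialS, int1_apply, h, ha, mul_left_comm]

theorem sUp_ext1 (A' : Fin 2) (a : Fin (2 * n + 2)) (F : Ten n R) :
    sUp A' (ext1 a F) = ext1 a (sUp A' F) := by
  funext p q S
  by_cases h : A' = 0 <;> by_cases ha : a ∈ S <;> by_cases hp : p = 0 <;> by_cases hq : q = 0 <;>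
    simp [sUp, ext1_apply, h, ha, hp, hq]

theorem sUp_int1 (A' : Fin 2) (a : Fin (2 * n + 2)) (F : Ten n R) :
    sUp A' (int1 a F) = int1 a (sUp A' F) := by
  funext p q S
  by_cases h : A' = 0 <;> by_cases ha : a ∈ S <;> by_cases hp : p = 0 <;> by_cases hq : q = 0 <;>
    simp [sUp, int1_apply, h, ha, hp, hq]

/-- `L` is only `ℂ`-linear, typically a derivation or a restriction; integer factors pass through it
because they are complex scalars. -/
theorem map_natCast_add_one_mul {R' : Type} [CommRing R'] [Algebra ℂ R'] (L : R →ₗ[ℂ] R') (p : ℕ)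
    (x : R) : L (((p : R) + 1) * x) = ((p : R') + 1) * L x := by
  have h (R : Type) [CommRing R] [Algebra ℂ R] (x : R) :
      ((p : R) + 1) * x = ((p : ℂ) + 1) • x := by
    rw [Algebra.smul_def]; simp
  rw [h, h, map_smul]

theorem partialS_mapT {R' : Type} [CommRing R'] [Algebra ℂ R'] (L : R →ₗ[ℂ] R') (A' : Fin 2)
    (F : Ten n R) : partialS A' (mapT L F) = mapT L (partialS A' F) := by
  funext p q S
  by_cases h : A' = 0 <;> simp [partialS, mapT_apply, h, map_natCast_add_one_mul]

theorem sUp_mapT {R' : Type} [CommRing R'] [Algebra ℂ R'] (L : R →ₗ[ℂ] R') (A' : Fin 2)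
    (F : Ten n R) : sUp A' (mapT L F) = mapT L (sUp A' F) := by
  funext p q S
  by_cases h : A' = 0 <;> by_cases hp : p = 0 <;> by_cases hq : q = 0 <;>
    simp [sUp, mapT_apply, h, hp, hq]

theorem map_neg_one_pow_mul {R' : Type} [CommRing R'] [Algebra ℂ R'] (L : R →ₗ[ℂ] R') (m : ℕ)
    (x : R) : L ((-1) ^ m * x) = (-1) ^ m * L x := by
  rcases neg_one_pow_eq_or R m with h | h <;> rcases Nat.even_or_odd m with h' | h' <;>
    simp [h'.neg_one_pow]

theorem mapT_ext1 {R' : Type} [CommRing R'] [Algebra ℂ R'] (L : R →ₗ[ℂ] R')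
    (a : Fin (2 * n + 2)) (F : Ten n R) : mapT L (ext1 a F) = ext1 a (mapT L F) := by
  funext p q S
  by_cases ha : a ∈ S <;> simp [ext1_apply, mapT_apply, ha, map_neg_one_pow_mul]

theorem mapT_int1 {R' : Type} [CommRing R'] [Algebra ℂ R'] (L : R →ₗ[ℂ] R')
    (a : Fin (2 * n + 2)) (F : Ten n R) : mapT L (int1 a F) = int1 a (mapT L F) := by
  funext p q S
  by_cases ha : a ∈ S <;> simp [int1_apply, mapT_apply, ha, map_neg_one_pow_mul]

theorem partialS_comm (A' B' : Fin 2) (F : Ten n R) :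
    partialS A' (partialS B' F) = partialS B' (partialS A' F) := by
  funext p q S
  by_cases h : A' = 0 <;> by_cases h' : B' = 0 <;> simp [partialS, h, h'] <;> ring

theorem sUp_comm (A' B' : Fin 2) (F : Ten n R) : sUp A' (sUp B' F) = sUp B' (sUp A' F) := by
  funext p q S
  by_cases h : A' = 0 <;> by_cases h' : B' = 0 <;> by_cases hp : p = 0 <;> by_cases hq : q = 0 <;>
    simp [sUp, h, h', hp, hq]

theorem sLow_zero : (sLow 0 : Ten n R →ₗ[ℂ] Ten n R) = -sUp 1 := by
  ext F p q S
  simp [sLow, epsLow]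

theorem sLow_one : (sLow 1 : Ten n R →ₗ[ℂ] Ten n R) = sUp 0 := by
  simp [sLow, epsLow]

/-- Euler's identity, in the form `∂_{A'} s^{A'} = degree + 2`. -/
theorem sum_partialS_sUp {N σ : ℕ} {τ : ℤ} {F : Ten n R} (hF : F ∈ Sec n R N σ τ) :
    partialS 1 (sUp 1 F) + partialS 0 (sUp 0 F) = ((σ : ℂ) + 2) • F := by
  funext p q S
  by_cases h : p + q = σ
  · subst h
    have h2 : algebraMap ℂ R 2 = 2 := map_ofNat _ 2
    simp [partialS, sUp, Algebra.smul_def, h2]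
    ring
  · have : F p q S = 0 := hF p q S fun h' => h h'.1
    simp [partialS, sUp, this]

/-- Euler's identity, in the form `s^{A'} ∂_{A'} = degree`. -/
theorem sum_sUp_partialS {N σ : ℕ} {τ : ℤ} {F : Ten n R} (hF : F ∈ Sec n R N σ τ) :
    sUp 0 (partialS 0 F) + sUp 1 (partialS 1 F) = (σ : ℂ) • F := by
  funext p q S
  by_cases h : p + q = σ
  · subst h
    rcases p with _ | p <;> rcases q with _ | q <;> (simp [partialS, sUp, Algebra.smul_def]; try ring)
  · have : F p q S = 0 := hF p q S fun h' => h h'.1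
    rcases p with _ | p <;> rcases q with _ | q <;> simp [partialS, sUp, this]

/-- By Euler's identity the partial derivatives determine a homogeneous polynomial of positive
degree. For `j < k` this forces the horizontal part of a section with zero Cauchy data to vanish on
`bD`. -/
theorem eq_zero_of_partialS {N σ : ℕ} {τ : ℤ} {F : Ten n R} (hF : F ∈ Sec n R N σ τ) (hσ : σ ≠ 0)
    (h : ∀ A', partialS A' F = 0) : F = 0 := by
  have := sum_sUp_partialS hF
  rw [h, h, map_zero, map_zero, add_zero] at this
  exact (smul_eq_zero_iff_right (M := Ten n R) (Nat.cast_ne_zero.2 hσ)).1 this.symm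

theorem eq_zero_of_sUp {F : Ten n R} (h : sUp 0 F = 0) : F = 0 := by
  funext p q S
  simpa [sUp] using congrFun (congrFun (congrFun h (p + 1)) q) S

end Fock

/-! ### Wedge products with one- and two-forms -/

section Wedge

variable {n : ℕ} {R : Type} [CommRing R] [Algebra ℂ R]

theorem wedge1_apply (α : Fin (2 * n + 2) → R) (F : Ten n R) :
    wedge1 α F = ∑ a, α a • ext1 a F := by
  simp [wedge1, mulT_eq_smul]

theorem wedge2_apply (β : Fin (2 * n + 2) → Fin (2 * n + 2) → R) (F : Ten n R) :
    wedge2 β F = ∑ a, ∑ b, β a b • ext1 a (ext1 b F) := by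
  simp [wedge2, mulT_eq_smul]

theorem hwedge1_apply (α : Fin (2 * n) → R) (F : Ten n R) :
    hwedge1 α F = ∑ A, α A • ext1 (hIdx A) F := by
  simp [hwedge1, mulT_eq_smul]

theorem hwedge2_apply (β : Fin (2 * n) → Fin (2 * n) → R) (F : Ten n R) :
    hwedge2 β F = ∑ A, ∑ B, β A B • ext1 (hIdx A) (ext1 (hIdx B) F) := by
  simp [hwedge2, mulT_eq_smul]

theorem wedge1_smul (α : Fin (2 * n + 2) → R) (r : R) (F : Ten n R) :
    wedge1 α (r • F) = r • wedge1 α F := by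
  simp only [wedge1_apply, ext1_smul, Finset.smul_sum, smul_comm r]

theorem wedge1_ext1 (α : Fin (2 * n + 2) → R) (b : Fin (2 * n + 2)) (F : Ten n R) :
    wedge1 α (ext1 b F) = -ext1 b (wedge1 α F) := by
  simp only [wedge1_apply, map_sum, ext1_smul, ← Finset.sum_neg_distrib, ← smul_neg]
  exact Finset.sum_congr rfl fun a _ => by rw [ext1_ext1 a b]

theorem ext1_wedge1 (α : Fin (2 * n + 2) → R) (b : Fin (2 * n + 2)) (F : Ten n R) :
    ext1 b (wedge1 α F) = -wedge1 α (ext1 b F) := by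
  rw [wedge1_ext1, neg_neg]

theorem wedge1_wedge1 (α β : Fin (2 * n + 2) → R) (F : Ten n R) :
    wedge1 α (wedge1 β F) = -wedge1 β (wedge1 α F) := by
  simp only [wedge1_apply β, map_sum, wedge1_smul, wedge1_ext1, ← Finset.sum_neg_distrib, smul_neg]

theorem wedge1_self (α : Fin (2 * n + 2) → R) (F : Ten n R) : wedge1 α (wedge1 α F) = 0 := by
  have h := wedge1_wedge1 α α F
  -- Anticommutation with itself gives `2 x = 0`, and `2` is invertible over `ℂ`.
  rw [eq_neg_iff_add_eq_zero, ← two_smul ℂ] at h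
  exact (smul_eq_zero_iff_right (M := Ten n R) two_ne_zero).1 h

theorem hwedge1_wedge1 (α : Fin (2 * n) → R) (β : Fin (2 * n + 2) → R) (F : Ten n R) :
    hwedge1 α (wedge1 β F) = -wedge1 β (hwedge1 α F) := by
  simp only [hwedge1_apply, map_sum, wedge1_smul, wedge1_ext1, ← Finset.sum_neg_distrib, smul_neg,
    neg_neg]

theorem wedge2_wedge1 (β : Fin (2 * n + 2) → Fin (2 * n + 2) → R) (α : Fin (2 * n + 2) → R)
    (F : Ten n R) : wedge2 β (wedge1 α F) = wedge1 α (wedge2 β F) := by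
  simp only [wedge2_apply, map_sum, wedge1_smul, ext1_wedge1, map_neg, neg_neg]

theorem wedge1_mem (α : Fin (2 * n + 2) → R) {σ : ℕ} {τ : ℤ} {F : Ten n R}
    (hF : F ∈ Sec n R (2 * n + 2) σ τ) : wedge1 α F ∈ Sec n R (2 * n + 2) σ (τ + 1) := by
  rw [wedge1_apply]
  exact Submodule.sum_mem _ fun a _ => Sec_smul_mem _ (ext1_mem a.2 hF)

/-! ### Horizontal forms -/

/-- The forms that involve only `ω^0, …, ω^{2n-1}`. -/
def Hor (F : Ten n R) : Prop := ∀ B' : Fin 2, int1 (vIdx B') F = 0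

theorem vIdx_ne_hIdx (B' : Fin 2) (A : Fin (2 * n)) : vIdx B' ≠ hIdx A := by
  intro h
  have := congrArg Fin.val h
  simp [vIdx, hIdx] at this
  omega

theorem Sec.hor {σ : ℕ} {τ : ℤ} {F : Ten n R} (hF : F ∈ Sec n R (2 * n) σ τ) : Hor F := by
  intro B'
  funext p q S
  by_cases hS : vIdx B' ∈ S
  · simp [int1_apply, hS]
  · have : F p q (insert (vIdx B') S) = 0 := hF _ _ _ fun ⟨_, _, h⟩ => by
      have := h (vIdx B') (Finset.mem_insert_self _ _)
      simp [vIdx] at this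
    simp [int1_apply, this]

theorem Hor.mem {F : Ten n R} (h : Hor F) {σ : ℕ} {τ : ℤ} (hF : F ∈ Sec n R (2 * n + 2) σ τ) :
    F ∈ Sec n R (2 * n) σ τ := by
  intro p q S hS
  by_cases hv : ∃ B' : Fin 2, vIdx B' ∈ S
  · obtain ⟨B', hB⟩ := hv
    -- The coefficient at `S` is, up to sign, the coefficient of the contraction at `S` without the
    -- vertical index.
    have := congrFun (congrFun (congrFun (h B') p) q) (S.erase (vIdx B'))
    rw [int1_apply, if_neg (Finset.notMem_erase _ _), Finset.insert_erase hB] at this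
    exact (((isUnit_one.neg).pow _).mul_right_eq_zero).1 this
  · refine hF _ _ _ fun ⟨h1, h2, _⟩ => hS ⟨h1, h2, fun a ha => ?_⟩
    by_contra hlt
    refine hv ⟨⟨a.val - 2 * n, by omega⟩, ?_⟩
    convert ha
    apply Fin.ext
    simp [vIdx]
    omega

theorem Hor.zero : Hor (0 : Ten n R) := fun _ => map_zero _

theorem Hor.add {F G : Ten n R} (hF : Hor F) (hG : Hor G) : Hor (F + G) := fun B => by
  rw [map_add, hF, hG, add_zero]

theorem Hor.sub {F G : Ten n R} (hF : Hor F) (hG : Hor G) : Hor (F - G) := fun B => by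
  rw [map_sub, hF, hG, sub_zero]

theorem Hor.neg {F : Ten n R} (hF : Hor F) : Hor (-F) := fun B => by
  rw [map_neg, hF, neg_zero]

theorem Hor.smul (r : R) {F : Ten n R} (hF : Hor F) : Hor (r • F) := fun B => by
  rw [int1_smul, hF, smul_zero]

theorem Hor.sum {ι : Type*} (s : Finset ι) {F : ι → Ten n R} (hF : ∀ i, Hor (F i)) :
    Hor (∑ i ∈ s, F i) := fun B => by
  rw [map_sum]
  exact Finset.sum_eq_zero fun i _ => hF i B

theorem Hor.ext1 (A : Fin (2 * n)) {F : Ten n R} (hF : Hor F) : Hor (ext1 (hIdx A) F) := fun B => by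
  rw [int1_ext1_of_ne (vIdx_ne_hIdx B A), hF, map_zero, neg_zero]

theorem Hor.hwedge1 (α : Fin (2 * n) → R) {F : Ten n R} (hF : Hor F) : Hor (hwedge1 α F) := by
  rw [hwedge1_apply]
  exact Hor.sum _ fun A => (hF.ext1 A).smul _

theorem Hor.hwedge2 (α : Fin (2 * n) → Fin (2 * n) → R) {F : Ten n R} (hF : Hor F) :
    Hor (hwedge2 α F) := by
  rw [hwedge2_apply]
  exact Hor.sum _ fun A => Hor.sum _ fun B => ((hF.ext1 B).ext1 A).smul _

theorem Hor.mapT {R' : Type} [CommRing R'] [Algebra ℂ R'] (L : R →ₗ[ℂ] R') {F : Ten n R}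
    (hF : Hor F) : Hor (mapT L F) := fun B => by
  rw [← mapT_int1, hF, map_zero]

/-! ### Frames `ω^0, …, ω^{2n-1}, Ω^{0'}, Ω^{1'}` -/

/-- Two one-forms `Ω^{0'}, Ω^{1'}` that complete `ω^0, …, ω^{2n-1}` to a frame; `inv` is the
inverse of the matrix of their components along `ω^{2n}, ω^{2n+1}`. -/
structure Frame (n : ℕ) (R : Type) [CommRing R] where
  /-- The one-forms. -/
  form : Fin 2 → Fin (2 * n + 2) → R
  /-- The inverse matrix. -/
  inv : Fin 2 → Fin 2 → R
  inv_mul : ∀ C D, ∑ B, inv C B * form D (vIdx B) = if C = D then 1 else 0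

omit [Algebra ℂ R] in
-- A one-sided inverse of a square matrix over a commutative ring is two-sided.
theorem Frame.mul_inv (fr : Frame n R) (B D : Fin 2) : ∑ C, fr.form C (vIdx B) * fr.inv C D = if B = D then 1 else 0 := by
  have h : (Matrix.of fr.inv) * (Matrix.of fun B C => fr.form C (vIdx B)) = 1 := by
    ext C D
    simp only [Matrix.mul_apply, Matrix.of_apply, fr.inv_mul, Matrix.one_apply]
  rw [mul_eq_one_comm] at h
  have h' := congrFun (congrFun h B) D
  simpa only [Matrix.mul_apply, Matrix.of_apply, Matrix.one_apply] using h'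

namespace Frame

variable (fr : Frame n R)

/-- `F ↦ Ω^{C'} ∧ F`. -/
def e (C : Fin 2) : Ten n R →ₗ[ℂ] Ten n R := wedge1 (fr.form C)

/-- The contraction with the vector dual to `Ω^{C'}`. -/
def contr (C : Fin 2) : Ten n R →ₗ[ℂ] Ten n R := ∑ B, mulT (fr.inv C B) ∘ₗ int1 (vIdx B)

theorem contr_apply (C : Fin 2) (F : Ten n R) :
    fr.contr C F = ∑ B, fr.inv C B • int1 (vIdx B) F := by
  simp [contr, mulT_eq_smul]

/-- The contractions dual to the `Ω^{C'}` and those dual to `ω^{2n}, ω^{2n+1}` differ by an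
invertible matrix, so they have the same common kernel. -/
theorem hor_iff {F : Ten n R} : Hor F ↔ ∀ C, fr.contr C F = 0 := by
  refine ⟨fun h C => ?_, fun h B => ?_⟩
  · rw [contr_apply]
    exact Finset.sum_eq_zero fun B _ => by rw [h, smul_zero]
  · have : int1 (vIdx B) F = ∑ C, fr.form C (vIdx B) • fr.contr C F := by
      simp only [contr_apply, Finset.smul_sum, smul_smul]
      rw [Finset.sum_comm]
      simp only [← Finset.sum_smul, mul_inv]
      simp
    rw [this]
    exact Finset.sum_eq_zero fun C _ => by rw [h, smul_zero]

/-- The anticommutation relation again, now for the frame. Existence and uniqueness of the frame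
expansion rest on it. -/
theorem contr_e (C D : Fin 2) (F : Ten n R) :
    fr.contr C (fr.e D F) = (if C = D then F else 0) - fr.e D (fr.contr C F) := by
  have h1 : ∀ B : Fin 2, int1 (vIdx B) (fr.e D F) =
      fr.form D (vIdx B) • F - fr.e D (int1 (vIdx B) F) := fun B => by
    simp [e, wedge1_apply, int1_smul, int1_ext1, smul_sub, Finset.sum_sub_distrib]
  have h2 : fr.e D (fr.contr C F) = ∑ B, fr.inv C B • fr.e D (int1 (vIdx B) F) := by
    simp only [contr_apply, map_sum, e, wedge1_smul]
  rw [h2, contr_apply]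
  simp only [h1, smul_sub, Finset.sum_sub_distrib, smul_smul, ← Finset.sum_smul, fr.inv_mul]
  congr 1
  split_ifs <;> simp

theorem contr_contr (C D : Fin 2) (F : Ten n R) :
    fr.contr C (fr.contr D F) = -fr.contr D (fr.contr C F) := by
  simp only [contr_apply, map_sum, int1_smul, ← Finset.sum_neg_distrib]
  rw [Finset.sum_comm]
  refine Finset.sum_congr rfl fun B _ => Finset.sum_congr rfl fun B' _ => ?_
  rw [int1_int1, smul_neg, smul_neg, smul_comm]

theorem contr_self (C : Fin 2) (F : Ten n R) : fr.contr C (fr.contr C F) = 0 := by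
  have h := fr.contr_contr C C F
  rw [eq_neg_iff_add_eq_zero, ← two_smul ℂ] at h
  exact (smul_eq_zero_iff_right (M := Ten n R) two_ne_zero).1 h

theorem e_self (C : Fin 2) (F : Ten n R) : fr.e C (fr.e C F) = 0 := wedge1_self _ _

theorem e_one_zero (F : Ten n R) : fr.e 1 (fr.e 0 F) = -fr.e 0 (fr.e 1 F) := wedge1_wedge1 _ _ _

/-- The component along `Ω^{0'} ∧ Ω^{1'}`. -/
def pK : Ten n R →ₗ[ℂ] Ten n R := fr.contr 1 ∘ₗ fr.contr 0

/-- The component along `Ω^{C'}`. -/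
def pH (C : Fin 2) : Ten n R →ₗ[ℂ] Ten n R :=
  -- For horizontal `K`, the two contractions send `Ω^{0'} ∧ Ω^{1'} ∧ K` to `Ω^{1'} ∧ K` and
  -- `-Ω^{0'} ∧ K`. The corrections remove these contributions.
  if C = 0 then fr.contr 0 - fr.e 1 ∘ₗ fr.pK else fr.contr 1 + fr.e 0 ∘ₗ fr.pK

/-- The horizontal component. -/
def pf : Ten n R →ₗ[ℂ] Ten n R :=
  LinearMap.id - fr.e 0 ∘ₗ fr.pH 0 - fr.e 1 ∘ₗ fr.pH 1 - fr.e 0 ∘ₗ fr.e 1 ∘ₗ fr.pK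

theorem pK_apply (F : Ten n R) : fr.pK F = fr.contr 1 (fr.contr 0 F) := rfl

theorem pH_zero_apply (F : Ten n R) : fr.pH 0 F = fr.contr 0 F - fr.e 1 (fr.pK F) := rfl

theorem pH_one_apply (F : Ten n R) : fr.pH 1 F = fr.contr 1 F + fr.e 0 (fr.pK F) := rfl

theorem pf_apply (F : Ten n R) : fr.pf F =
    F - fr.e 0 (fr.pH 0 F) - fr.e 1 (fr.pH 1 F) - fr.e 0 (fr.e 1 (fr.pK F)) := rfl

theorem hor_pK (F : Ten n R) : Hor (fr.pK F) := by
  rw [fr.hor_iff, Fin.forall_fin_two, pK_apply]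
  refine ⟨?_, fr.contr_self _ _⟩
  rw [fr.contr_contr 0 1, contr_self, map_zero, neg_zero]

theorem hor_pH (C : Fin 2) (F : Ten n R) : Hor (fr.pH C F) := by
  have hK := fr.hor_iff.1 (fr.hor_pK F)
  have h10 : fr.contr 0 (fr.contr 1 F) = -fr.pK F := fr.contr_contr 0 1 F
  rw [fr.hor_iff]
  revert C
  simp only [Fin.forall_fin_two, pH_zero_apply, pH_one_apply, map_sub, map_add, contr_e, hK,
    contr_self, h10, map_zero, ← pK_apply]
  simp

theorem eq_decomp (F : Ten n R) :
    F = fr.pf F + (fr.e 0 (fr.pH 0 F) + fr.e 1 (fr.pH 1 F)) + fr.e 0 (fr.e 1 (fr.pK F)) := by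
  rw [pf_apply]; abel

theorem hor_pf (F : Ten n R) : Hor (fr.pf F) := by
  have hK := fr.hor_iff.1 (fr.hor_pK F)
  have h0 := fr.hor_iff.1 (fr.hor_pH 0 F)
  have h1 := fr.hor_iff.1 (fr.hor_pH 1 F)
  rw [fr.hor_iff, Fin.forall_fin_two]
  simp only [pf_apply, map_sub, contr_e, h0, h1, hK, map_zero]
  simp [pH_zero_apply, pH_one_apply]

/-- With `pH_decomp` and `pf_decomp` this is the uniqueness of the frame expansion: contractions
kill horizontal forms, so only the term containing both `Ω`'s survives two of them. -/
theorem pK_decomp {f H₀ H₁ K : Ten n R} (hf : Hor f) (h₀ : Hor H₀) (h₁ : Hor H₁) (hK : Hor K) :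
    fr.pK (f + (fr.e 0 H₀ + fr.e 1 H₁) + fr.e 0 (fr.e 1 K)) = K := by
  rw [fr.hor_iff] at hf h₀ h₁ hK
  simp [pK_apply, contr_e, hf, h₀, h₁, hK]

theorem pH_decomp {f H₀ H₁ K : Ten n R} (hf : Hor f) (h₀ : Hor H₀) (h₁ : Hor H₁) (hK : Hor K) :
    fr.pH 0 (f + (fr.e 0 H₀ + fr.e 1 H₁) + fr.e 0 (fr.e 1 K)) = H₀ ∧
    fr.pH 1 (f + (fr.e 0 H₀ + fr.e 1 H₁) + fr.e 0 (fr.e 1 K)) = H₁ := by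
  have := fr.pK_decomp hf h₀ h₁ hK
  rw [fr.hor_iff] at hf h₀ h₁ hK
  rw [pH_zero_apply, pH_one_apply, this]
  simp [contr_e, hf, h₀, h₁, hK]

theorem pf_decomp {f H₀ H₁ K : Ten n R} (hf : Hor f) (h₀ : Hor H₀) (h₁ : Hor H₁) (hK : Hor K) :
    fr.pf (f + (fr.e 0 H₀ + fr.e 1 H₁) + fr.e 0 (fr.e 1 K)) = f := by
  rw [pf_apply, fr.pK_decomp hf h₀ h₁ hK, (fr.pH_decomp hf h₀ h₁ hK).1,
    (fr.pH_decomp hf h₀ h₁ hK).2]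
  abel

theorem e_mem (C : Fin 2) {σ : ℕ} {τ : ℤ} {F : Ten n R} (hF : F ∈ Sec n R (2 * n + 2) σ τ) :
    fr.e C F ∈ Sec n R (2 * n + 2) σ (τ + 1) := wedge1_mem _ hF

theorem contr_mem (C : Fin 2) {σ : ℕ} {τ : ℤ} {F : Ten n R} (hF : F ∈ Sec n R (2 * n + 2) σ τ) :
    fr.contr C F ∈ Sec n R (2 * n + 2) σ (τ - 1) := by
  rw [contr_apply]
  exact Submodule.sum_mem _ fun B _ => Sec_smul_mem _ (int1_mem hF)

theorem pK_mem {σ : ℕ} {τ : ℤ} {F : Ten n R} (hF : F ∈ Sec n R (2 * n + 2) σ τ) :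
    fr.pK F ∈ Sec n R (2 * n) σ (τ - 2) :=
  (fr.hor_pK F).mem (Sec_congr (fr.contr_mem 1 (fr.contr_mem 0 hF)) rfl (by ring))

theorem pH_mem (C : Fin 2) {σ : ℕ} {τ : ℤ} {F : Ten n R} (hF : F ∈ Sec n R (2 * n + 2) σ τ) :
    fr.pH C F ∈ Sec n R (2 * n) σ (τ - 1) := by
  refine (fr.hor_pH C F).mem ?_
  have hK (D : Fin 2) : fr.e D (fr.pK F) ∈ Sec n R (2 * n + 2) σ (τ - 1) :=
    Sec_congr (fr.e_mem D (Sec_mono (by omega) (fr.pK_mem hF))) rfl (by ring)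
  fin_cases C
  · exact Submodule.sub_mem _ (fr.contr_mem 0 hF) (hK 1)
  · exact Submodule.add_mem _ (fr.contr_mem 1 hF) (hK 0)

theorem pf_mem {σ : ℕ} {τ : ℤ} {F : Ten n R} (hF : F ∈ Sec n R (2 * n + 2) σ τ) :
    fr.pf F ∈ Sec n R (2 * n) σ τ := by
  refine (fr.hor_pf F).mem ?_
  have hH (C : Fin 2) : fr.e C (fr.pH C F) ∈ Sec n R (2 * n + 2) σ τ :=
    Sec_congr (fr.e_mem C (Sec_mono (by omega) (fr.pH_mem C hF))) rfl (by ring)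
  have hK : fr.e 0 (fr.e 1 (fr.pK F)) ∈ Sec n R (2 * n + 2) σ τ :=
    Sec_congr (fr.e_mem 0 (fr.e_mem 1 (Sec_mono (by omega) (fr.pK_mem hF)))) rfl (by ring)
  exact Submodule.sub_mem _ (Submodule.sub_mem _ (Submodule.sub_mem _ hF (hH 0)) (hH 1)) hK

end Frame

end Wedge

/-! ### Derivations on the algebras of smooth functions -/

section Derivations

variable {n : ℕ} (φ : GraphFn n) (U : TopologicalSpace.Opens (HSpace n))

/-- `∂/∂x_{4n+1}` as a vector. -/
def tvec (n : ℕ) : HSpace n := Pi.single (nIdx n) 1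

theorem differentiableAt_zext (f : SmoothFn (U : Set (HSpace n))) {x : HSpace n}
    (hx : x ∈ (U : Set (HSpace n))) : DifferentiableAt ℝ (zext f.1) x :=
  ((contDiffOn_zext U f).contDiffAt (U.isOpen.mem_nhds hx)).differentiableAt (by simp)

theorem pd_apply (i : Fin (4 * n + 4)) (f : SmoothFn (U : Set (HSpace n)))
    (x : (U : Set (HSpace n))) : (pd U i f).1 x = fderiv ℝ (zext f.1) x.1 (Pi.single i 1) := rfl

theorem zext_pd (i : Fin (4 * n + 4)) (f : SmoothFn (U : Set (HSpace n))) {x : HSpace n}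
    (hx : x ∈ (U : Set (HSpace n))) : zext (pd U i f).1 x = fderiv ℝ (zext f.1) x (Pi.single i 1) := by
  rw [zext_of_mem _ hx]; rfl

theorem pd_mul (i : Fin (4 * n + 4)) (f g : SmoothFn (U : Set (HSpace n))) :
    pd U i (f * g) = pd U i f * g + f * pd U i g := by
  ext x
  have : zext (f * g).1 = fun y => zext f.1 y * zext g.1 y := by
    funext y; by_cases hy : y ∈ (U : Set (HSpace n)) <;> simp [zext, hy]
  change fderiv ℝ (zext (f * g).1) x.1 _ = fderiv ℝ (zext f.1) x.1 _ * g.1 x +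
    f.1 x * fderiv ℝ (zext g.1) x.1 _
  rw [this, fderiv_fun_mul (differentiableAt_zext U f x.2) (differentiableAt_zext U g x.2)]
  simp only [zext_of_mem _ x.2, add_apply, smul_apply,
    smul_eq_mul]
  ring

theorem fderiv_fderiv_comm {E : Type*} [NormedAddCommGroup E] [NormedSpace ℝ E]
    {g : HSpace n → E} {x : HSpace n} (hg : ContDiffAt ℝ ∞ g x)
    (v w : HSpace n) :
    fderiv ℝ (fun y => fderiv ℝ g y v) x w = fderiv ℝ (fun y => fderiv ℝ g y w) x v := by
  have hd : DifferentiableAt ℝ (fderiv ℝ g) x :=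
    ((hg.fderiv_right (m := 1) (by norm_cast)).differentiableAt (by simp))
  have h (v : HSpace n) : fderiv ℝ (fun y => fderiv ℝ g y v) x =
      (fderiv ℝ (fderiv ℝ g) x).flip v := by
    ext w
    rw [fderiv_clm_apply hd (differentiableAt_const v)]
    simp
  rw [h, h]
  exact (hg.isSymmSndFDerivAt (by
    rw [minSmoothness_of_isRCLikeNormedField]
    exact ENat.LEInfty.out)) w v

theorem pd_comm (i j : Fin (4 * n + 4)) (f : SmoothFn (U : Set (HSpace n))) :
    pd U i (pd U j f) = pd U j (pd U i f) := by
  ext x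
  have h (i j : Fin (4 * n + 4)) : (pd U i (pd U j f)).1 x =
      fderiv ℝ (fun y => fderiv ℝ (zext f.1) y (Pi.single j 1)) x.1 (Pi.single i 1) := by
    rw [pd_apply]
    congr 1
    refine Filter.EventuallyEq.fderiv_eq ?_
    filter_upwards [U.isOpen.mem_nhds x.2] with y hy
    exact zext_pd U j f hy
  exact (h i j).trans ((fderiv_fderiv_comm ((contDiffOn_zext U f).contDiffAt
    (U.isOpen.mem_nhds x.2)) _ _).trans (h j i).symm)

/-- `φ` does not involve `x_{4n+1}`. Hence `∂ϱ/∂x_{4n+1} = 1`, and all derivatives of `ϱ` are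
constant in that direction. -/
theorem rho_add_tvec (x : HSpace n) (s : ℝ) : rho φ (x + s • tvec n) = rho φ x + s := by
  have : proj (x + s • tvec n) = proj x := by
    funext i; simp [proj, tvec, Fin.succAbove_ne]
  simp only [rho, this]
  simp [tvec]
  ring

theorem retr_eq_sub (x : HSpace n) : retr φ x = x - rho φ x • tvec n := by
  funext i
  by_cases h : i = nIdx n
  · subst h; simp [retr, rho, tvec]
  · simp [retr, h, tvec]

theorem retr_add_tvec (x : HSpace n) (s : ℝ) : retr φ (x + s • tvec n) = retr φ x := by
  rw [retr_eq_sub, retr_eq_sub, rho_add_tvec, add_smul]; abel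

theorem differentiable_rho : Differentiable ℝ (rho φ) :=
  (rho_contDiff φ).differentiable (by simp)

/-- Applied with `c = 1` to `ϱ`, and with `c = 0` to functions that do not depend on `x_{4n+1}`. -/
theorem fderiv_tvec_eq_zero {E : Type*} [NormedAddCommGroup E] [NormedSpace ℝ E]
    {g : HSpace n → E} {c : E} (hg : ∀ x (s : ℝ), g (x + s • tvec n) = g x + s • c) (x : HSpace n)
    (hd : DifferentiableAt ℝ g x) : fderiv ℝ g x (tvec n) = c := by
  have h1 : HasDerivAt (fun s : ℝ => g (x + s • tvec n)) (fderiv ℝ g x (tvec n)) 0 := by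
    have := hd.hasFDerivAt.hasLineDerivAt (tvec n)
    exact this
  have h2 : HasDerivAt (fun s : ℝ => g (x + s • tvec n)) c 0 := by
    simp only [hg]
    simpa using ((hasDerivAt_id (0 : ℝ)).smul_const c).const_add (g x)
  exact h1.unique h2

theorem drho_apply (S : Set (HSpace n)) (i : Fin (4 * n + 4)) (x : S) :
    (drho φ S i).1 x = ((fderiv ℝ (rho φ) x.1 (Pi.single i 1) : ℝ) : ℂ) := rfl

theorem drho_nIdx (S : Set (HSpace n)) : drho φ S (nIdx n) = 1 := by
  ext x
  have : fderiv ℝ (rho φ) x.1 (tvec n) = 1 :=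
    fderiv_tvec_eq_zero (c := (1 : ℝ)) (fun x s => by rw [rho_add_tvec]; simp) x.1
      (differentiable_rho φ _)
  change ((fderiv ℝ (rho φ) x.1 (tvec n) : ℝ) : ℂ) = 1
  exact_mod_cast this

theorem fderiv_rho_add_tvec (x : HSpace n) (s : ℝ) :
    fderiv ℝ (rho φ) (x + s • tvec n) = fderiv ℝ (rho φ) x := by
  rw [← fderiv_comp_add_right]
  simp only [rho_add_tvec]
  exact fderiv_add_const _

theorem ddrho_symm (S : Set (HSpace n)) (i j : Fin (4 * n + 4)) :
    ddrho φ S i j = ddrho φ S j i := by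
  ext x
  change ((fderiv ℝ (fun y => fderiv ℝ (rho φ) y (Pi.single j 1)) x.1 (Pi.single i 1) : ℝ) : ℂ) =
    ((fderiv ℝ (fun y => fderiv ℝ (rho φ) y (Pi.single i 1)) x.1 (Pi.single j 1) : ℝ) : ℂ)
  rw [fderiv_fderiv_comm (rho_contDiff φ).contDiffAt]

theorem fderiv_ofReal {g : HSpace n → ℝ} {x : HSpace n} (hg : DifferentiableAt ℝ g x)
    (v : HSpace n) : fderiv ℝ (fun y => ((g y : ℝ) : ℂ)) x v = ((fderiv ℝ g x v : ℝ) : ℂ) := by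
  have := (Complex.ofRealCLM.hasFDerivAt.comp x hg.hasFDerivAt).fderiv
  change fderiv ℝ (Complex.ofRealCLM ∘ g) x v = _
  rw [this]; rfl

theorem pd_ofGlobal (i : Fin (4 * n + 4)) {g : HSpace n → ℝ} (hg : ContDiff ℝ ∞ g) :
    pd U i (ofGlobal (U : Set (HSpace n)) g hg) =
      ofGlobal _ (fun x => fderiv ℝ g x (Pi.single i 1)) (contDiff_partial hg i) := by
  ext x
  have : zext (ofGlobal (U : Set (HSpace n)) g hg).1 =ᶠ[nhds x.1] fun y => ((g y : ℝ) : ℂ) := by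
    filter_upwards [U.isOpen.mem_nhds x.2] with y hy
    rw [zext_of_mem _ hy]; rfl
  rw [pd_apply, this.fderiv_eq, fderiv_ofReal (hg.differentiable (by simp) _)]
  rfl

theorem pd_rho (i : Fin (4 * n + 4)) :
    pd U i (ofGlobal (U : Set (HSpace n)) (rho φ) (rho_contDiff φ)) = drho φ U i :=
  pd_ofGlobal U i _

theorem pd_drho (i j : Fin (4 * n + 4)) : pd U i (drho φ (U : Set (HSpace n)) j) = ddrho φ U i j :=
  pd_ofGlobal U i _

theorem ddrho_nIdx_left (S : Set (HSpace n)) (j : Fin (4 * n + 4)) :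
    ddrho φ S (nIdx n) j = 0 := by
  ext x
  have : fderiv ℝ (fun y => fderiv ℝ (rho φ) y (Pi.single j 1)) x.1 (tvec n) = 0 :=
    fderiv_tvec_eq_zero (c := (0 : ℝ)) (fun x s => by rw [fderiv_rho_add_tvec]; simp) x.1
      ((contDiff_partial (rho_contDiff φ) j).differentiable (by simp) _)
  change ((fderiv ℝ (fun y => fderiv ℝ (rho φ) y (Pi.single j 1)) x.1 (tvec n) : ℝ) : ℂ) = 0
  exact_mod_cast this

theorem pd_nIdx_drho (j : Fin (4 * n + 4)) : pd U (nIdx n) (drho φ (U : Set (HSpace n)) j) = 0 := by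
  rw [pd_drho, ddrho_nIdx_left]

theorem restr_mul {S S' : Set (HSpace n)} (h : S ⊆ S') (f g : SmoothFn S') :
    restr h (f * g) = restr h f * restr h g := rfl

/-! Derivatives of functions on the hypersurface. -/

theorem bpd_apply (i : Fin (4 * n + 4)) (f : SmoothFn (bdry φ U)) (x : bdry φ U) :
    (bpd φ U i f).1 x = fderiv ℝ (cext φ U f.1) x.1 (Pi.single i 1) := rfl

theorem contDiffAt_cext (f : SmoothFn (bdry φ U)) (x : bdry φ U) :
    ContDiffAt ℝ ∞ (cext φ U f.1) x.1 := by
  obtain ⟨O, hO, hs, hc⟩ := cext_smooth φ U f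
  exact hc.contDiffAt (hO.mem_nhds (hs x.2))

theorem cext_of_mem (f : bdry φ U → ℂ) {x : HSpace n} (hx : x ∈ bdry φ U) :
    cext φ U f x = f ⟨x, hx⟩ := by
  rw [cext, retr_eq φ hx.2, zext_of_mem f hx]

theorem eventually_retr_mem (x : bdry φ U) : ∀ᶠ y in nhds x.1, retr φ y ∈ bdry φ U := by
  have : retr φ ⁻¹' (U : Set (HSpace n)) ∈ nhds x.1 :=
    (U.isOpen.preimage (retr_contDiff φ).continuous).mem_nhds
      (by rw [Set.mem_preimage, retr_eq φ x.2.2]; exact x.2.1)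
  filter_upwards [this] with y hy
  exact ⟨hy, rho_retr φ y⟩

theorem bpd_mul (i : Fin (4 * n + 4)) (f g : SmoothFn (bdry φ U)) :
    bpd φ U i (f * g) = bpd φ U i f * g + f * bpd φ U i g := by
  ext x
  have : cext φ U (f * g).1 = fun y => cext φ U f.1 y * cext φ U g.1 y := by
    funext y; by_cases hy : retr φ y ∈ bdry φ U <;> simp [cext, zext, hy]
  change fderiv ℝ (cext φ U (f * g).1) x.1 _ = fderiv ℝ (cext φ U f.1) x.1 _ * g.1 x +
    f.1 x * fderiv ℝ (cext φ U g.1) x.1 _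
  rw [this, fderiv_fun_mul ((contDiffAt_cext φ U f x).differentiableAt (by simp))
    ((contDiffAt_cext φ U g x).differentiableAt (by simp))]
  simp only [cext_of_mem φ U _ x.2, add_apply, smul_apply,
    smul_eq_mul]
  ring

theorem cext_add_tvec (f : bdry φ U → ℂ) (x : HSpace n) (s : ℝ) :
    cext φ U f (x + s • tvec n) = cext φ U f x := by
  rw [cext, retr_add_tvec]; rfl

theorem bpd_nIdx (f : SmoothFn (bdry φ U)) : bpd φ U (nIdx n) f = 0 := by
  ext x
  exact fderiv_tvec_eq_zero (c := (0 : ℂ)) (fun x s => by rw [cext_add_tvec]; simp) x.1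
    ((contDiffAt_cext φ U f x).differentiableAt (by simp))

/-- The chain rule for the restriction of functions to the hypersurface. -/
theorem restr_pd (i : Fin (4 * n + 4)) (f : SmoothFn (U : Set (HSpace n))) :
    restr (bdry_subset φ U) (pd U i f) = bpd φ U i (restr (bdry_subset φ U) f) +
      drho φ (bdry φ U) i * restr (bdry_subset φ U) (pd U (nIdx n) f) := by
  ext x
  have hx : x.1 ∈ (U : Set (HSpace n)) := x.2.1
  have hev : cext φ U (restr (bdry_subset φ U) f).1 =ᶠ[nhds x.1] zext f.1 ∘ retr φ := by
    filter_upwards [eventually_retr_mem φ U x] with y hy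
    rw [cext, zext_of_mem _ hy, Function.comp, zext_of_mem _ hy.1]; rfl
  -- Near the boundary the extension is `f ∘ retr`. Since `retr x = x - ϱ(x) t` with `t` the unit
  -- vector of `x_{4n+1}`, its differential is `id - dϱ ⊗ t`, and this produces the normal term.
  have hr : HasFDerivAt (retr φ) (ContinuousLinearMap.id ℝ (HSpace n) -
      (fderiv ℝ (rho φ) x.1).smulRight (tvec n)) x.1 := by
    have : retr φ = fun y => y - rho φ y • tvec n := funext (retr_eq_sub φ)
    rw [this]
    exact (hasFDerivAt_id x.1).sub ((differentiable_rho φ x.1).hasFDerivAt.smul_const (tvec n))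
  have hf : HasFDerivAt (zext f.1) (fderiv ℝ (zext f.1) x.1) (retr φ x.1) := by
    rw [retr_eq φ x.2.2]; exact (differentiableAt_zext U f hx).hasFDerivAt
  have hb : (bpd φ U i (restr (bdry_subset φ U) f)).1 x = fderiv ℝ (zext f.1) x.1 (Pi.single i 1) -
      (fderiv ℝ (rho φ) x.1 (Pi.single i 1) : ℝ) • fderiv ℝ (zext f.1) x.1 (tvec n) := by
    rw [bpd_apply, hev.fderiv_eq, (hf.comp x.1 hr).fderiv]
    simp
  change fderiv ℝ (zext f.1) x.1 (Pi.single i 1) =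
    (bpd φ U i (restr (bdry_subset φ U) f)).1 x + ((fderiv ℝ (rho φ) x.1 (Pi.single i 1) : ℝ) : ℂ) *
      fderiv ℝ (zext f.1) x.1 (tvec n)
  rw [hb, Complex.real_smul]
  ring

/-- The derivatives of `ϱ` are already constant in `x_{4n+1}`, so the normal term in `restr_pd`
disappears. -/
theorem bpd_drho (i j : Fin (4 * n + 4)) :
    bpd φ U i (drho φ (bdry φ U) j) = ddrho φ (bdry φ U) i j := by
  have h := restr_pd φ U i (drho φ (U : Set (HSpace n)) j)
  rw [pd_nIdx_drho, map_zero, mul_zero, add_zero, pd_drho] at h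
  exact h.symm

end Derivations

/-! ### The operators `d^{A'}` attached to commuting derivations -/

section Differential

variable {n : ℕ} {R : Type} [CommRing R] [Algebra ℂ R]

/-- `∇_a^{A'}`, with `δ i` in place of `∂/∂x_{i+1}`. -/
def nabD (δ : Fin (4 * n + 4) → R →ₗ[ℂ] R) (a : Fin (2 * n + 2)) (A' : Fin 2) : R →ₗ[ℂ] R :=
  ∑ i, nabUp a A' i • δ i

/-- `d^{A'}`, with `δ i` in place of `∂/∂x_{i+1}`. -/
def dOf (δ : Fin (4 * n + 4) → R →ₗ[ℂ] R) (A' : Fin 2) : Ten n R →ₗ[ℂ] Ten n R :=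
  ∑ a, ext1 a ∘ₗ mapT (nabD δ a A')

variable (δ : Fin (4 * n + 4) → R →ₗ[ℂ] R)

theorem nabD_apply (a : Fin (2 * n + 2)) (A' : Fin 2) (r : R) :
    nabD δ a A' r = ∑ i, nabUp a A' i • δ i r := by
  simp [nabD]

theorem dOf_apply (A' : Fin 2) (F : Ten n R) :
    dOf δ A' F = ∑ a, ext1 a (mapT (nabD δ a A') F) := by
  simp [dOf]

theorem nabD_comm (hc : ∀ i j r, δ i (δ j r) = δ j (δ i r)) (a b : Fin (2 * n + 2)) (A' B' : Fin 2)
    (r : R) : nabD δ a A' (nabD δ b B' r) = nabD δ b B' (nabD δ a A' r) := by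
  simp only [nabD_apply, map_sum, map_smul, Finset.smul_sum]
  rw [Finset.sum_comm]
  exact Finset.sum_congr rfl fun i _ => Finset.sum_congr rfl fun j _ => by rw [hc, smul_comm]

/-- The constant-coefficient fields commute and the `ω`'s anticommute. -/
theorem dOf_dOf (hc : ∀ i j r, δ i (δ j r) = δ j (δ i r)) (A' B' : Fin 2) (F : Ten n R) :
    dOf δ A' (dOf δ B' F) = -dOf δ B' (dOf δ A' F) := by
  simp only [dOf_apply, map_sum, mapT_ext1, ← Finset.sum_neg_distrib]
  rw [Finset.sum_comm]
  refine Finset.sum_congr rfl fun b _ => Finset.sum_congr rfl fun a _ => ?_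
  rw [ext1_ext1]
  congr 3
  funext p q S
  exact nabD_comm δ hc _ _ _ _ _

theorem dOf_self (hc : ∀ i j r, δ i (δ j r) = δ j (δ i r)) (A' : Fin 2) (F : Ten n R) :
    dOf δ A' (dOf δ A' F) = 0 := by
  have h := dOf_dOf δ hc A' A' F
  rw [eq_neg_iff_add_eq_zero, ← two_smul ℂ] at h
  exact (smul_eq_zero_iff_right (M := Ten n R) two_ne_zero).1 h

/-- The expansion of `ω^{2n+B'}` in a frame. -/
theorem Frame.ext1_vIdx (fr : Frame n R) {c : Fin (2 * n) → Fin 2 → R}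
    (hc : ∀ A B', c A B' = ∑ C' : Fin 2, fr.inv C' B' * fr.form C' (hIdx A)) (B' : Fin 2)
    (F : Ten n R) : ext1 (vIdx B') F =
      -(∑ A, c A B' • ext1 (hIdx A) F) + ∑ C' : Fin 2, fr.inv C' B' • wedge1 (fr.form C') F := by
  have h1 : ∀ C', wedge1 (fr.form C') F = ∑ A, fr.form C' (hIdx A) • ext1 (hIdx A) F +
        ∑ D', fr.form C' (vIdx D') • ext1 (vIdx D') F := fun C' => by
    rw [wedge1_apply, Fin.sum_univ_add]; rfl
  simp only [h1, smul_add, Finset.sum_add_distrib, Finset.smul_sum, smul_smul]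
  rw [Finset.sum_comm, Finset.sum_comm (s := (Finset.univ : Finset (Fin 2)))]
  have h2 (D' : Fin 2) : ∑ C', fr.inv C' B' * fr.form C' (vIdx D') = if D' = B' then 1 else 0 := by
    rw [← fr.mul_inv]
    exact Finset.sum_congr rfl fun _ _ => mul_comm _ _
  simp only [← Finset.sum_smul, ← hc, h2]
  simp

/-- The transformation of `d^{A'}` under a map `r` that commutes with the derivatives up to a
multiple of `D`. -/
theorem mapT_dOf {R' : Type} [CommRing R'] [Algebra ℂ R'] (r : R →ₗ[ℂ] R') (D : R →ₗ[ℂ] R)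
    (δ : Fin (4 * n + 4) → R →ₗ[ℂ] R) (δ' : Fin (4 * n + 4) → R' →ₗ[ℂ] R') (A' : Fin 2)
    (α : Fin (2 * n + 2) → R')
    (h : ∀ a f, r (nabD δ a A' f) = nabD δ' a A' (r f) + α a * r (D f)) (u : Ten n R) :
    mapT r (dOf δ A' u) = dOf δ' A' (mapT r u) + wedge1 α (mapT r (mapT D u)) := by
  rw [dOf_apply, dOf_apply, wedge1_apply, map_sum, ← Finset.sum_add_distrib]
  refine Finset.sum_congr rfl fun a _ => ?_
  rw [mapT_ext1, ← ext1_smul, ← map_add (ext1 a)]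
  congr 1
  funext p q S
  exact h a (u p q S)

theorem partialS_dOf (A' B' : Fin 2) (F : Ten n R) :
    partialS A' (dOf δ B' F) = dOf δ B' (partialS A' F) := by
  simp only [dOf_apply, map_sum, partialS_ext1, partialS_mapT]

theorem sUp_dOf (A' B' : Fin 2) (F : Ten n R) :
    sUp A' (dOf δ B' F) = dOf δ B' (sUp A' F) := by
  simp only [dOf_apply, map_sum, sUp_ext1, sUp_mapT]

theorem mapT_smul_of_leibniz {L : R →ₗ[ℂ] R} (hL : ∀ x y, L (x * y) = L x * y + x * L y) (r : R)
    (F : Ten n R) : mapT L (r • F) = L r • F + r • mapT L F := by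
  funext p q S
  exact hL _ _

theorem nabD_mul (hl : ∀ i x y, δ i (x * y) = δ i x * y + x * δ i y) (a : Fin (2 * n + 2))
    (A' : Fin 2) (x y : R) : nabD δ a A' (x * y) = nabD δ a A' x * y + x * nabD δ a A' y := by
  simp only [nabD_apply, hl, smul_add, Finset.sum_add_distrib, Finset.sum_mul, Finset.mul_sum,
    smul_mul_assoc, mul_smul_comm]

theorem dOf_smul (hl : ∀ i x y, δ i (x * y) = δ i x * y + x * δ i y) (A' : Fin 2) (r : R)
    (F : Ten n R) : dOf δ A' (r • F) = wedge1 (fun a => nabD δ a A' r) F + r • dOf δ A' F := by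
  simp only [dOf_apply, wedge1_apply, mapT_smul_of_leibniz (nabD_mul δ hl _ A'), map_add, ext1_smul,
    Finset.sum_add_distrib, Finset.smul_sum]

theorem dOf_ext1 (A' : Fin 2) (b : Fin (2 * n + 2)) (F : Ten n R) :
    dOf δ A' (ext1 b F) = -ext1 b (dOf δ A' F) := by
  simp only [dOf_apply, mapT_ext1, map_sum, ← Finset.sum_neg_distrib]
  exact Finset.sum_congr rfl fun a _ => ext1_ext1 _ _ _

/-- The graded Leibniz rule `d^{A'}(α ∧ F) = d^{A'}α ∧ F - α ∧ d^{A'}F`. The coefficients of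
`d^{A'}α` are not skew-symmetrised here, so the result is compared with other two-forms through
`wedge2_congr`. -/
theorem dOf_wedge1 (hl : ∀ i x y, δ i (x * y) = δ i x * y + x * δ i y) (A' : Fin 2)
    (α : Fin (2 * n + 2) → R) (F : Ten n R) : dOf δ A' (wedge1 α F) =
      wedge2 (fun a b => nabD δ a A' (α b)) F - wedge1 α (dOf δ A' F) := by
  have h1 : wedge2 (fun a b => nabD δ a A' (α b)) F =
      ∑ b, wedge1 (fun a => nabD δ a A' (α b)) (ext1 b F) := by
    rw [wedge2_apply, Finset.sum_comm]
    simp only [wedge1_apply]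
  rw [h1, wedge1_apply α F, map_sum, wedge1_apply α, ← Finset.sum_sub_distrib]
  exact Finset.sum_congr rfl fun b _ => by rw [dOf_smul δ hl, dOf_ext1, smul_neg, sub_eq_add_neg]

theorem dOf_mapT_comm {L : R →ₗ[ℂ] R} (hL : ∀ i r, δ i (L r) = L (δ i r)) (A' : Fin 2)
    (F : Ten n R) : dOf δ A' (mapT L F) = mapT L (dOf δ A' F) := by
  simp only [dOf_apply, map_sum, mapT_ext1]
  refine Finset.sum_congr rfl fun a _ => congrArg _ ?_
  funext p q S
  simp only [mapT_apply, nabD_apply, map_sum, map_smul, hL]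

theorem wedge2_neg (β : Fin (2 * n + 2) → Fin (2 * n + 2) → R) (F : Ten n R) :
    wedge2 (-β) F = -wedge2 β F := by
  simp only [wedge2_apply, Pi.neg_apply, neg_smul, Finset.sum_neg_distrib]

/-- A two-form depends only on its skew-symmetric part. -/
theorem wedge2_congr {β β' : Fin (2 * n + 2) → Fin (2 * n + 2) → R}
    (h : ∀ a b, β a b - β b a = β' a b - β' b a) (F : Ten n R) : wedge2 β F = wedge2 β' F := by
  have key (β : Fin (2 * n + 2) → Fin (2 * n + 2) → R) : (2 : ℂ) • wedge2 β F =
      wedge2 (fun a b => β a b - β b a) F := by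
    have h2 : wedge2 β F = -∑ a, ∑ b, β b a • ext1 a (ext1 b F) := by
      rw [wedge2_apply, Finset.sum_comm]
      simp only [← Finset.sum_neg_distrib, ← smul_neg]
      refine Finset.sum_congr rfl fun b _ => Finset.sum_congr rfl fun a _ => ?_
      rw [ext1_ext1]
    rw [two_smul]
    nth_rewrite 2 [h2]
    simp only [wedge2_apply, sub_smul, Finset.sum_sub_distrib]
    rw [sub_eq_add_neg]
  have : (2 : ℂ) • wedge2 β F = (2 : ℂ) • wedge2 β' F := by
    rw [key, key]; simp only [h]
  exact smul_right_injective (Ten n R) two_ne_zero this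

end Differential

/-! ### Geometry of the hypersurface -/

section Geometry

variable {n : ℕ} (φ : GraphFn n) (U : TopologicalSpace.Opens (HSpace n))

theorem dUp_eq (A' : Fin 2) : dUp U A' = dOf (pd U) A' := rfl

theorem dUp_dUp (A' B' : Fin 2) (F : Ten n (SmoothFn (U : Set (HSpace n)))) :
    dUp U A' (dUp U B' F) = -dUp U B' (dUp U A' F) := dOf_dOf _ (pd_comm U) A' B' F

theorem dUp_self (A' : Fin 2) (F : Ten n (SmoothFn (U : Set (HSpace n)))) :
    dUp U A' (dUp U A' F) = 0 := dOf_self _ (pd_comm U) A' F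

/-- The operator that corresponds to `d^{A'}` for sections that do not depend on `x_{4n+1}`. -/
def dB (A' : Fin 2) : BTen φ U →ₗ[ℂ] BTen φ U := dOf (bpd φ U) A'

theorem Omega_pd (A' : Fin 2) (a : Fin (2 * n + 2)) :
    nabD (pd U) a A' (ofGlobal (U : Set (HSpace n)) (rho φ) (rho_contDiff φ)) =
      Omega φ U A' a := by
  rw [nabD_apply]; simp only [pd_rho]; rfl

theorem restr_Omega (A' : Fin 2) (a : Fin (2 * n + 2)) :
    restr (bdry_subset φ U) (Omega φ U A' a) = Omega φ (bdry φ U) A' a := by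
  simp only [Omega, map_sum, map_smul]; rfl

theorem toBdry_smul (r : SmoothFn (U : Set (HSpace n)))
    (F : Ten n (SmoothFn (U : Set (HSpace n)))) :
    toBdry φ U (r • F) = restr (bdry_subset φ U) r • toBdry φ U F := rfl

theorem toBdry_ext1 (a : Fin (2 * n + 2)) (F : Ten n (SmoothFn (U : Set (HSpace n)))) :
    toBdry φ U (ext1 a F) = ext1 a (toBdry φ U F) := mapT_ext1 _ _ _

theorem toBdry_Omega (A' : Fin 2) (F : Ten n (SmoothFn (U : Set (HSpace n)))) :
    toBdry φ U (wedge1 (Omega φ U A') F) = wedge1 (Omega φ (bdry φ U) A') (toBdry φ U F) := by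
  simp only [wedge1_apply, map_sum, toBdry_smul, toBdry_ext1, restr_Omega]

theorem restr_nabD (a : Fin (2 * n + 2)) (A' : Fin 2) (f : SmoothFn (U : Set (HSpace n))) :
    restr (bdry_subset φ U) (nabD (pd U) a A' f) =
      nabD (bpd φ U) a A' (restr (bdry_subset φ U) f) +
        Omega φ (bdry φ U) A' a * restr (bdry_subset φ U) (pd U (nIdx n) f) := by
  rw [nabD_apply, nabD_apply, Omega, map_sum, Finset.sum_mul, ← Finset.sum_add_distrib]
  refine Finset.sum_congr rfl fun i _ => ?_
  rw [map_smul, restr_pd, smul_add, smul_mul_assoc]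

/-- The restriction of `d^{A'} u` to the hypersurface. -/
theorem toBdry_dUp (A' : Fin 2) (u : Ten n (SmoothFn (U : Set (HSpace n)))) :
    toBdry φ U (dUp U A' u) = dB φ U A' (toBdry φ U u) +
      wedge1 (Omega φ (bdry φ U) A') (toBdry φ U (mapT (pd U (nIdx n)) u)) := by
  rw [dUp_eq]
  exact mapT_dOf _ _ _ _ A' _ (fun a f => restr_nabD φ U a A' f) u

theorem pd_nIdx_Omega (A' : Fin 2) (F : Ten n (SmoothFn (U : Set (HSpace n)))) :
    mapT (pd U (nIdx n)) (wedge1 (Omega φ U A') F) =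
      wedge1 (Omega φ U A') (mapT (pd U (nIdx n)) F) := by
  have h (a : Fin (2 * n + 2)) : pd U (nIdx n) (Omega φ U A' a) = 0 := by
    simp only [Omega, map_sum, map_smul, pd_nIdx_drho, smul_zero, Finset.sum_const_zero]
  simp only [wedge1_apply, map_sum, mapT_smul_of_leibniz (pd_mul U (nIdx n)), h, zero_smul, zero_add,
    mapT_ext1]

theorem pd_nIdx_dUp (A' : Fin 2) (F : Ten n (SmoothFn (U : Set (HSpace n)))) :
    mapT (pd U (nIdx n)) (dUp U A' F) = dUp U A' (mapT (pd U (nIdx n)) F) :=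
  (dOf_mapT_comm (pd U) (fun _ r => pd_comm U _ _ r) A' F).symm

/-- `F ↦ ℰ ∧ F` on `bD ∩ U`. -/
def EB : BTen φ U →ₗ[ℂ] BTen φ U := wedge2 (Eform φ (bdry φ U))

theorem Eform_skew (S : Set (HSpace n)) (a b : Fin (2 * n + 2)) :
    Eform φ S a b - Eform φ S b a =
      -∑ i, ∑ j, (nabUp a 0 i * nabUp b 1 j - nabUp b 0 i * nabUp a 1 j) • ddrho φ S i j := by
  simp only [Eform, ← Finset.sum_sub_distrib, ← sub_smul, Finset.smul_sum, smul_smul,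
    ← Finset.sum_neg_distrib, ← neg_smul]
  refine Finset.sum_congr rfl fun i _ => Finset.sum_congr rfl fun j _ => ?_
  congr 1
  ring

theorem nabD_bpd_Omega (A' B' : Fin 2) (a b : Fin (2 * n + 2)) :
    nabD (bpd φ U) a A' (Omega φ (bdry φ U) B' b) =
      ∑ i, ∑ j, (nabUp a A' i * nabUp b B' j) • ddrho φ (bdry φ U) i j := by
  simp only [nabD_apply, Omega, map_sum, map_smul, bpd_drho, Finset.smul_sum, smul_smul]
  rw [Finset.sum_comm]
  exact Finset.sum_congr rfl fun i _ => Finset.sum_congr rfl fun j _ => by rw [mul_comm]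

/-- The term `d^{A'} Ω^{A'} = d^{A'} d^{A'} ϱ` vanishes because the Hessian of `ϱ` is symmetric. -/
theorem dB_e_self (A' : Fin 2) (F : BTen φ U) :
    dB φ U A' (wedge1 (Omega φ (bdry φ U) A') F) =
      -wedge1 (Omega φ (bdry φ U) A') (dB φ U A' F) := by
  rw [dB, dOf_wedge1 _ (bpd_mul φ U), wedge2_congr (β' := 0), wedge2_apply]
  · simp
  · intro a b
    simp only [nabD_bpd_Omega, Pi.zero_apply, sub_self]
    rw [sub_eq_zero, Finset.sum_comm]
    refine Finset.sum_congr rfl fun i _ => Finset.sum_congr rfl fun j _ => ?_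
    rw [ddrho_symm, mul_comm]

/-- Here the Leibniz term is `d^{0'} d^{1'} ϱ = -ℰ`. In `dB_one_e_zero` the two operators are
exchanged, which changes its sign. -/
theorem dB_zero_e_one (F : BTen φ U) : dB φ U 0 (wedge1 (Omega φ (bdry φ U) 1) F) =
    -EB φ U F - wedge1 (Omega φ (bdry φ U) 1) (dB φ U 0 F) := by
  rw [dB, dOf_wedge1 _ (bpd_mul φ U), wedge2_congr (β' := -Eform φ (bdry φ U)), EB]
  · rw [wedge2_neg]
  · intro a b
    simp only [Pi.neg_apply]
    rw [← neg_sub', Eform_skew, neg_neg, nabD_bpd_Omega, nabD_bpd_Omega]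
    simp only [← Finset.sum_sub_distrib, sub_smul]

theorem dB_one_e_zero (F : BTen φ U) : dB φ U 1 (wedge1 (Omega φ (bdry φ U) 0) F) =
    EB φ U F - wedge1 (Omega φ (bdry φ U) 0) (dB φ U 1 F) := by
  rw [dB, dOf_wedge1 _ (bpd_mul φ U), wedge2_congr (β' := Eform φ (bdry φ U)), EB]
  intro a b
  rw [Eform_skew, nabD_bpd_Omega, nabD_bpd_Omega, Finset.sum_comm]
  nth_rewrite 2 [Finset.sum_comm]
  simp only [← Finset.sum_sub_distrib, ← Finset.sum_neg_distrib, ← neg_smul]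
  refine Finset.sum_congr rfl fun i _ => Finset.sum_congr rfl fun j _ => ?_
  rw [ddrho_symm, ← sub_smul]
  congr 1
  ring

/-! The matrix `𝐍ϱ` and the frame. -/

/-- `|∇_{(2n)A'} ϱ|^2`, summed over `A'`. -/
def normSqN (x : HSpace n) : ℝ :=
  ∑ m : Fin 4, (fderiv ℝ (rho φ) x (Pi.single (Fin.natAdd (4 * n) m) 1)) ^ 2

theorem normSqN_contDiff : ContDiff ℝ ∞ (normSqN φ) :=
  ContDiff.sum fun _ _ => (contDiff_partial (rho_contDiff φ) _).pow 2

theorem normSqN_pos (x : HSpace n) : 0 < normSqN φ x := by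
  have h : fderiv ℝ (rho φ) x (Pi.single (nIdx n) 1) = 1 :=
    fderiv_tvec_eq_zero (c := (1 : ℝ)) (fun x s => by rw [rho_add_tvec]; simp) x
      (differentiable_rho φ _)
  have h0 : (Fin.natAdd (4 * n) (0 : Fin 4)) = nIdx n := rfl
  rw [normSqN, Fin.sum_univ_four, h0, h]
  positivity

/-- The fields `𝐍_{B'C'}` involve only the four coordinates of `q_{n+1}`. -/
theorem sum_nabLow_vIdx {M : Type*} [AddCommGroup M] [Module ℂ M] (B' C' : Fin 2)
    (g : Fin (4 * n + 4) → M) : ∑ i, nabLow (n := n) (vIdx B') C' i • g i =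
      if B' = 0 then
        if C' = 0 then g (Fin.natAdd (4 * n) 0) + Complex.I • g (Fin.natAdd (4 * n) 1)
        else -g (Fin.natAdd (4 * n) 2) - Complex.I • g (Fin.natAdd (4 * n) 3)
      else
        if C' = 0 then g (Fin.natAdd (4 * n) 2) - Complex.I • g (Fin.natAdd (4 * n) 3)
        else g (Fin.natAdd (4 * n) 0) - Complex.I • g (Fin.natAdd (4 * n) 1) := by
  have hz (B' C' : Fin 2) (i : Fin (4 * n)) : nabLow (n := n) (vIdx B') C' (Fin.castAdd 4 i) = 0 := by
    have hi := i.2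
    have e : ∀ m, ¬((i : ℕ) = 4 * ((2 * n + (B' : ℕ)) / 2) + m) := fun m => by omega
    have e0 : ¬((i : ℕ) = 4 * ((2 * n + (B' : ℕ)) / 2)) := by omega
    simp [nabLow, vIdx, e, e0]
  rw [Fin.sum_univ_add]
  have h1 : (2 * n + 1) / 2 = n := by omega
  have h2 : (2 * n + 1) % 2 = 1 := by omega
  simp only [hz, zero_smul, Finset.sum_const_zero, zero_add, Fin.sum_univ_four]
  fin_cases B' <;> fin_cases C' <;> simp [nabLow, vIdx, h1, h2, sub_eq_add_neg]

theorem Omega_eq (S : Set (HSpace n)) (A' : Fin 2) (a : Fin (2 * n + 2)) :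
    Omega φ S A' a = ∑ B' : Fin 2, epsUp B' A' • ∑ i, nabLow a B' i • drho φ S i := by
  simp only [Omega, nabUp, Finset.sum_smul, Finset.smul_sum, smul_smul]
  rw [Finset.sum_comm]
  simp only [mul_comm]

/-- The matrix `(𝐍_{B'C'} ϱ)` over a set `S`. -/
def NrhoOn (S : Set (HSpace n)) : Matrix (Fin 2) (Fin 2) (SmoothFn S) :=
  Matrix.of fun B' C' => ∑ i, nabLow (vIdx B') C' i • drho φ S i

/-- The matrix represents the quaternion formed by the four derivatives of `ϱ` in `q_{n+1}`, so its
determinant is the square of the quaternionic norm. One of these derivatives is `1`, so the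
determinant has no zeros. -/
theorem NrhoOn_det (S : Set (HSpace n)) :
    (NrhoOn φ S).det = ofGlobal S (normSqN φ) (normSqN_contDiff φ) := by
  have hI : ∀ x : SmoothFn S, Complex.I • x = algebraMap ℂ _ Complex.I * x :=
    fun x => Algebra.smul_def _ _
  have hI2 : algebraMap ℂ (SmoothFn S) Complex.I ^ 2 = -1 := by
    rw [← map_pow, Complex.I_sq, map_neg, map_one]
  have hr : ofGlobal S (normSqN φ) (normSqN_contDiff φ) =
      ∑ m : Fin 4, drho φ S (Fin.natAdd (4 * n) m) ^ 2 := by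
    ext x
    simp only [Fin.sum_univ_four]
    change ((normSqN φ x.1 : ℝ) : ℂ) = ((drho φ S _).1 x) ^ 2 + ((drho φ S _).1 x) ^ 2
      + ((drho φ S _).1 x) ^ 2 + ((drho φ S _).1 x) ^ 2
    simp only [drho_apply, normSqN, Fin.sum_univ_four]
    push_cast
    rfl
  rw [hr, Matrix.det_fin_two, Fin.sum_univ_four]
  simp only [NrhoOn, Matrix.of_apply, sum_nabLow_vIdx, hI]
  simp
  linear_combination (-(drho φ S (Fin.natAdd (4 * n) 1)) ^ 2 -
    (drho φ S (Fin.natAdd (4 * n) 3)) ^ 2) * hI2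

theorem isUnit_ofGlobal (S : Set (HSpace n)) {g : HSpace n → ℝ} (hg : ContDiff ℝ ∞ g)
    (h0 : ∀ x, g x ≠ 0) : IsUnit (ofGlobal S g hg) := by
  refine IsUnit.of_mul_eq_one (ofGlobal S (fun x => (g x)⁻¹) (hg.inv h0)) ?_
  ext x
  change ((g x.1 : ℝ) : ℂ) * (((g x.1)⁻¹ : ℝ) : ℂ) = 1
  rw [← Complex.ofReal_mul, mul_inv_cancel₀ (h0 _), Complex.ofReal_one]

theorem NrhoOn_isUnit_det (S : Set (HSpace n)) : IsUnit (NrhoOn φ S).det := by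
  rw [NrhoOn_det]
  exact isUnit_ofGlobal S _ fun x => (normSqN_pos φ x).ne'

/-- `R_{B'C'}` over a set `S`. -/
def RcoOn (S : Set (HSpace n)) (B' C' : Fin 2) : SmoothFn S :=
  ∑ D' : Fin 2, epsLow B' D' • (NrhoOn φ S)⁻¹ D' C'

/-- The `ε` in `R` lowers the index that the `ε` in `Ω` has raised, so the two cancel. On vertical
indices this gives the inverse matrix needed for the frame, and on horizontal ones the coefficients
`n_{AB'}`. -/
theorem sum_RcoOn_Omega (S : Set (HSpace n)) (B' : Fin 2) (a : Fin (2 * n + 2)) :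
    ∑ C' : Fin 2, RcoOn φ S C' B' * Omega φ S C' a =
      ∑ D' : Fin 2, (∑ i, nabLow a D' i • drho φ S i) * (NrhoOn φ S)⁻¹ D' B' := by
  simp [RcoOn, Omega_eq, epsLow, epsUp]
  ring

theorem sum_RcoOn_Omega_vIdx (S : Set (HSpace n)) (B' D' : Fin 2) :
    ∑ C' : Fin 2, RcoOn φ S C' B' * Omega φ S C' (vIdx D') = if D' = B' then 1 else 0 := by
  rw [sum_RcoOn_Omega]
  have := congrFun (congrFun (Matrix.mul_nonsing_inv _ (NrhoOn_isUnit_det φ S)) D') B'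
  rw [Matrix.mul_apply, Matrix.one_apply] at this
  exact this

/-- The frame `ω^0, …, ω^{2n-1}, Ω^{0'}, Ω^{1'}` over a set `S`. -/
def frame (S : Set (HSpace n)) : Frame n (SmoothFn S) where
  form := Omega φ S
  inv := RcoOn φ S
  inv_mul C D := by
    have h : (Matrix.of fun D' C' => Omega φ S C' (vIdx D')) * (Matrix.of (RcoOn φ S)) = 1 := by
      ext D' B' : 2
      simp only [Matrix.mul_apply, Matrix.of_apply, Matrix.one_apply,
        mul_comm (Omega φ S _ _), sum_RcoOn_Omega_vIdx]
    rw [mul_eq_one_comm] at h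
    have h' := congrFun (congrFun h C) D
    simpa only [Matrix.mul_apply, Matrix.of_apply, Matrix.one_apply] using h'

theorem nCo_eq (A : Fin (2 * n)) (B' : Fin 2) :
    nCo φ U A B' = ∑ C' : Fin 2, Rco φ U C' B' * Omega φ (bdry φ U) C' (hIdx A) :=
  (sum_RcoOn_Omega φ (bdry φ U) B' (hIdx A)).symm

theorem sum_Rco_Omega (C D : Fin 2) :
    ∑ B, Rco φ U C B * Omega φ (bdry φ U) D (vIdx B) = if C = D then 1 else 0 :=
  (frame φ (bdry φ U)).inv_mul C D

/-- `ω^{2n+B'} = -∑_A n_{AB'} ω^A + R_{C'B'} Ω^{C'}`. -/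
theorem ext1_vIdx (B' : Fin 2) (F : BTen φ U) : ext1 (vIdx B') F =
    -(∑ A, nCo φ U A B' • ext1 (hIdx A) F) +
      ∑ C' : Fin 2, Rco φ U C' B' • wedge1 (Omega φ (bdry φ U) C') F :=
  (frame φ (bdry φ U)).ext1_vIdx (nCo_eq φ U) B' F

end Geometry

/-! ### Expansion of two-forms in a frame. -/

section FrameExpansion

variable {n : ℕ} {R : Type} [CommRing R] [Algebra ℂ R]

theorem hwedge1_sum {ι : Type*} (s : Finset ι) (g : ι → Fin (2 * n) → R) (F : Ten n R) :
    hwedge1 (fun A => ∑ i ∈ s, g i A) F = ∑ i ∈ s, hwedge1 (g i) F := by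
  simp only [hwedge1_apply, Finset.sum_smul]
  exact Finset.sum_comm

theorem hwedge1_mul (r : R) (g : Fin (2 * n) → R) (F : Ten n R) :
    hwedge1 (fun A => r * g A) F = r • hwedge1 g F := by
  simp only [hwedge1_apply, mul_smul, Finset.smul_sum]

theorem hwedge2_sum {ι : Type*} (s : Finset ι) (g : ι → Fin (2 * n) → Fin (2 * n) → R)
    (F : Ten n R) : hwedge2 (fun A B => ∑ i ∈ s, g i A B) F = ∑ i ∈ s, hwedge2 (g i) F := by
  simp only [hwedge2_apply, Finset.sum_smul]
  rw [Finset.sum_comm' (t' := Finset.univ) (s' := fun _ => s) (by simp)]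
  simp only [Finset.sum_comm (s := s)]

theorem hwedge2_mul (r : R) (g : Fin (2 * n) → Fin (2 * n) → R) (F : Ten n R) :
    hwedge2 (fun A B => r * g A B) F = r • hwedge2 g F := by
  simp only [hwedge2_apply, mul_smul, Finset.smul_sum]

theorem hwedge2_prod (α β : Fin (2 * n) → R) (F : Ten n R) :
    hwedge2 (fun A B => α A * β B) F = hwedge1 α (hwedge1 β F) := by
  simp only [hwedge2_apply, mul_smul]
  rw [hwedge1_apply α]
  simp only [hwedge1_apply β, map_sum, ext1_smul, Finset.smul_sum]

theorem hwedge1_sub (α β : Fin (2 * n) → R) (F : Ten n R) :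
    hwedge1 (fun A => α A - β A) F = hwedge1 α F - hwedge1 β F := by
  simp only [hwedge1_apply, sub_smul, Finset.sum_sub_distrib]

theorem hwedge1_smul (α : Fin (2 * n) → R) (r : R) (F : Ten n R) :
    hwedge1 α (r • F) = r • hwedge1 α F := by
  simp only [hwedge1_apply, ext1_smul, Finset.smul_sum, smul_comm r]

theorem hwedge1_neg (α : Fin (2 * n) → R) (F : Ten n R) :
    hwedge1 (fun A => -α A) F = -hwedge1 α F := by
  simp only [hwedge1_apply, neg_smul, Finset.sum_neg_distrib]

theorem hwedge1_single (A : Fin (2 * n)) (F : Ten n R) :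
    hwedge1 (fun B => if A = B then 1 else 0) F = ext1 (hIdx A) F := by
  simp [hwedge1_apply]

namespace Frame

variable (fr : Frame n R)

theorem e_smul (C : Fin 2) (r : R) (F : Ten n R) : fr.e C (r • F) = r • fr.e C F :=
  wedge1_smul _ _ _

theorem hwedge1_e (α : Fin (2 * n) → R) (C : Fin 2) (F : Ten n R) :
    hwedge1 α (fr.e C F) = -fr.e C (hwedge1 α F) := hwedge1_wedge1 _ _ _

/-- The expansion of a two-form in the frame. -/
theorem wedge2_expand (P : Fin (2 * n + 2) → Fin (2 * n) → R) (Q : Fin (2 * n + 2) → Fin 2 → R)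
    (h : ∀ a F, ext1 a F = hwedge1 (P a) F + (Q a 0 • fr.e 0 F + Q a 1 • fr.e 1 F))
    (β : Fin (2 * n + 2) → Fin (2 * n + 2) → R) (F : Ten n R) :
    wedge2 β F = hwedge2 (fun A B => ∑ a, ∑ b, β a b * (P a A * P b B)) F +
      (∑ C, fr.e C (hwedge1 (fun A => ∑ a, ∑ b, β a b * (Q a C * P b A - P a A * Q b C)) F)) +
      (∑ a, ∑ b, β a b * (Q a 0 * Q b 1 - Q a 1 * Q b 0)) • fr.e 0 (fr.e 1 F) := by
  have h1 (a b : Fin (2 * n + 2)) : ext1 a (ext1 b F) = hwedge1 (P a) (hwedge1 (P b) F) +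
      (fr.e 0 (Q a 0 • hwedge1 (P b) F - Q b 0 • hwedge1 (P a) F) +
        fr.e 1 (Q a 1 • hwedge1 (P b) F - Q b 1 • hwedge1 (P a) F)) +
      (Q a 0 * Q b 1 - Q a 1 * Q b 0) • fr.e 0 (fr.e 1 F) := by
    -- The inner factor is expanded before the outer one. Two equal `Ω`'s give zero, and the mixed
    -- products are reordered by anticommutation.
    rw [h b, h a]
    simp only [map_add, map_sub, e_smul, hwedge1_smul, hwedge1_e, e_self, e_one_zero, smul_neg,
      smul_zero, smul_add, sub_smul, mul_smul]
    rw [smul_comm (Q a 1) (Q b 0)]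
    abel
  have h2 (C : Fin 2) (a b : Fin (2 * n + 2)) :
      (fun A => Q a C * P b A - P a A * Q b C) = fun A => Q a C * P b A - Q b C * P a A := by
    funext A; ring
  simp only [wedge2_apply, h1, hwedge2_sum, hwedge2_mul, hwedge1_sum, hwedge1_mul, map_sum, e_smul,
    hwedge2_prod, smul_add, Finset.sum_add_distrib, Finset.sum_smul, mul_smul, h2, hwedge1_sub,
    Fin.sum_univ_two]

end Frame

end FrameExpansion

/-! ### The tangential fields as frame components of `d^{A'}` on the hypersurface. -/

section TangentialCalculus

variable {n : ℕ} (φ : GraphFn n) (U : TopologicalSpace.Opens (HSpace n))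

theorem sum_nabUp_drho (S : Set (HSpace n)) (a : Fin (2 * n + 2)) (A' : Fin 2) :
    ∑ i, algebraMap ℂ (SmoothFn S) (nabUp a A' i) * drho φ S i = Omega φ S A' a := by
  simp only [Omega, Algebra.smul_def]

/-- Applied to `ϱ`, the field gives the difference of the `ω^A`-component of `Ω^{A'}` and the
combination of its vertical components with coefficients `n_{AB'}`. The `n_{AB'}` are built from the
inverse matrix so that this is zero. -/
theorem Zfield_tangential (A : Fin (2 * n)) (A' : Fin 2) :
    ∑ i, Zfield φ U A A' i * drho φ (bdry φ U) i = 0 := by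
  have h : ∑ i, Zfield φ U A A' i * drho φ (bdry φ U) i = Omega φ (bdry φ U) A' (hIdx A) -
      ∑ B', nCo φ U A B' * Omega φ (bdry φ U) A' (vIdx B') := by
    simp only [Zfield, sub_mul, Finset.sum_sub_distrib, sum_nabUp_drho, Finset.sum_mul]
    rw [Finset.sum_comm]
    congr 1
    refine Finset.sum_congr rfl fun B' _ => ?_
    rw [← sum_nabUp_drho, Finset.mul_sum]
    exact Finset.sum_congr rfl fun i _ => by rw [Algebra.smul_def]; ring
  have h2 : ∑ B', nCo φ U A B' * Omega φ (bdry φ U) A' (vIdx B') =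
      Omega φ (bdry φ U) A' (hIdx A) := by
    simp only [nCo_eq, Finset.sum_mul]
    rw [Finset.sum_comm]
    have h3 (C : Fin 2) : ∑ B', Rco φ U C B' * Omega φ (bdry φ U) C (hIdx A) *
        Omega φ (bdry φ U) A' (vIdx B') =
        Omega φ (bdry φ U) C (hIdx A) * if C = A' then 1 else 0 := by
      rw [← sum_Rco_Omega φ U, Finset.mul_sum]
      exact Finset.sum_congr rfl fun i _ => by ring
    simp only [h3]
    simp
  rw [h, h2, sub_self]

/-- The matrix `R` inverts the vertical components of the `Ω`'s, so `R_{B'C'} 𝐍_{C'}^{A'} ϱ =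
δ_{B'}^{A'}`. The subtracted multiple of `∂_{4n+1}` contributes the same value. -/
theorem Tfield_tangential (B' A' : Fin 2) :
    ∑ i, Tfield φ U B' A' i * drho φ (bdry φ U) i = 0 := by
  have h1 : ∑ i, (∑ C', nabUp (vIdx C') A' i • Rco φ U B' C') * drho φ (bdry φ U) i =
      if B' = A' then 1 else 0 := by
    rw [← sum_Rco_Omega φ U]
    simp only [Finset.sum_mul]
    rw [Finset.sum_comm]
    refine Finset.sum_congr rfl fun C _ => ?_
    rw [← sum_nabUp_drho, Finset.mul_sum]
    exact Finset.sum_congr rfl fun i _ => by rw [Algebra.smul_def]; ring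
  have h2 : ∑ i, (if A' = B' ∧ i = nIdx n then (1 : SmoothFn (bdry φ U)) else 0) *
      drho φ (bdry φ U) i = if B' = A' then 1 else 0 := by
    by_cases h : A' = B'
    · simp [h, drho_nIdx]
    · simp [h, Ne.symm h]
  simp only [Tfield, sub_mul, Finset.sum_sub_distrib, h1, h2, sub_self]

theorem vfB_apply (c : Fin (4 * n + 4) → SmoothFn (bdry φ U)) (f : SmoothFn (bdry φ U)) :
    vfB φ U c f = ∑ i, c i * bpd φ U i f := by
  simp [vfB]

theorem vfB_Zfield (A : Fin (2 * n)) (A' : Fin 2) (f : SmoothFn (bdry φ U)) :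
    vfB φ U (Zfield φ U A A') f = nabD (bpd φ U) (hIdx A) A' f -
      ∑ B', nCo φ U A B' * nabD (bpd φ U) (vIdx B') A' f := by
  simp only [vfB_apply, Zfield, nabD_apply, sub_mul, Finset.sum_sub_distrib, Finset.sum_mul,
    Finset.mul_sum, Algebra.smul_def]
  congr 1
  rw [Finset.sum_comm]
  exact Finset.sum_congr rfl fun i _ => Finset.sum_congr rfl fun j _ => by ring

theorem vfB_Tfield (B' A' : Fin 2) (f : SmoothFn (bdry φ U)) :
    vfB φ U (Tfield φ U B' A') f =
      ∑ C', Rco φ U B' C' * nabD (bpd φ U) (vIdx C') A' f := by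
  -- The field `∂_{4n+1}` kills the chosen extension, so subtracting it makes the field tangential
  -- without changing its action here.
  have h2 : ∑ i, (if A' = B' ∧ i = nIdx n then (1 : SmoothFn (bdry φ U)) else 0) *
      bpd φ U i f = 0 :=
    Finset.sum_eq_zero fun i _ => by
      split_ifs with h
      · rw [h.2, bpd_nIdx, mul_zero]
      · rw [zero_mul]
  simp only [vfB_apply, Tfield, nabD_apply, sub_mul, Finset.sum_sub_distrib, h2, sub_zero,
    Finset.sum_mul, Finset.mul_sum, Algebra.smul_def]
  rw [Finset.sum_comm]
  exact Finset.sum_congr rfl fun i _ => Finset.sum_congr rfl fun j _ => by ring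

theorem frd_apply (A' : Fin 2) (F : BTen φ U) :
    frd φ U A' F = ∑ A, ext1 (hIdx A) (mapT (vfB φ U (Zfield φ U A A')) F) := by
  simp [frd]

/-- The frame over `bD ∩ U`. -/
abbrev fB : Frame n (SmoothFn (bdry φ U)) := frame φ (bdry φ U)

theorem fB_e (C : Fin 2) (F : BTen φ U) :
    (fB φ U).e C F = wedge1 (Omega φ (bdry φ U) C) F := rfl

/-- The decomposition of `d^{A'}` into tangential operators. -/
theorem dB_eq (A' : Fin 2) (F : BTen φ U) : dB φ U A' F = frd φ U A' F +
    ((fB φ U).e 0 (Top φ U 0 A' F) + (fB φ U).e 1 (Top φ U 1 A' F)) := by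
  have hZ (A : Fin (2 * n)) : mapT (vfB φ U (Zfield φ U A A')) F =
      mapT (nabD (bpd φ U) (hIdx A) A') F -
        ∑ B', nCo φ U A B' • mapT (nabD (bpd φ U) (vIdx B') A') F := by
    funext p q S
    simp only [Pi.sub_apply, Finset.sum_apply, Pi.smul_apply, mapT_apply, vfB_Zfield, smul_eq_mul]
  have hT (C : Fin 2) : Top φ U C A' F =
      ∑ B', Rco φ U C B' • mapT (nabD (bpd φ U) (vIdx B') A') F := by
    funext p q S
    simp only [Top, Finset.sum_apply, Pi.smul_apply, mapT_apply, vfB_Tfield, smul_eq_mul]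
  -- Horizontal and vertical indices are separated. Each vertical `ω` is then rewritten in the
  -- frame: its horizontal part turns `∇_A` into `Z_A`, and its `Ω`-part yields `𝐓`.
  have hd : dB φ U A' F = ∑ A, ext1 (hIdx A) (mapT (nabD (bpd φ U) (hIdx A) A') F) +
      ∑ B', ext1 (vIdx B') (mapT (nabD (bpd φ U) (vIdx B') A') F) := by
    rw [dB, dOf_apply, Fin.sum_univ_add]; rfl
  rw [hd, frd_apply]
  simp only [Fin.sum_univ_two] at hZ hT ⊢
  simp only [hZ, hT, map_sub, map_add, ext1_smul, Finset.sum_sub_distrib, Finset.sum_add_distrib,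
    ext1_vIdx φ U, Frame.e_smul, Fin.sum_univ_two, fB_e]
  abel

theorem ext1_eq_PQ (a : Fin (2 * n + 2)) (F : BTen φ U) : ext1 a F =
    hwedge1 (Pco φ U a) F + (Qco φ U a 0 • (fB φ U).e 0 F + Qco φ U a 1 • (fB φ U).e 1 F) := by
  induction a using Fin.addCases with
  | left A =>
    have hP : Pco φ U (Fin.castAdd 2 A) = fun B => if A = B then 1 else 0 := by
      funext B; simp [Pco]
    have hQ (C : Fin 2) : Qco φ U (Fin.castAdd 2 A) C = 0 := by simp [Qco]
    rw [hP, hQ, hQ, zero_smul, zero_smul, add_zero, add_zero, hwedge1_single]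
    rfl
  | right C =>
    have hP : Pco φ U (Fin.natAdd (2 * n) C) = fun A => -nCo φ U A C := by
      funext B; simp [Pco]
    have hQ (B : Fin 2) : Qco φ U (Fin.natAdd (2 * n) C) B = Rco φ U B C := by simp [Qco]
    rw [hP, hQ, hQ, hwedge1_neg, hwedge1_apply]
    have := ext1_vIdx φ U C F
    rw [Fin.sum_univ_two] at this
    exact this

/-- The decomposition of `ℰ` in the frame. -/
theorem EB_eq (F : BTen φ U) : EB φ U F = hwedge2 (E0 φ U) F +
    ((fB φ U).e 0 (hwedge1 (E1 φ U 0) F) + (fB φ U).e 1 (hwedge1 (E1 φ U 1) F)) +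
      E01 φ U • (fB φ U).e 0 ((fB φ U).e 1 F) := by
  rw [EB, (fB φ U).wedge2_expand _ _ (ext1_eq_PQ φ U), Fin.sum_univ_two]
  rfl

theorem scalarT_mapT {R R' : Type} [CommRing R] [Algebra ℂ R] [CommRing R'] [Algebra ℂ R']
    (L : R →ₗ[ℂ] R') (r : R) : mapT L (scalarT (n := n) r) = scalarT (L r) := by
  funext p q S
  by_cases h : p = 0 ∧ q = 0 ∧ S = ∅ <;> simp [mapT_apply, scalarT, h]

theorem scalarT_eq_smul {R : Type} [CommRing R] [Algebra ℂ R] (r : R) :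
    scalarT (n := n) r = r • scalarT 1 := by
  funext p q S
  by_cases h : p = 0 ∧ q = 0 ∧ S = ∅ <;> simp [scalarT, h]

/-- Both sides have the Hessian of `ϱ` as coefficients. `Eform` is the skew-symmetrised version, and
a two-form sees only its skew part. The restriction to `bD` adds no normal term, because `∂_{4n+1} Ω
= 0`. -/
theorem Ebdry_eq : Ebdry φ U = EB φ U (scalarT 1) := by
  have h1 (a b : Fin (2 * n + 2)) : restr (bdry_subset φ U) (nabD (pd U) a 0 (nabD (pd U) b 1
      (ofGlobal (U : Set (HSpace n)) (rho φ) (rho_contDiff φ)))) =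
      ∑ i, ∑ j, (nabUp a 0 i * nabUp b 1 j) • ddrho φ (bdry φ U) i j := by
    rw [Omega_pd, restr_nabD, restr_Omega, ← nabD_bpd_Omega]
    have : pd U (nIdx n) (Omega φ U 1 b) = 0 := by
      simp only [Omega, map_sum, map_smul, pd_nIdx_drho, smul_zero, Finset.sum_const_zero]
    rw [this, map_zero, mul_zero, add_zero]
  have h2 : toBdry φ U (dUp U 0 (dUp U 1 (scalarT
      (ofGlobal (U : Set (HSpace n)) (rho φ) (rho_contDiff φ))))) =
      wedge2 (fun a b => ∑ i, ∑ j, (nabUp a 0 i * nabUp b 1 j) • ddrho φ (bdry φ U) i j)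
        (scalarT 1) := by
    rw [wedge2_apply, dUp_eq, dUp_eq, dOf_apply]
    simp only [dOf_apply _ 1, map_sum, mapT_ext1, scalarT_mapT, toBdry_ext1]
    refine Finset.sum_congr rfl fun a _ => Finset.sum_congr rfl fun b _ => ?_
    rw [toBdry, scalarT_mapT, h1, scalarT_eq_smul, ext1_smul, ext1_smul]
  rw [Ebdry, map_neg, h2, ← wedge2_neg, EB]
  refine wedge2_congr (fun a b => ?_) _
  rw [Eform_skew]
  simp only [Pi.neg_apply]
  rw [← neg_sub', neg_inj]
  simp only [← Finset.sum_sub_distrib, ← sub_smul]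

/-! Horizontality and commutation of the tangential operators. -/

theorem Hor.frd (A' : Fin 2) {F : BTen φ U} (hF : Hor F) : Hor (frd φ U A' F) := by
  rw [frd_apply]
  exact Hor.sum _ fun A => (hF.mapT _).ext1 A

theorem Hor.top (B' A' : Fin 2) {F : BTen φ U} (hF : Hor F) : Hor (Top φ U B' A' F) := hF.mapT _

theorem partialS_frd (A' B' : Fin 2) (F : BTen φ U) :
    partialS A' (frd φ U B' F) = frd φ U B' (partialS A' F) := by
  simp only [frd_apply, map_sum, partialS_ext1, partialS_mapT]

theorem partialS_Top (A' B' C' : Fin 2) (F : BTen φ U) :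
    partialS A' (Top φ U B' C' F) = Top φ U B' C' (partialS A' F) := partialS_mapT _ _ _

theorem TopUp_zero (A' : Fin 2) (F : BTen φ U) : TopUp φ U A' 0 F = Top φ U 1 A' F := by
  simp [TopUp, epsUp]

theorem TopUp_one (A' : Fin 2) (F : BTen φ U) : TopUp φ U A' 1 F = -Top φ U 0 A' F := by
  funext p q S
  simp [TopUp, epsUp]

theorem frdLow_zero (F : BTen φ U) : frdLow φ U 0 F = -frd φ U 1 F := by
  funext p q S
  simp [frdLow, epsLow]

theorem frdLow_one (F : BTen φ U) : frdLow φ U 1 F = frd φ U 0 F := by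
  simp [frdLow, epsLow]

theorem hwedge1_E1Up_zero (F : BTen φ U) : hwedge1 (E1Up φ U 0) F = hwedge1 (E1 φ U 1) F := by
  congr 2
  funext A; simp [E1Up, epsUp]

theorem hwedge1_E1Up_one (F : BTen φ U) : hwedge1 (E1Up φ U 1) F = -hwedge1 (E1 φ U 0) F := by
  have : E1Up φ U 1 = fun A => -E1 φ U 0 A := by
    funext A; simp [E1Up, epsUp]
  rw [this, hwedge1_neg]

end TangentialCalculus

/-! ### Extension of boundary data with prescribed normal derivatives. -/

section Lifts

variable {n : ℕ} (φ : GraphFn n) (U : TopologicalSpace.Opens (HSpace n))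

/-- A smooth function on `bD ∩ U` is the restriction of a smooth function on `U` that agrees with
its extension independent of `x_{4n+1}` near `bD ∩ U`. -/
theorem exists_extension (f : SmoothFn (bdry φ U)) : ∃ u : SmoothFn (U : Set (HSpace n)),
    ∀ x : bdry φ U, zext u.1 =ᶠ[nhds x.1] cext φ U f.1 := by
  obtain ⟨O, hO, hs, hc⟩ := cext_smooth φ U f
  have hclosed : IsClosed {x : HSpace n | rho φ x = 0} :=
    isClosed_eq (rho_contDiff φ).continuous continuous_const
  -- `p` is nonzero exactly on `O ∩ U`, where the extension is known to be smooth, and `q` exactly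
  -- on `U` away from `bD`. Hence `p + q > 0` on all of `U`.
  obtain ⟨p, hps, hp, hp01⟩ := (hO.inter U.isOpen).exists_contDiff_support_eq (n := ⊤)
  obtain ⟨q, hqs, hq, hq01⟩ :=
    (U.isOpen.inter hclosed.isOpen_compl).exists_contDiff_support_eq (n := ⊤)
  have hp0 : ∀ x, 0 ≤ p x := fun x => (hp01 (Set.mem_range_self x)).1
  have hq0 : ∀ x, 0 ≤ q x := fun x => (hq01 (Set.mem_range_self x)).1
  have hp' : ∀ {x}, x ∈ O → x ∈ U → 0 < p x := fun {x} h h' =>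
    lt_of_le_of_ne (hp0 x) (Ne.symm (by
      change x ∈ Function.support p; rw [hps]; exact ⟨h, h'⟩))
  have hpq : ∀ x ∈ (U : Set (HSpace n)), 0 < p x + q x := fun x hx => by
    by_cases h : rho φ x = 0
    · have := hp' (hs ⟨hx, h⟩) hx
      linarith [hq0 x]
    · have : q x ≠ 0 := by
        change x ∈ Function.support q; rw [hqs]; exact ⟨hx, h⟩
      have := lt_of_le_of_ne (hq0 x) this.symm
      linarith [hp0 x]
  -- The affine map sends the quotient values `1` on `bD` and `0` off `O` to `2` and `-1`, strictly
  -- outside `[0, 1]`. So `smoothTransition ∘ g` is constantly `1`, respectively `0`, in a whole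
  -- neighbourhood of such points.
  set g : HSpace n → ℝ := fun x => 3 * (p x / (p x + q x)) - 1 with hg
  have hgc : ∀ x ∈ (U : Set (HSpace n)), ContDiffAt ℝ ∞ g x := fun x hx =>
    (contDiffAt_const.mul (hp.contDiffAt.div (hp.contDiffAt.add hq.contDiffAt)
      (hpq x hx).ne')).sub contDiffAt_const
  set w : HSpace n → ℂ := fun x => (Real.smoothTransition (g x) : ℂ) * cext φ U f.1 x with hw
  have hwc : ContDiffOn ℝ ∞ w (U : Set (HSpace n)) := fun x hx => by
    refine ContDiffAt.contDiffWithinAt ?_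
    by_cases hxO : x ∈ O
    · have h1 : ContDiffAt ℝ ∞ (fun x => (Real.smoothTransition (g x) : ℂ)) x :=
        (Complex.ofRealCLM.contDiff.contDiffAt (x := Real.smoothTransition (g x))).comp x
          ((Real.smoothTransition.contDiffAt).comp x (hgc x hx))
      exact h1.mul (hc.contDiffAt (hO.mem_nhds hxO))
    · have hpx : p x = 0 := by
        by_contra h
        have : x ∈ Function.support p := h
        rw [hps] at this
        exact hxO this.1
      have hgx : g x < 0 := by simp [hg, hpx]
      have hev : w =ᶠ[nhds x] fun _ => 0 := by
        filter_upwards [(hgc x hx).continuousAt.eventually_lt continuousAt_const hgx] with y hy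
        simp [hw, Real.smoothTransition.zero_of_nonpos hy.le]
      exact contDiffAt_const.congr_of_eventuallyEq hev
  refine ⟨⟨fun x => w x.1, U, U.isOpen, subset_rfl, w, hwc, fun _ => rfl⟩, fun x => ?_⟩
  have hqx : q x.1 = 0 := by
    by_contra h
    have : x.1 ∈ Function.support q := h
    rw [hqs] at this
    exact this.2 x.2.2
  have hgx : 1 < g x.1 := by
    have := hp' (hs x.2) x.2.1
    simp only [hg, hqx, add_zero, div_self this.ne']
    norm_num
  filter_upwards [continuousAt_const.eventually_lt (hgc x.1 x.2.1).continuousAt hgx,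
    U.isOpen.mem_nhds x.2.1] with y hy hyU
  rw [zext_of_mem _ hyU]
  simp [hw, Real.smoothTransition.one_of_one_le hy.le]

theorem fderiv_cext_tvec (f : bdry φ U → ℂ) (x : HSpace n) :
    fderiv ℝ (cext φ U f) x (tvec n) = 0 := by
  by_cases hd : DifferentiableAt ℝ (cext φ U f) x
  · exact fderiv_tvec_eq_zero (c := (0 : ℂ)) (fun x s => by rw [cext_add_tvec]; simp) x hd
  · rw [fderiv_zero_of_not_differentiableAt hd]; rfl

/-- A lift with vanishing normal derivatives. -/
theorem exists_stationary_lift (f : SmoothFn (bdry φ U)) : ∃ u : SmoothFn (U : Set (HSpace n)),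
    restr (bdry_subset φ U) u = f ∧ restr (bdry_subset φ U) (pd U (nIdx n) u) = 0 ∧
      restr (bdry_subset φ U) (pd U (nIdx n) (pd U (nIdx n) u)) = 0 := by
  obtain ⟨u, hu⟩ := exists_extension φ U f
  -- Agreement near `bD`, and not merely on it, makes the second normal derivative vanish as well.
  have h1 (x : bdry φ U) : zext (pd U (nIdx n) u).1 =ᶠ[nhds x.1] fun _ => 0 := by
    filter_upwards [(hu x).eventuallyEq_nhds, U.isOpen.mem_nhds x.2.1] with y hy hyU
    rw [zext_pd U _ _ hyU, hy.fderiv_eq]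
    exact fderiv_cext_tvec φ U _ y
  refine ⟨u, ?_, ?_, ?_⟩
  · ext x
    have := (hu x).self_of_nhds
    rw [zext_of_mem _ x.2.1, cext_of_mem φ U _ x.2] at this
    exact this
  · ext x
    have := (h1 x).self_of_nhds
    rw [zext_of_mem _ x.2.1] at this
    exact this
  · ext x
    change fderiv ℝ (zext (pd U (nIdx n) u).1) x.1 _ = 0
    rw [(h1 x).fderiv_eq]
    simp

/-- Every pair of functions on `bD ∩ U` consists of the value and the normal derivative of a
smooth function on `U`. -/
theorem exists_lift (f g : SmoothFn (bdry φ U)) : ∃ u : SmoothFn (U : Set (HSpace n)),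
    restr (bdry_subset φ U) u = f ∧ restr (bdry_subset φ U) (pd U (nIdx n) u) = g ∧
      restr (bdry_subset φ U) (pd U (nIdx n) (pd U (nIdx n) u)) = 0 := by
  obtain ⟨u, hu, hu1, hu2⟩ := exists_stationary_lift φ U f
  obtain ⟨v, hv, hv1, hv2⟩ := exists_stationary_lift φ U g
  set r := ofGlobal (U : Set (HSpace n)) (rho φ) (rho_contDiff φ) with hr
  have hr1 : pd U (nIdx n) r = 1 := by rw [hr, pd_rho, drho_nIdx]
  have hr0 : restr (bdry_subset φ U) r = 0 := by
    ext x
    change ((rho φ x.1 : ℝ) : ℂ) = 0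
    rw [x.2.2, Complex.ofReal_zero]
  -- `ϱ v` vanishes on `bD` and has normal derivative `v` there. Its second normal derivative is `2
  -- ∂_{4n+1} v + ϱ ∂_{4n+1}^2 v`, which vanishes there since `v` is stationary.
  refine ⟨u + r * v, ?_, ?_, ?_⟩
  · rw [map_add, restr_mul, hr0, zero_mul, add_zero, hu]
  · rw [map_add, pd_mul, hr1, one_mul, map_add, map_add, restr_mul, hr0, zero_mul, add_zero, hu1, hv,
      zero_add]
  · rw [map_add, pd_mul, hr1, one_mul]
    simp only [map_add, pd_mul, hr1, one_mul, restr_mul, hr0, zero_mul, hu2, hv1, add_zero]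

theorem exists_lift_Sec {N σ : ℕ} {τ : ℤ} {F G : BTen φ U}
    (hF : F ∈ Sec n (SmoothFn (bdry φ U)) N σ τ) (hG : G ∈ Sec n (SmoothFn (bdry φ U)) N σ τ) :
    ∃ u ∈ Sec n (SmoothFn (U : Set (HSpace n))) N σ τ, toBdry φ U u = F ∧
      toBdry φ U (mapT (pd U (nIdx n)) u) = G ∧
      toBdry φ U (mapT (pd U (nIdx n)) (mapT (pd U (nIdx n)) u)) = 0 := by
  -- Zero data must be lifted to zero, so that lifting coefficient by coefficient respects the
  -- degrees of a section.
  have h (f g : SmoothFn (bdry φ U)) : ∃ u : SmoothFn (U : Set (HSpace n)),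
      (f = 0 → g = 0 → u = 0) ∧ restr (bdry_subset φ U) u = f ∧
        restr (bdry_subset φ U) (pd U (nIdx n) u) = g ∧
        restr (bdry_subset φ U) (pd U (nIdx n) (pd U (nIdx n) u)) = 0 := by
    by_cases h0 : f = 0 ∧ g = 0
    · exact ⟨0, fun _ _ => rfl, by simp [h0.1], by simp [h0.2], by simp⟩
    · obtain ⟨u, hu⟩ := exists_lift φ U f g
      exact ⟨u, fun h1 h2 => absurd ⟨h1, h2⟩ h0, hu⟩
  choose L hL0 hL1 hL2 hL3 using h
  refine ⟨fun p q S => L (F p q S) (G p q S), fun p q S hS => hL0 _ _ (hF _ _ _ hS) (hG _ _ _ hS),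
    ?_, ?_, ?_⟩ <;> funext p q S
  · exact hL1 _ _
  · exact hL2 _ _
  · exact hL3 _ _

end Lifts

open MeasureTheory

/-! ### Integration over the domain and over its boundary -/

section Integration

variable {n : ℕ} (φ : GraphFn n) (U : TopologicalSpace.Opens (HSpace n))

/-- The smooth functions on `U` that vanish outside `K`. -/
def suppF (K : Set (HSpace n)) : Submodule ℂ (SmoothFn (U : Set (HSpace n))) where
  carrier := {f | ∀ x : (U : Set (HSpace n)), x.1 ∉ K → f.1 x = 0}
  add_mem' hf hg x hx := by
    change _ + _ = (0 : ℂ)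
    rw [hf x hx, hg x hx, add_zero]
  zero_mem' _ _ := rfl
  smul_mem' c f hf x hx := by
    change c • _ = (0 : ℂ)
    rw [hf x hx, smul_zero]

variable {U} {K : Set (HSpace n)} {f g : SmoothFn (U : Set (HSpace n))}

theorem zext_eq_zero (hf : f ∈ suppF U K) {x : HSpace n} (hx : x ∉ K) : zext f.1 x = 0 := by
  by_cases h : x ∈ (U : Set (HSpace n))
  · rw [zext_of_mem _ h]; exact hf ⟨x, h⟩ hx
  · rw [zext, dif_neg h]

theorem suppF_mul (hf : f ∈ suppF U K) (g : SmoothFn (U : Set (HSpace n))) :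
    g * f ∈ suppF U K := fun x hx => by
  change g.1 x * f.1 x = 0
  rw [hf x hx, mul_zero]

theorem zext_eventually_zero (hK : IsClosed K) (hf : f ∈ suppF U K) {x : HSpace n} (hx : x ∉ K) :
    zext f.1 =ᶠ[nhds x] fun _ => 0 := by
  filter_upwards [hK.isOpen_compl.mem_nhds hx] with y hy
  exact zext_eq_zero hf hy

theorem suppF_pd (hK : IsClosed K) (hf : f ∈ suppF U K) (i : Fin (4 * n + 4)) :
    pd U i f ∈ suppF U K := fun x hx => by
  rw [pd_apply, (zext_eventually_zero hK hf hx).fderiv_eq]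
  simp

theorem zext_contDiff (hK : IsCompact K) (hKU : K ⊆ U) (hf : f ∈ suppF U K) :
    ContDiff ℝ ∞ (zext f.1) := by
  refine contDiff_iff_contDiffAt.2 fun x => ?_
  by_cases hx : x ∈ K
  · exact (contDiffOn_zext U f).contDiffAt (U.isOpen.mem_nhds (hKU hx))
  · exact contDiffAt_const.congr_of_eventuallyEq (zext_eventually_zero hK.isClosed hf hx)

theorem zext_hasCompactSupport (hK : IsCompact K) (hf : f ∈ suppF U K) :
    HasCompactSupport (zext f.1) := HasCompactSupport.intro hK fun _ hx => zext_eq_zero hf hx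

theorem zext_integrable (hK : IsCompact K) (hKU : K ⊆ U) (hf : f ∈ suppF U K) :
    Integrable (zext f.1) :=
  (zext_contDiff hK hKU hf).continuous.integrable_of_hasCompactSupport
    (zext_hasCompactSupport hK hf)

theorem zext_add (f g : SmoothFn (U : Set (HSpace n))) :
    zext (f + g).1 = fun x => zext f.1 x + zext g.1 x := by
  funext x
  by_cases h : x ∈ (U : Set (HSpace n)) <;> simp [zext, h]

theorem zext_mul (f g : SmoothFn (U : Set (HSpace n))) :
    zext (f * g).1 = fun x => zext f.1 x * zext g.1 x := by
  funext x
  by_cases h : x ∈ (U : Set (HSpace n)) <;> simp [zext, h]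

theorem zext_zero : zext (0 : SmoothFn (U : Set (HSpace n))).1 = fun _ => 0 := by
  funext x
  by_cases h : x ∈ (U : Set (HSpace n)) <;> simp [zext, h]

theorem zext_pd_eq (hK : IsCompact K) (hKU : K ⊆ U) (hf : f ∈ suppF U K) (i : Fin (4 * n + 4)) :
    zext (pd U i f).1 = fun x => fderiv ℝ (zext f.1) x (Pi.single i 1) := by
  funext x
  by_cases hx : x ∈ K
  · exact zext_pd U i f (hKU hx)
  · rw [zext_eq_zero (suppF_pd hK.isClosed hf i) hx,
      (zext_eventually_zero hK.isClosed hf hx).fderiv_eq]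
    simp

/-- The integral over the whole space. -/
def intAll (f : SmoothFn (U : Set (HSpace n))) : ℂ := ∫ x, zext f.1 x

/-- The integral over the domain `D`. -/
def intD (f : SmoothFn (U : Set (HSpace n))) : ℂ := ∫ x in dom φ, zext f.1 x

/-- The point of the graph over `y`. -/
def graphPt (y : Fin (4 * n + 3) → ℝ) : HSpace n := (nIdx n).insertNth (φ.toFun y) y

/-- The integral over the boundary of `D`, in the coordinates `(q', Im q_{n+1})`. -/
def intB (f : SmoothFn (U : Set (HSpace n))) : ℂ := ∫ y, zext f.1 (graphPt φ y)

theorem proj_insertNth (t : ℝ) (y : Fin (4 * n + 3) → ℝ) :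
    proj ((nIdx n).insertNth t y : HSpace n) = y := by
  funext i
  exact Fin.insertNth_apply_succAbove (α := fun _ => ℝ) (nIdx n) t y i

theorem rho_insertNth (t : ℝ) (y : Fin (4 * n + 3) → ℝ) :
    rho φ ((nIdx n).insertNth t y : HSpace n) = t - φ.toFun y := by
  rw [rho, proj_insertNth]
  congr 1
  exact Fin.insertNth_apply_same (α := fun _ => ℝ) (nIdx n) t y

theorem insertNth_eq_add (t : ℝ) (y : Fin (4 * n + 3) → ℝ) :
    ((nIdx n).insertNth t y : HSpace n) = (nIdx n).insertNth 0 y + t • tvec n := by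
  refine (Fin.insertNth_eq_iff (α := fun _ => ℝ)).2 ⟨?_, ?_⟩
  · simp [tvec]
  · funext i
    simp [tvec, Fin.removeNth, Fin.succAbove_ne]

theorem graphPt_continuous : Continuous (graphPt φ) := by
  have : graphPt φ = fun y => ((nIdx n).insertNth 0 y : HSpace n) + φ.toFun y • tvec n :=
    funext fun y => insertNth_eq_add _ _
  rw [this]
  have h0 : Continuous fun y : Fin (4 * n + 3) → ℝ => ((nIdx n).insertNth 0 y : HSpace n) :=
    continuous_const.finInsertNth (nIdx n) continuous_id
  exact h0.add (φ.smooth.continuous.smul continuous_const)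

theorem rho_graphPt (y : Fin (4 * n + 3) → ℝ) : rho φ (graphPt φ y) = 0 := by
  rw [graphPt, rho_insertNth, sub_self]

theorem graphPt_proj {x : HSpace n} (hx : rho φ x = 0) : graphPt φ (proj x) = x := by
  have h : φ.toFun (proj x) = x (nIdx n) := by unfold rho at hx; linarith
  rw [graphPt, h]
  exact Fin.insertNth_self_removeNth (α := fun _ => ℝ) (nIdx n) x

theorem zext_graphPt_integrable (hK : IsCompact K) (hKU : K ⊆ U) (hf : f ∈ suppF U K) :
    Integrable fun y => zext f.1 (graphPt φ y) := by
  refine ((zext_contDiff hK hKU hf).continuous.comp (graphPt_continuous φ)).integrable_of_hasCompactSupport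
    (HasCompactSupport.intro (hK.image proj_contDiff.continuous) fun y hy => ?_)
  refine zext_eq_zero hf fun h => hy ⟨graphPt φ y, h, proj_insertNth _ _⟩

theorem intB_add (hK : IsCompact K) (hKU : K ⊆ U) (hf : f ∈ suppF U K) (hg : g ∈ suppF U K) :
    intB φ (f + g) = intB φ f + intB φ g := by
  simp only [intB, zext_add]
  exact integral_add (zext_graphPt_integrable φ hK hKU hf) (zext_graphPt_integrable φ hK hKU hg)

theorem intD_add (hK : IsCompact K) (hKU : K ⊆ U) (hf : f ∈ suppF U K) (hg : g ∈ suppF U K) :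
    intD φ (f + g) = intD φ f + intD φ g := by
  simp only [intD, zext_add]
  exact integral_add (zext_integrable hK hKU hf).integrableOn
    (zext_integrable hK hKU hg).integrableOn

theorem intAll_add (hK : IsCompact K) (hKU : K ⊆ U) (hf : f ∈ suppF U K) (hg : g ∈ suppF U K) :
    intAll (f + g) = intAll f + intAll g := by
  simp only [intAll, zext_add]
  exact integral_add (zext_integrable hK hKU hf) (zext_integrable hK hKU hg)

theorem intB_zero : intB φ (0 : SmoothFn (U : Set (HSpace n))) = 0 := by
  rw [intB, zext_zero]; simp

theorem intD_zero : intD φ (0 : SmoothFn (U : Set (HSpace n))) = 0 := by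
  rw [intD, zext_zero]; simp

theorem intAll_zero : intAll (0 : SmoothFn (U : Set (HSpace n))) = 0 := by
  rw [intAll, zext_zero]; simp

theorem intB_sum (hK : IsCompact K) (hKU : K ⊆ U) {ι : Type*} (s : Finset ι)
    {f : ι → SmoothFn (U : Set (HSpace n))} (hf : ∀ i, f i ∈ suppF U K) :
    intB φ (∑ i ∈ s, f i) = ∑ i ∈ s, intB φ (f i) := by
  classical
  induction s using Finset.induction_on with
  | empty => simp [intB_zero]
  | insert a s ha ih =>
    rw [Finset.sum_insert ha, Finset.sum_insert ha,
      intB_add φ hK hKU (hf a) (Submodule.sum_mem _ fun i _ => hf i), ih]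

theorem intD_sum (hK : IsCompact K) (hKU : K ⊆ U) {ι : Type*} (s : Finset ι)
    {f : ι → SmoothFn (U : Set (HSpace n))} (hf : ∀ i, f i ∈ suppF U K) :
    intD φ (∑ i ∈ s, f i) = ∑ i ∈ s, intD φ (f i) := by
  classical
  induction s using Finset.induction_on with
  | empty => simp [intD_zero]
  | insert a s ha ih =>
    rw [Finset.sum_insert ha, Finset.sum_insert ha,
      intD_add φ hK hKU (hf a) (Submodule.sum_mem _ fun i _ => hf i), ih]

theorem intAll_sum (hK : IsCompact K) (hKU : K ⊆ U) {ι : Type*} (s : Finset ι)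
    {f : ι → SmoothFn (U : Set (HSpace n))} (hf : ∀ i, f i ∈ suppF U K) :
    intAll (∑ i ∈ s, f i) = ∑ i ∈ s, intAll (f i) := by
  classical
  induction s using Finset.induction_on with
  | empty => simp [intAll_zero]
  | insert a s ha ih =>
    rw [Finset.sum_insert ha, Finset.sum_insert ha,
      intAll_add hK hKU (hf a) (Submodule.sum_mem _ fun i _ => hf i), ih]

/-- Integration by parts against the constant function `1`. -/
theorem intAll_pd (hK : IsCompact K) (hKU : K ⊆ U) (hf : f ∈ suppF U K) (i : Fin (4 * n + 4)) :
    intAll (pd U i f) = 0 := by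
  have hi := zext_integrable hK hKU (suppF_pd hK.isClosed hf i)
  rw [zext_pd_eq hK hKU hf] at hi
  have := integral_mul_fderiv_eq_neg_fderiv_mul_of_integrable (μ := (volume : Measure (HSpace n)))
    (f := fun _ : HSpace n => (1 : ℂ)) (g := zext f.1) (v := Pi.single i 1) (by simp)
    (by simpa using hi) (by simpa using zext_integrable hK hKU hf) (by simp)
    (fun x _ => (zext_contDiff hK hKU hf).differentiable (by simp) x)
  simpa [intAll, zext_pd_eq hK hKU hf] using this

theorem measurableSet_dom : MeasurableSet (dom φ) :=
  (isOpen_lt continuous_const (rho_contDiff φ).continuous).measurableSet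

/-- Integration of `∂/∂x_{4n+1}` along the lines in that direction. -/
theorem intD_pd_nIdx (hK : IsCompact K) (hKU : K ⊆ U) (hf : f ∈ suppF U K) :
    intD φ (pd U (nIdx n) f) = -intB φ f := by
  have hG := zext_contDiff hK hKU hf
  set G := zext f.1 with hGdef
  set g : HSpace n → ℂ := fun x => fderiv ℝ G x (tvec n) with hg
  have hgi : Integrable g := by
    have := zext_integrable hK hKU (suppF_pd hK.isClosed hf (nIdx n))
    rwa [zext_pd_eq hK hKU hf] at this
  have hmp := (volume_preserving_piFinSuccAbove (fun _ : Fin (4 * n + 3 + 1) => ℝ) (nIdx n)).symm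
  -- On the line over `y` the domain is the ray `t > φ(y)`. Compact support leaves only the
  -- endpoint, which is the point of the graph.
  have hline (y : Fin (4 * n + 3) → ℝ) : ∫ t in Set.Ioi (φ.toFun y),
      g ((nIdx n).insertNth t y : HSpace n) = -G (graphPt φ y) := by
    have he : (fun t => G ((nIdx n).insertNth t y : HSpace n)) =
        fun t : ℝ => G (((nIdx n).insertNth 0 y : HSpace n) + t • tvec n) :=
      funext fun t => by rw [insertNth_eq_add t y]
    have hd (t : ℝ) : HasDerivAt (fun t => G ((nIdx n).insertNth t y : HSpace n))
        (g ((nIdx n).insertNth t y : HSpace n)) t := by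
      have h1 : HasDerivAt (fun t : ℝ => ((nIdx n).insertNth 0 y : HSpace n) + t • tvec n)
          (tvec n) t := by
        simpa using ((hasDerivAt_id t).smul_const (tvec n)).const_add
          ((nIdx n).insertNth 0 y : HSpace n)
      have h2 := (hG.differentiable (by simp)
        (((nIdx n).insertNth 0 y : HSpace n) + t • tvec n)).hasFDerivAt.comp_hasDerivAt t h1
      rw [he, insertNth_eq_add t y]
      exact h2
    have hc : ContDiff ℝ 1 (fun t => G ((nIdx n).insertNth t y : HSpace n)) := by
      rw [he]
      exact (hG.of_le (by simp)).comp (contDiff_const.add (contDiff_id.smul contDiff_const))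
    have hs : HasCompactSupport (fun t => G ((nIdx n).insertNth t y : HSpace n)) :=
      HasCompactSupport.intro (hK.image (continuous_apply (nIdx n))) fun t ht =>
        zext_eq_zero hf fun h => ht ⟨_, h, Fin.insertNth_apply_same (α := fun _ => ℝ) _ _ _⟩
    have := hs.integral_Ioi_deriv_eq hc (φ.toFun y)
    rw [← funext fun t => (hd t).deriv] at *
    exact this
  have h1 : intD φ (pd U (nIdx n) f) = ∫ x, (dom φ).indicator g x := by
    rw [intD, zext_pd_eq hK hKU hf, integral_indicator (measurableSet_dom φ)]
    rfl
  have hii : Integrable ((dom φ).indicator g) := hgi.indicator (measurableSet_dom φ)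
  rw [h1, ← hmp.integral_comp' (g := (dom φ).indicator g), Measure.volume_eq_prod,
    integral_prod_symm]
  · rw [intB, ← integral_neg]
    refine integral_congr_ae (Filter.Eventually.of_forall fun y => ?_)
    refine Eq.trans ?_ (hline y)
    rw [← integral_indicator measurableSet_Ioi]
    refine integral_congr_ae (Filter.Eventually.of_forall fun t => ?_)
    change (dom φ).indicator g ((nIdx n).insertNth t y : HSpace n) = _
    have : ((nIdx n).insertNth t y : HSpace n) ∈ dom φ ↔ t ∈ Set.Ioi (φ.toFun y) := by
      change 0 < rho φ _ ↔ _
      rw [rho_insertNth, sub_pos]; rfl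
    by_cases ht : t ∈ Set.Ioi (φ.toFun y)
    · rw [Set.indicator_of_mem ht, Set.indicator_of_mem (this.2 ht)]
    · rw [Set.indicator_of_notMem ht, Set.indicator_of_notMem (mt this.1 ht)]
  · exact (hmp.integrable_comp_emb (MeasurableEquiv.measurableEmbedding _)).2 hii

/-- The fields `∂_i - ∂_i ϱ · ∂_{4n+1}` annihilate functions of `ϱ`. -/
theorem intD_pd_sub (hK : IsCompact K) (hKU : K ⊆ U) (hf : f ∈ suppF U K) (i : Fin (4 * n + 4)) :
    intD φ (pd U i f - drho φ U i * pd U (nIdx n) f) = 0 := by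
  set w := pd U i f - drho φ U i * pd U (nIdx n) f with hw
  have hwK : w ∈ suppF U K := Submodule.sub_mem _ (suppF_pd hK.isClosed hf i)
    (suppF_mul (suppF_pd hK.isClosed hf _) _)
  -- Smooth functions of `ϱ` that increase to the indicator of `D`: they are `0` off `D` and equal
  -- `1` where `m ϱ ≥ 1`.
  set h : ℕ → HSpace n → ℝ := fun m x => Real.smoothTransition (m * rho φ x) with hh
  have hhc : ∀ m, ContDiff ℝ ∞ (h m) := fun m =>
    Real.smoothTransition.contDiff.comp (contDiff_const.mul (rho_contDiff φ))
  have hpd (m : ℕ) (i : Fin (4 * n + 4)) : pd U i (ofGlobal U (h m) (hhc m)) =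
      drho φ U i * pd U (nIdx n) (ofGlobal U (h m) (hhc m)) := by
    have hd (x v : HSpace n) : fderiv ℝ (h m) x v =
        deriv Real.smoothTransition (m * rho φ x) * m * fderiv ℝ (rho φ) x v := by
      have h1 : HasDerivAt Real.smoothTransition (deriv Real.smoothTransition (m * rho φ x))
          (m * rho φ x) :=
        ((Real.smoothTransition.contDiff (n := 1)).differentiable (by simp) _).hasDerivAt
      have h2 := h1.comp_hasFDerivAt x ((differentiable_rho φ x).hasFDerivAt.const_mul (m : ℝ))
      have h3 : fderiv ℝ (h m) x = _ := h2.fderiv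
      rw [h3]
      simp
      ring
    rw [pd_ofGlobal, pd_ofGlobal]
    ext x
    change ((fderiv ℝ (h m) x.1 (Pi.single i 1) : ℝ) : ℂ) =
      ((fderiv ℝ (rho φ) x.1 (Pi.single i 1) : ℝ) : ℂ) *
        ((fderiv ℝ (h m) x.1 (Pi.single (nIdx n) 1) : ℝ) : ℂ)
    have ht : fderiv ℝ (rho φ) x.1 (Pi.single (nIdx n) 1) = 1 := by
      have := congrFun (congrArg Subtype.val (drho_nIdx φ (U : Set (HSpace n)))) x
      change ((fderiv ℝ (rho φ) x.1 (Pi.single (nIdx n) 1) : ℝ) : ℂ) = 1 at this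
      exact_mod_cast this
    rw [hd, hd, ht]
    push_cast
    ring
  -- The tangential field kills `h m` and is divergence free because `∂_{4n+1} ∂_i ϱ = 0`. So the
  -- product is a sum of derivatives of compactly supported functions.
  have hzero (m : ℕ) : intAll (ofGlobal U (h m) (hhc m) * w) = 0 := by
    have e : ofGlobal U (h m) (hhc m) * w = pd U i (ofGlobal U (h m) (hhc m) * f) +
        pd U (nIdx n) (-(drho φ U i * (ofGlobal U (h m) (hhc m) * f))) := by
      rw [map_neg, pd_mul, pd_mul, pd_mul, pd_nIdx_drho, hpd m i, hw]
      ring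
    rw [e, intAll_add hK hKU (suppF_pd hK.isClosed (suppF_mul hf _) _)
      (suppF_pd hK.isClosed (Submodule.neg_mem _ (suppF_mul (suppF_mul hf _) _)) _),
      intAll_pd hK hKU (suppF_mul hf _),
      intAll_pd hK hKU (Submodule.neg_mem _ (suppF_mul (suppF_mul hf _) _)), add_zero]
  have hlim : Filter.Tendsto (fun m => intAll (ofGlobal U (h m) (hhc m) * w)) Filter.atTop
      (nhds (intD φ w)) := by
    rw [intD, ← integral_indicator (measurableSet_dom φ)]
    refine tendsto_integral_of_dominated_convergence (fun x => ‖zext w.1 x‖) (fun m => ?_)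
      (zext_integrable hK hKU hwK).norm (fun m => Filter.Eventually.of_forall fun x => ?_)
      (Filter.Eventually.of_forall fun x => ?_)
    · exact (zext_integrable hK hKU (suppF_mul hwK _)).aestronglyMeasurable
    · by_cases hx : x ∈ (U : Set (HSpace n))
      · rw [zext_mul, norm_mul]
        refine mul_le_of_le_one_left (norm_nonneg _) ?_
        rw [zext_of_mem _ hx]
        change ‖((h m x : ℝ) : ℂ)‖ ≤ 1
        rw [Complex.norm_real, Real.norm_of_nonneg (Real.smoothTransition.nonneg _)]
        exact Real.smoothTransition.le_one _
      · simp [zext, hx]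
    · by_cases hx : x ∈ (U : Set (HSpace n))
      · have e (m : ℕ) : zext (ofGlobal U (h m) (hhc m) * w).1 x = ((h m x : ℝ) : ℂ) * zext w.1 x := by
          rw [zext_mul]
          change zext (ofGlobal (U : Set (HSpace n)) (h m) (hhc m)).1 x * _ = _
          rw [zext_of_mem _ hx]; rfl
        simp only [e]
        by_cases hD : x ∈ dom φ
        · rw [Set.indicator_of_mem hD]
          refine tendsto_const_nhds.congr' ?_
          obtain ⟨N, hN⟩ := exists_nat_ge (1 / rho φ x)
          filter_upwards [Filter.eventually_ge_atTop N] with m hm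
          have hpos : 0 < rho φ x := hD
          have : (1 : ℝ) ≤ m * rho φ x := by
            rw [← div_le_iff₀ hpos]
            exact hN.trans (by exact_mod_cast hm)
          simp only [hh]
          rw [Real.smoothTransition.one_of_one_le this, Complex.ofReal_one, one_mul]
        · rw [Set.indicator_of_notMem hD]
          have : ∀ m, h m x = 0 := fun m => Real.smoothTransition.zero_of_nonpos
            (mul_nonpos_of_nonneg_of_nonpos (Nat.cast_nonneg m) (not_lt.1 hD))
          simp [this]
      · have e (v : SmoothFn (U : Set (HSpace n))) : zext v.1 x = 0 := by rw [zext, dif_neg hx]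
        rw [Set.indicator_apply_eq_zero.2 fun _ => e w]
        simp only [e]
        exact tendsto_const_nhds
  simp only [hzero] at hlim
  exact (tendsto_nhds_unique hlim tendsto_const_nhds)

/-- The divergence theorem. -/
theorem intD_pd (hK : IsCompact K) (hKU : K ⊆ U) (hf : f ∈ suppF U K) (i : Fin (4 * n + 4)) :
    intD φ (pd U i f) = -intB φ (drho φ U i * f) := by
  have h1 := intD_pd_sub φ hK hKU hf i
  have h2 := intD_pd_nIdx φ hK hKU (suppF_mul hf (drho φ U i))
  have h3 := intD_add φ hK hKU (Submodule.sub_mem _ (suppF_pd hK.isClosed hf i)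
    (suppF_mul (suppF_pd hK.isClosed hf (nIdx n)) (drho φ U i)))
    (suppF_mul (suppF_pd hK.isClosed hf (nIdx n)) (drho φ U i))
  rw [pd_mul, pd_nIdx_drho, zero_mul, zero_add] at h2
  rw [sub_add_cancel, h1, zero_add, h2] at h3
  exact h3

/-- Tangential fields integrate to zero over the boundary. -/
theorem intB_pd (hK : IsCompact K) (hKU : K ⊆ U) (hf : f ∈ suppF U K) (i : Fin (4 * n + 4)) :
    intB φ (pd U i f) = intB φ (drho φ U i * pd U (nIdx n) f) := by
  have hp := suppF_pd hK.isClosed hf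
  -- Both boundary integrals equal `-∫_D ∂_i ∂_{4n+1} f`, computed in the two orders of
  -- differentiation.
  rw [← neg_inj, ← intD_pd_nIdx φ hK hKU (hp i), ← intD_pd φ hK hKU (hp (nIdx n)), pd_comm]

theorem intB_eq_zero (h : restr (bdry_subset φ U) f = 0) : intB φ f = 0 := by
  rw [intB]
  refine integral_eq_zero_of_ae (Filter.Eventually.of_forall fun y => ?_)
  by_cases hy : graphPt φ y ∈ (U : Set (HSpace n))
  · change zext f.1 _ = 0
    rw [zext_of_mem _ hy]
    exact congrFun (congrArg Subtype.val h) ⟨_, hy, rho_graphPt φ y⟩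
  · change zext f.1 _ = 0
    rw [zext, dif_neg hy]

/-- A continuous nonnegative function with zero integral vanishes identically. The graph
parametrisation reaches every point of the boundary. -/
theorem restr_eq_zero_of_intB (hK : IsCompact K) (hKU : K ⊆ U) (hf : f ∈ suppF U K)
    {r : ↥(U : Set (HSpace n)) → ℝ} (hr : ∀ x, f.1 x = r x) (h0 : ∀ x, 0 ≤ r x) (h : intB φ f = 0) :
    restr (bdry_subset φ U) f = 0 := by
  have hc : Continuous fun y => zext f.1 (graphPt φ y) :=
    (zext_contDiff hK hKU hf).continuous.comp (graphPt_continuous φ)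
  have hi := zext_graphPt_integrable φ hK hKU hf
  have hre : ∀ x, zext f.1 x = ((zext f.1 x).re : ℂ) ∧ 0 ≤ (zext f.1 x).re := fun x => by
    by_cases hx : x ∈ (U : Set (HSpace n))
    · rw [zext_of_mem _ hx, hr]; simp [h0]
    · simp [zext, hx]
  have h1 : ∫ y, (zext f.1 (graphPt φ y)).re = 0 := by
    have := congrArg Complex.re h
    rw [intB] at this
    rw [← Complex.zero_re, ← this]
    exact integral_re hi
  rw [integral_eq_zero_iff_of_nonneg (fun y => (hre _).2) hi.re] at h1
  have h2 := (Continuous.ae_eq_iff_eq _ (Complex.continuous_re.comp hc) continuous_const).1 h1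
  ext x
  have h3 := congrFun h2 (proj x.1)
  change (zext f.1 (graphPt φ (proj x.1))).re = 0 at h3
  rw [graphPt_proj φ x.2.2] at h3
  have h4 := (hre x.1).1
  rw [h3, zext_of_mem _ x.2.1] at h4
  exact h4.trans Complex.ofReal_zero

theorem eq_zero_of_intAll (hK : IsCompact K) (hKU : K ⊆ U) (hf : f ∈ suppF U K)
    {r : ↥(U : Set (HSpace n)) → ℝ} (hr : ∀ x, f.1 x = r x) (h0 : ∀ x, 0 ≤ r x)
    (h : intAll f = 0) : f = 0 := by
  have hc := (zext_contDiff hK hKU hf).continuous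
  have hi := zext_integrable hK hKU hf
  have hre : ∀ x, zext f.1 x = ((zext f.1 x).re : ℂ) ∧ 0 ≤ (zext f.1 x).re := fun x => by
    by_cases hx : x ∈ (U : Set (HSpace n))
    · rw [zext_of_mem _ hx, hr]; simp [h0]
    · simp [zext, hx]
  have h1 : ∫ x, (zext f.1 x).re = 0 := by
    have := congrArg Complex.re h
    rw [intAll] at this
    rw [← Complex.zero_re, ← this]
    exact integral_re hi
  rw [integral_eq_zero_iff_of_nonneg (fun y => (hre _).2) hi.re] at h1
  have h2 := (Continuous.ae_eq_iff_eq _ (Complex.continuous_re.comp hc) continuous_const).1 h1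
  ext x
  have h3 : (zext f.1 x.1).re = 0 := congrFun h2 x.1
  have h4 := (hre x.1).1
  rw [h3, zext_of_mem _ x.2] at h4
  simpa using h4

end Integration

/-! ### Pointwise pairings and formal adjoints -/

theorem csmul_smul {n : ℕ} {R : Type} [CommRing R] [Algebra ℂ R] (c : ℂ) (r : R) (F : Ten n R) :
    (c • r) • F = r • c • F := by
  rw [smul_assoc, smul_comm]

section Adjoints

variable {n : ℕ} {U : TopologicalSpace.Opens (HSpace n)}

/-- Complex conjugation of smooth functions. -/
def conjFn (f : SmoothFn (U : Set (HSpace n))) : SmoothFn (U : Set (HSpace n)) :=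
  ⟨fun x => (starRingEnd ℂ) (f.1 x), by
    obtain ⟨f, O, hO, hs, g, hg, e⟩ := f
    exact ⟨O, hO, hs, fun x => (starRingEnd ℂ) (g x),
      Complex.conjCLE.contDiff.comp_contDiffOn hg, fun x => congrArg _ (e x)⟩⟩

theorem conjFn_add (f g : SmoothFn (U : Set (HSpace n))) :
    conjFn (f + g) = conjFn f + conjFn g := by
  ext x; exact map_add _ _ _

theorem conjFn_zero : conjFn (0 : SmoothFn (U : Set (HSpace n))) = 0 := by
  ext x; exact map_zero _

theorem conjFn_mul (f g : SmoothFn (U : Set (HSpace n))) :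
    conjFn (f * g) = conjFn f * conjFn g := by
  ext x; exact map_mul _ _ _

theorem conjFn_smul (c : ℂ) (f : SmoothFn (U : Set (HSpace n))) :
    conjFn (c • f) = (starRingEnd ℂ) c • conjFn f := by
  ext x; exact map_mul (starRingEnd ℂ) c (f.1 x)

theorem conjFn_natCast_add_one_mul (m : ℕ) (f : SmoothFn (U : Set (HSpace n))) :
    conjFn (((m : SmoothFn (U : Set (HSpace n))) + 1) * f) =
      ((m : SmoothFn (U : Set (HSpace n))) + 1) * conjFn f := by
  ext x
  change (starRingEnd ℂ) (((m : ℂ) + 1) * f.1 x) = ((m : ℂ) + 1) * (starRingEnd ℂ) (f.1 x)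
  simp

theorem conjFn_neg_one_pow (m : ℕ) :
    conjFn ((-1) ^ m : SmoothFn (U : Set (HSpace n))) = (-1) ^ m := by
  ext x
  change (starRingEnd ℂ) ((-1) ^ m) = (-1) ^ m
  simp

theorem pd_conjFn (i : Fin (4 * n + 4)) (f : SmoothFn (U : Set (HSpace n))) :
    pd U i (conjFn f) = conjFn (pd U i f) := by
  ext x
  have h : zext (conjFn f).1 =ᶠ[nhds x.1] fun y => Complex.conjCLE (zext f.1 y) := by
    filter_upwards [U.isOpen.mem_nhds x.2] with y hy
    rw [zext_of_mem _ hy, zext_of_mem _ hy]; rfl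
  change fderiv ℝ (zext (conjFn f).1) x.1 _ = (starRingEnd ℂ) (fderiv ℝ (zext f.1) x.1 _)
  rw [h.fderiv_eq]
  have := (Complex.conjCLE.toContinuousLinearMap.hasFDerivAt.comp x.1
    (differentiableAt_zext U f x.2).hasFDerivAt).fderiv
  exact congrFun (congrArg DFunLike.coe this) _

/-- The pointwise Hermitian product of two sections of degree `σ`. -/
def pr (σ : ℕ) (u v : Ten n (SmoothFn (U : Set (HSpace n)))) : SmoothFn (U : Set (HSpace n)) :=
  ∑ pq ∈ Finset.HasAntidiagonal.antidiagonal σ, ∑ S, u pq.1 pq.2 S * conjFn (v pq.1 pq.2 S)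

theorem pairing_eq (k j : ℕ) (u v : cfSec U k j) :
    pairing U k j u v = zext (pr (sig k j) u.1 v.1).1 := by
  rw [pairing]
  congr 1
  funext x
  have h {ι : Type} (s : Finset ι) (f : ι → SmoothFn (U : Set (HSpace n))) :
      (∑ i ∈ s, f i).1 x = ∑ i ∈ s, (f i).1 x := by
    rw [AddSubmonoidClass.coe_finsetSum, Finset.sum_apply]
  rw [pr, h]
  refine Finset.sum_congr rfl fun pq _ => ?_
  rw [h]
  rfl

theorem pr_add_left (σ : ℕ) (u u' v : Ten n (SmoothFn (U : Set (HSpace n)))) :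
    pr σ (u + u') v = pr σ u v + pr σ u' v := by
  simp only [pr, Pi.add_apply, add_mul, Finset.sum_add_distrib]

theorem pr_add_right (σ : ℕ) (u v v' : Ten n (SmoothFn (U : Set (HSpace n)))) :
    pr σ u (v + v') = pr σ u v + pr σ u v' := by
  simp only [pr, Pi.add_apply, conjFn_add, mul_add, Finset.sum_add_distrib]

theorem pr_smul_left (σ : ℕ) (r : SmoothFn (U : Set (HSpace n)))
    (u v : Ten n (SmoothFn (U : Set (HSpace n)))) : pr σ (r • u) v = r * pr σ u v := by
  simp only [pr, Pi.smul_apply, smul_eq_mul, mul_assoc, Finset.mul_sum]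

theorem pr_smul_right (σ : ℕ) (r : SmoothFn (U : Set (HSpace n)))
    (u v : Ten n (SmoothFn (U : Set (HSpace n)))) : pr σ u (r • v) = conjFn r * pr σ u v := by
  simp only [pr, Pi.smul_apply, smul_eq_mul, conjFn_mul, mul_left_comm, Finset.mul_sum]

theorem pr_csmul_left (σ : ℕ) (c : ℂ) (u v : Ten n (SmoothFn (U : Set (HSpace n)))) :
    pr σ (c • u) v = c • pr σ u v := by
  simp only [pr, Pi.smul_apply, smul_mul_assoc, Finset.smul_sum]

theorem pr_csmul_right (σ : ℕ) (c : ℂ) (u v : Ten n (SmoothFn (U : Set (HSpace n)))) :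
    pr σ u (c • v) = (starRingEnd ℂ) c • pr σ u v := by
  simp only [pr, Pi.smul_apply, conjFn_smul, mul_smul_comm, Finset.smul_sum]

theorem pr_zero_left (σ : ℕ) (v : Ten n (SmoothFn (U : Set (HSpace n)))) : pr σ 0 v = 0 := by
  simp [pr]

theorem pr_zero_right (σ : ℕ) (u : Ten n (SmoothFn (U : Set (HSpace n)))) : pr σ u 0 = 0 := by
  simp [pr, conjFn_zero]

theorem pr_sum_left {ι : Type*} (σ : ℕ) (s : Finset ι)
    (u : ι → Ten n (SmoothFn (U : Set (HSpace n)))) (v : Ten n (SmoothFn (U : Set (HSpace n)))) :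
    pr σ (∑ i ∈ s, u i) v = ∑ i ∈ s, pr σ (u i) v := by
  classical
  induction s using Finset.induction_on with
  | empty => simp [pr_zero_left]
  | insert a s ha ih => rw [Finset.sum_insert ha, Finset.sum_insert ha, pr_add_left, ih]

theorem pr_sum_right {ι : Type*} (σ : ℕ) (s : Finset ι)
    (u : Ten n (SmoothFn (U : Set (HSpace n)))) (v : ι → Ten n (SmoothFn (U : Set (HSpace n)))) :
    pr σ u (∑ i ∈ s, v i) = ∑ i ∈ s, pr σ u (v i) := by
  classical
  induction s using Finset.induction_on with
  | empty => simp [pr_zero_right]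
  | insert a s ha ih => rw [Finset.sum_insert ha, Finset.sum_insert ha, pr_add_right, ih]

theorem pr_neg_right (σ : ℕ) (u v : Ten n (SmoothFn (U : Set (HSpace n)))) :
    pr σ u (-v) = -pr σ u v := by
  have h := pr_add_right σ u (-v) v
  rw [neg_add_cancel, pr_zero_right] at h
  exact eq_neg_of_add_eq_zero_left h.symm

theorem pr_sub_right (σ : ℕ) (u v v' : Ten n (SmoothFn (U : Set (HSpace n)))) :
    pr σ u (v - v') = pr σ u v - pr σ u v' := by
  rw [sub_eq_add_neg, pr_add_right, pr_neg_right, sub_eq_add_neg]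

/-- Since the `ω^S` are orthonormal, exterior multiplication and contraction are adjoint. The sums
are matched by `S ↔ S \ {a}`, and removing `a` does not change the number of elements below it. -/
theorem pr_ext1 (σ : ℕ) (a : Fin (2 * n + 2)) (u v : Ten n (SmoothFn (U : Set (HSpace n)))) :
    pr σ (ext1 a u) v = pr σ u (int1 a v) := by
  refine Finset.sum_congr rfl fun pq _ => ?_
  have h1 : ∀ S, ext1 a u pq.1 pq.2 S * conjFn (v pq.1 pq.2 S) =
      if a ∈ S then (-1) ^ (S.filter (· < a)).card * u pq.1 pq.2 (S.erase a) *
        conjFn (v pq.1 pq.2 S) else 0 := fun S => by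
    rw [ext1_apply]; split_ifs <;> simp
  have h2 : ∀ S, u pq.1 pq.2 S * conjFn (int1 a v pq.1 pq.2 S) =
      if a ∉ S then (-1) ^ (S.filter (· < a)).card * u pq.1 pq.2 S *
        conjFn (v pq.1 pq.2 (insert a S)) else 0 := fun S => by
    rw [int1_apply]
    by_cases h : a ∈ S
    · simp [h, conjFn_zero]
    · rw [if_neg h, if_pos h, conjFn_mul, conjFn_neg_one_pow]; ring
  simp only [h1, h2, ← Finset.sum_filter]
  refine Finset.sum_nbij' (fun S => S.erase a) (fun S => insert a S) ?_ ?_ ?_ ?_ ?_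
  · intro S hS; simp
  · intro S hS; simp
  · intro S hS
    simp only [Finset.mem_filter, Finset.mem_univ, true_and] at hS
    exact Finset.insert_erase hS
  · intro S hS
    simp only [Finset.mem_filter, Finset.mem_univ, true_and] at hS
    exact Finset.erase_insert hS
  · intro S hS
    simp only [Finset.mem_filter, Finset.mem_univ, true_and] at hS
    have := posSign_erase (R := SmoothFn (U : Set (HSpace n))) a hS
    rw [if_neg (lt_irrefl a)] at this
    change _ = posSign _ a (S.erase a) * _ * _
    rw [this, Finset.insert_erase hS]
    rfl

/-- The transpose of `∂_{A'}`. -/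
def partialSt (A' : Fin 2) (v : Ten n (SmoothFn (U : Set (HSpace n)))) :
    Ten n (SmoothFn (U : Set (HSpace n))) := fun p q S =>
  -- For `p = 0` the truncated `p - 1` is harmless because the factor `p` vanishes; likewise for
  -- `q`.
  if A' = 0 then (p : SmoothFn (U : Set (HSpace n))) * v (p - 1) q S
  else (q : SmoothFn (U : Set (HSpace n))) * v p (q - 1) S

/-- The transpose of the multiplication by `s^{A'}`. -/
def sDown (A' : Fin 2) (v : Ten n (SmoothFn (U : Set (HSpace n)))) :
    Ten n (SmoothFn (U : Set (HSpace n))) := fun p q S =>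
  if A' = 0 then v (p + 1) q S else v p (q + 1) S

theorem pr_partialS (σ : ℕ) (A' : Fin 2) (u v : Ten n (SmoothFn (U : Set (HSpace n)))) :
    pr σ (partialS A' u) v = pr (σ + 1) u (partialSt A' v) := by
  have h (m : ℕ) (f g : SmoothFn (U : Set (HSpace n))) :
      ((m : SmoothFn (U : Set (HSpace n))) + 1) * f * conjFn g =
        f * conjFn (((m + 1 : ℕ) : SmoothFn (U : Set (HSpace n))) * g) := by
    rw [Nat.cast_succ, conjFn_natCast_add_one_mul, mul_assoc, mul_left_comm]
  have h0 (f g : SmoothFn (U : Set (HSpace n))) :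
      f * conjFn (((0 : ℕ) : SmoothFn (U : Set (HSpace n))) * g) = 0 := by
    rw [Nat.cast_zero, zero_mul, conjFn_zero, mul_zero]
  fin_cases A'
  · rw [pr, pr, Finset.Nat.sum_antidiagonal_succ]
    -- The extra term `p = 0` of the sum in degree `σ + 1` carries the factor zero; the others match
    -- after the shift of `p`.
    refine Eq.symm ((congrArg₂ _ (Finset.sum_eq_zero fun S _ => h0 _ _) ?_).trans (zero_add _))
    exact Finset.sum_congr rfl fun pq _ => Finset.sum_congr rfl fun S _ => (h _ _ _).symm
  · rw [pr, pr, Finset.Nat.sum_antidiagonal_succ']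
    refine Eq.symm ((congrArg₂ _ (Finset.sum_eq_zero fun S _ => h0 _ _) ?_).trans (zero_add _))
    exact Finset.sum_congr rfl fun pq _ => Finset.sum_congr rfl fun S _ => (h _ _ _).symm

theorem pr_sUp (σ : ℕ) (A' : Fin 2) (u v : Ten n (SmoothFn (U : Set (HSpace n)))) :
    pr (σ + 1) (sUp A' u) v = pr σ u (sDown A' v) := by
  fin_cases A'
  · rw [pr, pr, Finset.Nat.sum_antidiagonal_succ]
    simp [sDown, sUp]
  · rw [pr, pr, Finset.Nat.sum_antidiagonal_succ']
    simp [sDown, sUp]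

theorem partialSt_mem {A' : Fin 2} {N σ : ℕ} {τ : ℤ} {F : Ten n (SmoothFn (U : Set (HSpace n)))}
    (hF : F ∈ Sec n (SmoothFn (U : Set (HSpace n))) N σ τ) :
    partialSt A' F ∈ Sec n (SmoothFn (U : Set (HSpace n))) N (σ + 1) τ := fun p q S h => by
  by_cases hA : A' = 0
  · rcases Nat.eq_zero_or_pos p with hp | hp
    · simp [partialSt, hA, hp]
    · have : F (p - 1) q S = 0 := hF _ _ _ fun ⟨h1, h2, h3⟩ => h ⟨by omega, h2, h3⟩
      simp [partialSt, hA, this]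
  · rcases Nat.eq_zero_or_pos q with hp | hp
    · simp [partialSt, hA, hp]
    · have : F p (q - 1) S = 0 := hF _ _ _ fun ⟨h1, h2, h3⟩ => h ⟨by omega, h2, h3⟩
      simp [partialSt, hA, this]

theorem sDown_mem {A' : Fin 2} {N σ : ℕ} {τ : ℤ} {F : Ten n (SmoothFn (U : Set (HSpace n)))}
    (hF : F ∈ Sec n (SmoothFn (U : Set (HSpace n))) N (σ + 1) τ) :
    sDown A' F ∈ Sec n (SmoothFn (U : Set (HSpace n))) N σ τ := fun p q S h => by
  have h1 : F (p + 1) q S = 0 := hF _ _ _ fun ⟨h1, h2, h3⟩ => h ⟨by omega, h2, h3⟩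
  have h2 : F p (q + 1) S = 0 := hF _ _ _ fun ⟨h1, h2, h3⟩ => h ⟨by omega, h2, h3⟩
  simp [sDown, h1, h2]

/-- The sections that vanish outside `K`. -/
def suppT (U : TopologicalSpace.Opens (HSpace n)) (K : Set (HSpace n)) :
    Submodule ℂ (Ten n (SmoothFn (U : Set (HSpace n)))) where
  carrier := {F | ∀ p q S, F p q S ∈ suppF U K}
  add_mem' hF hG p q S := Submodule.add_mem _ (hF p q S) (hG p q S)
  zero_mem' _ _ _ := Submodule.zero_mem _
  smul_mem' c _ hF p q S := Submodule.smul_mem _ c (hF p q S)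

variable {K : Set (HSpace n)} {F : Ten n (SmoothFn (U : Set (HSpace n)))}

theorem suppT_pd (hK : IsClosed K) (hF : F ∈ suppT U K) (i : Fin (4 * n + 4)) :
    mapT (pd U i) F ∈ suppT U K := fun p q S => suppF_pd hK (hF p q S) i

theorem suppT_int1 (hF : F ∈ suppT U K) (a : Fin (2 * n + 2)) : int1 a F ∈ suppT U K :=
  fun p q S => by
    rw [int1_apply]
    split_ifs
    · exact Submodule.zero_mem _
    · exact suppF_mul (hF _ _ _) _

theorem suppT_partialSt (hF : F ∈ suppT U K) (A' : Fin 2) : partialSt A' F ∈ suppT U K :=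
  fun p q S => by
    unfold partialSt
    split_ifs <;> exact suppF_mul (hF _ _ _) _

theorem suppT_sDown (hF : F ∈ suppT U K) (A' : Fin 2) : sDown A' F ∈ suppT U K :=
  fun p q S => by
    unfold sDown
    split_ifs <;> exact hF _ _ _

theorem conjFn_suppF {f : SmoothFn (U : Set (HSpace n))} (hf : f ∈ suppF U K) :
    conjFn f ∈ suppF U K := fun x hx => by
  change (starRingEnd ℂ) (f.1 x) = 0
  rw [hf x hx, map_zero]

theorem pr_mem_suppF (σ : ℕ) (u : Ten n (SmoothFn (U : Set (HSpace n)))) (hF : F ∈ suppT U K) :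
    pr σ u F ∈ suppF U K :=
  Submodule.sum_mem _ fun _ _ => Submodule.sum_mem _ fun _ _ =>
    suppF_mul (conjFn_suppF (hF _ _ _)) _

theorem compactSupp_iff {k j : ℕ} (u : cfSec U k j) :
    CompactSupp U u ↔ ∃ K : Set (HSpace n), IsCompact K ∧ K ⊆ U ∧ u.1 ∈ suppT U K :=
  Iff.rfl

theorem pd_pr (σ : ℕ) (i : Fin (4 * n + 4)) (u v : Ten n (SmoothFn (U : Set (HSpace n)))) :
    pd U i (pr σ u v) = pr σ (mapT (pd U i) u) v + pr σ u (mapT (pd U i) v) := by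
  simp only [pr, map_sum, pd_mul, pd_conjFn, Finset.sum_add_distrib, mapT_apply]

/-- The coefficient of `∂/∂x_{i+1}` in `d^{A'}`. -/
def dSym (A' : Fin 2) (i : Fin (4 * n + 4)) (u : Ten n (SmoothFn (U : Set (HSpace n)))) :
    Ten n (SmoothFn (U : Set (HSpace n))) := ∑ a, nabUp a A' i • ext1 a u

/-- The adjoint of `dSym`. -/
def dSymT (A' : Fin 2) (i : Fin (4 * n + 4)) (v : Ten n (SmoothFn (U : Set (HSpace n)))) :
    Ten n (SmoothFn (U : Set (HSpace n))) := ∑ a, (starRingEnd ℂ) (nabUp a A' i) • int1 a v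

/-- The formal adjoint of `d^{A'}`. -/
def dStar (A' : Fin 2) (v : Ten n (SmoothFn (U : Set (HSpace n)))) :
    Ten n (SmoothFn (U : Set (HSpace n))) := -∑ i, dSymT A' i (mapT (pd U i) v)

theorem pr_dSym (σ : ℕ) (A' : Fin 2) (i : Fin (4 * n + 4))
    (u v : Ten n (SmoothFn (U : Set (HSpace n)))) :
    pr σ (dSym A' i u) v = pr σ u (dSymT A' i v) := by
  simp only [dSym, dSymT, pr_sum_left, pr_sum_right, pr_csmul_left, pr_csmul_right, pr_ext1,
    Complex.conj_conj]

theorem mapT_dSymT (A' : Fin 2) (i l : Fin (4 * n + 4))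
    (v : Ten n (SmoothFn (U : Set (HSpace n)))) :
    mapT (pd U l) (dSymT A' i v) = dSymT A' i (mapT (pd U l) v) := by
  simp only [dSymT, map_sum, map_smul, mapT_int1]

theorem dUp_eq_dSym (A' : Fin 2) (u : Ten n (SmoothFn (U : Set (HSpace n)))) :
    dUp U A' u = ∑ i, dSym A' i (mapT (pd U i) u) := by
  rw [dUp_eq, dOf_apply]
  simp only [dSym]
  rw [Finset.sum_comm]
  refine Finset.sum_congr rfl fun a _ => ?_
  rw [← map_sum (ext1 a) _ _ |>.trans (Finset.sum_congr rfl fun i _ => map_smul (ext1 a) _ _)]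
  congr 1
  funext p q S
  rw [mapT_apply, nabD_apply, Finset.sum_apply, Finset.sum_apply, Finset.sum_apply]
  rfl

theorem wedge1_Omega_eq_dSym (φ : GraphFn n) (A' : Fin 2)
    (u : Ten n (SmoothFn (U : Set (HSpace n)))) :
    wedge1 (Omega φ U A') u = ∑ i, drho φ U i • dSym A' i u := by
  rw [wedge1_apply]
  simp only [dSym, Omega, Finset.sum_smul, Finset.smul_sum]
  rw [Finset.sum_comm]
  refine Finset.sum_congr rfl fun i _ => Finset.sum_congr rfl fun a _ => ?_
  exact csmul_smul _ _ _

theorem dSymT_mem (A' : Fin 2) (i : Fin (4 * n + 4)) {N σ : ℕ} {τ : ℤ}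
    (hF : F ∈ Sec n (SmoothFn (U : Set (HSpace n))) N σ τ) :
    dSymT A' i F ∈ Sec n (SmoothFn (U : Set (HSpace n))) N σ (τ - 1) :=
  Submodule.sum_mem _ fun _ _ => Submodule.smul_mem _ _ (int1_mem hF)

theorem dStar_mem (A' : Fin 2) {N σ : ℕ} {τ : ℤ}
    (hF : F ∈ Sec n (SmoothFn (U : Set (HSpace n))) N σ τ) :
    dStar A' F ∈ Sec n (SmoothFn (U : Set (HSpace n))) N σ (τ - 1) :=
  Submodule.neg_mem _ (Submodule.sum_mem _ fun _ _ => dSymT_mem _ _ (mapT_mem _ hF))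

theorem suppT_dSymT (hF : F ∈ suppT U K) (A' : Fin 2) (i : Fin (4 * n + 4)) :
    dSymT A' i F ∈ suppT U K :=
  Submodule.sum_mem _ fun a _ => Submodule.smul_mem _ _ (suppT_int1 hF a)

theorem suppT_dStar (hK : IsClosed K) (hF : F ∈ suppT U K) (A' : Fin 2) :
    dStar A' F ∈ suppT U K :=
  Submodule.neg_mem _ (Submodule.sum_mem _ fun i _ => suppT_dSymT (suppT_pd hK hF i) _ _)

/-- The pointwise form of Green's formula. Integrating the divergence over the whole space gives the
formal adjoint, and integrating it over `D` gives the boundary term. -/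
theorem pr_dUp (σ : ℕ) (A' : Fin 2) (u v : Ten n (SmoothFn (U : Set (HSpace n)))) :
    pr σ (dUp U A' u) v = pr σ u (dStar A' v) + ∑ i, pd U i (pr σ (dSym A' i u) v) := by
  simp only [dUp_eq_dSym, pr_sum_left, pr_dSym, pd_pr, Finset.sum_add_distrib, dStar, pr_neg_right,
    pr_sum_right, mapT_dSymT]
  ring

theorem intAll_pr_dUp (hK : IsCompact K) (hKU : K ⊆ U) (hF : F ∈ suppT U K) (σ : ℕ) (A' : Fin 2)
    (u : Ten n (SmoothFn (U : Set (HSpace n)))) :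
    intAll (pr σ (dUp U A' u) F) = intAll (pr σ u (dStar A' F)) := by
  rw [pr_dUp, intAll_add hK hKU (pr_mem_suppF _ _ (suppT_dStar hK.isClosed hF _))
    (Submodule.sum_mem _ fun i _ => suppF_pd hK.isClosed (pr_mem_suppF _ _ hF) i),
    intAll_sum hK hKU _ fun i => suppF_pd hK.isClosed (pr_mem_suppF _ _ hF) i,
    Finset.sum_eq_zero fun i _ => intAll_pd hK hKU (pr_mem_suppF _ _ hF) i, add_zero]

/-- Green's formula for `d^{A'}`. -/
theorem intD_pr_dUp (φ : GraphFn n) (hK : IsCompact K) (hKU : K ⊆ U) (hF : F ∈ suppT U K) (σ : ℕ)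
    (A' : Fin 2) (u : Ten n (SmoothFn (U : Set (HSpace n)))) :
    intD φ (pr σ (dUp U A' u) F) =
      intD φ (pr σ u (dStar A' F)) - intB φ (pr σ (wedge1 (Omega φ U A') u) F) := by
  rw [pr_dUp, intD_add φ hK hKU (pr_mem_suppF _ _ (suppT_dStar hK.isClosed hF _))
    (Submodule.sum_mem _ fun i _ => suppF_pd hK.isClosed (pr_mem_suppF _ _ hF) i),
    intD_sum φ hK hKU _ fun i => suppF_pd hK.isClosed (pr_mem_suppF _ _ hF) i,
    wedge1_Omega_eq_dSym, pr_sum_left,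
    intB_sum φ hK hKU _ fun i => pr_mem_suppF _ _ hF, sub_eq_add_neg, ← Finset.sum_neg_distrib]
  congr 1
  refine Finset.sum_congr rfl fun i _ => ?_
  rw [intD_pd φ hK hKU (pr_mem_suppF _ _ hF), pr_smul_left]

/-- Integration by parts on the boundary. -/
theorem intB_pr_dStar (φ : GraphFn n) (hK : IsCompact K) (hKU : K ⊆ U) (hF : F ∈ suppT U K) (σ : ℕ)
    (A' : Fin 2) (w : Ten n (SmoothFn (U : Set (HSpace n)))) :
    intB φ (pr σ w (dStar A' F)) = intB φ (pr σ (dUp U A' w) F -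
      pd U (nIdx n) (pr σ (wedge1 (Omega φ U A') w) F)) := by
  have hc := hK.isClosed
  -- By `intB_pd` each `∂_i` in the divergence is replaced on the boundary by `∂_i ϱ · ∂_{4n+1}`;
  -- summed over `i`, the symbols combine to `Ω^{A'}`.
  have h1 : intB φ (pr σ (dUp U A' w) F) = intB φ (pr σ w (dStar A' F)) +
      intB φ (pd U (nIdx n) (pr σ (wedge1 (Omega φ U A') w) F)) := by
    rw [pr_dUp, intB_add φ hK hKU (pr_mem_suppF _ _ (suppT_dStar hc hF _))
      (Submodule.sum_mem _ fun i _ => suppF_pd hc (pr_mem_suppF _ _ hF) i)]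
    congr 1
    rw [wedge1_Omega_eq_dSym, pr_sum_left, map_sum,
      intB_sum φ hK hKU _ fun i => suppF_pd hc (pr_mem_suppF _ _ hF) i,
      intB_sum φ hK hKU _ fun i => suppF_pd hc (pr_mem_suppF _ _ hF) _]
    refine Finset.sum_congr rfl fun i _ => ?_
    rw [intB_pd φ hK hKU (pr_mem_suppF _ _ hF), pr_smul_left, pd_mul, pd_nIdx_drho, zero_mul,
      zero_add]
  have h2 := intB_add φ hK hKU (Submodule.sub_mem _ (pr_mem_suppF σ (dUp U A' w) hF)
    (suppF_pd hc (pr_mem_suppF σ (wedge1 (Omega φ U A') w) hF) (nIdx n)))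
    (suppF_pd hc (pr_mem_suppF σ (wedge1 (Omega φ U A') w) hF) (nIdx n))
  rw [sub_add_cancel, h1] at h2
  exact add_right_cancel h2

end Adjoints

/-! ### The complex and the sections with zero Cauchy data -/

section CauchyData

variable {n : ℕ} {U : TopologicalSpace.Opens (HSpace n)}

theorem cfOp_of_gt {k j : ℕ} (h : 2 * n < j) : cfOp U k j = 0 := if_pos h

theorem cfOp_of_lt {k j : ℕ} (hj : j ≤ 2 * n) (h : j < k)
    (u : Ten n (SmoothFn (U : Set (HSpace n)))) :
    cfOp U k j u = partialS 0 (dUp U 0 u) + partialS 1 (dUp U 1 u) := by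
  rw [cfOp, if_neg (by omega), if_pos h, Fin.sum_univ_two]; rfl

theorem cfOp_of_eq {k : ℕ} (hj : k ≤ 2 * n) (u : Ten n (SmoothFn (U : Set (HSpace n)))) :
    cfOp U k k u = dUp U 0 (dUp U 1 u) := by
  rw [cfOp, if_neg (by omega), if_neg (by omega), if_pos rfl]; rfl

theorem cfOp_of_between {k j : ℕ} (hj : j ≤ 2 * n) (h : k < j)
    (u : Ten n (SmoothFn (U : Set (HSpace n)))) :
    cfOp U k j u = sUp 0 (dUp U 1 u) - sUp 1 (dUp U 0 u) := by
  rw [cfOp, if_neg (by omega), if_neg (by omega), if_neg (by omega), Fin.sum_univ_two, sLow_zero,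
    sLow_one, LinearMap.add_apply, LinearMap.comp_apply, LinearMap.comp_apply, LinearMap.neg_apply]
  abel

theorem partialS_dUp (A' B' : Fin 2) (F : Ten n (SmoothFn (U : Set (HSpace n)))) :
    partialS A' (dUp U B' F) = dUp U B' (partialS A' F) := partialS_dOf _ _ _ _

theorem sUp_dUp (A' B' : Fin 2) (F : Ten n (SmoothFn (U : Set (HSpace n)))) :
    sUp A' (dUp U B' F) = dUp U B' (sUp A' F) := sUp_dOf _ _ _ _

/-- The `k`-Cauchy–Fueter complex is a complex. -/
theorem cfOp_cfOp (k j : ℕ) (u : Ten n (SmoothFn (U : Set (HSpace n)))) :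
    cfOp U k (j + 1) (cfOp U k j u) = 0 := by
  rcases Nat.lt_or_ge (2 * n) (j + 1) with h | h
  · rw [cfOp_of_gt h]; rfl
  rcases lt_trichotomy (j + 1) k with hk | hk | hk
  · rw [cfOp_of_lt h hk, cfOp_of_lt (by omega) (by omega)]
    simp only [map_add, partialS_dUp, dUp_self, zero_add, add_zero]
    rw [dUp_dUp U 1 0, partialS_comm 1 0]
    exact add_neg_cancel _
  · subst hk
    rw [cfOp_of_eq h, cfOp_of_lt (by omega) (by omega)]
    simp only [map_add, partialS_dUp, dUp_self, add_zero]
    rw [dUp_dUp U 1 0, map_neg, dUp_self, neg_zero]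
  · rcases Nat.eq_or_lt_of_le (Nat.lt_succ_iff.1 hk) with hk' | hk'
    · subst hk'
      rw [cfOp_of_between h hk, cfOp_of_eq (by omega)]
      simp only [dUp_self, map_zero, sub_zero]
      rw [dUp_dUp U 1 0, dUp_self, map_zero, neg_zero, map_zero]
    · rw [cfOp_of_between h hk, cfOp_of_between (by omega) hk']
      simp only [map_sub, sUp_dUp, dUp_self, zero_sub, sub_zero]
      rw [dUp_dUp U 1 0, neg_neg, sUp_dUp, sUp_dUp, sUp_comm 0 1, sub_self]

variable {K : Set (HSpace n)} {F : Ten n (SmoothFn (U : Set (HSpace n)))}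

theorem suppT_ext1 (hF : F ∈ suppT U K) (a : Fin (2 * n + 2)) : ext1 a F ∈ suppT U K :=
  fun p q S => by
    rw [ext1_apply]
    split_ifs
    · exact suppF_mul (hF _ _ _) _
    · exact Submodule.zero_mem _

theorem suppT_dUp (hK : IsClosed K) (hF : F ∈ suppT U K) (A' : Fin 2) : dUp U A' F ∈ suppT U K := by
  rw [dUp_eq_dSym]
  exact Submodule.sum_mem _ fun i _ => Submodule.sum_mem _ fun a _ =>
    Submodule.smul_mem _ _ (suppT_ext1 (suppT_pd hK hF i) a)

theorem suppT_partialS (hF : F ∈ suppT U K) (A' : Fin 2) : partialS A' F ∈ suppT U K :=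
  fun p q S => by
    simp only [partialS, LinearMap.coe_mk, AddHom.coe_mk]
    split_ifs <;> exact suppF_mul (hF _ _ _) _

theorem suppT_sUp (hF : F ∈ suppT U K) (A' : Fin 2) : sUp A' F ∈ suppT U K :=
  fun p q S => by
    simp only [sUp, LinearMap.coe_mk, AddHom.coe_mk]
    split_ifs <;> first | exact hF _ _ _ | exact Submodule.zero_mem _

theorem suppT_cfOp (k j : ℕ) (hK : IsClosed K) (hF : F ∈ suppT U K) :
    cfOp U k j F ∈ suppT U K := by
  rcases Nat.lt_or_ge (2 * n) j with h | h
  · rw [cfOp_of_gt h]; exact Submodule.zero_mem _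
  rcases lt_trichotomy j k with hk | hk | hk
  · rw [cfOp_of_lt h hk]
    exact Submodule.add_mem _ (suppT_partialS (suppT_dUp hK hF _) _)
      (suppT_partialS (suppT_dUp hK hF _) _)
  · subst hk
    rw [cfOp_of_eq h]
    exact suppT_dUp hK (suppT_dUp hK hF _) _
  · rw [cfOp_of_between h hk]
    exact Submodule.sub_mem _ (suppT_sUp (suppT_dUp hK hF _) _) (suppT_sUp (suppT_dUp hK hF _) _)

theorem compactSupp_zero {k j : ℕ} : CompactSupp U (0 : cfSec U k j) :=
  (compactSupp_iff _).2 ⟨∅, isCompact_empty, Set.empty_subset _, Submodule.zero_mem _⟩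

theorem integral_pairing {k j : ℕ} (u v : cfSec U k j) :
    ∫ x, pairing U k j u v x = intAll (pr (sig k j) u.1 v.1) := by
  rw [pairing_eq]; rfl

theorem integral_dom_pairing (φ : GraphFn n) {k j : ℕ} (u v : cfSec U k j) :
    ∫ x in dom φ, pairing U k j u v x = intD φ (pr (sig k j) u.1 v.1) := by
  rw [pairing_eq]; rfl

theorem cfD_coe {k j : ℕ} (u : cfSec U k j) : (cfD U k j u).1 = cfOp U k j u.1 := rfl

/-- The operators of the complex preserve the sections with zero Cauchy data. -/
theorem cauchyJ_le_comap (φ : GraphFn n) (k j : ℕ) : cauchyJ U (dom φ) k j ≤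
    (cauchyJ U (dom φ) k (j + 1)).comap (cfD U k j) := by
  intro u hu ψ hψ χ hχ had
  -- For compactly supported `v` one has `∫⟨D_j v, χ⟩ = ∫⟨D_{j+1} D_j v, ψ⟩ = 0`. Zero Cauchy data
  -- of `u` tested with `χ` then gives `∫_D ⟨D_j u, χ⟩ = 0`.
  have h0 : IsAdjointImage U k j χ 0 := by
    intro v hv
    obtain ⟨K, hK, hKU, hvK⟩ := (compactSupp_iff v).1 hv
    have hDv : CompactSupp U (cfD U k j v) :=
      (compactSupp_iff _).2 ⟨K, hK, hKU, suppT_cfOp k j hK.isClosed hvK⟩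
    have := had _ hDv
    rw [← this, integral_pairing, integral_pairing, cfD_coe, cfD_coe, cfOp_cfOp, pr_zero_left]
    change _ = intAll (pr _ v.1 0)
    rw [pr_zero_right]
  have := hu χ hχ 0 compactSupp_zero h0
  rw [this, integral_dom_pairing, integral_dom_pairing, cfD_coe, cfD_coe, cfOp_cfOp, pr_zero_left]
  change _ = intD φ (pr _ u.1 0)
  rw [pr_zero_right]

theorem coe_sum_apply {ι : Type} (s : Finset ι) (f : ι → SmoothFn (U : Set (HSpace n)))
    (x : (U : Set (HSpace n))) : (∑ i ∈ s, f i).1 x = ∑ i ∈ s, (f i).1 x := by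
  rw [AddSubmonoidClass.coe_finsetSum, Finset.sum_apply]

/-- The pointwise square norm. -/
def normSqT (σ : ℕ) (u : Ten n (SmoothFn (U : Set (HSpace n)))) (x : (U : Set (HSpace n))) : ℝ :=
  ∑ pq ∈ Finset.HasAntidiagonal.antidiagonal σ, ∑ S, Complex.normSq ((u pq.1 pq.2 S).1 x)

theorem pr_self_apply (σ : ℕ) (u : Ten n (SmoothFn (U : Set (HSpace n))))
    (x : (U : Set (HSpace n))) : (pr σ u u).1 x = (normSqT σ u x : ℂ) := by
  rw [pr, coe_sum_apply, normSqT, Complex.ofReal_sum]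
  refine Finset.sum_congr rfl fun pq _ => ?_
  rw [coe_sum_apply, Complex.ofReal_sum]
  exact Finset.sum_congr rfl fun S _ => Complex.mul_conj _

theorem normSqT_nonneg (σ : ℕ) (u : Ten n (SmoothFn (U : Set (HSpace n))))
    (x : (U : Set (HSpace n))) : 0 ≤ normSqT σ u x :=
  Finset.sum_nonneg fun _ _ => Finset.sum_nonneg fun _ _ => Complex.normSq_nonneg _

theorem eq_zero_of_normSqT {N σ : ℕ} {τ : ℤ} {u : Ten n (SmoothFn (U : Set (HSpace n)))}
    (hu : u ∈ Sec n (SmoothFn (U : Set (HSpace n))) N σ τ) {x : (U : Set (HSpace n))}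
    (h : normSqT σ u x = 0) (p q : ℕ) (S : Finset (Fin (2 * n + 2))) : (u p q S).1 x = 0 := by
  by_cases hpq : p + q = σ
  · rw [normSqT, Finset.sum_eq_zero_iff_of_nonneg fun _ _ =>
      Finset.sum_nonneg fun _ _ => Complex.normSq_nonneg _] at h
    have h1 := h (p, q) (by simpa using hpq)
    rw [Finset.sum_eq_zero_iff_of_nonneg fun _ _ => Complex.normSq_nonneg _] at h1
    exact Complex.normSq_eq_zero.1 (h1 S (Finset.mem_univ _))
  · rw [hu p q S fun h => hpq h.1]; rfl

/-- Testing with the difference itself gives it zero `L^2` norm. -/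
theorem eq_of_intAll_pr_sub {N σ : ℕ} {τ : ℤ} {χ χ' : Ten n (SmoothFn (U : Set (HSpace n)))}
    (hχ : χ ∈ Sec n (SmoothFn (U : Set (HSpace n))) N σ τ)
    (hχ' : χ' ∈ Sec n (SmoothFn (U : Set (HSpace n))) N σ τ) (hK : IsCompact K) (hKU : K ⊆ U)
    (t : χ ∈ suppT U K) (t' : χ' ∈ suppT U K)
    (e : intAll (pr σ (χ - χ') χ) = intAll (pr σ (χ - χ') χ')) : χ = χ' := by
  obtain ⟨w, hw⟩ : ∃ w, χ - χ' = w := ⟨_, rfl⟩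
  have ht : w ∈ suppT U K := hw ▸ Submodule.sub_mem _ t t'
  have e2 : pr σ w χ = pr σ w w + pr σ w χ' := by
    rw [← pr_add_right, ← hw, sub_add_cancel]
  rw [hw, e2, intAll_add hK hKU (pr_mem_suppF _ _ ht) (pr_mem_suppF _ _ t'), add_eq_right] at e
  have h0 := eq_zero_of_intAll hK hKU (pr_mem_suppF _ _ ht) (pr_self_apply _ _)
    (normSqT_nonneg _ _) e
  refine sub_eq_zero.1 (hw.trans ?_)
  funext p q S
  ext x
  refine eq_zero_of_normSqT (hw ▸ Submodule.sub_mem _ hχ hχ') ?_ p q S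
  have := pr_self_apply σ w x
  rw [h0] at this
  change (0 : ℂ) = _ at this
  exact_mod_cast this.symm

/-- The adjoint image is unique. -/
theorem IsAdjointImage.unique {k j : ℕ} {ψ : cfSec U k (j + 1)} {χ χ' : cfSec U k j}
    (h : IsAdjointImage U k j ψ χ) (h' : IsAdjointImage U k j ψ χ') (hχ : CompactSupp U χ)
    (hχ' : CompactSupp U χ') : χ = χ' := by
  obtain ⟨K, hK, hKU, hs⟩ := (compactSupp_iff _).1 hχ
  obtain ⟨K', hK', hKU', hs'⟩ := (compactSupp_iff _).1 hχ'
  have hL := hK.union hK'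
  have hLU : K ∪ K' ⊆ U := Set.union_subset hKU hKU'
  have t : χ.1 ∈ suppT U (K ∪ K') := fun p q S x hx => hs p q S x fun h => hx (Or.inl h)
  have t' : χ'.1 ∈ suppT U (K ∪ K') := fun p q S x hx => hs' p q S x fun h => hx (Or.inr h)
  have hc : CompactSupp U (χ - χ') :=
    (compactSupp_iff _).2 ⟨_, hL, hLU, Submodule.sub_mem _ t t'⟩
  have e := (h _ hc).symm.trans (h' _ hc)
  rw [integral_pairing, integral_pairing] at e
  exact Subtype.ext (eq_of_intAll_pr_sub χ.2 χ'.2 hL hLU t t' e)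

/-- Zero Cauchy data in terms of Green's formula. -/
theorem mem_cauchyJ_iff (φ : GraphFn n) {k j σ σ' : ℕ} {τ τ' : ℤ} (hσ : sig k j = σ)
    (hτ : tau k j = τ) (hσ' : sig k (j + 1) = σ') (hτ' : tau k (j + 1) = τ')
    {D Dst : Ten n (SmoothFn (U : Set (HSpace n))) → Ten n (SmoothFn (U : Set (HSpace n)))}
    {b : Ten n (SmoothFn (U : Set (HSpace n))) → SmoothFn (U : Set (HSpace n))}
    (hD : ∀ u, cfOp U k j u = D u)
    (hmem : ∀ ψ ∈ Sec n (SmoothFn (U : Set (HSpace n))) (2 * n + 2) σ' τ',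
      Dst ψ ∈ Sec n (SmoothFn (U : Set (HSpace n))) (2 * n + 2) σ τ)
    (hsupp : ∀ K, IsClosed K → ∀ ψ ∈ suppT U K, Dst ψ ∈ suppT U K)
    (hadj : ∀ K, IsCompact K → K ⊆ U → ∀ ψ ∈ suppT U K, ∀ u,
      intAll (pr σ' (D u) ψ) = intAll (pr σ u (Dst ψ)))
    (u : cfSec U k j)
    (hgreen : ∀ K, IsCompact K → K ⊆ U → ∀ ψ ∈ suppT U K,
      intD φ (pr σ' (D u.1) ψ) = intD φ (pr σ u.1 (Dst ψ)) - intB φ (b ψ)) :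
    u ∈ cauchyJ U (dom φ) k j ↔ ∀ K, IsCompact K → K ⊆ (U : Set (HSpace n)) →
      ∀ ψ ∈ Sec n (SmoothFn (U : Set (HSpace n))) (2 * n + 2) σ' τ', ψ ∈ suppT U K →
        intB φ (b ψ) = 0 := by
  subst hσ hτ hσ' hτ'
  -- The explicit transpose is an adjoint image. By uniqueness every admissible `χ` equals it, so
  -- only the explicit Green formula matters.
  have had (K) (hK : IsCompact K) (hKU : K ⊆ U) (ψ : cfSec U k (j + 1)) (hψ : ψ.1 ∈ suppT U K) :
      IsAdjointImage U k j ψ ⟨Dst ψ.1, hmem _ ψ.2⟩ := fun v _ => by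
    rw [integral_pairing, integral_pairing, cfD_coe, hD]
    exact hadj K hK hKU ψ.1 hψ v.1
  constructor
  · intro hu K hK hKU ψ hψ hψK
    have h1 := hu ⟨ψ, hψ⟩ ((compactSupp_iff _).2 ⟨K, hK, hKU, hψK⟩) ⟨Dst ψ, hmem _ hψ⟩
      ((compactSupp_iff _).2 ⟨K, hK, hKU, hsupp K hK.isClosed _ hψK⟩) (had K hK hKU _ hψK)
    rw [integral_dom_pairing, integral_dom_pairing, cfD_coe, hD, hgreen K hK hKU ψ hψK] at h1
    exact sub_eq_self.1 h1
  · intro h ψ hψ χ hχ hχad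
    obtain ⟨K, hK, hKU, hψK⟩ := (compactSupp_iff _).1 hψ
    have hc : CompactSupp U (⟨Dst ψ.1, hmem _ ψ.2⟩ : cfSec U k j) :=
      (compactSupp_iff _).2 ⟨K, hK, hKU, hsupp K hK.isClosed _ hψK⟩
    rw [hχad.unique (had K hK hKU ψ hψK) hχ hc, integral_dom_pairing, integral_dom_pairing, cfD_coe,
      hD, hgreen K hK hKU ψ.1 hψK, h K hK hKU ψ.1 ψ.2 hψK, sub_zero]

theorem cauchyJ_of_gt (φ : GraphFn n) {k j : ℕ} (h : 2 * n < j) : cauchyJ U (dom φ) k j = ⊤ := by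
  refine eq_top_iff.2 fun u _ => (mem_cauchyJ_iff φ rfl rfl rfl rfl (D := fun _ => 0)
    (Dst := fun _ => 0) (b := fun _ => 0) (fun u => by rw [cfOp_of_gt h]; rfl)
    (fun _ _ => Submodule.zero_mem _) (fun _ _ _ _ => Submodule.zero_mem _) ?_ u ?_).2 ?_
  · intro K _ _ ψ _ u
    rw [pr_zero_left, pr_zero_right]
  · intro K _ _ ψ _
    rw [pr_zero_left, pr_zero_right, intD_zero, intB_zero, sub_zero]
  · intro K _ _ ψ _ _
    exact intB_zero φ

/-- Bump functions. -/
theorem exists_bump {x : HSpace n} (hx : x ∈ U) : ∃ K, IsCompact K ∧ K ⊆ (U : Set (HSpace n)) ∧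
    ∃ (η : HSpace n → ℝ) (hη : ContDiff ℝ ∞ η), (∀ y, 0 ≤ η y) ∧ η x = 1 ∧
      ofGlobal (U : Set (HSpace n)) η hη ∈ suppF U K := by
  obtain ⟨ε, hε, hb⟩ := Metric.isOpen_iff.1 U.isOpen x hx
  let f : ContDiffBump x := ⟨ε / 3, ε / 2, by positivity, by linarith⟩
  refine ⟨Metric.closedBall x (ε / 2), isCompact_closedBall _ _,
    (Metric.closedBall_subset_ball (by linarith)).trans hb, f, f.contDiff, fun y => f.nonneg,
    f.one_of_mem_closedBall (Metric.mem_closedBall_self (by positivity)), fun y hy => ?_⟩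
  change ((f y.1 : ℝ) : ℂ) = 0
  rw [f.zero_of_le_dist, Complex.ofReal_zero]
  exact (not_le.1 hy).le

theorem conjFn_ofGlobal {g : HSpace n → ℝ} (hg : ContDiff ℝ ∞ g) :
    conjFn (ofGlobal (U : Set (HSpace n)) g hg) = ofGlobal _ g hg := by
  ext x; exact Complex.conj_ofReal _

theorem suppF_mul_right {f : SmoothFn (U : Set (HSpace n))} (hf : f ∈ suppF U K)
    (g : SmoothFn (U : Set (HSpace n))) : f * g ∈ suppF U K := fun x hx => by
  change f.1 x * g.1 x = 0
  rw [hf x hx, zero_mul]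

/-- A bump function around each boundary point localises: the integrand `η |w|^2` is nonnegative, so
it vanishes on `bD`. -/
theorem toBdry_eq_zero_of_intB (φ : GraphFn n) {N σ : ℕ} {τ : ℤ}
    {w : Ten n (SmoothFn (U : Set (HSpace n)))}
    (hw : w ∈ Sec n (SmoothFn (U : Set (HSpace n))) N σ τ)
    (h : ∀ K, IsCompact K → K ⊆ (U : Set (HSpace n)) → ∀ (η : HSpace n → ℝ) (hη : ContDiff ℝ ∞ η),
      ofGlobal (U : Set (HSpace n)) η hη ∈ suppF U K →
        intB φ (ofGlobal (U : Set (HSpace n)) η hη * pr σ w w) = 0) : toBdry φ U w = 0 := by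
  funext p q S
  ext x
  obtain ⟨K, hK, hKU, η, hη, hη0, hη1, hηK⟩ := exists_bump x.2.1
  have h1 := restr_eq_zero_of_intB φ (r := fun x => η x.1 * normSqT σ w x) hK hKU
    (suppF_mul_right hηK (pr σ w w))
    (fun x => by
      change ((η x.1 : ℝ) : ℂ) * (pr σ w w).1 x = _
      rw [pr_self_apply]; push_cast; rfl)
    (fun x => mul_nonneg (hη0 _) (normSqT_nonneg _ _ _)) (h K hK hKU η hη hηK)
  have h2 := congrFun (congrArg Subtype.val h1) x
  change ((η x.1 : ℝ) : ℂ) * (pr σ w w).1 ⟨x.1, x.2.1⟩ = 0 at h2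
  rw [hη1, Complex.ofReal_one, one_mul, pr_self_apply] at h2
  exact eq_zero_of_normSqT hw (by exact_mod_cast h2) p q S

theorem suppT_smul {r : SmoothFn (U : Set (HSpace n))} (hr : r ∈ suppF U K)
    (F : Ten n (SmoothFn (U : Set (HSpace n)))) : r • F ∈ suppT U K := fun p q S =>
  suppF_mul_right hr (F p q S)

theorem restr_pr (φ : GraphFn n) (σ : ℕ) {w : Ten n (SmoothFn (U : Set (HSpace n)))}
    (hw : toBdry φ U w = 0) (v : Ten n (SmoothFn (U : Set (HSpace n)))) :
    restr (bdry_subset φ U) (pr σ w v) = 0 := by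
  rw [pr, map_sum]
  refine Finset.sum_eq_zero fun pq _ => ?_
  rw [map_sum]
  refine Finset.sum_eq_zero fun S _ => ?_
  rw [restr_mul]
  have : restr (bdry_subset φ U) (w pq.1 pq.2 S) = 0 :=
    congrFun (congrFun (congrFun hw pq.1) pq.2) S
  rw [this, zero_mul]

/-- The boundary condition for an operator of first order. -/
theorem forall_intB_pr_iff (φ : GraphFn n) {N σ : ℕ} {τ : ℤ}
    {w : Ten n (SmoothFn (U : Set (HSpace n)))}
    (hw : w ∈ Sec n (SmoothFn (U : Set (HSpace n))) N σ τ) :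
    (∀ K, IsCompact K → K ⊆ (U : Set (HSpace n)) →
      ∀ ψ ∈ Sec n (SmoothFn (U : Set (HSpace n))) N σ τ, ψ ∈ suppT U K →
        intB φ (pr σ w ψ) = 0) ↔ toBdry φ U w = 0 := by
  constructor
  · intro h
    refine toBdry_eq_zero_of_intB φ hw fun K hK hKU η hη hηK => ?_
    have := h K hK hKU _ (Sec_smul_mem (ofGlobal (U : Set (HSpace n)) η hη) hw) (suppT_smul hηK w)
    rwa [pr_smul_right, conjFn_ofGlobal] at this
  · intro h K _ _ ψ _ _
    exact intB_eq_zero φ (restr_pr φ σ h ψ)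

theorem intB_congr (φ : GraphFn n) {f g : SmoothFn (U : Set (HSpace n))}
    (h : restr (bdry_subset φ U) f = restr (bdry_subset φ U) g) : intB φ f = intB φ g := by
  refine MeasureTheory.integral_congr_ae (Filter.Eventually.of_forall fun y => ?_)
  change zext f.1 _ = zext g.1 _
  by_cases hy : graphPt φ y ∈ (U : Set (HSpace n))
  · rw [zext_of_mem _ hy, zext_of_mem _ hy]
    exact congrFun (congrArg Subtype.val h) ⟨_, hy, rho_graphPt φ y⟩
  · rw [zext, zext, dif_neg hy, dif_neg hy]

theorem restr_rho (φ : GraphFn n) : restr (bdry_subset φ U)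
    (ofGlobal (U : Set (HSpace n)) (rho φ) (rho_contDiff φ)) = 0 := by
  ext x
  change ((rho φ x.1 : ℝ) : ℂ) = 0
  rw [x.2.2, Complex.ofReal_zero]

theorem mul_sub_mul_eq {R : Type} [CommRing R] (r η a b c d : R) :
    r * η * a - ((η + r * d) * b + r * η * c) = r * (η * a - (d * b + η * c)) + -(η * b) := by
  ring

/-- The test section `r η a`, with `r = ϱ` in the application, vanishes on `bD` and has normal
derivative `η a` there. Only the term with the normal derivative survives. -/
theorem restr_pr_sub_test (φ : GraphFn n) (σ : ℕ) {r η : SmoothFn (U : Set (HSpace n))}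
    (hr : conjFn r = r) (hη : conjFn η = η) (hr0 : restr (bdry_subset φ U) r = 0)
    (hr1 : pd U (nIdx n) r = 1) (a c : Ten n (SmoothFn (U : Set (HSpace n)))) :
    restr (bdry_subset φ U) (pr σ c ((r * η) • a) -
      pr σ a (mapT (pd U (nIdx n)) ((r * η) • a))) =
        restr (bdry_subset φ U) (-(η * pr σ a a)) := by
  have h2 : mapT (pd U (nIdx n)) ((r * η) • a) =
      (η + r * pd U (nIdx n) η) • a + (r * η) • mapT (pd U (nIdx n)) a := by
    rw [mapT_smul_of_leibniz (pd_mul U (nIdx n)), pd_mul, hr1, one_mul]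
  rw [h2, pr_add_right, pr_smul_right, pr_smul_right, pr_smul_right, conjFn_add, conjFn_mul,
    conjFn_mul, hr, hη]
  have h3 (x : SmoothFn (U : Set (HSpace n))) : restr (bdry_subset φ U) (r * x) = 0 := by
    rw [restr_mul, hr0, zero_mul]
  rw [mul_sub_mul_eq, map_add, h3, zero_add]

/-- Separates the boundary form into the part that sees `ψ` and the part that sees its normal
derivative. -/
theorem pr_sub_pd_pr (σ : ℕ) (a b ψ : Ten n (SmoothFn (U : Set (HSpace n)))) :
    pr σ b ψ - pd U (nIdx n) (pr σ a ψ) =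
      pr σ (b - mapT (pd U (nIdx n)) a) ψ - pr σ a (mapT (pd U (nIdx n)) ψ) := by
  have : pr σ b ψ = pr σ (b - mapT (pd U (nIdx n)) a) ψ + pr σ (mapT (pd U (nIdx n)) a) ψ := by
    rw [← pr_add_left, sub_add_cancel]
  rw [pd_pr, this]
  ring

theorem toBdry_eq_zero_of_intB_pr_sub (φ : GraphFn n) {N σ : ℕ} {τ : ℤ}
    {a c : Ten n (SmoothFn (U : Set (HSpace n)))}
    (ha : a ∈ Sec n (SmoothFn (U : Set (HSpace n))) N σ τ)
    (h : ∀ K, IsCompact K → K ⊆ (U : Set (HSpace n)) →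
      ∀ ψ ∈ Sec n (SmoothFn (U : Set (HSpace n))) N σ τ, ψ ∈ suppT U K →
        intB φ (pr σ c ψ - pr σ a (mapT (pd U (nIdx n)) ψ)) = 0) : toBdry φ U a = 0 := by
  refine toBdry_eq_zero_of_intB φ ha fun K hK hKU η hη hηK => ?_
  have hr1 : pd U (nIdx n) (ofGlobal (U : Set (HSpace n)) (rho φ) (rho_contDiff φ)) = 1 := by
    rw [pd_rho, drho_nIdx]
  have h1 := h K hK hKU _ (Sec_smul_mem (ofGlobal (U : Set (HSpace n)) (rho φ) (rho_contDiff φ) *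
    ofGlobal (U : Set (HSpace n)) η hη) ha) (suppT_smul (suppF_mul hηK _) a)
  rw [intB_congr φ (restr_pr_sub_test φ σ (conjFn_ofGlobal _) (conjFn_ofGlobal _) (restr_rho φ) hr1
    a c)] at h1
  have h2 := suppF_mul_right hηK (pr σ a a)
  have h3 := intB_add φ hK hKU (Submodule.neg_mem _ h2) h2
  rw [neg_add_cancel, intB_zero, h1, zero_add] at h3
  exact h3.symm

/-- The boundary condition for an operator of second order. -/
theorem forall_intB_pr_sub_iff (φ : GraphFn n) {N σ : ℕ} {τ : ℤ}
    {a b : Ten n (SmoothFn (U : Set (HSpace n)))}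
    (ha : a ∈ Sec n (SmoothFn (U : Set (HSpace n))) N σ τ)
    (hb : b ∈ Sec n (SmoothFn (U : Set (HSpace n))) N σ τ) :
    (∀ K, IsCompact K → K ⊆ (U : Set (HSpace n)) →
      ∀ ψ ∈ Sec n (SmoothFn (U : Set (HSpace n))) N σ τ, ψ ∈ suppT U K →
        intB φ (pr σ b ψ - pd U (nIdx n) (pr σ a ψ)) = 0) ↔
      toBdry φ U a = 0 ∧ toBdry φ U (b - mapT (pd U (nIdx n)) a) = 0 := by
  have hcm : b - mapT (pd U (nIdx n)) a ∈ Sec n (SmoothFn (U : Set (HSpace n))) N σ τ :=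
    Submodule.sub_mem _ hb (mapT_mem _ ha)
  constructor
  · intro h
    have h0 : toBdry φ U a = 0 := toBdry_eq_zero_of_intB_pr_sub φ
      (c := b - mapT (pd U (nIdx n)) a) ha fun K hK hKU ψ hψ hψK => by
        rw [← pr_sub_pd_pr]; exact h K hK hKU ψ hψ hψK
    -- Once `a` is known to vanish on `bD`, the term with the normal derivative of `ψ` drops out and
    -- the criterion of first order applies.
    refine ⟨h0, (forall_intB_pr_iff φ hcm).1 fun K hK hKU ψ hψ hψK => ?_⟩
    rw [← h K hK hKU ψ hψ hψK, pr_sub_pd_pr]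
    refine intB_congr φ ?_
    rw [map_sub, restr_pr φ σ h0, sub_zero]
  · rintro ⟨h0, h1⟩ K _ _ ψ _ _
    refine intB_eq_zero φ ?_
    rw [pr_sub_pd_pr, map_sub, restr_pr φ σ h0, restr_pr φ σ h1, sub_zero]

end CauchyData

/-! ### The boundary conditions for zero Cauchy data -/

section CauchyCondition

variable {n : ℕ} {U : TopologicalSpace.Opens (HSpace n)} {K : Set (HSpace n)} (φ : GraphFn n)

theorem toBdry_partialS (A' : Fin 2) (F : Ten n (SmoothFn (U : Set (HSpace n)))) :
    toBdry φ U (partialS A' F) = partialS A' (toBdry φ U F) := (partialS_mapT _ _ _).symm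

theorem toBdry_sUp (A' : Fin 2) (F : Ten n (SmoothFn (U : Set (HSpace n)))) :
    toBdry φ U (sUp A' F) = sUp A' (toBdry φ U F) := (sUp_mapT _ _ _).symm

theorem pr_sub_left (σ : ℕ) (u u' v : Ten n (SmoothFn (U : Set (HSpace n)))) :
    pr σ (u - u') v = pr σ u v - pr σ u' v := by
  rw [eq_sub_iff_add_eq, ← pr_add_left, sub_add_cancel]

theorem intB_sub {f g : SmoothFn (U : Set (HSpace n))} (hK : IsCompact K) (hKU : K ⊆ U)
    (hf : f ∈ suppF U K) (hg : g ∈ suppF U K) : intB φ (f - g) = intB φ f - intB φ g := by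
  rw [eq_sub_iff_add_eq, ← intB_add φ hK hKU (Submodule.sub_mem _ hf hg) hg, sub_add_cancel]

theorem intD_sub {f g : SmoothFn (U : Set (HSpace n))} (hK : IsCompact K) (hKU : K ⊆ U)
    (hf : f ∈ suppF U K) (hg : g ∈ suppF U K) : intD φ (f - g) = intD φ f - intD φ g := by
  rw [eq_sub_iff_add_eq, ← intD_add φ hK hKU (Submodule.sub_mem _ hf hg) hg, sub_add_cancel]

theorem intAll_sub {f g : SmoothFn (U : Set (HSpace n))} (hK : IsCompact K) (hKU : K ⊆ U)
    (hf : f ∈ suppF U K) (hg : g ∈ suppF U K) : intAll (f - g) = intAll f - intAll g := by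
  rw [eq_sub_iff_add_eq, ← intAll_add hK hKU (Submodule.sub_mem _ hf hg) hg, sub_add_cancel]

section First

variable {ψ : Ten n (SmoothFn (U : Set (HSpace n)))} (hK : IsCompact K)
  (hKU : K ⊆ (U : Set (HSpace n))) (hψ : ψ ∈ suppT U K) (σ : ℕ)
  (u : Ten n (SmoothFn (U : Set (HSpace n))))

theorem pr_partialS_two (a b : Ten n (SmoothFn (U : Set (HSpace n)))) :
    pr σ (partialS 0 a + partialS 1 b) ψ =
      pr (σ + 1) a (partialSt 0 ψ) + pr (σ + 1) b (partialSt 1 ψ) := by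
  rw [pr_add_left, pr_partialS, pr_partialS]

theorem pr_sUp_two (a b : Ten n (SmoothFn (U : Set (HSpace n)))) :
    pr (σ + 1) (sUp 0 a - sUp 1 b) ψ = pr σ a (sDown 0 ψ) - pr σ b (sDown 1 ψ) := by
  rw [pr_sub_left, pr_sUp, pr_sUp]

include hK hKU hψ

theorem intAll_partialS_dUp :
    intAll (pr σ (partialS 0 (dUp U 0 u) + partialS 1 (dUp U 1 u)) ψ) =
      intAll (pr (σ + 1) u (dStar 0 (partialSt 0 ψ) + dStar 1 (partialSt 1 ψ))) := by
  have hs (A' : Fin 2) := suppT_partialSt hψ A'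
  have hs' (A' : Fin 2) := suppT_dStar hK.isClosed (hs A') A'
  rw [pr_partialS_two, pr_add_right,
    intAll_add hK hKU (pr_mem_suppF _ _ (hs 0)) (pr_mem_suppF _ _ (hs 1)),
    intAll_add hK hKU (pr_mem_suppF _ _ (hs' 0)) (pr_mem_suppF _ _ (hs' 1)),
    intAll_pr_dUp hK hKU (hs 0), intAll_pr_dUp hK hKU (hs 1)]

theorem intD_partialS_dUp :
    intD φ (pr σ (partialS 0 (dUp U 0 u) + partialS 1 (dUp U 1 u)) ψ) =
      intD φ (pr (σ + 1) u (dStar 0 (partialSt 0 ψ) + dStar 1 (partialSt 1 ψ))) -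
      intB φ (pr σ (partialS 0 (wedge1 (Omega φ U 0) u) + partialS 1 (wedge1 (Omega φ U 1) u)) ψ) := by
  have hs (A' : Fin 2) := suppT_partialSt hψ A'
  have hs' (A' : Fin 2) := suppT_dStar hK.isClosed (hs A') A'
  rw [pr_partialS_two, pr_partialS_two, pr_add_right,
    intD_add φ hK hKU (pr_mem_suppF _ _ (hs 0)) (pr_mem_suppF _ _ (hs 1)),
    intD_add φ hK hKU (pr_mem_suppF _ _ (hs' 0)) (pr_mem_suppF _ _ (hs' 1)),
    intB_add φ hK hKU (pr_mem_suppF _ _ (hs 0)) (pr_mem_suppF _ _ (hs 1)),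
    intD_pr_dUp φ hK hKU (hs 0), intD_pr_dUp φ hK hKU (hs 1)]
  ring

theorem intAll_sUp_dUp :
    intAll (pr (σ + 1) (sUp 0 (dUp U 1 u) - sUp 1 (dUp U 0 u)) ψ) =
      intAll (pr σ u (dStar 1 (sDown 0 ψ) - dStar 0 (sDown 1 ψ))) := by
  have hs (A' : Fin 2) := suppT_sDown hψ A'
  have hs' (A' B' : Fin 2) := suppT_dStar hK.isClosed (hs A') B'
  rw [pr_sUp_two, pr_sub_right,
    intAll_sub hK hKU (pr_mem_suppF _ _ (hs 0)) (pr_mem_suppF _ _ (hs 1)),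
    intAll_sub hK hKU (pr_mem_suppF _ _ (hs' 0 1)) (pr_mem_suppF _ _ (hs' 1 0)),
    intAll_pr_dUp hK hKU (hs 0), intAll_pr_dUp hK hKU (hs 1)]

theorem intD_sUp_dUp :
    intD φ (pr (σ + 1) (sUp 0 (dUp U 1 u) - sUp 1 (dUp U 0 u)) ψ) =
      intD φ (pr σ u (dStar 1 (sDown 0 ψ) - dStar 0 (sDown 1 ψ))) -
      intB φ (pr (σ + 1) (sUp 0 (wedge1 (Omega φ U 1) u) - sUp 1 (wedge1 (Omega φ U 0) u)) ψ) := by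
  have hs (A' : Fin 2) := suppT_sDown hψ A'
  have hs' (A' B' : Fin 2) := suppT_dStar hK.isClosed (hs A') B'
  rw [pr_sUp_two, pr_sUp_two, pr_sub_right,
    intD_sub φ hK hKU (pr_mem_suppF _ _ (hs 0)) (pr_mem_suppF _ _ (hs 1)),
    intD_sub φ hK hKU (pr_mem_suppF _ _ (hs' 0 1)) (pr_mem_suppF _ _ (hs' 1 0)),
    intB_sub φ hK hKU (pr_mem_suppF _ _ (hs 0)) (pr_mem_suppF _ _ (hs 1)),
    intD_pr_dUp φ hK hKU (hs 0), intD_pr_dUp φ hK hKU (hs 1)]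
  ring

theorem intAll_dUp_dUp : intAll (pr σ (dUp U 0 (dUp U 1 u)) ψ) =
    intAll (pr σ u (dStar 1 (dStar 0 ψ))) := by
  rw [intAll_pr_dUp hK hKU hψ, intAll_pr_dUp hK hKU (suppT_dStar hK.isClosed hψ _)]

/-- Green's formula is used twice. The second boundary term still contains the adjoint of `d^{0'}`
acting on `ψ`, which is moved back by `intB_pr_dStar` at the cost of a normal derivative. -/
theorem intD_dUp_dUp : intD φ (pr σ (dUp U 0 (dUp U 1 u)) ψ) =
    intD φ (pr σ u (dStar 1 (dStar 0 ψ))) -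
      intB φ (pr σ (dUp U 0 (wedge1 (Omega φ U 1) u) + wedge1 (Omega φ U 0) (dUp U 1 u)) ψ -
        pd U (nIdx n) (pr σ (wedge1 (Omega φ U 0) (wedge1 (Omega φ U 1) u)) ψ)) := by
  have hs := pr_mem_suppF (U := U) σ (wedge1 (Omega φ U 0) (dUp U 1 u)) hψ
  have hs' := pr_mem_suppF (U := U) σ (dUp U 0 (wedge1 (Omega φ U 1) u)) hψ
  have hs'' := suppF_pd hK.isClosed
    (pr_mem_suppF (U := U) σ (wedge1 (Omega φ U 0) (wedge1 (Omega φ U 1) u)) hψ) (nIdx n)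
  rw [intD_pr_dUp φ hK hKU hψ, intD_pr_dUp φ hK hKU (suppT_dStar hK.isClosed hψ _),
    intB_pr_dStar φ hK hKU hψ, pr_add_left, add_sub_right_comm,
    intB_add φ hK hKU (Submodule.sub_mem _ hs' hs'') hs]
  ring

end First

/-- The boundary term of a first-order operator is its symbol at `dϱ`, obtained by replacing
`d^{A'}` with `Ω^{A'} ∧`. It is orthogonal to all test sections only if it vanishes. -/
theorem mem_cauchyJ_of_lt {k j : ℕ} (hj : j ≤ 2 * n) (h : j < k) (u : cfSec U k j) :
    u ∈ cauchyJ U (dom φ) k j ↔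
      partialS 0 ((fB φ U).e 0 (toBdry φ U u.1)) + partialS 1 ((fB φ U).e 1 (toBdry φ U u.1)) = 0 := by
  obtain ⟨σ, hσ⟩ : ∃ σ, sig k (j + 1) = σ := ⟨_, rfl⟩
  obtain ⟨τ, hτ⟩ : ∃ τ, tau k j = τ := ⟨_, rfl⟩
  have hσ' : sig k j = σ + 1 := by rw [← hσ]; unfold sig; split_ifs <;> omega
  have hτ' : tau k (j + 1) = τ + 1 := by rw [← hτ]; unfold tau; split_ifs <;> omega
  have hu : u.1 ∈ Sec n (SmoothFn (U : Set (HSpace n))) (2 * n + 2) (σ + 1) τ :=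
    Sec_congr u.2 hσ' hτ
  have hwm : partialS 0 (wedge1 (Omega φ U 0) u.1) + partialS 1 (wedge1 (Omega φ U 1) u.1) ∈
      Sec n (SmoothFn (U : Set (HSpace n))) (2 * n + 2) σ (τ + 1) :=
    Submodule.add_mem _ (partialS_mem (wedge1_mem _ hu)) (partialS_mem (wedge1_mem _ hu))
  have hb : toBdry φ U (partialS 0 (wedge1 (Omega φ U 0) u.1) +
      partialS 1 (wedge1 (Omega φ U 1) u.1)) = partialS 0 ((fB φ U).e 0 (toBdry φ U u.1)) +
      partialS 1 ((fB φ U).e 1 (toBdry φ U u.1)) := by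
    rw [map_add, toBdry_partialS, toBdry_partialS, toBdry_Omega, toBdry_Omega]; rfl
  rw [← hb, ← forall_intB_pr_iff φ hwm]
  refine mem_cauchyJ_iff φ hσ' hτ hσ hτ' (fun u => cfOp_of_lt hj h u) ?_ ?_
    (fun K hK hKU ψ hψ v => intAll_partialS_dUp hK hKU hψ σ v) u
    (fun K hK hKU ψ hψ => intD_partialS_dUp φ hK hKU hψ σ u.1)
  · intro ψ hψ
    exact Submodule.add_mem _ (Sec_congr (dStar_mem _ (partialSt_mem hψ)) rfl (by ring))
      (Sec_congr (dStar_mem _ (partialSt_mem hψ)) rfl (by ring))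
  · intro K hK ψ hψ
    exact Submodule.add_mem _ (suppT_dStar hK (suppT_partialSt hψ _) _)
      (suppT_dStar hK (suppT_partialSt hψ _) _)

theorem mem_cauchyJ_of_between {k j : ℕ} (hj : j ≤ 2 * n) (h : k < j) (u : cfSec U k j) :
    u ∈ cauchyJ U (dom φ) k j ↔
      sUp 0 ((fB φ U).e 1 (toBdry φ U u.1)) - sUp 1 ((fB φ U).e 0 (toBdry φ U u.1)) = 0 := by
  obtain ⟨σ, hσ⟩ : ∃ σ, sig k j = σ := ⟨_, rfl⟩
  obtain ⟨τ, hτ⟩ : ∃ τ, tau k j = τ := ⟨_, rfl⟩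
  have hσ' : sig k (j + 1) = σ + 1 := by rw [← hσ]; unfold sig; split_ifs <;> omega
  have hτ' : tau k (j + 1) = τ + 1 := by rw [← hτ]; unfold tau; split_ifs <;> omega
  have hu : u.1 ∈ Sec n (SmoothFn (U : Set (HSpace n))) (2 * n + 2) σ τ :=
    Sec_congr u.2 hσ hτ
  have hwm : sUp 0 (wedge1 (Omega φ U 1) u.1) - sUp 1 (wedge1 (Omega φ U 0) u.1) ∈
      Sec n (SmoothFn (U : Set (HSpace n))) (2 * n + 2) (σ + 1) (τ + 1) :=
    Submodule.sub_mem _ (sUp_mem (wedge1_mem _ hu)) (sUp_mem (wedge1_mem _ hu))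
  have hb : toBdry φ U (sUp 0 (wedge1 (Omega φ U 1) u.1) - sUp 1 (wedge1 (Omega φ U 0) u.1)) =
      sUp 0 ((fB φ U).e 1 (toBdry φ U u.1)) - sUp 1 ((fB φ U).e 0 (toBdry φ U u.1)) := by
    rw [map_sub, toBdry_sUp, toBdry_sUp, toBdry_Omega, toBdry_Omega]; rfl
  rw [← hb, ← forall_intB_pr_iff φ hwm]
  refine mem_cauchyJ_iff φ hσ hτ hσ' hτ' (fun u => cfOp_of_between hj h u) ?_ ?_
    (fun K hK hKU ψ hψ v => intAll_sUp_dUp hK hKU hψ σ v) u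
    (fun K hK hKU ψ hψ => intD_sUp_dUp φ hK hKU hψ σ u.1)
  · intro ψ hψ
    have h0 := dStar_mem 1 (sDown_mem (A' := 0) hψ)
    have h1 := dStar_mem 0 (sDown_mem (A' := 1) hψ)
    exact Sec_congr (Submodule.sub_mem _ h0 h1) rfl (by ring)
  · intro K hK ψ hψ
    exact Submodule.sub_mem _ (suppT_dStar hK (suppT_sDown hψ _) _)
      (suppT_dStar hK (suppT_sDown hψ _) _)

/-- Each of the three terms contributes the same multiple `Ω^{0'} ∧ Ω^{1'} ∧ ∂_{4n+1} u`, with signs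
`+`, `+`, `-`, so one copy remains. -/
theorem toBdry_second_order (u : Ten n (SmoothFn (U : Set (HSpace n)))) :
    toBdry φ U (dUp U 0 (wedge1 (Omega φ U 1) u) + wedge1 (Omega φ U 0) (dUp U 1 u) -
      mapT (pd U (nIdx n)) (wedge1 (Omega φ U 0) (wedge1 (Omega φ U 1) u))) =
    dB φ U 0 ((fB φ U).e 1 (toBdry φ U u)) + (fB φ U).e 0 (dB φ U 1 (toBdry φ U u)) +
      (fB φ U).e 0 ((fB φ U).e 1 (toBdry φ U (mapT (pd U (nIdx n)) u))) := by
  have h1 : toBdry φ U (dUp U 0 (wedge1 (Omega φ U 1) u)) = dB φ U 0 ((fB φ U).e 1 (toBdry φ U u)) +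
      (fB φ U).e 0 ((fB φ U).e 1 (toBdry φ U (mapT (pd U (nIdx n)) u))) := by
    rw [toBdry_dUp, pd_nIdx_Omega, toBdry_Omega, toBdry_Omega]
    rfl
  have h2 : toBdry φ U (wedge1 (Omega φ U 0) (dUp U 1 u)) = (fB φ U).e 0 (dB φ U 1 (toBdry φ U u)) +
      (fB φ U).e 0 ((fB φ U).e 1 (toBdry φ U (mapT (pd U (nIdx n)) u))) := by
    rw [toBdry_Omega, toBdry_dUp, map_add]
    rfl
  have h3 : toBdry φ U (mapT (pd U (nIdx n)) (wedge1 (Omega φ U 0) (wedge1 (Omega φ U 1) u))) =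
      (fB φ U).e 0 ((fB φ U).e 1 (toBdry φ U (mapT (pd U (nIdx n)) u))) := by
    rw [pd_nIdx_Omega, pd_nIdx_Omega, toBdry_Omega, toBdry_Omega]
    rfl
  rw [map_sub, map_add, h1, h2, h3]
  abel

theorem mem_cauchyJ_of_eq {k : ℕ} (hj : k ≤ 2 * n) (u : cfSec U k k) :
    u ∈ cauchyJ U (dom φ) k k ↔ (fB φ U).e 0 ((fB φ U).e 1 (toBdry φ U u.1)) = 0 ∧
      dB φ U 0 ((fB φ U).e 1 (toBdry φ U u.1)) + (fB φ U).e 0 (dB φ U 1 (toBdry φ U u.1)) +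
        (fB φ U).e 0 ((fB φ U).e 1 (toBdry φ U (mapT (pd U (nIdx n)) u.1))) = 0 := by
  obtain ⟨σ, hσ⟩ : ∃ σ, sig k k = σ := ⟨_, rfl⟩
  obtain ⟨τ, hτ⟩ : ∃ τ, tau k k = τ := ⟨_, rfl⟩
  have hσ' : sig k (k + 1) = σ := by rw [← hσ]; unfold sig; split_ifs <;> omega
  have hτ' : tau k (k + 1) = τ + 1 + 1 := by rw [← hτ]; unfold tau; split_ifs <;> omega
  have hu : u.1 ∈ Sec n (SmoothFn (U : Set (HSpace n))) (2 * n + 2) σ τ :=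
    Sec_congr u.2 hσ hτ
  have ham : wedge1 (Omega φ U 0) (wedge1 (Omega φ U 1) u.1) ∈
      Sec n (SmoothFn (U : Set (HSpace n))) (2 * n + 2) σ (τ + 1 + 1) :=
    wedge1_mem _ (wedge1_mem _ hu)
  have hbm : dUp U 0 (wedge1 (Omega φ U 1) u.1) + wedge1 (Omega φ U 0) (dUp U 1 u.1) ∈
      Sec n (SmoothFn (U : Set (HSpace n))) (2 * n + 2) σ (τ + 1 + 1) :=
    Submodule.add_mem _ (dUp_mem U _ (wedge1_mem _ hu)) (wedge1_mem _ (dUp_mem U _ hu))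
  have hab : toBdry φ U (wedge1 (Omega φ U 0) (wedge1 (Omega φ U 1) u.1)) =
      (fB φ U).e 0 ((fB φ U).e 1 (toBdry φ U u.1)) := by
    rw [toBdry_Omega, toBdry_Omega]; rfl
  have hmem : ∀ ψ ∈ Sec n (SmoothFn (U : Set (HSpace n))) (2 * n + 2) σ (τ + 1 + 1),
      dStar 1 (dStar 0 ψ) ∈ Sec n (SmoothFn (U : Set (HSpace n))) (2 * n + 2) σ τ := by
    intro ψ hψ
    have h := dStar_mem 1 (dStar_mem 0 hψ)
    exact Sec_congr h rfl (by ring)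
  have key := mem_cauchyJ_iff φ hσ hτ hσ' hτ' (D := fun u => dUp U 0 (dUp U 1 u))
    (Dst := fun ψ => dStar 1 (dStar 0 ψ)) (b := fun ψ =>
      pr σ (dUp U 0 (wedge1 (Omega φ U 1) u.1) + wedge1 (Omega φ U 0) (dUp U 1 u.1)) ψ -
        pd U (nIdx n) (pr σ (wedge1 (Omega φ U 0) (wedge1 (Omega φ U 1) u.1)) ψ))
    (fun u => cfOp_of_eq hj u) hmem
    (fun K hK ψ hψ => suppT_dStar hK (suppT_dStar hK hψ _) _)
    (fun K hK hKU ψ hψ v => intAll_dUp_dUp hK hKU hψ σ v) u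
    (fun K hK hKU ψ hψ => intD_dUp_dUp φ hK hKU hψ σ u.1)
  have key2 := forall_intB_pr_sub_iff φ ham hbm
  rw [hab, toBdry_second_order] at key2
  exact key.trans key2

end CauchyCondition

/-! ### Pairs of operators on the polynomial variables -/

section FiberOperators

variable {n : ℕ} {R : Type} [CommRing R] [Algebra ℂ R]

/-- A commuting pair of operators that act on the polynomial variables only. -/
structure FiberPair (L : Fin 2 → Ten n R →ₗ[ℂ] Ten n R) : Prop where
  smul : ∀ A' (r : R) F, L A' (r • F) = r • L A' F
  ext1 : ∀ A' a F, L A' (ext1 a F) = ext1 a (L A' F)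
  int1 : ∀ A' a F, L A' (int1 a F) = int1 a (L A' F)
  mapT : ∀ A' (M : R →ₗ[ℂ] R) F, L A' (mapT M F) = mapT M (L A' F)
  comm : ∀ A' B' F, L A' (L B' F) = L B' (L A' F)

theorem fiberPair_partialS : FiberPair (partialS : Fin 2 → Ten n R →ₗ[ℂ] Ten n R) where
  smul := partialS_smul
  ext1 := partialS_ext1
  int1 := partialS_int1
  mapT A' M F := partialS_mapT M A' F
  comm := partialS_comm

theorem fiberPair_sLow : FiberPair (sLow : Fin 2 → Ten n R →ₗ[ℂ] Ten n R) where
  smul A' r F := by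
    fin_cases A'
    · change sLow 0 _ = _ • sLow 0 _
      rw [sLow_zero, LinearMap.neg_apply, LinearMap.neg_apply, sUp_smul, smul_neg]
    · change sLow 1 _ = _ • sLow 1 _
      rw [sLow_one, sUp_smul]
  ext1 A' a F := by
    fin_cases A'
    · change sLow 0 _ = KCF.ext1 a (sLow 0 _)
      rw [sLow_zero, LinearMap.neg_apply, LinearMap.neg_apply, sUp_ext1, LinearMap.map_neg]
    · change sLow 1 _ = KCF.ext1 a (sLow 1 _)
      rw [sLow_one, sUp_ext1]
  int1 A' a F := by
    fin_cases A'
    · change sLow 0 _ = KCF.int1 a (sLow 0 _)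
      rw [sLow_zero, LinearMap.neg_apply, LinearMap.neg_apply, sUp_int1, LinearMap.map_neg]
    · change sLow 1 _ = KCF.int1 a (sLow 1 _)
      rw [sLow_one, sUp_int1]
  mapT A' M F := by
    fin_cases A'
    · change sLow 0 _ = KCF.mapT M (sLow 0 _)
      rw [sLow_zero, LinearMap.neg_apply, LinearMap.neg_apply, sUp_mapT, LinearMap.map_neg]
    · change sLow 1 _ = KCF.mapT M (sLow 1 _)
      rw [sLow_one, sUp_mapT]
  comm A' B' F := by
    fin_cases A' <;> fin_cases B'
    · rfl
    · change sLow 0 (sLow 1 F) = sLow 1 (sLow 0 F)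
      rw [sLow_zero, sLow_one, LinearMap.neg_apply, LinearMap.neg_apply, LinearMap.map_neg, sUp_comm]
    · change sLow 1 (sLow 0 F) = sLow 0 (sLow 1 F)
      rw [sLow_zero, sLow_one, LinearMap.neg_apply, LinearMap.neg_apply, LinearMap.map_neg, sUp_comm]
    · rfl

namespace FiberPair

variable {L : Fin 2 → Ten n R →ₗ[ℂ] Ten n R} (hL : FiberPair L)

include hL

theorem wedge1 (A' : Fin 2) (α : Fin (2 * n + 2) → R) (F : Ten n R) :
    L A' (wedge1 α F) = KCF.wedge1 α (L A' F) := by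
  simp only [wedge1_apply, map_sum, hL.smul, hL.ext1]

theorem wedge2 (A' : Fin 2) (β : Fin (2 * n + 2) → Fin (2 * n + 2) → R) (F : Ten n R) :
    L A' (wedge2 β F) = KCF.wedge2 β (L A' F) := by
  simp only [wedge2_apply, map_sum, hL.smul, hL.ext1]

theorem hwedge1 (A' : Fin 2) (α : Fin (2 * n) → R) (F : Ten n R) :
    L A' (hwedge1 α F) = KCF.hwedge1 α (L A' F) := by
  simp only [hwedge1_apply, map_sum, hL.smul, hL.ext1]

theorem e (fr : Frame n R) (A' C : Fin 2) (F : Ten n R) : L A' (fr.e C F) = fr.e C (L A' F) :=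
  hL.wedge1 _ _ _

theorem hor (A' : Fin 2) {F : Ten n R} (hF : Hor F) : Hor (L A' F) := fun B => by
  rw [← hL.int1, hF, LinearMap.map_zero]

end FiberPair

/-- Needed for `j + 1 = k`, where the second component has degree zero in `s` and the chosen
`H_{A'}` are linear in `s`. -/
theorem partialS_sUp_of_degree_zero {N : ℕ} {τ : ℤ} {F : Ten n R} (hF : F ∈ Sec n R N 0 τ)
    (A' B' : Fin 2) : partialS A' (sUp B' F) = if A' = B' then F else 0 := by
  have h0 (p q : ℕ) (S : Finset (Fin (2 * n + 2))) (h : p + q ≠ 0) : F p q S = 0 :=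
    hF _ _ _ fun h' => h h'.1
  funext p q S
  fin_cases A' <;> fin_cases B'
  · rcases Nat.eq_zero_or_pos p with rfl | hp
    · simp [partialS, sUp]
    · simp [partialS, sUp, h0 p q S (by omega)]
  · rcases Nat.eq_zero_or_pos q with rfl | hq
    · simp [partialS, sUp]
    · simp [partialS, sUp, h0 (p + 1) (q - 1) S (by omega)]
  · rcases Nat.eq_zero_or_pos p with rfl | hp
    · simp [partialS, sUp]
    · simp [partialS, sUp, h0 (p - 1) (q + 1) S (by omega)]
  · rcases Nat.eq_zero_or_pos q with rfl | hq
    · simp [partialS, sUp]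
    · simp [partialS, sUp, h0 p q S (by omega)]

namespace Frame

variable (fr : Frame n R)

theorem pf_of_hor {f : Ten n R} (hf : Hor f) : fr.pf f = f := by
  have := fr.pf_decomp hf Hor.zero Hor.zero Hor.zero
  simpa only [LinearMap.map_zero, add_zero] using this

theorem decomp_eq_zero_iff {f H₀ H₁ K : Ten n R} (hf : Hor f) (h₀ : Hor H₀) (h₁ : Hor H₁)
    (hK : Hor K) : f + (fr.e 0 H₀ + fr.e 1 H₁) + fr.e 0 (fr.e 1 K) = 0 ↔
      f = 0 ∧ H₀ = 0 ∧ H₁ = 0 ∧ K = 0 := by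
  constructor
  · intro h
    have e0 := fr.pf_decomp hf h₀ h₁ hK
    have e1 := fr.pH_decomp hf h₀ h₁ hK
    have e2 := fr.pK_decomp hf h₀ h₁ hK
    rw [h, LinearMap.map_zero] at e0 e2
    rw [h, LinearMap.map_zero, LinearMap.map_zero] at e1
    exact ⟨e0.symm, e1.1.symm, e1.2.symm, e2.symm⟩
  · rintro ⟨rfl, rfl, rfl, rfl⟩
    simp only [LinearMap.map_zero, add_zero]

theorem e_e_eq_zero {F : Ten n R} (hF : Hor F) (h : fr.e 0 (fr.e 1 F) = 0) : F = 0 := by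
  refine ((fr.decomp_eq_zero_iff Hor.zero Hor.zero Hor.zero hF).1 ?_).2.2.2
  rw [h, LinearMap.map_zero, LinearMap.map_zero, add_zero, add_zero, add_zero]

/-- Every non-horizontal term of the expansion repeats one of the `Ω`'s. -/
theorem e_e_expand (F : Ten n R) : fr.e 0 (fr.e 1 F) = fr.e 0 (fr.e 1 (fr.pf F)) := by
  conv_lhs => rw [fr.eq_decomp F]
  simp only [LinearMap.map_add, e_one_zero, e_self, LinearMap.map_zero, LinearMap.map_neg, neg_zero, add_zero]

/-- The boundary condition of an operator of first order. -/
theorem sum_e_eq_zero_iff {L : Fin 2 → Ten n R →ₗ[ℂ] Ten n R} (hL : FiberPair L) (v : Ten n R) :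
    L 0 (fr.e 0 v) + L 1 (fr.e 1 v) = 0 ↔ L 0 (fr.pf v) = 0 ∧ L 1 (fr.pf v) = 0 ∧
      L 1 (fr.pH 0 v) - L 0 (fr.pH 1 v) = 0 := by
  -- The `K` component drops out, and reordering the two `Ω`'s combines the `H` components into one
  -- difference. Uniqueness of the expansion then gives the three conditions.
  have h : L 0 (fr.e 0 v) + L 1 (fr.e 1 v) = 0 + (fr.e 0 (L 0 (fr.pf v)) + fr.e 1 (L 1 (fr.pf v))) +
      fr.e 0 (fr.e 1 (-(L 1 (fr.pH 0 v) - L 0 (fr.pH 1 v)))) := by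
    conv_lhs => rw [fr.eq_decomp v]
    simp only [LinearMap.map_add, LinearMap.map_sub, LinearMap.map_neg, e_one_zero, e_self, LinearMap.map_zero, hL.e]
    abel
  rw [h, fr.decomp_eq_zero_iff Hor.zero (hL.hor _ (fr.hor_pf v)) (hL.hor _ (fr.hor_pf v))
    ((hL.hor _ (fr.hor_pH 0 v)).sub (hL.hor _ (fr.hor_pH 1 v))).neg, neg_eq_zero]
  exact ⟨fun h => h.2, fun h => ⟨rfl, h⟩⟩

end Frame

end FiberOperators

/-! ### Frame decomposition of the boundary conditions and of first-order operators. -/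

section BoundaryExpansions

variable {n : ℕ} (φ : GraphFn n) (U : TopologicalSpace.Opens (HSpace n))

theorem EB_e (C : Fin 2) (F : BTen φ U) : EB φ U ((fB φ U).e C F) = (fB φ U).e C (EB φ U F) :=
  wedge2_wedge1 _ _ _

theorem dB_zero_e_zero (F : BTen φ U) :
    dB φ U 0 ((fB φ U).e 0 F) = -(fB φ U).e 0 (dB φ U 0 F) := dB_e_self φ U 0 F

theorem dB_one_e_one (F : BTen φ U) :
    dB φ U 1 ((fB φ U).e 1 F) = -(fB φ U).e 1 (dB φ U 1 F) := dB_e_self φ U 1 F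

theorem dB_zero_e_one' (F : BTen φ U) : dB φ U 0 ((fB φ U).e 1 F) =
    -EB φ U F - (fB φ U).e 1 (dB φ U 0 F) := dB_zero_e_one φ U F

theorem dB_one_e_zero' (F : BTen φ U) : dB φ U 1 ((fB φ U).e 0 F) =
    EB φ U F - (fB φ U).e 0 (dB φ U 1 F) := dB_one_e_zero φ U F

/-- Under `Ω^{0'} ∧ Ω^{1'} ∧` the terms of `dB` with `𝐓` die, so the second-order boundary condition
contains only `𝔡`. -/
theorem e_e_dB (A' : Fin 2) {F : BTen φ U} :
    (fB φ U).e 0 ((fB φ U).e 1 (dB φ U A' F)) = (fB φ U).e 0 ((fB φ U).e 1 (frd φ U A' F)) := by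
  rw [dB_eq]
  simp only [LinearMap.map_add, Frame.e_one_zero, Frame.e_self, LinearMap.map_neg, neg_zero, add_zero]

theorem e_e_EB {F : BTen φ U} :
    (fB φ U).e 0 ((fB φ U).e 1 (EB φ U F)) = (fB φ U).e 0 ((fB φ U).e 1 (hwedge2 (E0 φ U) F)) := by
  rw [EB_eq]
  simp only [LinearMap.map_add, Frame.e_smul, Frame.e_one_zero, Frame.e_self, LinearMap.map_zero, LinearMap.map_neg, neg_zero,
    smul_zero, add_zero]

/-- The boundary condition of the operator of second order. -/
theorem second_order_condition_iff (v w : BTen φ U) :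
    ((fB φ U).e 0 ((fB φ U).e 1 v) = 0 ∧
      dB φ U 0 ((fB φ U).e 1 v) + (fB φ U).e 0 (dB φ U 1 v) + (fB φ U).e 0 ((fB φ U).e 1 w) = 0) ↔
    (fB φ U).pf v = 0 ∧ (fB φ U).pf w - (frd φ U 0 ((fB φ U).pH 0 v) + frd φ U 1 ((fB φ U).pH 1 v)) +
      hwedge2 (E0 φ U) ((fB φ U).pK v) = 0 := by
  have h1 : (fB φ U).e 0 ((fB φ U).e 1 v) = 0 ↔ (fB φ U).pf v = 0 := by
    rw [Frame.e_e_expand]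
    exact ⟨(fB φ U).e_e_eq_zero ((fB φ U).hor_pf v), fun h => by rw [h, LinearMap.map_zero, LinearMap.map_zero]⟩
  rw [h1]
  refine and_congr_right fun hf => ?_
  have hh : Hor ((fB φ U).pf w - (frd φ U 0 ((fB φ U).pH 0 v) + frd φ U 1 ((fB φ U).pH 1 v)) +
      hwedge2 (E0 φ U) ((fB φ U).pK v)) :=
    (((fB φ U).hor_pf w).sub ((Hor.frd φ U 0 ((fB φ U).hor_pH 0 v)).add
      (Hor.frd φ U 1 ((fB φ U).hor_pH 1 v)))).add (((fB φ U).hor_pK v).hwedge2 _)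
  -- With the horizontal part of `v` gone, everything left is divisible by `Ω^{0'} ∧ Ω^{1'}`, so the
  -- second condition is one equation between horizontal forms.
  have key : dB φ U 0 ((fB φ U).e 1 v) + (fB φ U).e 0 (dB φ U 1 v) + (fB φ U).e 0 ((fB φ U).e 1 w) =
      (fB φ U).e 0 ((fB φ U).e 1 ((fB φ U).pf w -
        (frd φ U 0 ((fB φ U).pH 0 v) + frd φ U 1 ((fB φ U).pH 1 v)) +
        hwedge2 (E0 φ U) ((fB φ U).pK v))) := by
    have hv := (fB φ U).eq_decomp v
    rw [hf, zero_add] at hv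
    obtain ⟨H₀, hH₀⟩ : ∃ x, (fB φ U).pH 0 v = x := ⟨_, rfl⟩
    obtain ⟨H₁, hH₁⟩ : ∃ x, (fB φ U).pH 1 v = x := ⟨_, rfl⟩
    obtain ⟨K, hK⟩ : ∃ x, (fB φ U).pK v = x := ⟨_, rfl⟩
    rw [hH₀, hH₁, hK] at hv ⊢
    rw [hv, Frame.e_e_expand _ w]
    simp only [LinearMap.map_add, LinearMap.map_sub, LinearMap.map_neg, LinearMap.map_zero, Frame.e_one_zero, Frame.e_self, dB_zero_e_zero,
      dB_one_e_one, dB_zero_e_one', dB_one_e_zero', EB_e, e_e_EB, e_e_dB, neg_zero, sub_zero,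
      neg_neg, add_zero]
    abel
  rw [key]
  exact ⟨(fB φ U).e_e_eq_zero hh, fun h => by rw [h, LinearMap.map_zero, LinearMap.map_zero]⟩

variable {L : Fin 2 → BTen φ U →ₗ[ℂ] BTen φ U} (hL : FiberPair L)

include hL

theorem FiberPair.frd (A' B' : Fin 2) (F : BTen φ U) :
    L A' (frd φ U B' F) = KCF.frd φ U B' (L A' F) := by
  simp only [frd_apply, map_sum, hL.ext1, hL.mapT]

/-- The frame decomposition of the restriction of an operator of first order. -/
theorem sum_dB_decomp (f H₀ H₁ : BTen φ U) :
    L 0 (dB φ U 0 (f + ((fB φ U).e 0 H₀ + (fB φ U).e 1 H₁))) +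
      L 1 (dB φ U 1 (f + ((fB φ U).e 0 H₀ + (fB φ U).e 1 H₁))) =
    (L 0 (frd φ U 0 f) + L 1 (frd φ U 1 f) + hwedge2 (E0 φ U) (L 1 H₀ - L 0 H₁)) +
      ((fB φ U).e 0 (L 0 (Top φ U 0 0 f) + L 1 (Top φ U 0 1 f) +
          hwedge1 (E1 φ U 0) (L 1 H₀ - L 0 H₁) - (L 0 (frd φ U 0 H₀) + L 1 (frd φ U 1 H₀))) +
        (fB φ U).e 1 (L 0 (Top φ U 1 0 f) + L 1 (Top φ U 1 1 f) +
          hwedge1 (E1 φ U 1) (L 1 H₀ - L 0 H₁) - (L 0 (frd φ U 0 H₁) + L 1 (frd φ U 1 H₁)))) +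
      (fB φ U).e 0 ((fB φ U).e 1 (E01 φ U • (L 1 H₀ - L 0 H₁) -
        (L 0 (Top φ U 1 0 H₀) + L 1 (Top φ U 1 1 H₀)) +
        (L 0 (Top φ U 0 0 H₁) + L 1 (Top φ U 0 1 H₁)))) := by
  -- Only the mixed products `dB^{0'} Ω^{1'}` and `dB^{1'} Ω^{0'}` produce `ℰ`, with opposite signs.
  -- Hence `ℰ` meets exactly the combination that is the second component of `Π_j`.
  have h1 : L 0 (dB φ U 0 (f + ((fB φ U).e 0 H₀ + (fB φ U).e 1 H₁))) +
      L 1 (dB φ U 1 (f + ((fB φ U).e 0 H₀ + (fB φ U).e 1 H₁))) =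
      L 0 (dB φ U 0 f) + L 1 (dB φ U 1 f) + EB φ U (L 1 H₀ - L 0 H₁) -
        (fB φ U).e 0 (L 0 (dB φ U 0 H₀) + L 1 (dB φ U 1 H₀)) -
        (fB φ U).e 1 (L 0 (dB φ U 0 H₁) + L 1 (dB φ U 1 H₁)) := by
    have hE (A' : Fin 2) (F : BTen φ U) : L A' (EB φ U F) = EB φ U (L A' F) := hL.wedge2 _ _ _
    simp only [LinearMap.map_add, LinearMap.map_sub, LinearMap.map_neg, dB_zero_e_zero, dB_one_e_one, dB_zero_e_one',
      dB_one_e_zero', hL.e, hE]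
    abel
  rw [h1, EB_eq]
  simp only [dB_eq, LinearMap.map_add, LinearMap.map_sub, hL.e, Frame.e_one_zero, Frame.e_self, smul_sub, Frame.e_smul]
  abel

end BoundaryExpansions

/-! ### The maps `Π_j` -/

/-- The operators `∂_{A'}` (`j < k`) and `s_{A'}` (`j > k`). -/
def fib {n : ℕ} {R : Type} [CommRing R] [Algebra ℂ R] (k j : ℕ) (A' : Fin 2) :
    Ten n R →ₗ[ℂ] Ten n R := if j < k then partialS A' else sLow A'

theorem fiberPair_fib {n : ℕ} {R : Type} [CommRing R] [Algebra ℂ R] (k j : ℕ) :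
    FiberPair (n := n) (R := R) (fib k j) := by
  by_cases h : j < k
  · have : (fib k j : Fin 2 → Ten n R →ₗ[ℂ] Ten n R) = partialS := funext fun _ => if_pos h
    rw [this]; exact fiberPair_partialS
  · have : (fib k j : Fin 2 → Ten n R →ₗ[ℂ] Ten n R) = sLow := funext fun _ => if_neg h
    rw [this]; exact fiberPair_sLow

theorem fib_of_lt {n : ℕ} {R : Type} [CommRing R] [Algebra ℂ R] {k j : ℕ} (h : j < k)
    (A' : Fin 2) : (fib k j A' : Ten n R →ₗ[ℂ] Ten n R) = partialS A' := if_pos h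

theorem fib_of_ge {n : ℕ} {R : Type} [CommRing R] [Algebra ℂ R] {k j : ℕ} (h : k ≤ j)
    (A' : Fin 2) : (fib k j A' : Ten n R →ₗ[ℂ] Ten n R) = sLow A' := if_neg (not_lt.2 h)

theorem fib_mem {n : ℕ} {R : Type} [CommRing R] [Algebra ℂ R] {k j : ℕ} (h : j ≠ k) {N : ℕ} {τ : ℤ}
    (A' : Fin 2) {F : Ten n R} (hF : F ∈ Sec n R N (sig k j) τ) :
    fib k j A' F ∈ Sec n R N (sig k (j + 1)) τ := by
  rcases lt_or_gt_of_ne h with h | h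
  · rw [fib_of_lt h]
    exact partialS_mem (Sec_congr hF (by unfold sig; split_ifs <;> omega) rfl)
  · rw [fib_of_ge h.le]
    exact Sec_congr (sLow_mem hF) (by unfold sig; split_ifs <;> omega) rfl

theorem eq_zero_of_fib {n : ℕ} {R : Type} [CommRing R] [Algebra ℂ R] {k j : ℕ} {N : ℕ}
    {τ : ℤ} {F : Ten n R} (hF : F ∈ Sec n R N (sig k j) τ) (h0 : fib k j 0 F = 0)
    (h1 : fib k j 1 F = 0) : F = 0 := by
  rcases lt_or_ge j k with h | h
  · rw [fib_of_lt h] at h0 h1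
    exact eq_zero_of_partialS hF (by unfold sig; split_ifs <;> omega) (Fin.forall_fin_two.2 ⟨h0, h1⟩)
  · rw [fib_of_ge h, sLow_one] at h1
    exact eq_zero_of_sUp h1

/-- The equation `L_1 H_0 - L_0 H_1 = F`, with `L = ∂` or `L = s`. -/
theorem exists_fib_sub_eq {n : ℕ} {R : Type} [CommRing R] [Algebra ℂ R] {k j : ℕ} (h : j ≠ k) {N : ℕ}
    {τ : ℤ} {F : Ten n R} (hF : F ∈ Sec n R N (sig k (j + 1)) τ) :
    ∃ H₀ ∈ Sec n R N (sig k j) τ, ∃ H₁ ∈ Sec n R N (sig k j) τ,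
      fib k j 1 H₀ - fib k j 0 H₁ = F ∧ (j + 1 = k → partialS 0 H₀ = 0 ∧ partialS 1 H₁ = 0 ∧
        partialS 1 H₀ = (1 / 2 : ℂ) • F ∧ partialS 0 H₁ = -((1 / 2 : ℂ) • F)) := by
  rcases lt_or_gt_of_ne h with h | h
  · obtain ⟨σ, hσ⟩ : ∃ σ, sig k (j + 1) = σ := ⟨_, rfl⟩
    have hσ' : sig k j = σ + 1 := by rw [← hσ]; unfold sig; split_ifs <;> omega
    rw [hσ] at hF
    rw [hσ']
    have h2 : ((σ : ℂ) + 2) ≠ 0 := by exact_mod_cast (show σ + 2 ≠ 0 by omega)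
    -- This choice turns the equation into Euler's identity `∂_{A'} s^{A'} = σ + 2`. For `σ = 0` its
    -- symmetry produces the halves in `𝒟_{k-1}`.
    refine ⟨((σ : ℂ) + 2)⁻¹ • sUp 1 F, Submodule.smul_mem _ _ (sUp_mem hF),
      -(((σ : ℂ) + 2)⁻¹ • sUp 0 F), Submodule.neg_mem _ (Submodule.smul_mem _ _ (sUp_mem hF)), ?_, ?_⟩
    · rw [fib_of_lt h, fib_of_lt h, LinearMap.map_neg, LinearMap.map_smul, LinearMap.map_smul, sub_neg_eq_add, ← smul_add,
        sum_partialS_sUp hF, smul_smul, inv_mul_cancel₀ h2, one_smul]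
    · intro hjk
      have hσ0 : σ = 0 := by rw [← hσ, hjk]; simp [sig]
      subst hσ0
      have h3 : (((0 : ℕ) : ℂ) + 2)⁻¹ = 1 / 2 := by norm_num
      rw [LinearMap.map_smul, LinearMap.map_neg, LinearMap.map_neg, LinearMap.map_smul, LinearMap.map_smul, LinearMap.map_smul, h3,
        partialS_sUp_of_degree_zero hF, partialS_sUp_of_degree_zero hF,
        partialS_sUp_of_degree_zero hF, partialS_sUp_of_degree_zero hF]
      simp
  · obtain ⟨σ, hσ⟩ : ∃ σ, sig k j = σ := ⟨_, rfl⟩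
    have hσ' : sig k (j + 1) = σ + 1 := by rw [← hσ]; unfold sig; split_ifs <;> omega
    rw [hσ'] at hF
    rw [hσ]
    have h2 : (((σ + 1 : ℕ) : ℂ)) ≠ 0 := by exact_mod_cast Nat.succ_ne_zero σ
    -- Since `s_{1'} = s^{0'}` and `s_{0'} = -s^{1'}`, the left side becomes `s^{A'} ∂_{A'} F`, that
    -- is the degree `σ + 1` of `F` times `F`, divided by `σ + 1`.
    refine ⟨((σ + 1 : ℕ) : ℂ)⁻¹ • partialS 0 F, Submodule.smul_mem _ _ (partialS_mem hF),
      ((σ + 1 : ℕ) : ℂ)⁻¹ • partialS 1 F, Submodule.smul_mem _ _ (partialS_mem hF), ?_,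
      fun h' => by omega⟩
    rw [fib_of_ge h.le, fib_of_ge h.le, LinearMap.map_smul, LinearMap.map_smul, sLow_one, sLow_zero, LinearMap.neg_apply,
      ← smul_sub, sub_neg_eq_add, sum_sUp_partialS hF, smul_smul, inv_mul_cancel₀ h2, one_smul]

/-! ### Quotients of section spaces by the kernel of a surjection. -/

section Quotient

variable {n : ℕ} {R R' : Type} [CommRing R] [Algebra ℂ R] [CommRing R'] [Algebra ℂ R']
  {N N₁ N₂ σ σ₁ σ₂ : ℕ} {τ τ₁ τ₂ : ℤ} {J : Submodule ℂ (Sec n R N σ τ)}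

/-- The isomorphism induced by a surjective map. -/
def secQuotEquiv (p : Sec n R N σ τ →ₗ[ℂ] (Sec n R' N₁ σ₁ τ₁ × Sec n R' N₂ σ₂ τ₂)) (hJ : J = LinearMap.ker p)
    (hp : Function.Surjective p) : SecQuot J ≃ₗ[ℂ] (Sec n R' N₁ σ₁ τ₁ × Sec n R' N₂ σ₂ τ₂) :=
  (Submodule.quotEquivOfEq _ _ hJ).trans (p.quotKerEquivOfSurjective hp)

theorem secQuotEquiv_mk (p : Sec n R N σ τ →ₗ[ℂ] (Sec n R' N₁ σ₁ τ₁ × Sec n R' N₂ σ₂ τ₂)) (hJ : J = LinearMap.ker p)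
    (hp : Function.Surjective p) (u : Sec n R N σ τ) :
    secQuotEquiv p hJ hp (secMk J u) = p u := rfl

end Quotient

section Pi

variable {n : ℕ} (φ : GraphFn n) (U : TopologicalSpace.Opens (HSpace n))

theorem bSec2_of_ne {k j : ℕ} (h : j ≠ k) : bSec2 φ U k j =
    Sec n (SmoothFn (bdry φ U)) (2 * n) (sig k (j + 1)) (tau k j - 1) := by
  rw [bSec2, if_neg h, if_neg h]

theorem bSec2_self (k : ℕ) : bSec2 φ U k k = Sec n (SmoothFn (bdry φ U)) (2 * n) 0 (k : ℤ) := by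
  rw [bSec2, if_pos rfl, if_pos rfl]

theorem toBdry_mem {N σ : ℕ} {τ : ℤ} {u : Ten n (SmoothFn (U : Set (HSpace n)))}
    (hu : u ∈ Sec n (SmoothFn (U : Set (HSpace n))) N σ τ) :
    toBdry φ U u ∈ Sec n (SmoothFn (bdry φ U)) N σ τ := mapT_mem _ hu

/-- The second component of `Π_j[u]` in terms of the restrictions `v`, `w` of `u` and of
`∂u/∂x_{4n+1}`. -/
def jetSnd (k j : ℕ) : BTen φ U × BTen φ U →ₗ[ℂ] BTen φ U :=
  let V := LinearMap.fst ℂ (BTen φ U) (BTen φ U)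
  let W := LinearMap.snd ℂ (BTen φ U) (BTen φ U)
  if j = k then
    -- The frame is constant in `x_{4n+1}`, so the horizontal part of `∂_{4n+1} u` is `∂_{4n+1} f`.
    (fB φ U).pf ∘ₗ W - (frd φ U 0 ∘ₗ (fB φ U).pH 0 + frd φ U 1 ∘ₗ (fB φ U).pH 1) ∘ₗ V +
      hwedge2 (E0 φ U) ∘ₗ (fB φ U).pK ∘ₗ V
  else (fib k j 1 ∘ₗ (fB φ U).pH 0 - fib k j 0 ∘ₗ (fB φ U).pH 1) ∘ₗ V

theorem jetSnd_self (k : ℕ) (v w : BTen φ U) : jetSnd φ U k k (v, w) =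
    (fB φ U).pf w - (frd φ U 0 ((fB φ U).pH 0 v) + frd φ U 1 ((fB φ U).pH 1 v)) +
      hwedge2 (E0 φ U) ((fB φ U).pK v) := by
  rw [jetSnd, if_pos rfl]; rfl

theorem jetSnd_of_ne {k j : ℕ} (h : j ≠ k) (v w : BTen φ U) : jetSnd φ U k j (v, w) =
    fib k j 1 ((fB φ U).pH 0 v) - fib k j 0 ((fB φ U).pH 1 v) := by
  rw [jetSnd, if_neg h]; rfl

theorem jetSnd_mem {k j : ℕ} {v w : BTen φ U}
    (hv : v ∈ Sec n (SmoothFn (bdry φ U)) (2 * n + 2) (sig k j) (tau k j))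
    (hw : w ∈ Sec n (SmoothFn (bdry φ U)) (2 * n + 2) (sig k j) (tau k j)) :
    jetSnd φ U k j (v, w) ∈ bSec2 φ U k j := by
  by_cases h : j = k
  · subst h
    have hσ : sig j j = 0 := by simp [sig]
    have hτ : tau j j = j := by simp [tau]
    have hv' := Sec_congr hv hσ hτ
    have hw' := Sec_congr hw hσ hτ
    rw [jetSnd_self, bSec2_self]
    have hd (A' : Fin 2) := frd_mem φ U A' ((fB φ U).pH_mem A' hv')
    have hE := hwedge2_mem (E0 φ U) ((fB φ U).pK_mem hv')
    exact Submodule.add_mem _ (Submodule.sub_mem _ ((fB φ U).pf_mem hw')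
      (Submodule.add_mem _ (Sec_congr (hd 0) rfl (by ring)) (Sec_congr (hd 1) rfl (by ring))))
      (Sec_congr hE rfl (by ring))
  · rw [jetSnd_of_ne φ U h, bSec2_of_ne φ U h]
    exact Submodule.sub_mem _ (fib_mem h _ ((fB φ U).pH_mem 0 hv))
      (fib_mem h _ ((fB φ U).pH_mem 1 hv))

/-- The restrictions of a section and of its derivative in the direction `x_{4n+1}`. -/
def jet : Ten n (SmoothFn (U : Set (HSpace n))) →ₗ[ℂ] BTen φ U × BTen φ U :=
  (toBdry φ U).prod (toBdry φ U ∘ₗ mapT (pd U (nIdx n)))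

/-- The map that induces `Π_j`. -/
def piMap (k j : ℕ) : cfSec U k j →ₗ[ℂ] bSec1 φ U k j × bSec2 φ U k j :=
  (((fB φ U).pf ∘ₗ toBdry φ U ∘ₗ (cfSec U k j).subtype).codRestrict (bSec1 φ U k j)
    fun u => (fB φ U).pf_mem (toBdry_mem φ U u.2)).prod
  ((jetSnd φ U k j ∘ₗ jet φ U ∘ₗ (cfSec U k j).subtype).codRestrict (bSec2 φ U k j)
    fun u => jetSnd_mem φ U (toBdry_mem φ U u.2) (toBdry_mem φ U (mapT_mem _ u.2)))

theorem piMap_fst {k j : ℕ} (u : cfSec U k j) :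
    (piMap φ U k j u).1.1 = (fB φ U).pf (toBdry φ U u.1) := rfl

theorem piMap_snd {k j : ℕ} (u : cfSec U k j) : (piMap φ U k j u).2.1 =
    jetSnd φ U k j (toBdry φ U u.1, toBdry φ U (mapT (pd U (nIdx n)) u.1)) := rfl

theorem piMap_eq_zero_iff {k j : ℕ} (u : cfSec U k j) : piMap φ U k j u = 0 ↔
    (fB φ U).pf (toBdry φ U u.1) = 0 ∧
      jetSnd φ U k j (toBdry φ U u.1, toBdry φ U (mapT (pd U (nIdx n)) u.1)) = 0 := by
  rw [← piMap_fst, ← piMap_snd, Prod.ext_iff, Subtype.ext_iff, Subtype.ext_iff]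
  rfl

/-- The kernel of `Π_j` consists of the sections with zero Cauchy data. -/
theorem ker_piMap {k j : ℕ} (hj : j ≤ 2 * n) :
    cauchyJ U (dom φ) k j = LinearMap.ker (piMap φ U k j) := by
  ext u
  rw [LinearMap.mem_ker, piMap_eq_zero_iff]
  have hm := (fB φ U).pf_mem (toBdry_mem φ U u.2)
  have key (h : j ≠ k) : fib k j 0 ((fB φ U).e 0 (toBdry φ U u.1)) +
      fib k j 1 ((fB φ U).e 1 (toBdry φ U u.1)) = 0 ↔ (fB φ U).pf (toBdry φ U u.1) = 0 ∧
        jetSnd φ U k j (toBdry φ U u.1, toBdry φ U (mapT (pd U (nIdx n)) u.1)) = 0 := by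
    rw [(fB φ U).sum_e_eq_zero_iff (fiberPair_fib k j), jetSnd_of_ne φ U h, ← and_assoc]
    -- The two conditions on the horizontal part say together that it vanishes.
    exact and_congr_left' ⟨fun h' => eq_zero_of_fib hm h'.1 h'.2,
      fun h' => by rw [h', LinearMap.map_zero, LinearMap.map_zero]; exact ⟨rfl, rfl⟩⟩
  rcases lt_trichotomy j k with h | h | h
  · rw [mem_cauchyJ_of_lt φ hj h, ← key h.ne, fib_of_lt h, fib_of_lt h]
  · subst h
    rw [mem_cauchyJ_of_eq φ hj, second_order_condition_iff, jetSnd_self]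
  · rw [mem_cauchyJ_of_between φ hj h, ← key h.ne', fib_of_ge h.le, fib_of_ge h.le, sLow_zero,
      sLow_one, LinearMap.neg_apply, sub_eq_neg_add]

theorem hor_of_bSec1 {k j : ℕ} (F : bSec1 φ U k j) : Hor F.1 := Sec.hor F.2

theorem hor_of_bSec2 {k j : ℕ} (F : bSec2 φ U k j) : Hor F.1 := Sec.hor F.2

/-- Sections with given image under `Π_j` and simple normal derivatives, for `j ≠ k`. -/
theorem exists_lift_of_ne {k j : ℕ} (h : j ≠ k) (F : bSec1 φ U k j × bSec2 φ U k j) :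
    ∃ (u : cfSec U k j) (H₀ H₁ : BTen φ U), Hor H₀ ∧ Hor H₁ ∧ fib k j 1 H₀ - fib k j 0 H₁ = F.2.1 ∧
      (j + 1 = k → partialS 0 H₀ = 0 ∧ partialS 1 H₁ = 0 ∧
        partialS 1 H₀ = (1 / 2 : ℂ) • F.2.1 ∧ partialS 0 H₁ = -((1 / 2 : ℂ) • F.2.1)) ∧
      toBdry φ U u.1 = F.1.1 + ((fB φ U).e 0 H₀ + (fB φ U).e 1 H₁) ∧
      toBdry φ U (mapT (pd U (nIdx n)) u.1) = 0 ∧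
      toBdry φ U (mapT (pd U (nIdx n)) (mapT (pd U (nIdx n)) u.1)) = 0 := by
  have h2 := Sec_congr F.2.2 (if_neg h) (if_neg h)
  obtain ⟨H₀, hH₀, H₁, hH₁, e1, e2⟩ := exists_fib_sub_eq h h2
  have hm (C : Fin 2) {H : BTen φ U}
      (hH : H ∈ Sec n (SmoothFn (bdry φ U)) (2 * n) (sig k j) (tau k j - 1)) :
      (fB φ U).e C H ∈ Sec n (SmoothFn (bdry φ U)) (2 * n + 2) (sig k j) (tau k j) :=
    Sec_congr ((fB φ U).e_mem C (Sec_mono (by omega) hH)) rfl (by ring)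
  have hv : F.1.1 + ((fB φ U).e 0 H₀ + (fB φ U).e 1 H₁) ∈
      Sec n (SmoothFn (bdry φ U)) (2 * n + 2) (sig k j) (tau k j) :=
    Submodule.add_mem _ (Sec_mono (by omega) F.1.2) (Submodule.add_mem _ (hm 0 hH₀) (hm 1 hH₁))
  obtain ⟨u, hu, h1, h2, h3⟩ := exists_lift_Sec φ U hv (Submodule.zero_mem _)
  exact ⟨⟨u, hu⟩, H₀, H₁, Sec.hor hH₀, Sec.hor hH₁, e1, e2, h1, h2, h3⟩

/-- Sections with given image under `Π_k` and simple normal derivatives. -/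
theorem exists_lift_self {k : ℕ} (F : bSec1 φ U k k × bSec2 φ U k k) :
    ∃ u : cfSec U k k, toBdry φ U u.1 = F.1.1 ∧ toBdry φ U (mapT (pd U (nIdx n)) u.1) = F.2.1 ∧
      toBdry φ U (mapT (pd U (nIdx n)) (mapT (pd U (nIdx n)) u.1)) = 0 := by
  have h2 := Sec_congr F.2.2 (if_pos rfl) (if_pos rfl)
  have h2' : F.2.1 ∈ Sec n (SmoothFn (bdry φ U)) (2 * n) (sig k k) (tau k k) :=
    Sec_congr h2 (by simp [sig]) (by simp [tau])
  obtain ⟨u, hu, h⟩ := exists_lift_Sec φ U (Sec_mono (show 2 * n ≤ 2 * n + 2 by omega) F.1.2)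
    (Sec_mono (show 2 * n ≤ 2 * n + 2 by omega) h2')
  exact ⟨⟨u, hu⟩, h⟩

theorem piMap_of_lift_of_ne {k j : ℕ} (h : j ≠ k) {F : bSec1 φ U k j × bSec2 φ U k j}
    {u : cfSec U k j} {H₀ H₁ : BTen φ U} (h₀ : Hor H₀) (h₁ : Hor H₁)
    (hF : fib k j 1 H₀ - fib k j 0 H₁ = F.2.1)
    (hu : toBdry φ U u.1 = F.1.1 + ((fB φ U).e 0 H₀ + (fB φ U).e 1 H₁)) : piMap φ U k j u = F := by
  have hu' : toBdry φ U u.1 = F.1.1 + ((fB φ U).e 0 H₀ + (fB φ U).e 1 H₁) +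
      (fB φ U).e 0 ((fB φ U).e 1 0) := by
    rw [hu, LinearMap.map_zero, LinearMap.map_zero, add_zero]
  have hf := hor_of_bSec1 φ U F.1
  refine Prod.ext (Subtype.ext ?_) (Subtype.ext ?_)
  · rw [piMap_fst, hu', (fB φ U).pf_decomp hf h₀ h₁ Hor.zero]
  · rw [piMap_snd, jetSnd_of_ne φ U h, hu', ((fB φ U).pH_decomp hf h₀ h₁ Hor.zero).1,
      ((fB φ U).pH_decomp hf h₀ h₁ Hor.zero).2, hF]

theorem Frame.pH_pK_of_hor {R : Type} [CommRing R] [Algebra ℂ R] (fr : Frame n R) {f : Ten n R}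
    (hf : Hor f) : fr.pH 0 f = 0 ∧ fr.pH 1 f = 0 ∧ fr.pK f = 0 := by
  have h1 := fr.pH_decomp hf Hor.zero Hor.zero Hor.zero
  have h2 := fr.pK_decomp hf Hor.zero Hor.zero Hor.zero
  simp only [LinearMap.map_zero, add_zero] at h1 h2
  exact ⟨h1.1, h1.2, h2⟩

theorem piMap_of_lift_self {k : ℕ} {F : bSec1 φ U k k × bSec2 φ U k k} {u : cfSec U k k}
    (hu : toBdry φ U u.1 = F.1.1) (hu' : toBdry φ U (mapT (pd U (nIdx n)) u.1) = F.2.1) :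
    piMap φ U k k u = F := by
  have hf := hor_of_bSec1 φ U F.1
  have hg := hor_of_bSec2 φ U F.2
  obtain ⟨h0, h1, hK⟩ := (fB φ U).pH_pK_of_hor hf
  refine Prod.ext (Subtype.ext ?_) (Subtype.ext ?_)
  · rw [piMap_fst, hu, (fB φ U).pf_of_hor hf]
  · rw [piMap_snd, jetSnd_self, hu, hu', h0, h1, hK, LinearMap.map_zero, LinearMap.map_zero, LinearMap.map_zero, add_zero, add_zero,
      sub_zero, (fB φ U).pf_of_hor hg]

theorem piMap_surjective (k j : ℕ) : Function.Surjective (piMap φ U k j) := by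
  intro F
  by_cases h : j = k
  · subst h
    obtain ⟨u, h1, h2, -⟩ := exists_lift_self φ U F
    exact ⟨u, piMap_of_lift_self φ U h1 h2⟩
  · obtain ⟨u, H₀, H₁, h₀, h₁, hF, -, hu, -⟩ := exists_lift_of_ne φ U h F
    exact ⟨u, piMap_of_lift_of_ne φ U h h₀ h₁ hF hu⟩

/-- The isomorphism `Π_j`. -/
def piEquiv (k j : ℕ) (hj : j ≤ 2 * n) :
    cfQuot φ U k j ≃ₗ[ℂ] (bSec1 φ U k j × bSec2 φ U k j) :=
  secQuotEquiv (piMap φ U k j) (ker_piMap φ U hj) (piMap_surjective φ U k j)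

theorem piEquiv_mk {k j : ℕ} (hj : j ≤ 2 * n) (u : cfSec U k j) :
    piEquiv φ U k j hj (cfQuotMk φ U k j u) = piMap φ U k j u := secQuotEquiv_mk _ _ _ _

end Pi

/-! ### The operators of the boundary complex -/

/-- Because of this principle the intertwining relation has to be checked on only one lift of each
boundary section. -/
theorem apply_eq_of_ker {M M₁ M₂ : Type} [AddCommGroup M] [Module ℂ M] [AddCommGroup M₁]
    [Module ℂ M₁] [AddCommGroup M₂] [Module ℂ M₂] (p : M →ₗ[ℂ] M₁) (q : M →ₗ[ℂ] M₂)
    (h : ∀ u, p u = 0 → q u = 0) {u u' : M} (hu : p u = p u') : q u = q u' := by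
  have := h (u - u') (by rw [LinearMap.map_sub, hu, sub_self])
  rwa [LinearMap.map_sub, sub_eq_zero] at this

theorem Sec_eq_of_ker {n : ℕ} {R R' : Type} [CommRing R] [Algebra ℂ R] [CommRing R']
    [Algebra ℂ R'] {N N' N₁ N₂ N₃ N₄ σ σ' σ₁ σ₂ σ₃ σ₄ : ℕ} {τ τ' τ₁ τ₂ τ₃ τ₄ : ℤ}
    (p : Sec n R N σ τ →ₗ[ℂ] (Sec n R' N₁ σ₁ τ₁ × Sec n R' N₂ σ₂ τ₂))
    (D : Sec n R N σ τ →ₗ[ℂ] Sec n R N' σ' τ')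
    (q : Sec n R N' σ' τ' →ₗ[ℂ] (Sec n R' N₃ σ₃ τ₃ × Sec n R' N₄ σ₄ τ₄))
    (h : ∀ u, p u = 0 → q (D u) = 0) {u u' : Sec n R N σ τ} (hu : p u = p u') :
    q (D u) = q (D u') := apply_eq_of_ker p (q ∘ₗ D) h hu

theorem Frame.proj_of_eq {n : ℕ} {R : Type} [CommRing R] [Algebra ℂ R] (fr : Frame n R)
    {v f H₀ H₁ K : Ten n R} (hf : Hor f) (h₀ : Hor H₀) (h₁ : Hor H₁) (hK : Hor K)
    (hv : v = f + (fr.e 0 H₀ + fr.e 1 H₁) + fr.e 0 (fr.e 1 K)) :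
    fr.pf v = f ∧ fr.pH 0 v = H₀ ∧ fr.pH 1 v = H₁ ∧ fr.pK v = K := by
  subst hv
  exact ⟨fr.pf_decomp hf h₀ h₁ hK, (fr.pH_decomp hf h₀ h₁ hK).1, (fr.pH_decomp hf h₀ h₁ hK).2,
    fr.pK_decomp hf h₀ h₁ hK⟩

theorem sum_comp_apply {M : Type} [AddCommGroup M] [Module ℂ M] (s d w t t' : Fin 2 → M →ₗ[ℂ] M)
    (T e e' : M →ₗ[ℂ] M) (x y : M) :
    (∑ A' : Fin 2, s A' ∘ₗ (-(d A' ∘ₗ LinearMap.snd ℂ M M) -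
        w A' ∘ₗ (T ∘ₗ LinearMap.fst ℂ M M + LinearMap.snd ℂ M M) +
        t A' ∘ₗ e ∘ₗ LinearMap.fst ℂ M M - e' ∘ₗ t' A' ∘ₗ LinearMap.fst ℂ M M)) (x, y) =
      s 0 (-d 0 y - w 0 (T x + y) + t 0 (e x) - e' (t' 0 x)) +
        s 1 (-d 1 y - w 1 (T x + y) + t 1 (e x) - e' (t' 1 x)) := by
  rw [Fin.sum_univ_two]
  rfl

section Intertwining

variable {n : ℕ} (φ : GraphFn n) (U : TopologicalSpace.Opens (HSpace n))

theorem toBdry_fib (k j : ℕ) (A' : Fin 2) (F : Ten n (SmoothFn (U : Set (HSpace n)))) :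
    toBdry φ U (fib k j A' F) = fib k j A' (toBdry φ U F) := by
  by_cases h : j < k
  · rw [fib_of_lt h, fib_of_lt h, toBdry_partialS]
  · rw [fib_of_ge (not_lt.1 h), fib_of_ge (not_lt.1 h), sLow, sLow, LinearMap.sum_apply,
      LinearMap.sum_apply, map_sum]
    exact Finset.sum_congr rfl fun B _ => by
      rw [LinearMap.smul_apply, LinearMap.smul_apply, LinearMap.map_smul, toBdry_sUp]

theorem cfOp_of_ne {k j : ℕ} (hj : j ≤ 2 * n) (h : j ≠ k)
    (u : Ten n (SmoothFn (U : Set (HSpace n)))) :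
    cfOp U k j u = fib k j 0 (dUp U 0 u) + fib k j 1 (dUp U 1 u) := by
  rcases lt_or_gt_of_ne h with h | h
  · rw [cfOp_of_lt hj h, fib_of_lt h, fib_of_lt h]
  · rw [cfOp_of_between hj h, fib_of_ge h.le, fib_of_ge h.le, sLow_zero, sLow_one,
      LinearMap.neg_apply, sub_eq_neg_add]

theorem toBdry_cfOp_of_ne {k j : ℕ} (hj : j ≤ 2 * n) (h : j ≠ k)
    {u : Ten n (SmoothFn (U : Set (HSpace n)))} (hu : toBdry φ U (mapT (pd U (nIdx n)) u) = 0) :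
    toBdry φ U (cfOp U k j u) =
      fib k j 0 (dB φ U 0 (toBdry φ U u)) + fib k j 1 (dB φ U 1 (toBdry φ U u)) := by
  rw [cfOp_of_ne U hj h, LinearMap.map_add, toBdry_fib, toBdry_fib, toBdry_dUp, toBdry_dUp, hu, LinearMap.map_zero,
    LinearMap.map_zero, add_zero, add_zero]

theorem pd_nIdx_cfOp_of_ne {k j : ℕ} (hj : j ≤ 2 * n) (h : j ≠ k)
    (u : Ten n (SmoothFn (U : Set (HSpace n)))) :
    mapT (pd U (nIdx n)) (cfOp U k j u) = cfOp U k j (mapT (pd U (nIdx n)) u) := by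
  rw [cfOp_of_ne U hj h, cfOp_of_ne U hj h, LinearMap.map_add, ← (fiberPair_fib k j).mapT,
    ← (fiberPair_fib k j).mapT, pd_nIdx_dUp, pd_nIdx_dUp]

theorem bD1_of_ne {k j : ℕ} (h : j ≠ k) (F₁ F₂ : BTen φ U) : bD1 φ U k j (F₁, F₂) =
    fib k j 0 (frd φ U 0 F₁) + fib k j 1 (frd φ U 1 F₁) + hwedge2 (E0 φ U) F₂ := by
  rw [bD1, if_neg h]
  rcases lt_or_gt_of_ne h with h | h
  · rw [if_pos h, Fin.sum_univ_two, fib_of_lt h, fib_of_lt h]; rfl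
  · rw [if_neg (by omega), Fin.sum_univ_two, fib_of_ge h.le, fib_of_ge h.le]; rfl

theorem bD1_self (k : ℕ) (F₁ F₂ : BTen φ U) : bD1 φ U k k (F₁, F₂) =
    frd φ U 0 (frd φ U 1 F₁) - hwedge2 (E0 φ U) (Top φ U 1 1 F₁ + F₂) := by
  rw [bD1, if_pos rfl, ← TopUp_zero]; rfl

theorem bD2_of_ne {k j : ℕ} (h : j ≠ k) (h' : j + 1 ≠ k) (F₁ F₂ : BTen φ U) :
    bD2 φ U k j (F₁, F₂) =
      -(fib k j 0 (frd φ U 0 F₂ + hwedge1 (E1 φ U 1) F₂) +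
        fib k j 1 (frd φ U 1 F₂ - hwedge1 (E1 φ U 0) F₂)) -
      (fib k j 0 (fib k j 0 (Top φ U 1 0 F₁)) - fib k j 0 (fib k j 1 (Top φ U 0 0 F₁)) +
        (fib k j 1 (fib k j 0 (Top φ U 1 1 F₁)) - fib k j 1 (fib k j 1 (Top φ U 0 1 F₁)))) := by
  have key (L : Fin 2 → BTen φ U →ₗ[ℂ] BTen φ U) :
      (-(∑ A' : Fin 2, L A' ∘ₗ (frd φ U A' + hwedge1 (E1Up φ U A')) ∘ₗ
          LinearMap.snd ℂ (BTen φ U) (BTen φ U)) - ∑ A' : Fin 2, ∑ B' : Fin 2,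
            L A' ∘ₗ L B' ∘ₗ TopUp φ U A' B' ∘ₗ LinearMap.fst ℂ (BTen φ U) (BTen φ U)) (F₁, F₂) =
      -(L 0 (frd φ U 0 F₂ + hwedge1 (E1 φ U 1) F₂) + L 1 (frd φ U 1 F₂ - hwedge1 (E1 φ U 0) F₂)) -
      (L 0 (L 0 (Top φ U 1 0 F₁)) - L 0 (L 1 (Top φ U 0 0 F₁)) +
        (L 1 (L 0 (Top φ U 1 1 F₁)) - L 1 (L 1 (Top φ U 0 1 F₁)))) := by
    simp only [Fin.sum_univ_two, LinearMap.sub_apply, LinearMap.neg_apply, LinearMap.add_apply,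
      LinearMap.comp_apply, LinearMap.fst_apply, LinearMap.snd_apply, TopUp_zero, TopUp_one,
      hwedge1_E1Up_zero, hwedge1_E1Up_one, LinearMap.map_neg, sub_eq_add_neg]
  rw [bD2]
  rcases lt_or_gt_of_ne h with h | h
  · rw [if_pos (by omega), ← funext (fib_of_lt h)]
    exact key (fib k j)
  · rw [if_neg (by omega), if_neg h', if_neg (by omega), ← funext (fib_of_ge h.le)]
    exact key (fib k j)

theorem bD2_of_succ_eq {k j : ℕ} (h : j + 1 = k) (F₁ F₂ : BTen φ U) : bD2 φ U k j (F₁, F₂) =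
    (1 / 2 : ℂ) • (frd φ U 0 (frd φ U 1 F₂) - frd φ U 1 (frd φ U 0 F₂)) -
      (frd φ U 0 (hwedge1 (E1 φ U 0) F₂) + frd φ U 1 (hwedge1 (E1 φ U 1) F₂)) +
      hwedge2 (E0 φ U) ((1 / 2 : ℂ) • (-Top φ U 0 0 F₂ - Top φ U 1 1 F₂) + E01 φ U • F₂) -
      (partialS 0 (frd φ U 0 (Top φ U 0 0 F₁)) + partialS 0 (frd φ U 1 (Top φ U 1 0 F₁)) +
        (partialS 1 (frd φ U 0 (Top φ U 0 1 F₁)) + partialS 1 (frd φ U 1 (Top φ U 1 1 F₁)))) := by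
  rw [bD2, if_neg (by omega), if_pos h, ← TopUp_one, ← TopUp_zero]
  simp only [Fin.sum_univ_two]
  rfl

theorem bD2_self (k : ℕ) (F₁ F₂ : BTen φ U) : bD2 φ U k k (F₁, F₂) =
    sUp 0 (frd φ U 1 F₂ - hwedge1 (E1 φ U 0) (Top φ U 1 1 F₁ + F₂) + Top φ U 0 0 (frd φ U 1 F₁) -
      frd φ U 0 (Top φ U 0 1 F₁)) +
    sUp 1 (-frd φ U 0 F₂ - hwedge1 (E1 φ U 1) (Top φ U 1 1 F₁ + F₂) + Top φ U 1 0 (frd φ U 1 F₁) -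
      frd φ U 0 (Top φ U 1 1 F₁)) := by
  rw [bD2, if_neg (by omega), if_neg (by omega), if_pos rfl]
  refine (sum_comp_apply _ _ _ _ _ _ _ _ _ _).trans ?_
  rw [frdLow_zero, frdLow_one, TopUp_zero, neg_neg]

theorem bDop_fst {k j : ℕ} (F : bSec1 φ U k j × bSec2 φ U k j) :
    (bDop φ U k j F).1.1 = bD1 φ U k j (F.1.1, F.2.1) := rfl

theorem fib_succ {R : Type} [CommRing R] [Algebra ℂ R] {k j : ℕ} (h : j ≠ k) (h' : j + 1 ≠ k)
    (A' : Fin 2) : (fib k (j + 1) A' : Ten n R →ₗ[ℂ] Ten n R) = fib k j A' := by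
  rcases lt_or_gt_of_ne h with h | h
  · rw [fib_of_lt h, fib_of_lt (by omega)]
  · rw [fib_of_ge h.le, fib_of_ge (by omega)]

/-- The second component for a pair of operators of first order. -/
theorem fiber_second {L : Fin 2 → BTen φ U →ₗ[ℂ] BTen φ U} (hL : FiberPair L) (f H₀ H₁ : BTen φ U) :
    L 1 (L 0 (Top φ U 0 0 f) + L 1 (Top φ U 0 1 f) +
          hwedge1 (E1 φ U 0) (L 1 H₀ - L 0 H₁) - (L 0 (frd φ U 0 H₀) + L 1 (frd φ U 1 H₀))) -
      L 0 (L 0 (Top φ U 1 0 f) + L 1 (Top φ U 1 1 f) +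
          hwedge1 (E1 φ U 1) (L 1 H₀ - L 0 H₁) - (L 0 (frd φ U 0 H₁) + L 1 (frd φ U 1 H₁))) =
      -(L 0 (frd φ U 0 (L 1 H₀ - L 0 H₁) + hwedge1 (E1 φ U 1) (L 1 H₀ - L 0 H₁)) +
        L 1 (frd φ U 1 (L 1 H₀ - L 0 H₁) - hwedge1 (E1 φ U 0) (L 1 H₀ - L 0 H₁))) -
      (L 0 (L 0 (Top φ U 1 0 f)) - L 0 (L 1 (Top φ U 0 0 f)) +
        (L 1 (L 0 (Top φ U 1 1 f)) - L 1 (L 1 (Top φ U 0 1 f)))) := by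
  simp only [LinearMap.map_add, LinearMap.map_sub, hL.frd φ U, hL.hwedge1, hL.comm 1 0]
  abel

/-- The second component in the case `j + 1 = k`. -/
theorem second_of_succ_eq {f H₀ H₁ G : BTen φ U} (h00 : partialS 0 H₀ = 0) (h11 : partialS 1 H₁ = 0)
    (h10 : partialS 1 H₀ = (1 / 2 : ℂ) • G) (h01 : partialS 0 H₁ = -((1 / 2 : ℂ) • G)) :
    0 - (frd φ U 0 (partialS 0 (Top φ U 0 0 f) + partialS 1 (Top φ U 0 1 f) +
          hwedge1 (E1 φ U 0) G - (partialS 0 (frd φ U 0 H₀) + partialS 1 (frd φ U 1 H₀))) +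
        frd φ U 1 (partialS 0 (Top φ U 1 0 f) + partialS 1 (Top φ U 1 1 f) +
          hwedge1 (E1 φ U 1) G - (partialS 0 (frd φ U 0 H₁) + partialS 1 (frd φ U 1 H₁)))) +
      hwedge2 (E0 φ U) (E01 φ U • G -
        (partialS 0 (Top φ U 1 0 H₀) + partialS 1 (Top φ U 1 1 H₀)) +
        (partialS 0 (Top φ U 0 0 H₁) + partialS 1 (Top φ U 0 1 H₁))) =
    (1 / 2 : ℂ) • (frd φ U 0 (frd φ U 1 G) - frd φ U 1 (frd φ U 0 G)) -
      (frd φ U 0 (hwedge1 (E1 φ U 0) G) + frd φ U 1 (hwedge1 (E1 φ U 1) G)) +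
      hwedge2 (E0 φ U) ((1 / 2 : ℂ) • (-Top φ U 0 0 G - Top φ U 1 1 G) + E01 φ U • G) -
      (partialS 0 (frd φ U 0 (Top φ U 0 0 f)) + partialS 0 (frd φ U 1 (Top φ U 1 0 f)) +
        (partialS 1 (frd φ U 0 (Top φ U 0 1 f)) + partialS 1 (frd φ U 1 (Top φ U 1 1 f)))) := by
  -- The derivatives `∂_{A'}` pass through `𝔡` and `𝐓` to the `H`'s, where each of them gives `0` or
  -- `±G/2`.
  simp only [partialS_frd, partialS_Top, h00, h11, h10, h01, LinearMap.map_zero, LinearMap.map_neg, LinearMap.map_smul, LinearMap.map_add,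
    LinearMap.map_sub, smul_sub, smul_neg]
  abel

theorem toBdry_cfOp_self {k : ℕ} (hk : k ≤ 2 * n) {u : Ten n (SmoothFn (U : Set (HSpace n)))}
    (hu : toBdry φ U (mapT (pd U (nIdx n)) (mapT (pd U (nIdx n)) u)) = 0) :
    toBdry φ U (cfOp U k k u) = dB φ U 0 (dB φ U 1 (toBdry φ U u)) -
      EB φ U (toBdry φ U (mapT (pd U (nIdx n)) u)) -
      (fB φ U).e 1 (dB φ U 0 (toBdry φ U (mapT (pd U (nIdx n)) u))) +
      (fB φ U).e 0 (dB φ U 1 (toBdry φ U (mapT (pd U (nIdx n)) u))) := by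
  have h1 : toBdry φ U (dUp U 1 u) = dB φ U 1 (toBdry φ U u) +
      (fB φ U).e 1 (toBdry φ U (mapT (pd U (nIdx n)) u)) := toBdry_dUp φ U 1 u
  -- The restriction formula is needed for `d^{1'} u` and for its normal derivative. The latter
  -- would contain the second normal derivative of `u`, which the lift makes zero.
  have h2 : toBdry φ U (mapT (pd U (nIdx n)) (dUp U 1 u)) =
      dB φ U 1 (toBdry φ U (mapT (pd U (nIdx n)) u)) := by
    rw [pd_nIdx_dUp, toBdry_dUp, hu, LinearMap.map_zero, add_zero]
  have h3 : toBdry φ U (dUp U 0 (dUp U 1 u)) = dB φ U 0 (toBdry φ U (dUp U 1 u)) +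
      (fB φ U).e 0 (toBdry φ U (mapT (pd U (nIdx n)) (dUp U 1 u))) := toBdry_dUp φ U 0 _
  rw [cfOp_of_eq hk, h3, h2, h1, LinearMap.map_add, dB_zero_e_one']
  abel

/-- The frame decomposition of the restriction of the operator of second order. -/
theorem second_order_decomp (f g : BTen φ U) :
    dB φ U 0 (dB φ U 1 f) - EB φ U g - (fB φ U).e 1 (dB φ U 0 g) + (fB φ U).e 0 (dB φ U 1 g) =
    (frd φ U 0 (frd φ U 1 f) - hwedge2 (E0 φ U) (Top φ U 1 1 f + g)) +
      ((fB φ U).e 0 (frd φ U 1 g - hwedge1 (E1 φ U 0) (Top φ U 1 1 f + g) +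
          Top φ U 0 0 (frd φ U 1 f) - frd φ U 0 (Top φ U 0 1 f)) +
        (fB φ U).e 1 (-frd φ U 0 g - hwedge1 (E1 φ U 1) (Top φ U 1 1 f + g) +
          Top φ U 1 0 (frd φ U 1 f) - frd φ U 0 (Top φ U 1 1 f))) +
      (fB φ U).e 0 ((fB φ U).e 1 (Top φ U 1 1 g + Top φ U 0 0 g - E01 φ U • (Top φ U 1 1 f + g) -
        Top φ U 1 0 (Top φ U 0 1 f) + Top φ U 0 0 (Top φ U 1 1 f))) := by
  have h1 : dB φ U 0 (dB φ U 1 f) = dB φ U 0 (frd φ U 1 f) -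
      (fB φ U).e 0 (dB φ U 0 (Top φ U 0 1 f)) - EB φ U (Top φ U 1 1 f) -
      (fB φ U).e 1 (dB φ U 0 (Top φ U 1 1 f)) := by
    rw [dB_eq φ U 1 f, LinearMap.map_add, LinearMap.map_add, dB_zero_e_zero, dB_zero_e_one']
    abel
  rw [h1, EB_eq, EB_eq]
  simp only [dB_eq, LinearMap.map_add, LinearMap.map_sub, LinearMap.map_neg, Frame.e_one_zero, Frame.e_self, smul_add,
    Frame.e_smul]
  abel

theorem piMap_eq_of {k j : ℕ} {u : cfSec U k j} {G : bSec1 φ U k j × bSec2 φ U k j}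
    (h₁ : (fB φ U).pf (toBdry φ U u.1) = G.1.1)
    (h₂ : jetSnd φ U k j (toBdry φ U u.1, toBdry φ U (mapT (pd U (nIdx n)) u.1)) = G.2.1) :
    piMap φ U k j u = G := Prod.ext (Subtype.ext h₁) (Subtype.ext h₂)

/-- The components in the frame of the restriction of an operator of first order. -/
theorem proj_sum_dB {L : Fin 2 → BTen φ U →ₗ[ℂ] BTen φ U} (hL : FiberPair L) {f g H₀ H₁ v : BTen φ U}
    (hf : Hor f) (h₀ : Hor H₀) (h₁ : Hor H₁) (hg : L 1 H₀ - L 0 H₁ = g)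
    (hv : v = L 0 (dB φ U 0 (f + ((fB φ U).e 0 H₀ + (fB φ U).e 1 H₁))) +
      L 1 (dB φ U 1 (f + ((fB φ U).e 0 H₀ + (fB φ U).e 1 H₁)))) :
    (fB φ U).pf v = L 0 (frd φ U 0 f) + L 1 (frd φ U 1 f) + hwedge2 (E0 φ U) g ∧
    (fB φ U).pH 0 v = L 0 (Top φ U 0 0 f) + L 1 (Top φ U 0 1 f) + hwedge1 (E1 φ U 0) g -
      (L 0 (frd φ U 0 H₀) + L 1 (frd φ U 1 H₀)) ∧
    (fB φ U).pH 1 v = L 0 (Top φ U 1 0 f) + L 1 (Top φ U 1 1 f) + hwedge1 (E1 φ U 1) g -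
      (L 0 (frd φ U 0 H₁) + L 1 (frd φ U 1 H₁)) ∧
    (fB φ U).pK v = E01 φ U • g - (L 0 (Top φ U 1 0 H₀) + L 1 (Top φ U 1 1 H₀)) +
      (L 0 (Top φ U 0 0 H₁) + L 1 (Top φ U 0 1 H₁)) := by
  have hg' : Hor g := hg ▸ (hL.hor 1 h₀).sub (hL.hor 0 h₁)
  rw [sum_dB_decomp φ U hL, hg] at hv
  -- The right side of `sum_dB_decomp` is already an expansion with horizontal coefficients, so
  -- uniqueness identifies the components.
  exact (fB φ U).proj_of_eq
    (((hL.hor 0 (hf.frd φ U 0)).add (hL.hor 1 (hf.frd φ U 1))).add (hg'.hwedge2 (E0 φ U)))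
    ((((hL.hor 0 (hf.top φ U 0 0)).add (hL.hor 1 (hf.top φ U 0 1))).add
      (hg'.hwedge1 (E1 φ U 0))).sub ((hL.hor 0 (h₀.frd φ U 0)).add (hL.hor 1 (h₀.frd φ U 1))))
    ((((hL.hor 0 (hf.top φ U 1 0)).add (hL.hor 1 (hf.top φ U 1 1))).add
      (hg'.hwedge1 (E1 φ U 1))).sub ((hL.hor 0 (h₁.frd φ U 0)).add (hL.hor 1 (h₁.frd φ U 1))))
    (((hg'.smul (E01 φ U)).sub ((hL.hor 0 (h₀.top φ U 1 0)).add (hL.hor 1 (h₀.top φ U 1 1)))).add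
      ((hL.hor 0 (h₁.top φ U 0 0)).add (hL.hor 1 (h₁.top φ U 0 1)))) hv

theorem toBdry_pd_nIdx_cfOp_of_ne {k j : ℕ} (hj : j ≤ 2 * n) (h : j ≠ k)
    {u : Ten n (SmoothFn (U : Set (HSpace n)))}
    (hu1 : toBdry φ U (mapT (pd U (nIdx n)) u) = 0)
    (hu2 : toBdry φ U (mapT (pd U (nIdx n)) (mapT (pd U (nIdx n)) u)) = 0) :
    toBdry φ U (mapT (pd U (nIdx n)) (cfOp U k j u)) = 0 := by
  rw [pd_nIdx_cfOp_of_ne U hj h, toBdry_cfOp_of_ne φ U hj h hu2, hu1, LinearMap.map_zero, LinearMap.map_zero,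
    LinearMap.map_zero, LinearMap.map_zero, add_zero]

/-- The second component of `Π_{j+1} D_j`. -/
theorem jetSnd_cfOp_of_ne {k j : ℕ} (h : j ≠ k) {f g H₀ H₁ v : BTen φ U}
    (hf : Hor f) (h₀ : Hor H₀) (h₁ : Hor H₁) (hg : fib k j 1 H₀ - fib k j 0 H₁ = g)
    (hs : j + 1 = k → partialS 0 H₀ = 0 ∧ partialS 1 H₁ = 0 ∧
        partialS 1 H₀ = (1 / 2 : ℂ) • g ∧ partialS 0 H₁ = -((1 / 2 : ℂ) • g))
    (hv : v = fib k j 0 (dB φ U 0 (f + ((fB φ U).e 0 H₀ + (fB φ U).e 1 H₁))) +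
      fib k j 1 (dB φ U 1 (f + ((fB φ U).e 0 H₀ + (fB φ U).e 1 H₁)))) :
    jetSnd φ U k (j + 1) (v, 0) = bD2 φ U k j (f, g) := by
  have hL := fiberPair_fib (n := n) (R := SmoothFn (bdry φ U)) k j
  obtain ⟨-, p0, p1, pK⟩ := proj_sum_dB φ U hL hf h₀ h₁ hg hv
  -- For `j + 1 = k` the target uses the second-order formula for `Π_k`, which involves derivatives
  -- of the `H` components and also the `K` component. Otherwise both operators belong to the same
  -- fiber pair.
  by_cases h' : j + 1 = k
  · obtain ⟨c1, c2, c3, c4⟩ := hs h'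
    have hl : j < k := by omega
    rw [fib_of_lt hl, fib_of_lt hl] at p0 p1 pK
    rw [bD2_of_succ_eq φ U h', ← second_of_succ_eq φ U c1 c2 c3 c4, h', jetSnd_self, p0, p1, pK,
      LinearMap.map_zero]
  · rw [jetSnd_of_ne φ U h', p0, p1, bD2_of_ne φ U h h', fib_succ h h', fib_succ h h', ← hg]
    exact fiber_second φ U hL f H₀ H₁

/-- `Π_{j+1} D_j = 𝒟_j Π_j` for the lifts of `exists_lift_of_ne`. -/
theorem piMap_cfD_of_lift_of_ne {k j : ℕ} (hj : j ≤ 2 * n) (h : j ≠ k)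
    {F : bSec1 φ U k j × bSec2 φ U k j} {u : cfSec U k j} {H₀ H₁ : BTen φ U} (h₀ : Hor H₀)
    (h₁ : Hor H₁) (hF : fib k j 1 H₀ - fib k j 0 H₁ = F.2.1)
    (hs : j + 1 = k → partialS 0 H₀ = 0 ∧ partialS 1 H₁ = 0 ∧
        partialS 1 H₀ = (1 / 2 : ℂ) • F.2.1 ∧ partialS 0 H₁ = -((1 / 2 : ℂ) • F.2.1))
    (hu : toBdry φ U u.1 = F.1.1 + ((fB φ U).e 0 H₀ + (fB φ U).e 1 H₁))
    (hu1 : toBdry φ U (mapT (pd U (nIdx n)) u.1) = 0)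
    (hu2 : toBdry φ U (mapT (pd U (nIdx n)) (mapT (pd U (nIdx n)) u.1)) = 0) :
    piMap φ U k (j + 1) (cfD U k j u) = bDop φ U k j F := by
  have hv := toBdry_cfOp_of_ne φ U hj h hu1
  rw [hu] at hv
  have h₁' := (proj_sum_dB φ U (fiberPair_fib k j) (hor_of_bSec1 φ U F.1) h₀ h₁ hF hv).1
  have h₂' := jetSnd_cfOp_of_ne φ U h (hor_of_bSec1 φ U F.1) h₀ h₁ hF hs hv
  rw [← bD1_of_ne φ U h] at h₁'
  rw [← toBdry_pd_nIdx_cfOp_of_ne φ U hj h hu1 hu2] at h₂'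
  exact piMap_eq_of φ U h₁' h₂'

/-- The components in the frame of the restriction of the operator of second order. -/
theorem proj_second_order {f g v : BTen φ U} (hf : Hor f) (hg : Hor g)
    (hv : v = dB φ U 0 (dB φ U 1 f) - EB φ U g - (fB φ U).e 1 (dB φ U 0 g) +
      (fB φ U).e 0 (dB φ U 1 g)) :
    (fB φ U).pf v = frd φ U 0 (frd φ U 1 f) - hwedge2 (E0 φ U) (Top φ U 1 1 f + g) ∧
    (fB φ U).pH 0 v = frd φ U 1 g - hwedge1 (E1 φ U 0) (Top φ U 1 1 f + g) +
          Top φ U 0 0 (frd φ U 1 f) - frd φ U 0 (Top φ U 0 1 f) ∧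
    (fB φ U).pH 1 v = -frd φ U 0 g - hwedge1 (E1 φ U 1) (Top φ U 1 1 f + g) +
          Top φ U 1 0 (frd φ U 1 f) - frd φ U 0 (Top φ U 1 1 f) := by
  have a0 := (hf.top φ U 1 1).add hg
  rw [second_order_decomp] at hv
  obtain ⟨b1, b2, b3, -⟩ := (fB φ U).proj_of_eq
    (((hf.frd φ U 1).frd φ U 0).sub (a0.hwedge2 (E0 φ U)))
    ((((hg.frd φ U 1).sub (a0.hwedge1 (E1 φ U 0))).add
      ((hf.frd φ U 1).top φ U 0 0)).sub ((hf.top φ U 0 1).frd φ U 0))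
    ((((hg.frd φ U 0).neg.sub (a0.hwedge1 (E1 φ U 1))).add
      ((hf.frd φ U 1).top φ U 1 0)).sub ((hf.top φ U 1 1).frd φ U 0))
    (((((hg.top φ U 1 1).add (hg.top φ U 0 0)).sub (a0.smul (E01 φ U))).sub
      ((hf.top φ U 0 1).top φ U 1 0)).add ((hf.top φ U 1 1).top φ U 0 0)) hv
  exact ⟨b1, b2, b3⟩

/-- The components of `Π_{k+1} D_k`. -/
theorem jetSnd_cfOp_self {k : ℕ} {f g v : BTen φ U} (hf : Hor f) (hg : Hor g)
    (hv : v = dB φ U 0 (dB φ U 1 f) - EB φ U g - (fB φ U).e 1 (dB φ U 0 g) +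
      (fB φ U).e 0 (dB φ U 1 g)) :
    (fB φ U).pf v = bD1 φ U k k (f, g) ∧
      ∀ w, jetSnd φ U k (k + 1) (v, w) = bD2 φ U k k (f, g) := by
  obtain ⟨b1, b2, b3⟩ := proj_second_order φ U hf hg hv
  refine ⟨by rw [b1, bD1_self], fun w => ?_⟩
  rw [jetSnd_of_ne φ U (by omega), b2, b3, bD2_self, fib_of_ge (by omega), fib_of_ge (by omega),
    sLow_one, sLow_zero, LinearMap.neg_apply, sub_neg_eq_add]

/-- `Π_{k+1} D_k = 𝒟_k Π_k` for the lifts of `exists_lift_self`. -/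
theorem piMap_cfD_of_lift_self {k : ℕ} (hk : k ≤ 2 * n) {F : bSec1 φ U k k × bSec2 φ U k k}
    {u : cfSec U k k} (hu : toBdry φ U u.1 = F.1.1)
    (hu1 : toBdry φ U (mapT (pd U (nIdx n)) u.1) = F.2.1)
    (hu2 : toBdry φ U (mapT (pd U (nIdx n)) (mapT (pd U (nIdx n)) u.1)) = 0) :
    piMap φ U k (k + 1) (cfD U k k u) = bDop φ U k k F := by
  have hv := toBdry_cfOp_self φ U hk hu2
  rw [hu, hu1] at hv
  have h := jetSnd_cfOp_self φ U (k := k) (hor_of_bSec1 φ U F.1) (hor_of_bSec2 φ U F.2) hv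
  exact piMap_eq_of φ U h.1 (h.2 _)

/-- The inclusion of the spaces of zero Cauchy data under `D_j`, read through the kernels of the
maps `piMap`. -/
theorem piMap_cfD_eq_zero {k j : ℕ} (hj : j + 1 ≤ 2 * n) {u : cfSec U k j}
    (hu : piMap φ U k j u = 0) : piMap φ U k (j + 1) (cfD U k j u) = 0 := by
  have h : u ∈ cauchyJ U (dom φ) k j := by
    rw [ker_piMap φ U (by omega)]; exact hu
  have h' : cfD U k j u ∈ cauchyJ U (dom φ) k (j + 1) := cauchyJ_le_comap φ k j h
  rw [ker_piMap φ U hj] at h'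
  exact h'

/-- The maps `Π_j` carry `D_j` to `𝒟_j` for some lift of each section. -/
theorem exists_piMap_cfD {k j : ℕ} (hj : j + 1 ≤ 2 * n) (F : bSec1 φ U k j × bSec2 φ U k j) :
    ∃ u : cfSec U k j, piMap φ U k j u = F ∧
      piMap φ U k (j + 1) (cfD U k j u) = bDop φ U k j F := by
  by_cases h : j = k
  · subst h
    obtain ⟨u', h1, h2, h3⟩ := exists_lift_self φ U F
    exact ⟨u', piMap_of_lift_self φ U h1 h2, piMap_cfD_of_lift_self φ U (by omega) h1 h2 h3⟩
  · obtain ⟨u', H₀, H₁, h₀, h₁, hF, hs, h1, h2, h3⟩ := exists_lift_of_ne φ U h F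
    exact ⟨u', piMap_of_lift_of_ne φ U h h₀ h₁ hF h1,
      piMap_cfD_of_lift_of_ne φ U (by omega) h h₀ h₁ hF hs h1 h2 h3⟩

/-- The maps `Π_j` carry `D_j` to `𝒟_j`. -/
theorem piMap_cfD {k j : ℕ} (hj : j + 1 ≤ 2 * n) (u : cfSec U k j) :
    piMap φ U k (j + 1) (cfD U k j u) = bDop φ U k j (piMap φ U k j u) := by
  obtain ⟨u', h1, h2⟩ := exists_piMap_cfD φ U hj (piMap φ U k j u)
  -- `u` and the convenient lift differ by an element of the kernel, which `D_j` carries into the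
  -- next kernel.
  have h3 := Sec_eq_of_ker (piMap φ U k j) (cfD U k j) (piMap φ U k (j + 1))
    (fun v hv => piMap_cfD_eq_zero φ U hj hv) h1
  exact h3.symm.trans h2

end Intertwining

theorem secQuotEquiv_comp {n : ℕ} {R R' : Type} [CommRing R] [Algebra ℂ R] [CommRing R']
    [Algebra ℂ R'] {N N₁ N₂ N₃ N₄ σ σ' σ₁ σ₂ σ₃ σ₄ : ℕ} {τ τ' τ₁ τ₂ τ₃ τ₄ : ℤ}
    {J : Submodule ℂ (Sec n R N σ τ)} {J' : Submodule ℂ (Sec n R N σ' τ')}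
    (p : Sec n R N σ τ →ₗ[ℂ] (Sec n R' N₁ σ₁ τ₁ × Sec n R' N₂ σ₂ τ₂)) (hJ : J = LinearMap.ker p)
    (hp : Function.Surjective p)
    (p' : Sec n R N σ' τ' →ₗ[ℂ] (Sec n R' N₃ σ₃ τ₃ × Sec n R' N₄ σ₄ τ₄))
    (hJ' : J' = LinearMap.ker p') (hp' : Function.Surjective p')
    (L : Sec n R N σ τ →ₗ[ℂ] Sec n R N σ' τ') (h : J ≤ J'.comap L)
    (b : (Sec n R' N₁ σ₁ τ₁ × Sec n R' N₂ σ₂ τ₂) →ₗ[ℂ] (Sec n R' N₃ σ₃ τ₃ × Sec n R' N₄ σ₄ τ₄))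
    (H : ∀ u, p' (L u) = b (p u)) :
    (secQuotEquiv p' hJ' hp').toLinearMap ∘ₗ
        (secMap (n := n) (N := N) (σ := σ) (σ' := σ') (τ := τ) (τ' := τ') J J' L h) =
      b ∘ₗ (secQuotEquiv p hJ hp).toLinearMap :=
  Submodule.linearMap_qext J (LinearMap.ext fun u => H u)

theorem map_frame_sum {n : ℕ} {R : Type} [CommRing R] [Algebra ℂ R] (D : Ten n R →ₗ[ℂ] Ten n R)
    (α : Fin 2 → Fin (2 * n + 2) → R) (hD : ∀ A' F, D (wedge1 (α A') F) = wedge1 (α A') (D F))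
    (f : Ten n R) (H : Fin 2 → Ten n R) (K : Ten n R) :
    D (f + (∑ A' : Fin 2, wedge1 (α A') (H A')) + wedge1 (α 0) (wedge1 (α 1) K)) =
      D f + (∑ A' : Fin 2, wedge1 (α A') (D (H A'))) + wedge1 (α 0) (wedge1 (α 1) (D K)) := by
  rw [map_add, map_add, map_sum, hD, hD]
  simp only [hD]

/-! ### The quotient complex, frame expansions on `U`, and the right-type case. -/

section Complex

variable {n : ℕ} (φ : GraphFn n) (U : TopologicalSpace.Opens (HSpace n))

theorem piEquiv_comp {k j : ℕ} (hj : j + 1 ≤ 2 * n) (hj' : j ≤ 2 * n)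
    (hJ : cauchyJ U (dom φ) k j ≤ (cauchyJ U (dom φ) k (j + 1)).comap (cfD U k j)) :
    (piEquiv φ U k (j + 1) hj).toLinearMap ∘ₗ cfQuotD φ U k j hJ =
      bDop φ U k j ∘ₗ (piEquiv φ U k j hj').toLinearMap :=
  secQuotEquiv_comp (piMap φ U k j) (ker_piMap φ U hj') (piMap_surjective φ U k j)
    (piMap φ U k (j + 1)) (ker_piMap φ U hj) (piMap_surjective φ U k (j + 1)) (cfD U k j) hJ
    (bDop φ U k j) (piMap_cfD φ U hj)

theorem toBdry_frameForm (f : Ten n (SmoothFn (U : Set (HSpace n))))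
    (H : Fin 2 → Ten n (SmoothFn (U : Set (HSpace n)))) (K : Ten n (SmoothFn (U : Set (HSpace n)))) :
    toBdry φ U (frameForm φ U f H K) = toBdry φ U f +
      ((fB φ U).e 0 (toBdry φ U (H 0)) + (fB φ U).e 1 (toBdry φ U (H 1))) +
      (fB φ U).e 0 ((fB φ U).e 1 (toBdry φ U K)) := by
  rw [frameForm, map_add, map_add, Fin.sum_univ_two, map_add, toBdry_Omega, toBdry_Omega,
    toBdry_Omega, toBdry_Omega]
  rfl

/-- The forms `Ω^{A'}` do not depend on `x_{4n+1}`, so the derivative acts on the coefficients only.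
-/
theorem pd_nIdx_frameForm (f : Ten n (SmoothFn (U : Set (HSpace n))))
    (H : Fin 2 → Ten n (SmoothFn (U : Set (HSpace n)))) (K : Ten n (SmoothFn (U : Set (HSpace n)))) :
    mapT (pd U (nIdx n)) (frameForm φ U f H K) = frameForm φ U (mapT (pd U (nIdx n)) f)
      (fun A' => mapT (pd U (nIdx n)) (H A')) (mapT (pd U (nIdx n)) K) :=
  map_frame_sum (mapT (pd U (nIdx n))) (Omega φ (U : Set (HSpace n))) (pd_nIdx_Omega φ U) f H K

theorem piSecond_of_ne {k j : ℕ} (h : j ≠ k) (f : Ten n (SmoothFn (U : Set (HSpace n))))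
    (H : Fin 2 → Ten n (SmoothFn (U : Set (HSpace n)))) (K : Ten n (SmoothFn (U : Set (HSpace n)))) :
    piSecond φ U k j f H K = fib k j 1 (toBdry φ U (H 0)) - fib k j 0 (toBdry φ U (H 1)) := by
  rw [piSecond, ← toBdry_fib, ← toBdry_fib, ← map_sub]
  rcases lt_or_gt_of_ne h with h | h
  · rw [if_pos h, fib_of_lt h, fib_of_lt h]
  · rw [if_neg (by omega), if_neg (by omega), fib_of_ge h.le, fib_of_ge h.le]

theorem piSecond_self (k : ℕ) (f : Ten n (SmoothFn (U : Set (HSpace n))))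
    (H : Fin 2 → Ten n (SmoothFn (U : Set (HSpace n)))) (K : Ten n (SmoothFn (U : Set (HSpace n)))) :
    piSecond φ U k k f H K = toBdry φ U (mapT (pd U (nIdx n)) f) -
      (frd φ U 0 (toBdry φ U (H 0)) + frd φ U 1 (toBdry φ U (H 1))) +
        hwedge2 (E0 φ U) (toBdry φ U K) := by
  rw [piSecond, if_neg (lt_irrefl k), if_pos rfl, Fin.sum_univ_two]

theorem proj_frameForm {f : Ten n (SmoothFn (U : Set (HSpace n)))}
    {H : Fin 2 → Ten n (SmoothFn (U : Set (HSpace n)))} {K : Ten n (SmoothFn (U : Set (HSpace n)))}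
    (hf : Hor f) (hH : ∀ A', Hor (H A')) (hK : Hor K) :
    (fB φ U).pf (toBdry φ U (frameForm φ U f H K)) = toBdry φ U f ∧
    (fB φ U).pH 0 (toBdry φ U (frameForm φ U f H K)) = toBdry φ U (H 0) ∧
    (fB φ U).pH 1 (toBdry φ U (frameForm φ U f H K)) = toBdry φ U (H 1) ∧
    (fB φ U).pK (toBdry φ U (frameForm φ U f H K)) = toBdry φ U K :=
  (fB φ U).proj_of_eq (hf.mapT _) ((hH 0).mapT _) ((hH 1).mapT _) (hK.mapT _)
    (toBdry_frameForm φ U f H K)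

theorem jetSnd_frameForm (k j : ℕ) {f : Ten n (SmoothFn (U : Set (HSpace n)))}
    {H : Fin 2 → Ten n (SmoothFn (U : Set (HSpace n)))} {K : Ten n (SmoothFn (U : Set (HSpace n)))}
    (hf : Hor f) (hH : ∀ A', Hor (H A')) (hK : Hor K) :
    jetSnd φ U k j (toBdry φ U (frameForm φ U f H K),
      toBdry φ U (mapT (pd U (nIdx n)) (frameForm φ U f H K))) = piSecond φ U k j f H K := by
  obtain ⟨-, p0, p1, pK⟩ := proj_frameForm φ U hf hH hK
  by_cases h : j = k
  · subst h
    rw [jetSnd_self, piSecond_self, p0, p1, pK, pd_nIdx_frameForm,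
      (proj_frameForm φ U (hf.mapT _) (fun A' => (hH A').mapT _) (hK.mapT _)).1]
  · rw [jetSnd_of_ne φ U h, piSecond_of_ne φ U h, p0, p1]

/-- The values of `Π_j` in terms of the expansion of a section with respect to the frame. -/
theorem piMap_frameForm {k j : ℕ} {u : cfSec U k j} {f : Ten n (SmoothFn (U : Set (HSpace n)))}
    {H : Fin 2 → Ten n (SmoothFn (U : Set (HSpace n)))} {K : Ten n (SmoothFn (U : Set (HSpace n)))}
    (hf : Hor f) (hH : ∀ A', Hor (H A')) (hK : Hor K) (hu : u.1 = frameForm φ U f H K) :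
    (piMap φ U k j u).1.1 = toBdry φ U f ∧ (piMap φ U k j u).2.1 = piSecond φ U k j f H K := by
  rw [piMap_fst, piMap_snd, hu]
  exact ⟨(proj_frameForm φ U hf hH hK).1, jetSnd_frameForm φ U k j hf hH hK⟩

theorem exists_frameForm {σ : ℕ} {τ : ℤ} {u : Ten n (SmoothFn (U : Set (HSpace n)))}
    (hu : u ∈ Sec n (SmoothFn (U : Set (HSpace n))) (2 * n + 2) σ τ) :
    ∃ f ∈ Sec n (SmoothFn (U : Set (HSpace n))) (2 * n) σ τ,
    ∃ H : Fin 2 → Ten n (SmoothFn (U : Set (HSpace n))),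
      (∀ A', H A' ∈ Sec n (SmoothFn (U : Set (HSpace n))) (2 * n) σ (τ - 1)) ∧
    ∃ K ∈ Sec n (SmoothFn (U : Set (HSpace n))) (2 * n) σ (τ - 2), u = frameForm φ U f H K := by
  refine ⟨(frame φ (U : Set (HSpace n))).pf u, Frame.pf_mem _ hu,
    fun A' => (frame φ (U : Set (HSpace n))).pH A' u, fun A' => Frame.pH_mem _ A' hu,
    (frame φ (U : Set (HSpace n))).pK u, Frame.pK_mem _ hu, ?_⟩
  rw [frameForm, Fin.sum_univ_two]
  exact (frame φ (U : Set (HSpace n))).eq_decomp u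

theorem cfD_cfD (k j : ℕ) (u : cfSec U k j) : cfD U k (j + 1) (cfD U k j u) = 0 :=
  Subtype.ext (cfOp_cfOp k j u.1)

/-- Every boundary section is the image of a section over `U`, so the identity is transported from
the `k`-Cauchy–Fueter complex. -/
theorem bDop_bDop {k j : ℕ} (hj : j + 2 ≤ 2 * n) (F : bSec1 φ U k j × bSec2 φ U k j) :
    bDop φ U k (j + 1) (bDop φ U k j F) = 0 := by
  obtain ⟨u, rfl⟩ := piMap_surjective φ U k j F
  rw [← piMap_cfD φ U (by omega), ← piMap_cfD φ U hj, cfD_cfD]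
  exact map_zero (piMap φ U k (j + 1 + 1))

theorem Sec_eq_bot {R : Type} [CommRing R] [Algebra ℂ R] {N σ : ℕ} {τ : ℤ} (h : τ < 0 ∨ (N : ℤ) < τ) :
    Sec n R N σ τ = ⊥ := by
  refine eq_bot_iff.2 fun F hF => (Submodule.mem_bot ℂ).2 ?_
  funext p q S
  refine hF p q S fun ⟨_, hS, hN⟩ => ?_
  have hle : S.card ≤ N := by
    rw [← Finset.card_range N]
    exact Finset.card_le_card_of_injOn Fin.val (fun a ha => by simpa using hN a ha)
      (Fin.val_injective.injOn)
  omega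

theorem bD1_of_E0 (h : ∀ A B : Fin (2 * n), E0 φ U A B = 0) (k j : ℕ) (F₁ F₂ : BTen φ U) :
    bD1 φ U k j (F₁, F₂) = bOp φ U k j F₁ := by
  have h0 (G : BTen φ U) : hwedge2 (E0 φ U) G = 0 := by
    rw [hwedge2_apply]
    exact Finset.sum_eq_zero fun A _ => Finset.sum_eq_zero fun B _ => by rw [h, zero_smul]
  by_cases hjk : j = k
  · subst hjk
    rw [bD1_self, h0, sub_zero, bOp, if_neg (lt_irrefl j), if_pos rfl]
    rfl
  · rw [bD1_of_ne φ U hjk, h0, add_zero, bOp]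
    rcases lt_or_gt_of_ne hjk with hl | hl
    · rw [if_pos hl, fib_of_lt hl, fib_of_lt hl, Fin.sum_univ_two]
      rfl
    · rw [if_neg (by omega), if_neg (by omega), fib_of_ge hl.le, fib_of_ge hl.le, Fin.sum_univ_two]
      rfl

theorem bDop_fst_of_E0 (h : ∀ A B : Fin (2 * n), E0 φ U A B = 0) {k j : ℕ}
    (F : bSec1 φ U k j × bSec2 φ U k j) : (bDop φ U k j F).1 = bD1only φ U k j F.1 :=
  Subtype.ext ((bDop_fst φ U F).trans (bD1_of_E0 φ U h k j F.1.1 F.2.1))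

/-- When `ℰ_0 = 0`, the projection to the first component commutes with the operators. Applying
`𝒟_{j+1} 𝒟_j = 0` to `(F, 0)` and projecting gives the claim. -/
theorem bD1only_bD1only (h : ∀ A B : Fin (2 * n), E0 φ U A B = 0) {k j : ℕ} (hj : j + 2 ≤ 2 * n)
    (F : bSec1 φ U k j) : bD1only φ U k (j + 1) (bD1only φ U k j F) = 0 := by
  have h1 := bDop_bDop φ U hj (F, (0 : bSec2 φ U k j))
  rw [← bDop_fst_of_E0 φ U h (F, (0 : bSec2 φ U k j)), ← bDop_fst_of_E0 φ U h, h1]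
  rfl

theorem subsingleton_secQuot {R : Type} [CommRing R] [Algebra ℂ R] {N σ : ℕ} {τ : ℤ}
    {J : Submodule ℂ (Sec n R N σ τ)} (h : J = ⊤) : Subsingleton (SecQuot J) :=
  Submodule.Quotient.subsingleton_iff.2 h

theorem Ebdry_decomp : Ebdry φ U = hwedge2 (E0 φ U) (scalarT 1)
      + (∑ A' : Fin 2, wedge1 (Omega φ (bdry φ U) A') (hwedge1 (E1 φ U A') (scalarT 1)))
      + mulT (E01 φ U) (wedge1 (Omega φ (bdry φ U) 0)
          (wedge1 (Omega φ (bdry φ U) 1) (scalarT 1))) := by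
  rw [Ebdry_eq, EB_eq, Fin.sum_univ_two]
  rfl

end Complex

end KCF

end

theorem theorem1p1 (n k : ℕ) (φ : KCF.GraphFn n) (U : TopologicalSpace.Opens (KCF.HSpace n)) :
    -- the fields `Z_A^{A'}` and `𝐓_{B'}^{A'}` are tangential to `bD`
    (∀ (A : Fin (2 * n)) (A' : Fin 2),
      ∑ i, KCF.Zfield φ U A A' i * KCF.drho φ (KCF.bdry φ U) i = 0) ∧
    (∀ B' A' : Fin 2, ∑ i, KCF.Tfield φ U B' A' i * KCF.drho φ (KCF.bdry φ U) i = 0) ∧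
    -- `-d^{0'} d^{1'} ϱ = ℰ_0 + Ω^{A'} ∧ ℰ_{A'} + ℰ_{0'1'} Ω^{0'} ∧ Ω^{1'}` on `bD ∩ U`
    (KCF.Ebdry φ U = KCF.hwedge2 (KCF.E0 φ U) (KCF.scalarT 1)
      + (∑ A' : Fin 2, KCF.wedge1 (KCF.Omega φ (KCF.bdry φ U) A')
          (KCF.hwedge1 (KCF.E1 φ U A') (KCF.scalarT 1)))
      + KCF.mulT (KCF.E01 φ U) (KCF.wedge1 (KCF.Omega φ (KCF.bdry φ U) 0)
          (KCF.wedge1 (KCF.Omega φ (KCF.bdry φ U) 1) (KCF.scalarT 1)))) ∧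
    -- the operators `D_j` induce operators on `Q_j = Γ(U, V_j) / J_j`, and the isomorphisms `Π_j`
    -- identify the resulting sequence with `(Γ(bD ∩ U, 𝒱_j), 𝒟_j)`
    (∃ hJ : ∀ j, KCF.cauchyJ U (KCF.dom φ) k j ≤
        (KCF.cauchyJ U (KCF.dom φ) k (j + 1)).comap (KCF.cfD U k j),
      ∃ P : ∀ j, j ≤ 2 * n → (KCF.cfQuot φ U k j ≃ₗ[ℂ]
          (KCF.bSec1 φ U k j × KCF.bSec2 φ U k j)),
        (∀ (j : ℕ) (hj : j ≤ 2 * n) (u : KCF.cfSec U k j)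
            (f : KCF.Ten n (KCF.SmoothFn (U : Set (KCF.HSpace n))))
            (H : Fin 2 → KCF.Ten n (KCF.SmoothFn (U : Set (KCF.HSpace n))))
            (K : KCF.Ten n (KCF.SmoothFn (U : Set (KCF.HSpace n)))),
          f ∈ KCF.Sec n (KCF.SmoothFn (U : Set (KCF.HSpace n))) (2 * n)
            (KCF.sig k j) (KCF.tau k j) →
          (∀ A', H A' ∈ KCF.Sec n (KCF.SmoothFn (U : Set (KCF.HSpace n))) (2 * n)
            (KCF.sig k j) (KCF.tau k j - 1)) →
          K ∈ KCF.Sec n (KCF.SmoothFn (U : Set (KCF.HSpace n))) (2 * n)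
            (KCF.sig k j) (KCF.tau k j - 2) →
          u.1 = KCF.frameForm φ U f H K →
          (P j hj (KCF.cfQuotMk φ U k j u)).1.1 = KCF.toBdry φ U f ∧
          (P j hj (KCF.cfQuotMk φ U k j u)).2.1 = KCF.piSecond φ U k j f H K) ∧
        (∀ (j : ℕ) (hj : j + 1 ≤ 2 * n),
          (P (j + 1) hj).toLinearMap ∘ₗ KCF.cfQuotD φ U k j (hJ j) =
            KCF.bDop φ U k j ∘ₗ (P j (by omega)).toLinearMap)) ∧
    -- `Q_j = 0` for `j > 2n`
    (∀ j, 2 * n < j → Subsingleton (KCF.cfQuot φ U k j)) ∧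
    -- every section over `U` has an expansion with respect to `ω^A`, `Ω^{0'}`, `Ω^{1'}`
    (∀ (j : ℕ) (u : KCF.cfSec U k j),
      ∃ f ∈ KCF.Sec n (KCF.SmoothFn (U : Set (KCF.HSpace n))) (2 * n) (KCF.sig k j) (KCF.tau k j),
      ∃ H : Fin 2 → KCF.Ten n (KCF.SmoothFn (U : Set (KCF.HSpace n))),
        (∀ A', H A' ∈ KCF.Sec n (KCF.SmoothFn (U : Set (KCF.HSpace n))) (2 * n)
          (KCF.sig k j) (KCF.tau k j - 1)) ∧
      ∃ K ∈ KCF.Sec n (KCF.SmoothFn (U : Set (KCF.HSpace n))) (2 * n)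
          (KCF.sig k j) (KCF.tau k j - 2),
        u.1 = KCF.frameForm φ U f H K) ∧
    -- the boundary complex is a complex
    (∀ j, j + 2 ≤ 2 * n → KCF.bDop φ U k (j + 1) ∘ₗ KCF.bDop φ U k j = 0) ∧
    (0 < k → KCF.bSec2 φ U k 0 = ⊥) ∧
    -- the right-type case
    ((∀ A B : Fin (2 * n), KCF.E0 φ U A B = 0) →
      (∀ (j : ℕ) (F : KCF.bSec1 φ U k j × KCF.bSec2 φ U k j),
        (KCF.bDop φ U k j F).1 = KCF.bD1only φ U k j F.1) ∧
      (∀ j, j + 2 ≤ 2 * n → KCF.bD1only φ U k (j + 1) ∘ₗ KCF.bD1only φ U k j = 0)) ∧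
    (∀ j, k < j → 2 * n ≤ j → KCF.bSec1 φ U k j = ⊥) := by
  refine ⟨KCF.Zfield_tangential φ U, KCF.Tfield_tangential φ U, KCF.Ebdry_decomp φ U,
    ⟨KCF.cauchyJ_le_comap φ k, fun j hj => KCF.piEquiv φ U k j hj, ?_, fun j hj =>
      KCF.piEquiv_comp φ U hj (by omega) (KCF.cauchyJ_le_comap φ k j)⟩,
    fun j hj => KCF.subsingleton_secQuot (KCF.cauchyJ_of_gt φ hj),
    fun j u => KCF.exists_frameForm φ U u.2,
    fun j hj => LinearMap.ext fun F => KCF.bDop_bDop φ U hj F, fun hk => ?_,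
    fun h => ⟨fun j F => KCF.bDop_fst_of_E0 φ U h F,
      fun j hj => LinearMap.ext fun F => KCF.bD1only_bD1only φ U h hj F⟩, fun j hk hj => ?_⟩
  · intro j hj u f H K hf hH hK hu
    rw [KCF.piEquiv_mk]
    exact KCF.piMap_frameForm φ U (KCF.Sec.hor hf) (fun A' => KCF.Sec.hor (hH A')) (KCF.Sec.hor hK) hu
  · rw [KCF.bSec2_of_ne φ U hk.ne]
    -- For `j = 0 < k` the form degree of the second component is `τ_0 - 1 = -1`.
    exact KCF.Sec_eq_bot (Or.inl (by simp [KCF.tau]))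
  · refine KCF.Sec_eq_bot (Or.inr ?_)
    rw [KCF.tau, if_neg (by omega)]
    push_cast
    omega
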